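/- Let $k\ge 0$ and let $M$ be a smooth Riemannian manifold of dimension $8k+4$, with Levi-Civita connection $\nabla^{TM}$ and curvature $R^{TM}$. Let $T_{\mathbf C}M=TM\otimes\mathbf C$ carry the induced connection, and let tensor products, symmetric powers and exterior powers of $T_{\mathbf C}M$ carry the induced connections. Put $$\widehat A={\det}^{1/2}\!\left(\frac{\frac{\sqrt{-1}}{4\pi}R^{TM}}{\sinh\left(\frac{\sqrt{-1}}{4\pi}R^{TM}\right)}\right),\qquad \widehat L={\det}^{1/2}\!\left(\frac{\frac{\sqrt{-1}}{2\pi}R^{TM}}{\tanh\left(\frac{\sqrt{-1}}{4\pi}R^{TM}\right)}\right),\qquad \mathrm{ch}(E)=\mathrm{tr}\exp\left(\frac{\sqrt{-1}}{2\pi}R^{E}\right),$$ with $\mathrm{ch}$ extended additively to formal differences of bundles, and let $\{\cdot\}^{(8k+4)}$ denote the component of degree $8k+4$ of a differential form. For an indeterminate $t$ put $S_t(E)=\sum_b t^bS^b(E)$ and $\Lambda_t(E)=\sum_b t^b\Lambda^b(E)$, extended to formal differences by $S_t(E-F)=S_t(E)/S_t(F)$ and $\Lambda_t(E-F)=\Lambda_t(E)/\Lambda_t(F)$.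 Let $\widetilde{T_{\mathbf C}M}=T_{\mathbf C}M-\mathbf C^{8k+4}$, and define virtual bundles $B_j(T_{\mathbf C}M)$, $j\ge0$, by $$\bigotimes_{n\ge1}S_{q^n}(\widetilde{T_{\mathbf C}M})\otimes\bigotimes_{m\ge1}\Lambda_{-q^{m-1/2}}(\widetilde{T_{\mathbf C}M})=\sum_{j\ge0}B_j(T_{\mathbf C}M)\,q^{j/2}.$$ Let $8\delta_2=-(\theta_1^4+\theta_3^4)=-1-24q^{1/2}-\cdots$ and $\varepsilon_2=\frac1{16}\theta_1^4\theta_3^4=q^{1/2}+8q+\cdots$, where $\theta_1=2q^{1/8}\prod_{j\ge1}(1-q^j)(1+q^j)^2$ and $\theta_3=\prod_{j\ge1}(1-q^j)(1+q^{j-1/2})^2$. There are unique integers $c_{rj}$ ($0\le r,j\le k$), depending only on $k$, such that with $b_r=\sum_{j=0}^{k}c_{rj}B_j$ one has, for indeterminates $B_0,\dots,B_k$, $$\sum_{m=0}^{k}B_m\,q^{m/2}\equiv\sum_{r=0}^{k}b_r\,(8\delta_2)^{2k+1-2r}\varepsilon_2^{\,r}\pmod{q^{(k+1)/2}};$$ moreover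 $c_{rj}=0$ for $j>r$. Let $b_r(T_{\mathbf C}M)=\sum_{j=0}^{r}c_{rj}B_j(T_{\mathbf C}M)$ and $h_r(T_{\mathbf C}M)=\{\widehat A\,\mathrm{ch}(b_r(T_{\mathbf C}M))\}^{(8k+4)}$. Then at every point of $M$ $$\left\{\widehat L\,\mathrm{ch}(T_{\mathbf C}M\otimes T_{\mathbf C}M)-55\,\widehat L\,\mathrm{ch}(T_{\mathbf C}M)+768\,\widehat L\right\}^{(8k+4)}=2^{25}\sum_{r=0}^{k-2}(k-r)(k-r-1)\,2^{6(k-r-2)}\,h_r(T_{\mathbf C}M),$$ where the right-hand side is $0$ if $k<2$. In particular, the left-hand side is $0$ in dimensions $4$ and $12$ (and in dimension $4$ also $\{\widehat L\,\mathrm{ch}(T_{\mathbf C}M\otimes T_{\mathbf C}M)-112\,\widehat L\}^{(4)}=0$), it is $-2^{26}\{\widehat A\}^{(20)}$ in dimension $20$, and it is $2^{26}\{\widehat A\,\mathrm{ch}(T_{\mathbf C}M)-52\,\widehat A\}^{(28)}$ in dimension $28$. -/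

import Mathlib

open scoped Manifold ContDiff Matrix Kronecker Nat

namespace TwistedCancellation

noncomputable section

/-! ## Riemannian geometry in the preferred chart at a point

`M` is a smooth manifold without boundary modelled on `ℝⁿ`; `g` is a smooth Riemannian metric. -/

section Riemannian

variable {n : ℕ} {M : Type*} [TopologicalSpace M] [ChartedSpace (EuclideanSpace ℝ (Fin n)) M]
  [IsManifold (𝓡 n) ∞ M]

/-- Smooth Riemannian metrics on the `n`-manifold `M`. -/
abbrev RiemMetric (n : ℕ) (M : Type*) [TopologicalSpace M]
    [ChartedSpace (EuclideanSpace ℝ (Fin n)) M] [IsManifold (𝓡 n) ∞ M] :=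
  Bundle.ContMDiffRiemannianMetric (𝓡 n) ∞ (EuclideanSpace ℝ (Fin n))
    (fun x : M => TangentSpace (𝓡 n) x)

/-- The `i`-th standard basis vector of `ℝⁿ`. -/
def basisVec (i : Fin n) : EuclideanSpace ℝ (Fin n) := EuclideanSpace.single i 1

/-- The partial derivative `∂ᵢ f` of a function of `n` real variables. -/
def partialDeriv (i : Fin n) (f : EuclideanSpace ℝ (Fin n) → ℝ)
    (y : EuclideanSpace ℝ (Fin n)) : ℝ :=
  fderiv ℝ f y (basisVec i)

/-- The coordinate vector field `∂ᵢ` of the preferred chart `φ` at `x`, at the point `φ⁻¹ y`. -/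
def coordVector (x : M) (y : EuclideanSpace ℝ (Fin n)) (i : Fin n) :
    TangentSpace (𝓡 n) ((extChartAt (𝓡 n) x).symm y) :=
  mfderiv 𝓘(ℝ, EuclideanSpace ℝ (Fin n)) (𝓡 n) (extChartAt (𝓡 n) x).symm y (basisVec i)

/-- The Gram matrix `gᵢⱼ = g(∂ᵢ, ∂ⱼ)` in the preferred chart at `x`, as a function of the
coordinates `y`. -/
def gram (g : RiemMetric n M) (x : M) (y : EuclideanSpace ℝ (Fin n)) : Matrix (Fin n) (Fin n) ℝ :=
  Matrix.of fun i j =>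
    g.inner ((extChartAt (𝓡 n) x).symm y) (coordVector x y i) (coordVector x y j)

/-- The Christoffel symbols of the Levi-Civita connection, `∇_{∂ⱼ} ∂ₖ = ∑ᵢ Γⁱⱼₖ ∂ᵢ`, with
`Γⁱⱼₖ = ½ ∑ₗ gⁱˡ (∂ⱼ gₗₖ + ∂ₖ gₗⱼ - ∂ₗ gⱼₖ)`. -/
def christoffel (g : RiemMetric n M) (x : M) (i j k : Fin n) (y : EuclideanSpace ℝ (Fin n)) : ℝ :=
  (1 / 2) * ∑ l, (gram g x y)⁻¹ i l *
    (partialDeriv j (fun z => gram g x z l k) y + partialDeriv k (fun z => gram g x z l j) y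
      - partialDeriv l (fun z => gram g x z j k) y)

/-- The components at `x` of the Riemann curvature tensor, `R(∂ₖ, ∂ₗ) ∂ⱼ = ∑ᵢ Rⁱⱼₖₗ ∂ᵢ`, where
`R(X, Y) = ∇_X ∇_Y - ∇_Y ∇_X - ∇_[X,Y]`. -/
def riemann (g : RiemMetric n M) (x : M) (i j k l : Fin n) : ℝ :=
  let p := extChartAt (𝓡 n) x x
  partialDeriv k (christoffel g x i l j) p - partialDeriv l (christoffel g x i k j) p
    + ∑ m, (christoffel g x i k m p * christoffel g x m l j p
        - christoffel g x i l m p * christoffel g x m k j p)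

end Riemannian

/-! ## Complex-valued differential forms at a point -/

section Forms

/-- The complexified cotangent space at `x`. -/
abbrev Cotangent (n : ℕ) {M : Type*} [TopologicalSpace M]
    [ChartedSpace (EuclideanSpace ℝ (Fin n)) M] (x : M) : Type :=
  TangentSpace (𝓡 n) x →L[ℝ] ℂ

/-- The algebra of complex-valued differential forms at `x`, under the wedge product. -/
abbrev Form (n : ℕ) {M : Type*} [TopologicalSpace M]
    [ChartedSpace (EuclideanSpace ℝ (Fin n)) M] (x : M) : Type :=
  ExteriorAlgebra ℂ (Cotangent n x)

/-- The centre of the algebra of forms at `x`. It contains all forms of even degree (in particular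
curvature forms and everything built from them), so that determinants and traces of matrices
of such forms make sense in it. -/
abbrev CForm (n : ℕ) {M : Type*} [TopologicalSpace M]
    [ChartedSpace (EuclideanSpace ℝ (Fin n)) M] (x : M) : Type :=
  Subalgebra.center ℂ (Form n x)

theorem ι_mul_ι_mem_center {V : Type*} [AddCommGroup V] [Module ℂ V] (a b : V) :
    ExteriorAlgebra.ι ℂ a * ExteriorAlgebra.ι ℂ b ∈
      Subalgebra.center ℂ (ExteriorAlgebra ℂ V) := by
  rw [Subalgebra.mem_center_iff]
  intro z
  induction z using ExteriorAlgebra.induction with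
  | algebraMap r => exact Algebra.commutes r _
  | ι c =>
    have h1 := eq_neg_of_add_eq_zero_left (ExteriorAlgebra.ι_add_mul_swap (R := ℂ) c a)
    have h2 := eq_neg_of_add_eq_zero_left (ExteriorAlgebra.ι_add_mul_swap (R := ℂ) c b)
    rw [← mul_assoc, h1, neg_mul, mul_assoc, h2, mul_neg, neg_neg, mul_assoc]
  | mul u v hu hv => rw [mul_assoc, hv, ← mul_assoc, hu, mul_assoc]
  | add u v hu hv => rw [add_mul, mul_add, hu, hv]

variable {n : ℕ} {M : Type*} [TopologicalSpace M] [ChartedSpace (EuclideanSpace ℝ (Fin n)) M]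

/-- The coordinate one-form `dxⁱ` of the preferred chart at `x`, at the point `x`. -/
def dCoord (x : M) (i : Fin n) : Cotangent n x :=
  (Complex.ofRealCLM.comp (EuclideanSpace.proj i : EuclideanSpace ℝ (Fin n) →L[ℝ] ℝ)).comp
    (mfderiv (𝓡 n) 𝓘(ℝ, EuclideanSpace ℝ (Fin n)) (extChartAt (𝓡 n) x) x)

/-- The two-form `dxᵏ ∧ dxˡ` at `x`. -/
def dCoord₂ (x : M) (k l : Fin n) : CForm n x :=
  ⟨ExteriorAlgebra.ι ℂ (dCoord x k) * ExteriorAlgebra.ι ℂ (dCoord x l), ι_mul_ι_mem_center _ _⟩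

/-- The curvature `R^{TM} = (∇^{TM})²` of the Levi-Civita connection at `x`, as a matrix of
two-forms in the coordinate frame: `Ωⁱⱼ = ½ ∑ₖₗ Rⁱⱼₖₗ dxᵏ ∧ dxˡ`. -/
def curvature [IsManifold (𝓡 n) ∞ M] (g : RiemMetric n M) (x : M) :
    Matrix (Fin n) (Fin n) (CForm n x) :=
  Matrix.of fun i j => ∑ k, ∑ l, (((1 / 2) * riemann g x i j k l : ℝ) : ℂ) • dCoord₂ x k l

/-- The component of degree `d` of a form at `x`. -/
def component (x : M) (d : ℕ) (α : CForm n x) : Form n x :=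
  GradedAlgebra.proj (fun i : ℕ => ⋀[ℂ]^i (Cotangent n x)) d (α : Form n x)

/-- The value `f(A) = ∑ₘ fₘ Aᵐ` of a power series at a matrix `A` of two-forms (or of linear
combinations of forms of positive even degree). The sum stops at `m = n`, since forms of degree
greater than `n` vanish. -/
def evalSeries {x : M} {ι : Type*} [Fintype ι] [DecidableEq ι] (f : PowerSeries ℂ)
    (A : Matrix ι ι (CForm n x)) : Matrix ι ι (CForm n x) :=
  ∑ m ∈ Finset.range (n + 1), PowerSeries.coeff m f • A ^ m

/-- The square root, with positive component of degree zero, of an even form `α` whose component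
`c` of degree zero is a positive real number: `√c · ∑ₘ (1/2 choose m) (α / c - 1)ᵐ`. The sum
stops at `m = n`, since `α / c - 1` has no component of degree less than two. -/
def formSqrt {x : M} (α : CForm n x) : CForm n x :=
  let c : ℂ := ExteriorAlgebra.algebraMapInv (α : Form n x)
  ((Real.sqrt c.re : ℝ) : ℂ) •
    ∑ m ∈ Finset.range (n + 1), ((Ring.choose (1 / 2 : ℚ) m : ℚ) : ℂ) • (c⁻¹ • α - 1) ^ m

end Forms

/-! ## Characteristic forms -/

section CharacteristicForms

/-- The power series of `sinh z / z`. -/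
def sinhcSeries : PowerSeries ℂ := PowerSeries.mk fun m => if Even m then ((m + 1)! : ℂ)⁻¹ else 0

/-- The power series of `cosh z`. -/
def coshSeries : PowerSeries ℂ := PowerSeries.mk fun m => if Even m then (m ! : ℂ)⁻¹ else 0

variable {n : ℕ} {M : Type*} [TopologicalSpace M] [ChartedSpace (EuclideanSpace ℝ (Fin n)) M]

/-- The Chern character form `tr exp((√-1 / 2π) R)` of a bundle with connection with curvature
matrix `R`. -/
def ch {x : M} {ι : Type*} [Fintype ι] [DecidableEq ι] (R : Matrix ι ι (CForm n x)) : CForm n x :=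
  (evalSeries (PowerSeries.exp ℂ) ((Complex.I / (2 * Real.pi)) • R)).trace

/-- The Chern character form of the parallel subbundle that is the image of the parallel
projection `P`, with the restricted connection: as `P` commutes with the curvature `R`,
the trace over the image of `P` of the exponential of the restricted curvature is
`tr (P exp((√-1 / 2π) R))`. -/
def chOfProj {x : M} {ι : Type*} [Fintype ι] [DecidableEq ι] (P R : Matrix ι ι (CForm n x)) :
    CForm n x :=
  (P * evalSeries (PowerSeries.exp ℂ) ((Complex.I / (2 * Real.pi)) • R)).trace

/-- The curvature `∑ₛ 1 ⊗ ⋯ ⊗ R ⊗ ⋯ ⊗ 1` of the connection induced on the `b`-th tensor power of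
a bundle with curvature matrix `R`, in the frame `e_{I 0} ⊗ ⋯ ⊗ e_{I (b-1)}`. -/
def tensorPowerCurvature {x : M} (R : Matrix (Fin n) (Fin n) (CForm n x)) (b : ℕ) :
    Matrix (Fin b → Fin n) (Fin b → Fin n) (CForm n x) :=
  Matrix.of fun I J => ∑ s, if ∀ t, t ≠ s → I t = J t then R (I s) (J s) else 0

/-- The projection `(1 / b!) ∑_σ σ` of the `b`-th tensor power onto the `b`-th symmetric power. -/
def symProj (x : M) (b : ℕ) : Matrix (Fin b → Fin n) (Fin b → Fin n) (CForm n x) :=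
  Matrix.of fun I J => (b ! : ℂ)⁻¹ •
    ∑ σ : Equiv.Perm (Fin b), if I = J ∘ σ then (1 : CForm n x) else 0

/-- The projection `(1 / b!) ∑_σ sgn(σ) σ` of the `b`-th tensor power onto the `b`-th exterior
power. -/
def extProj (x : M) (b : ℕ) : Matrix (Fin b → Fin n) (Fin b → Fin n) (CForm n x) :=
  Matrix.of fun I J => (b ! : ℂ)⁻¹ •
    ∑ σ : Equiv.Perm (Fin b),
      if I = J ∘ σ then ((Equiv.Perm.sign σ : ℤ) : CForm n x) else 0

variable [IsManifold (𝓡 n) ∞ M] (g : RiemMetric n M) (x : M)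

/-- The form `Â(TM, ∇) = det^{1/2} (Z / sinh Z)`, where `Z = (√-1 / 4π) R^{TM}`. -/
def aHat : CForm n x :=
  formSqrt (evalSeries sinhcSeries⁻¹ ((Complex.I / (4 * Real.pi)) • curvature g x)).det

/-- The form `L̂(TM, ∇) = det^{1/2} (2 Z / tanh Z)`, where `Z = (√-1 / 4π) R^{TM}`. -/
def lHat : CForm n x :=
  formSqrt (evalSeries ((2 : ℂ) • (coshSeries * sinhcSeries⁻¹))
    ((Complex.I / (4 * Real.pi)) • curvature g x)).det

/-- The Chern character form of `T_ℂ M`. -/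
def chT : CForm n x := ch (curvature g x)

/-- The Chern character form of `T_ℂ M ⊗ T_ℂ M` with the tensor product connection, whose
curvature is `R ⊗ 1 + 1 ⊗ R`. -/
def chTT : CForm n x := ch (curvature g x ⊗ₖ 1 + 1 ⊗ₖ curvature g x)

/-- The Chern character form of the symmetric power `S^b(T_ℂ M)`. -/
def chSym (b : ℕ) : CForm n x := chOfProj (symProj x b) (tensorPowerCurvature (curvature g x) b)

/-- The Chern character form of the exterior power `Λ^b(T_ℂ M)`. -/
def chExt (b : ℕ) : CForm n x := chOfProj (extProj x b) (tensorPowerCurvature (curvature g x) b)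

end CharacteristicForms

/-! ## Virtual bundles derived from `T_ℂ M` -/

section VirtualBundles

/-- Formal integral combinations of tensor products of symmetric powers `S^b(T_ℂ M)`
(the variables `Sum.inl b`) and exterior powers `Λ^b(T_ℂ M)` (the variables `Sum.inr b`) of the
complexified tangent bundle. The integer `N` stands for the trivial bundle `ℂ^N`, and the product
for the tensor product. -/
abbrev VirtualBundle := MvPolynomial (ℕ ⊕ ℕ) ℤ

/-- The symmetric power `S^b(T_ℂ M)`; the zeroth one is the trivial line bundle. -/
def symPow (b : ℕ) : VirtualBundle := if b = 0 then 1 else MvPolynomial.X (Sum.inl b)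

/-- The exterior power `Λ^b(T_ℂ M)`; the zeroth one is the trivial line bundle. -/
def extPow (b : ℕ) : VirtualBundle := if b = 0 then 1 else MvPolynomial.X (Sum.inr b)

/-- The Chern character form of a virtual bundle with the induced connection. It is additive on
formal sums and differences, and multiplicative on tensor products. -/
def chVirtual {n : ℕ} {M : Type*} [TopologicalSpace M]
    [ChartedSpace (EuclideanSpace ℝ (Fin n)) M] [IsManifold (𝓡 n) ∞ M]
    (g : RiemMetric n M) (x : M) (E : VirtualBundle) : CForm n x :=
  MvPolynomial.aeval (Sum.elim (chSym g x) (chExt g x)) E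

/-- The infinite product `∏_{j ≥ 1} f j` of power series with `f j ≡ 1` modulo `X ^ j`: the
factors with `j > m` do not contribute to the coefficient of `X ^ m`. -/
def infProd {R : Type*} [CommRing R] (f : ℕ → PowerSeries R) : PowerSeries R :=
  PowerSeries.mk fun m => PowerSeries.coeff m (∏ j ∈ Finset.Icc 1 m, f j)

/-- The total symmetric power `S_u(T_ℂ M - ℂ^N) = S_u(T_ℂ M) (1 - u)^N` at `u = X ^ d`; here
`X = q^{1/2}`. -/
def totalSym (N d : ℕ) : PowerSeries VirtualBundle :=
  PowerSeries.mk (fun m => if d ∣ m then symPow (m / d) else 0) * (1 - PowerSeries.X ^ d) ^ N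

/-- The total exterior power `Λ_u(T_ℂ M - ℂ^N) = Λ_u(T_ℂ M) (1 + u)^{-N}` at `u = -X ^ d`; here
`X = q^{1/2}`. -/
def totalExt (N d : ℕ) : PowerSeries VirtualBundle :=
  PowerSeries.mk (fun m => if d ∣ m then (-1) ^ (m / d) * extPow (m / d) else 0) *
    PowerSeries.invOfUnit ((1 - PowerSeries.X ^ d) ^ N) 1

/-- `Θ₂(T_ℂ M) = ⨂_{j ≥ 1} S_{q^j}(T_ℂ M - ℂ^N) ⊗ ⨂_{j ≥ 1} Λ_{-q^{j - 1/2}}(T_ℂ M - ℂ^N)` for a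
manifold of dimension `N`, as a power series in `X = q^{1/2}`. -/
def Theta₂ (N : ℕ) : PowerSeries VirtualBundle :=
  infProd fun j => totalSym N (2 * j) * totalExt N (2 * j - 1)

/-- The coefficient `B_j(T_ℂ M)` of `q^{j/2}` in `Θ₂(T_ℂ M)`, for a manifold of dimension `N`. -/
def B (N j : ℕ) : VirtualBundle := PowerSeries.coeff j (Theta₂ N)

end VirtualBundles

/-! ## The modular forms `8 δ₂` and `ε₂`, as power series in `X = q^{1/2}` -/

section ModularForms

/-- `θ₁(0, τ)⁴ / 16 = q^{1/2} ∏_{j ≥ 1} ((1 - q^j) (1 + q^j)²)⁴`. -/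
def theta₁Fourth : PowerSeries ℤ :=
  PowerSeries.X *
    infProd fun j => ((1 - PowerSeries.X ^ (2 * j)) * (1 + PowerSeries.X ^ (2 * j)) ^ 2) ^ 4

/-- `θ₃(0, τ)⁴ = ∏_{j ≥ 1} ((1 - q^j) (1 + q^{j - 1/2})²)⁴`. -/
def theta₃Fourth : PowerSeries ℤ :=
  infProd fun j => ((1 - PowerSeries.X ^ (2 * j)) * (1 + PowerSeries.X ^ (2 * j - 1)) ^ 2) ^ 4

/-- `8 δ₂ = -(θ₁⁴ + θ₃⁴) = -1 - 24 q^{1/2} - ⋯`. -/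
def eightDelta₂ : PowerSeries ℤ := -(16 * theta₁Fourth + theta₃Fourth)

/-- `ε₂ = θ₁⁴ θ₃⁴ / 16 = q^{1/2} + 8 q + ⋯`. -/
def epsilon₂ : PowerSeries ℤ := theta₁Fourth * theta₃Fourth

/-- The integers `c r j` are the coefficients of the canonical combinations `b_r = ∑ⱼ c r j B_j`,
`0 ≤ r ≤ k`: those obtained by comparing the coefficients of `q^{m/2}`, `0 ≤ m ≤ k`, in
`∑ₘ B_m q^{m/2} = ∑ᵣ b_r (8 δ₂)^{2k+1-2r} ε₂^r`, the `B_m` being treated as indeterminates. -/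
def IsCanonical (k : ℕ) (c : Matrix (Fin (k + 1)) (Fin (k + 1)) ℤ) : Prop :=
  ∀ m j : Fin (k + 1),
    ∑ r : Fin (k + 1), c r j * PowerSeries.coeff (m : ℕ)
      (eightDelta₂ ^ (2 * k + 1 - 2 * (r : ℕ)) * epsilon₂ ^ (r : ℕ)) = if m = j then 1 else 0

/-- The virtual bundle `b_r(T_ℂ M) = ∑ⱼ c r j B_j(T_ℂ M)` on a manifold of dimension `8k + 4`. -/
def bBundle (k : ℕ) (c : Matrix (Fin (k + 1)) (Fin (k + 1)) ℤ) (r : Fin (k + 1)) :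
    VirtualBundle :=
  ∑ j : Fin (k + 1), c r j • B (8 * k + 4) (j : ℕ)

/-- The form `h_r(T_ℂ M) = {Â(TM, ∇) ch(b_r(T_ℂ M))}^{(8k+4)}` at `x`. -/
def hForm {k : ℕ} {M : Type*} [TopologicalSpace M]
    [ChartedSpace (EuclideanSpace ℝ (Fin (8 * k + 4))) M] [IsManifold (𝓡 (8 * k + 4)) ∞ M]
    (g : RiemMetric (8 * k + 4) M) (x : M) (c : Matrix (Fin (k + 1)) (Fin (k + 1)) ℤ)
    (r : Fin (k + 1)) : Form (8 * k + 4) x :=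
  component x (8 * k + 4) (aHat g x * chVirtual g x (bBundle k c r))

end ModularForms

end

end TwistedCancellation

open TwistedCancellation

/-! Grade all forms by the power of a formal variable, written `x` or `t`, that scales the
curvature. A multiplicative characteristic form then has a logarithmic derivative `∑ ψ_j tr(A ^ j) x
^ j`, where `A` is the matrix `(√-1 / 2π) R`. Curvature is skew for the metric, so the odd traces
vanish and only `ψ(x) + ψ(-x)` matters.

For `Â ch(Θ₂)` this even part is `V + 1` with `V = x v(exp x)`, where `v(z) = ∑ zⁱ / (1 + Qⁱ)` is a
bilateral Lambert series and `Q = q^{1/2}`. For `L̂` (normalized to constant term one) twisted by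
`exp(2 κ τ) = 1 + 2 κ τ + 2 κ² τ²`, with `τ = ch(T) - N`, `N` the dimension, and `κ³ = 0`, it is `V
+ 1` with `V = -x / sinh x + 4 κ x sinh x`. Both functions `V` start with `-1` and satisfy the same
Jacobi elliptic equation `(x V' - V)² = (V² + 2 δ x²)² - 4 ε x⁴`, the first with `(δ, ε) = (δ₂, ε₂)`
(`jacV_equation`), the second with `(1/4 + 6 κ, 1/16 - κ + 8 κ²)` (`hypV_equation`).

The equation is a recursion that expresses the coefficients of `V`, hence those of the
characteristic form, as weighted homogeneous polynomials in `δ` (weight 2) and `ε` (weight 4): see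
`coeff_mem_weightSpan`, `mem_weightSpan_of_log_deriv`. Run over a product of two rings, it gives one
and the same expression `∑ s_r δ^{2k+1-2r} ε^r` for both top-degree components
(`exists_common_coeff`, `exists_common_polynomial`). This takes the place of the modular
transformation that exchanges the two cusps.

Comparing coefficients of `Q` gives `h_r = 8^{-(2k+1-2r)} s_r`. Comparing those of `1, κ, κ²`
expresses `L̂`, `L̂ τ`, `L̂ τ²` through the `s_r`. In the combination with `-55` and `768` the
coefficient of `s_r` is quadratic in `k` and `r` and collapses to `2^{10} (k - r)(k - r - 1)`
(`signatureCoeff_cancel`), which kills `r = k` and `r = k - 1`.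

The analytic core is the elliptic equation for `v`. Partial fractions and telescoping give `v² = p +
S` and `2 v p = v'' - 2 D v`, where `p = ∑ i zⁱ / (1 - Qⁱ)`, `S` and `D` depend on `Q` only and the
derivative is `z d/dz`. Hence `p + D ± v'` have logarithmic derivatives `±2 v`, their product is
constant, and it is a first integral. A theta quotient with logarithmic derivative `-2 v`, compared
at `z = 1` and `z = -1`, identifies the constants with `ε₂` and `δ₂`.

The link with the given definitions, where sums stop at the dimension and forms are not scaled, is
`gradedPairs`: a polynomial in `t` with homogeneous coefficients, paired with its value at `t = 1`.
-/

namespace TwistedCancellation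
noncomputable section

/-! ## Bilateral Lambert series -/

section Bilateral

open PowerSeries

/-- The power series `1 / (1 + X ^ m)`. -/
def invAdd (m : ℕ) : PowerSeries ℂ := (1 + X ^ m)⁻¹

/-- The power series `1 / (1 - X ^ m)` for `m > 0`. -/
def invSub (m : ℕ) : PowerSeries ℂ := (1 - X ^ m)⁻¹

theorem invAdd_mul (m : ℕ) : invAdd m * (1 + X ^ m) = 1 := by
  refine PowerSeries.inv_mul_cancel _ ?_
  rcases m with _ | m
  · simp only [pow_zero, map_add, map_one]; norm_num
  · simp

theorem invSub_mul {m : ℕ} (hm : m ≠ 0) : invSub m * (1 - X ^ m) = 1 := by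
  refine PowerSeries.inv_mul_cancel _ ?_
  simp [hm]

/-- `1 / (1 + X ^ i)` for an integer `i`. -/
def lamAdd (i : ℤ) : PowerSeries ℂ := X ^ (-i).toNat * invAdd i.natAbs

/-- `1 / (1 - X ^ i)` for an integer `i ≠ 0`. -/
def lamSub (i : ℤ) : PowerSeries ℂ :=
  if 0 ≤ i then invSub i.natAbs else -(X ^ (-i).toNat * invSub i.natAbs)

/-- The field of fractions used to verify identities of Lambert series. -/
abbrev LFrac := FractionRing (PowerSeries ℂ)

/-- The variable as an element of the field of fractions. -/
def xf : LFrac := algebraMap (PowerSeries ℂ) LFrac X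

theorem xf_ne : xf ≠ 0 := by
  simp [xf, X_ne_zero]

theorem algebraMap_injective_LFrac :
    Function.Injective (algebraMap (PowerSeries ℂ) LFrac) :=
  IsFractionRing.injective _ _

theorem one_add_xf_pow_ne (n : ℕ) : 1 + xf ^ n ≠ 0 := by
  intro h
  have h2 := congrArg (algebraMap (PowerSeries ℂ) LFrac) (invAdd_mul n)
  rw [map_mul, map_add, map_pow, map_one, ← xf, h, mul_zero] at h2
  exact zero_ne_one h2

theorem one_sub_xf_pow_ne {n : ℕ} (hn : n ≠ 0) : 1 - xf ^ n ≠ 0 := by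
  intro h
  have h2 := congrArg (algebraMap (PowerSeries ℂ) LFrac) (invSub_mul hn)
  rw [map_mul, map_sub, map_pow, map_one, ← xf, h, mul_zero] at h2
  exact zero_ne_one h2

theorem map_invAdd (n : ℕ) : algebraMap _ LFrac (invAdd n) = (1 + xf ^ n)⁻¹ := by
  refine eq_inv_of_mul_eq_one_left ?_
  have h2 := congrArg (algebraMap (PowerSeries ℂ) LFrac) (invAdd_mul n)
  simpa [xf] using h2

theorem map_invSub {n : ℕ} (hn : n ≠ 0) : algebraMap _ LFrac (invSub n) = (1 - xf ^ n)⁻¹ := by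
  refine eq_inv_of_mul_eq_one_left ?_
  have h2 := congrArg (algebraMap (PowerSeries ℂ) LFrac) (invSub_mul hn)
  simpa [xf] using h2

theorem one_add_xf_zpow_ne (i : ℤ) : 1 + xf ^ i ≠ 0 := by
  have hx := xf_ne
  rcases i with n | n
  · simpa using one_add_xf_pow_ne n
  · intro h
    apply one_add_xf_pow_ne (n + 1)
    rw [Int.negSucc_eq, zpow_neg] at h
    have h3 : xf ^ (n + 1) ≠ 0 := pow_ne_zero _ hx
    have h4 : xf ^ ((n : ℤ) + 1) = xf ^ (n + 1) := by norm_cast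
    rw [h4] at h
    field_simp at h
    linear_combination h

theorem one_sub_xf_zpow_ne {i : ℤ} (hi : i ≠ 0) : 1 - xf ^ i ≠ 0 := by
  have hx := xf_ne
  rcases i with n | n
  · simpa using one_sub_xf_pow_ne (n := n) (by simpa using hi)
  · intro h
    apply one_sub_xf_pow_ne (n := n + 1) (by omega)
    rw [Int.negSucc_eq, zpow_neg] at h
    have h3 : xf ^ (n + 1) ≠ 0 := pow_ne_zero _ hx
    have h4 : xf ^ ((n : ℤ) + 1) = xf ^ (n + 1) := by norm_cast
    rw [h4] at h
    field_simp at h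
    linear_combination -h

theorem map_lamAdd (i : ℤ) : algebraMap _ LFrac (lamAdd i) = (1 + xf ^ i)⁻¹ := by
  have hx := xf_ne
  rcases i with n | n
  · simp [lamAdd, map_invAdd]
  · have h := one_add_xf_pow_ne (n + 1)
    have h' := one_add_xf_zpow_ne (Int.negSucc n)
    have e : (-(Int.negSucc n)).toNat = n + 1 := by simp
    have e' : (Int.negSucc n).natAbs = n + 1 := rfl
    rw [lamAdd, map_mul, map_pow, e, e', map_invAdd, ← xf]
    have h3 : xf ^ (n + 1) ≠ 0 := pow_ne_zero _ hx
    have e2 : 1 + (xf ^ (n + 1))⁻¹ = (1 + xf ^ (n + 1)) / xf ^ (n + 1) := by field_simp; ring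
    rw [zpow_negSucc, e2, inv_div, div_eq_mul_inv]

theorem map_lamSub {i : ℤ} (hi : i ≠ 0) :
    algebraMap _ LFrac (lamSub i) = (1 - xf ^ i)⁻¹ := by
  have hx := xf_ne
  rcases i with n | n
  · have hn : n ≠ 0 := by simpa using hi
    simp [lamSub, map_invSub hn]
  · have h := one_sub_xf_pow_ne (n := n + 1) (by omega)
    have h' := one_sub_xf_zpow_ne hi
    have e : (-(Int.negSucc n)).toNat = n + 1 := by simp
    have e' : (Int.negSucc n).natAbs = n + 1 := rfl
    rw [lamSub, if_neg (by simp), map_neg, map_mul, map_pow, e, e', map_invSub (by omega), ← xf]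
    rw [zpow_negSucc] at h' ⊢
    have h3 : xf ^ (n + 1) ≠ 0 := pow_ne_zero _ hx
    have h4 : xf ^ (n + 1) - 1 ≠ 0 := by
      intro h5; apply h; linear_combination -h5
    rw [← one_div, ← one_div, neg_eq_iff_eq_neg, mul_one_div, ← neg_eq_iff_eq_neg, ← neg_div,
      div_eq_div_iff h h']
    field_simp
    ring

/-- This reflection makes the deviation of `1 / (1 + Qⁱ)` from the step function odd in `i`. -/
theorem lamAdd_neg (i : ℤ) : lamAdd (-i) = 1 - lamAdd i := by
  apply algebraMap_injective_LFrac
  rw [map_sub, map_lamAdd, map_lamAdd, map_one]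
  have h := one_add_xf_zpow_ne i
  have h' := one_add_xf_zpow_ne (-i)
  have hx : xf ^ i ≠ 0 := zpow_ne_zero _ xf_ne
  have e2 : 1 + (xf ^ i)⁻¹ = (1 + xf ^ i) / xf ^ i := by field_simp; ring
  rw [zpow_neg, e2, inv_div]
  field_simp
  ring

theorem lamSub_neg {i : ℤ} (hi : i ≠ 0) : lamSub (-i) = 1 - lamSub i := by
  apply algebraMap_injective_LFrac
  rw [map_sub, map_lamSub hi, map_lamSub (neg_ne_zero.2 hi), map_one]
  have h := one_sub_xf_zpow_ne hi
  have h' := one_sub_xf_zpow_ne (neg_ne_zero.2 hi)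
  have hx : xf ^ i ≠ 0 := zpow_ne_zero _ xf_ne
  rw [zpow_neg] at h' ⊢
  generalize xf ^ i = y at *
  have h4 : y - 1 ≠ 0 := by intro h5; apply h; linear_combination -h5
  have e : 1 - y⁻¹ = (y - 1) / y := by field_simp
  rw [e]
  field_simp
  ring

/-- Partial fractions: with `m` fixed the product becomes a difference of two shifts of one sequence
in `i`, so summation over `i` telescopes. -/
theorem lamAdd_mul_lamAdd {m : ℤ} (hm : m ≠ 0) (i : ℤ) :
    lamAdd i * lamAdd (m - i) = lamSub m * (lamAdd i - lamAdd (i - m)) := by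
  apply algebraMap_injective_LFrac
  rw [map_mul, map_mul, map_sub, map_lamAdd, map_lamAdd, map_lamAdd, map_lamSub hm]
  have h1 := one_add_xf_zpow_ne i
  have h2 := one_add_xf_zpow_ne (m - i)
  have h3 := one_add_xf_zpow_ne (i - m)
  have h4 := one_sub_xf_zpow_ne hm
  have hx : xf ^ i ≠ 0 := zpow_ne_zero _ xf_ne
  have hy : xf ^ m ≠ 0 := zpow_ne_zero _ xf_ne
  rw [zpow_sub₀ xf_ne] at h2 h3 ⊢
  rw [zpow_sub₀ xf_ne]
  generalize xf ^ i = y at *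
  generalize xf ^ m = z at *
  have e2 : 1 + z / y = (y + z) / y := by field_simp
  have e3 : 1 + y / z = (y + z) / z := by field_simp; ring
  rw [e2] at h2 ⊢
  rw [e3]
  have h5 : y + z ≠ 0 := by intro h; apply h2; rw [h, zero_div]
  field_simp
  ring

/-- The mixed version of the same partial fraction. The prefactor now depends on `m` alone through
`1 / (1 + Q ^ m)`, so the convolution reproduces a term of `v`. -/
theorem lamAdd_mul_lamSub {m i : ℤ} (hm : m - i ≠ 0) :
    lamAdd i * lamSub (m - i) = lamAdd m * (lamAdd i - lamSub (i - m)) := by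
  apply algebraMap_injective_LFrac
  have hm' : i - m ≠ 0 := by omega
  rw [map_mul, map_mul, map_sub, map_lamAdd, map_lamAdd, map_lamSub hm, map_lamSub hm']
  have h1 := one_add_xf_zpow_ne i
  have h2 := one_sub_xf_zpow_ne hm
  have h3 := one_sub_xf_zpow_ne hm'
  have h4 := one_add_xf_zpow_ne m
  have hx : xf ^ i ≠ 0 := zpow_ne_zero _ xf_ne
  have hy : xf ^ m ≠ 0 := zpow_ne_zero _ xf_ne
  rw [zpow_sub₀ xf_ne] at h2 h3 ⊢
  rw [zpow_sub₀ xf_ne]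
  generalize xf ^ i = y at *
  generalize xf ^ m = z at *
  have e2 : 1 - z / y = (y - z) / y := by field_simp
  have e3 : 1 - y / z = -(y - z) / z := by field_simp; ring
  rw [e2] at h2 ⊢
  rw [e3]
  have h5 : y - z ≠ 0 := by intro h; apply h2; rw [h, zero_div]
  have h6 : -(y - z) ≠ 0 := neg_ne_zero.2 h5
  rw [inv_div, inv_div, neg_sub] 
  have h7 : z - y ≠ 0 := by intro h; apply h5; linear_combination -h
  field_simp
  ring

/-- The Heaviside function. -/
def heav (A : Type*) [CommRing A] (i : ℤ) : A := if 0 ≤ i then 1 else 0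

section Nilpotent

variable {A : Type*} [CommRing A]

/-- The monomial `z ^ i` on the annulus with coordinates `α = z` and `β = Q / z`, up to a power
of `Q`. -/
def annMon (α β : A) (i : ℤ) : A := α ^ i.toNat * β ^ (-i).toNat

theorem annMon_swap (α β : A) (i : ℤ) : annMon β α i = annMon α β (-i) := by
  rw [annMon, annMon, neg_neg, mul_comm]

theorem annMon_eq_zero {α β : A} {J : ℕ} (hα : α ^ J = 0) (hβ : β ^ J = 0) {i : ℤ}
    (hi : J ≤ i.natAbs) : annMon α β i = 0 := by
  rw [annMon]
  rcases le_total 0 i with h | h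
  · rw [pow_eq_zero_of_le (show J ≤ i.toNat by omega) hα, zero_mul]
  · rw [pow_eq_zero_of_le (show J ≤ (-i).toNat by omega) hβ, mul_zero]

/-- Negative powers of `z` are stored as powers of `β = Q / z`, so `zⁱ z^{m-i} = z^m` costs powers
of `Q = α β`. These are exactly the powers of `Q` built into `lamAdd` and `lamSub` at negative
indices. -/
theorem annMon_mul (α β : A) {m : ℤ} (hm : 0 ≤ m) (i : ℤ) :
    annMon α β i * annMon α β (m - i) =
      annMon α β m * ((α * β) ^ (-i).toNat * (α * β) ^ (-(m - i)).toNat) := by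
  have e1 : i.toNat + (m - i).toNat = m.toNat + ((-i).toNat + (-(m - i)).toNat) := by omega
  have e2 : (-m).toNat = 0 := by omega
  rw [annMon, annMon, annMon, e2, pow_zero, mul_one]
  calc _ = α ^ (i.toNat + (m - i).toNat) * β ^ ((-i).toNat + (-(m - i)).toNat) := by ring
    _ = _ := by rw [e1]; ring

variable (ρ : PowerSeries ℂ →+* A) (α β : A)

/-- The general term of the bilateral series `∑ zⁱ / (1 + Qⁱ)`. -/
def addTerm (i : ℤ) : A := annMon α β i * ρ (invAdd i.natAbs)

/-- The general term of the bilateral series `∑ i zⁱ / (1 - Qⁱ)`. -/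
def subTerm (i : ℤ) : A := annMon α β i * ((i.natAbs : A) * ρ (invSub i.natAbs))

theorem addTerm_swap (i : ℤ) : addTerm ρ β α i = addTerm ρ α β (-i) := by
  rw [addTerm, addTerm, annMon_swap, Int.natAbs_neg]

theorem subTerm_swap (i : ℤ) : subTerm ρ β α i = subTerm ρ α β (-i) := by
  rw [subTerm, subTerm, annMon_swap, Int.natAbs_neg]

theorem natAbs_mul_pow_mul_invSub (j : ℤ) :
    (X : PowerSeries ℂ) ^ (-j).toNat * ((j.natAbs : PowerSeries ℂ) * invSub j.natAbs) =
      (j : PowerSeries ℂ) * lamSub j := by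
  rcases j with n | n
  · simp [lamSub]
  · have e : (-(Int.negSucc n)).toNat = n + 1 := by simp
    have e' : (Int.negSucc n).natAbs = n + 1 := rfl
    rw [lamSub, if_neg (by simp), e, e', Int.negSucc_eq]
    push_cast
    ring

variable {ρ α β}

theorem addTerm_mul_addTerm (hρ : ρ X = α * β) {m : ℤ} (hm : 0 ≤ m) (i : ℤ) :
    addTerm ρ α β i * addTerm ρ α β (m - i) =
      annMon α β m * ρ (lamAdd i * lamAdd (m - i)) := by
  rw [addTerm, addTerm, lamAdd, lamAdd, map_mul, map_mul, map_mul, map_pow, map_pow, hρ]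
  linear_combination (ρ (invAdd i.natAbs) * ρ (invAdd (m - i).natAbs)) * annMon_mul α β hm i

theorem addTerm_mul_subTerm (hρ : ρ X = α * β) {m : ℤ} (hm : 0 ≤ m) (i : ℤ) :
    addTerm ρ α β i * subTerm ρ α β (m - i) =
      annMon α β m * ρ (lamAdd i * (((m - i : ℤ) : PowerSeries ℂ) * lamSub (m - i))) := by
  rw [addTerm, subTerm, ← natAbs_mul_pow_mul_invSub, lamAdd]
  simp only [map_mul, map_pow, hρ, map_natCast]
  linear_combination (ρ (invAdd i.natAbs) * ((m - i).natAbs * ρ (invSub (m - i).natAbs))) *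
    annMon_mul α β hm i

variable (ρ) in
/-- The deviation of `1 / (1 + Qⁱ)` from the Heaviside function. -/
def addDev (i : ℤ) : A := ρ (lamAdd i) - heav A i

variable (ρ) in
/-- The deviation of `1 / (1 - Qⁱ)` from the Heaviside function, times `i`. -/
def subDev (i : ℤ) : A := (i : A) * (ρ (lamSub i) - heav A i)

/-- The deviation is divisible by `Q ^ |i|`. With `Q` nilpotent the bilateral sums of deviations are
therefore finite, although those of `1 / (1 + Qⁱ)` are not. -/
theorem addDev_eq_zero {J : ℕ} (hJ : ρ X ^ J = 0) {i : ℤ} (hi : J < i.natAbs) :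
    addDev ρ i = 0 := by
  rcases le_or_gt 0 i with h | h
  · have e := lamAdd_neg (-i)
    rw [neg_neg] at e
    rw [addDev, e, lamAdd, heav, if_pos h, neg_neg, map_sub, map_mul, map_pow,
      pow_eq_zero_of_le (show J ≤ i.toNat by omega) hJ, map_one]
    ring
  · rw [addDev, lamAdd, heav, if_neg (by omega), map_mul, map_pow,
      pow_eq_zero_of_le (show J ≤ (-i).toNat by omega) hJ]
    ring

theorem subDev_eq_zero {J : ℕ} (hJ : ρ X ^ J = 0) {i : ℤ} (hi : J < i.natAbs) :
    subDev ρ i = 0 := by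
  rcases le_or_gt 0 i with h | h
  · have e := lamSub_neg (i := -i) (by omega)
    rw [neg_neg] at e
    rw [subDev, e, lamSub, heav, if_pos h, if_neg (by omega), neg_neg, map_sub, map_neg, map_mul,
      map_pow, pow_eq_zero_of_le (show J ≤ i.toNat by omega) hJ, map_one]
    ring
  · rw [subDev, lamSub, heav, if_neg (by omega), if_neg (by omega), map_neg, map_mul, map_pow,
      pow_eq_zero_of_le (show J ≤ (-i).toNat by omega) hJ]
    ring

theorem addDev_neg {i : ℤ} (hi : i ≠ 0) : addDev ρ (-i) = -addDev ρ i := by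
  have : heav A (-i) = 1 - heav A i := by
    rcases lt_or_gt_of_ne hi with h | h
    · simp [heav, not_le.2 h, h.le]
    · simp [heav, h.le, not_le.2 h]
  rw [addDev, addDev, lamAdd_neg, this, map_sub, map_one]
  ring

theorem two_mul_addDev_zero : 2 * addDev ρ 0 = -1 := by
  have h := congrArg ρ (invAdd_mul 0)
  simp only [pow_zero, map_mul, map_add, map_one] at h
  simp only [addDev, lamAdd, heav, neg_zero, Int.toNat_zero, pow_zero, one_mul, Int.natAbs_zero,
    le_refl, if_true]
  linear_combination h

theorem finite_support_of_natAbs {f : ℤ → A} {J : ℕ} (hf : ∀ i : ℤ, J < i.natAbs → f i = 0) :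
    f.support.Finite := by
  refine (Set.finite_Icc (-(J : ℤ)) J).subset fun i hi => ?_
  by_contra h
  apply hi
  apply hf
  rw [Set.mem_Icc] at h
  omega

variable [TopologicalSpace A]

theorem summable_of_natAbs {f : ℤ → A} {J : ℕ} (hf : ∀ i : ℤ, J < i.natAbs → f i = 0) :
    Summable f :=
  summable_of_hasFiniteSupport (finite_support_of_natAbs hf)

variable [DiscreteTopology A]

/-- The difference of the two step functions is the indicator of `-m ≤ i ≤ -1`. -/
theorem hasSum_heav_sub {m : ℕ} (w : ℤ → A) :
    HasSum (fun i : ℤ => w i * (heav A (i + m) - heav A i)) (∑ j ∈ Finset.range m, w (-(j + 1))) := by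
  induction m with
  | zero => simp [hasSum_zero]
  | succ m ih =>
    rw [Finset.sum_range_succ]
    have h1 : HasSum (fun i : ℤ => w i * (heav A (i + (m + 1 : ℕ)) - heav A (i + m)))
        (w (-(m + 1))) := by
      convert hasSum_single (-((m : ℤ) + 1)) ?_ using 1
      · simp [heav]
      · intro i hi
        have : heav A (i + (m + 1 : ℕ)) = heav A (i + m) := by
          rw [heav, heav]
          have : (0 ≤ i + ((m + 1 : ℕ) : ℤ)) ↔ 0 ≤ i + (m : ℤ) := by push_cast; omega
          simp only [this]
        rw [this, sub_self, mul_zero]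
    convert ih.add h1 using 2
    ring

/-- The deviations cancel in pairs `±i`; the term at `0` is `1/2 - 1`. -/
theorem two_mul_tsum_addDev {J : ℕ} (hJ : ρ X ^ J = 0) : 2 * ∑' i, addDev ρ i = -1 := by
  have h1 := (summable_of_natAbs (J := J) fun i => addDev_eq_zero (ρ := ρ) hJ).hasSum
  have h2 := (Equiv.neg ℤ).hasSum_iff.2 h1
  have h3 := h1.add h2
  have h4 : HasSum (fun i : ℤ => addDev ρ i + addDev ρ (-i)) (2 * addDev ρ 0) := by
    convert hasSum_single (0 : ℤ) ?_ using 1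
    · simp [two_mul]
    · intro i hi
      rw [addDev_neg hi]; ring
  rw [two_mul, ← two_mul_addDev_zero (ρ := ρ)]
  exact h3.unique h4

/-- The telescoping sum. Neither part is summable alone, as `1 / (1 + Qⁱ)` tends to `1` at `+∞`.
After subtracting step functions the deviations cancel by translation invariance, and the steps
contribute `m`. -/
theorem hasSum_lamAdd_sub {J : ℕ} (hJ : ρ X ^ J = 0) (m : ℕ) :
    HasSum (fun i : ℤ => ρ (lamAdd i - lamAdd (i - m))) (m : A) := by
  have h1 := (summable_of_natAbs (J := J) fun i => addDev_eq_zero (ρ := ρ) hJ).hasSum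
  have h2 := (Equiv.subRight (m : ℤ)).hasSum_iff.2 h1
  have h3 := (Equiv.subRight (m : ℤ)).hasSum_iff.2 (hasSum_heav_sub (A := A) (m := m) fun _ => 1)
  have h4 := (h1.sub h2).add h3
  have e : (m : A) = ∑' b, addDev ρ b - ∑' b, addDev ρ b + ∑ j ∈ Finset.range m, 1 := by simp
  rw [e]
  refine h4.congr_fun ?_
  intro i
  simp [addDev]
  ring

/-- The constant `∑ⱼ j (1 / (1 + Qʲ) - 1 / (1 - Qʲ))`. -/
def devConst (ρ : PowerSeries ℂ →+* A) : A := ∑' j : ℤ, ((j : A) * addDev ρ j - subDev ρ j)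

/-- Again both parts are split into step function and deviation. Shifting the deviation of `1 / (1 +
Qʲ)` by `m` costs `-m ∑ addDev = m / 2`, and the shifted step function gives `-(1 + ⋯ + m)`; twice
the sum of these corrections is `-m²`. -/
theorem hasSum_mul_lamAdd_sub_lamSub {J : ℕ} (hJ : ρ X ^ J = 0) (m : ℕ) :
    HasSum (fun j : ℤ => 2 * ((j : A) * ρ (lamAdd (j + m) - lamSub j)))
      (2 * devConst ρ - (m : A) ^ 2) := by
  have z : ∀ i : ℤ, J < i.natAbs → addDev ρ i = 0 := fun i => addDev_eq_zero hJ
  have h0 := (summable_of_natAbs (J := J) z).hasSum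
  have h1 : HasSum (fun j : ℤ => (j : A) * addDev ρ j) (∑' j : ℤ, (j : A) * addDev ρ j) :=
    (summable_of_natAbs (J := J) fun i hi => by rw [z i hi, mul_zero]).hasSum
  have h2 : HasSum (fun j : ℤ => subDev ρ j) (∑' j : ℤ, subDev ρ j) :=
    (summable_of_natAbs (J := J) fun i hi => subDev_eq_zero hJ hi).hasSum
  have h3 := h1.sub h2
  have e : devConst ρ = (∑' j : ℤ, (j : A) * addDev ρ j) - ∑' j : ℤ, subDev ρ j := h3.tsum_eq
  have h4 := (Equiv.addRight (m : ℤ)).hasSum_iff.2 (h1.sub (h0.mul_left (m : A)))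
  have h5 := hasSum_heav_sub (A := A) (m := m) fun j => (j : A)
  have h6 := ((h4.add h5).sub h2).mul_left 2
  have e2 : 2 * devConst ρ - (m : A) ^ 2 = 2 * (∑' (j : ℤ), (j : A) * addDev ρ j -
      m * ∑' (b : ℤ), addDev ρ b + ∑ j ∈ Finset.range m, ((-((j : ℤ) + 1) : ℤ) : A) -
        ∑' (j : ℤ), subDev ρ j) := by
    have h7 : ∀ m : ℕ, 2 * ∑ j ∈ Finset.range m, ((-((j : ℤ) + 1) : ℤ) : A) = -(m : A) ^ 2 - m := by
      intro m
      induction m with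
      | zero => simp
      | succ m ih =>
        rw [Finset.sum_range_succ, mul_add, ih]
        push_cast
        ring
    have h8 := two_mul_tsum_addDev hJ
    rw [e]
    linear_combination (m : A) * h8 - h7 m
  rw [e2]
  refine h6.congr_fun ?_
  intro j
  simp only [Function.comp, Equiv.coe_addRight, addDev, subDev, map_sub]
  push_cast
  ring

/-- Cauchy product of bilateral series. Both factors have finite support, so the double sum may be
regrouped along `i + j = m`. -/
theorem hasSum_conv {f g c : ℤ → A} {a b : A} {J : ℕ} (hf : ∀ i : ℤ, J < i.natAbs → f i = 0)
    (hg : ∀ i : ℤ, J < i.natAbs → g i = 0) (ha : HasSum f a) (hb : HasSum g b)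
    (hc : ∀ m, HasSum (fun i => f i * g (m - i)) (c m)) : HasSum c (a * b) := by
  have hs : Summable fun x : ℤ × ℤ => f x.1 * g x.2 := by
    refine summable_of_hasFiniteSupport
      (((finite_support_of_natAbs hf).prod (finite_support_of_natAbs hg)).subset ?_)
    intro x hx
    refine ⟨fun h => hx ?_, fun h => hx ?_⟩
    · show f x.1 * g x.2 = 0
      rw [h, zero_mul]
    · show f x.1 * g x.2 = 0
      rw [h, mul_zero]
  have h := ha.mul hb hs
  let e : ℤ × ℤ ≃ ℤ × ℤ :=
    { toFun := fun x => (x.2, x.1 - x.2)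
      invFun := fun x => (x.1 + x.2, x.1)
      left_inv := fun x => by simp
      right_inv := fun x => by simp }
  have h2 := e.hasSum_iff.2 h
  exact h2.prod_fiberwise hc

end Nilpotent

end Bilateral
end
end TwistedCancellation

namespace TwistedCancellation
noncomputable section

/-! ### Convolution identities for the bilateral series, with nilpotent coordinates -/

section BilateralConvolution

open PowerSeries

variable {A : Type*} [CommRing A] {ρ : PowerSeries ℂ →+* A} {α β : A}

theorem addTerm_of_nonneg {m : ℤ} (hm : 0 ≤ m) :
    addTerm ρ α β m = annMon α β m * ρ (lamAdd m) := by
  have e : (-m).toNat = 0 := by omega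
  rw [addTerm, lamAdd, e, pow_zero, one_mul]

theorem subTerm_of_pos {m : ℤ} (hm : 0 < m) :
    subTerm ρ α β m = annMon α β m * ((m : A) * ρ (lamSub m)) := by
  obtain ⟨n, rfl⟩ := Int.eq_ofNat_of_zero_le hm.le
  simp [subTerm, lamSub]

theorem addTerm_eq_zero {J : ℕ} (hα : α ^ J = 0) (hβ : β ^ J = 0) (i : ℤ) (hi : J < i.natAbs) :
    addTerm ρ α β i = 0 := by
  rw [addTerm, annMon_eq_zero hα hβ hi.le, zero_mul]

theorem subTerm_eq_zero {J : ℕ} (hα : α ^ J = 0) (hβ : β ^ J = 0) (i : ℤ) (hi : J < i.natAbs) :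
    subTerm ρ α β i = 0 := by
  rw [subTerm, annMon_eq_zero hα hβ hi.le, zero_mul]

theorem annMon_succ (α β : A) (m : ℕ) : annMon α β (m + 1) = α ^ (m + 1) := by
  have e1 : ((m : ℤ) + 1).toNat = m + 1 := by omega
  have e2 : (-((m : ℤ) + 1)).toNat = 0 := by omega
  rw [annMon, e1, e2, pow_zero, mul_one]

theorem annMon_neg_succ (α β : A) (m : ℕ) : annMon α β (-(m + 1)) = β ^ (m + 1) := by
  rw [← annMon_swap, annMon_succ]

variable [TopologicalSpace A] [DiscreteTopology A]

theorem hasSum_addTerm_mul_addTerm {J : ℕ} (hρ : ρ X = α * β) (hJ : ρ X ^ J = 0) {m : ℤ}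
    (hm : 0 < m) :
    HasSum (fun i => addTerm ρ α β i * addTerm ρ α β (m - i)) (subTerm ρ α β m) := by
  obtain ⟨n, rfl⟩ := Int.eq_ofNat_of_zero_le hm.le
  rw [subTerm_of_pos hm]
  have h := (hasSum_lamAdd_sub hJ n).mul_left (annMon α β n * ρ (lamSub n))
  have e : annMon α β n * (((n : ℤ) : A) * ρ (lamSub n)) =
      annMon α β n * ρ (lamSub n) * (n : A) := by
    push_cast; ring
  rw [e]
  refine h.congr_fun fun i => ?_
  rw [addTerm_mul_addTerm hρ hm.le, lamAdd_mul_lamAdd hm.ne', map_mul]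
  ring

theorem hasSum_addTerm_mul_subTerm {J : ℕ} (hρ : ρ X = α * β) (hJ : ρ X ^ J = 0) {m : ℤ}
    (hm : 0 ≤ m) :
    HasSum (fun i => 2 * (addTerm ρ α β i * subTerm ρ α β (m - i)))
      (((m : A) ^ 2 - 2 * devConst ρ) * addTerm ρ α β m) := by
  obtain ⟨n, rfl⟩ := Int.eq_ofNat_of_zero_le hm
  rw [addTerm_of_nonneg hm]
  have h := ((Equiv.subRight (n : ℤ)).hasSum_iff.2
    (hasSum_mul_lamAdd_sub_lamSub hJ n)).mul_left (-(annMon α β n * ρ (lamAdd n)))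
  have e : (((n : ℤ) : A) ^ 2 - 2 * devConst ρ) * (annMon α β n * ρ (lamAdd n)) =
      -(annMon α β n * ρ (lamAdd n)) * (2 * devConst ρ - (n : A) ^ 2) := by
    push_cast; ring
  rw [e]
  refine h.congr_fun fun i => ?_
  rw [addTerm_mul_subTerm hρ hm]
  simp only [Function.comp, Equiv.subRight_apply, sub_add_cancel]
  -- The partial fraction is unavailable where `1 - Q ^ (m - i)` vanishes, but there the factor `m -
  -- i` kills both sides.
  rcases eq_or_ne ((n : ℤ) - i) 0 with h0 | h0
  · have : i - (n : ℤ) = 0 := by omega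
    rw [h0, this]
    simp
  · have h1 := congrArg ρ (lamAdd_mul_lamSub h0)
    simp only [map_mul, map_sub, map_intCast] at h1 ⊢
    push_cast
    linear_combination (2 * annMon α β n * ((n : A) - i)) * h1

/-- The bilateral series `∑ zⁱ / (1 + Qⁱ)`. -/
def addSum (ρ : PowerSeries ℂ →+* A) (α β : A) : A := ∑' i, addTerm ρ α β i

/-- The bilateral series `∑ i zⁱ / (1 - Qⁱ)`. -/
def subSum (ρ : PowerSeries ℂ →+* A) (α β : A) : A := ∑' i, subTerm ρ α β i

/-- The bilateral series `∑ i² zⁱ / (1 + Qⁱ)`. -/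
def addSum₂ (ρ : PowerSeries ℂ →+* A) (α β : A) : A := ∑' i : ℤ, (i : A) ^ 2 * addTerm ρ α β i

/-- The constant term of the square of `∑ zⁱ / (1 + Qⁱ)`. -/
def sqConst (ρ : PowerSeries ℂ →+* A) (α β : A) : A :=
  ∑' i, addTerm ρ α β i * addTerm ρ α β (-i)

/-- Compare coefficients of `z ^ m`: for `m ≠ 0` the convolution telescopes to `m / (1 - Q ^ m)`,
and for `m = 0` it is by definition the constant `sqConst`. -/
theorem addSum_mul_addSum {J : ℕ} (hρ : ρ X = α * β) (hα : α ^ J = 0) (hβ : β ^ J = 0) :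
    addSum ρ α β * addSum ρ α β = subSum ρ α β + sqConst ρ α β := by
  have hJ : ρ X ^ J = 0 := by rw [hρ, mul_pow, hα, zero_mul]
  have hs := summable_of_natAbs (addTerm_eq_zero (ρ := ρ) hα hβ)
  have key := hasSum_conv (c := fun m => subTerm ρ α β m + if m = 0 then sqConst ρ α β else 0)
    (addTerm_eq_zero (ρ := ρ) hα hβ) (addTerm_eq_zero (ρ := ρ) hα hβ) hs.hasSum hs.hasSum ?_
  · refine key.unique ?_
    exact (summable_of_natAbs (subTerm_eq_zero (ρ := ρ) hα hβ)).hasSum.add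
      (hasSum_ite_eq 0 (sqConst ρ α β))
  · intro m
    rcases lt_trichotomy m 0 with hm | rfl | hm
    -- Negative `m` reduces to positive `m` by the symmetry `z ↔ Q / z`, which exchanges `α` and `β`
    -- and negates indices.
    · have h := (Equiv.neg ℤ).hasSum_iff.2
        (hasSum_addTerm_mul_addTerm (α := β) (β := α) (by rw [hρ, mul_comm]) hJ
          (neg_pos.2 hm))
      rw [subTerm_swap, neg_neg] at h
      rw [if_neg hm.ne, add_zero]
      refine h.congr_fun fun i => ?_
      simp only [Function.comp, Equiv.neg_apply, addTerm_swap ρ α β, neg_neg]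
      congr 2
      ring
    · have : subTerm ρ α β 0 = 0 := by simp [subTerm]
      simp only [this, if_true, zero_add, zero_sub]
      refine (summable_of_natAbs (J := J) fun i hi => ?_).hasSum
      rw [addTerm_eq_zero hα hβ i hi, zero_mul]
    · simpa [hm.ne'] using hasSum_addTerm_mul_addTerm hρ hJ hm

/-- In terms of functions of `z` this reads `2 v p = v'' - 2 D v`. The second derivative comes from
the `m²` in the convolution. -/
theorem two_mul_addSum_mul_subSum {J : ℕ} (hρ : ρ X = α * β) (hα : α ^ J = 0) (hβ : β ^ J = 0) :
    2 * addSum ρ α β * subSum ρ α β =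
      addSum₂ ρ α β - 2 * devConst ρ * addSum ρ α β := by
  have hJ : ρ X ^ J = 0 := by rw [hρ, mul_pow, hα, zero_mul]
  have hs := summable_of_natAbs (addTerm_eq_zero (ρ := ρ) hα hβ)
  have hs' := summable_of_natAbs (subTerm_eq_zero (ρ := ρ) hα hβ)
  have key := hasSum_conv (c := fun m => ((m : A) ^ 2 - 2 * devConst ρ) * addTerm ρ α β m)
    (f := fun i => 2 * addTerm ρ α β i) (J := J)
    (fun i hi => by rw [addTerm_eq_zero hα hβ i hi, mul_zero])
    (subTerm_eq_zero (ρ := ρ) hα hβ) (hs.hasSum.mul_left 2) hs'.hasSum ?_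
  · refine key.unique ?_
    have h2 : HasSum (fun i : ℤ => (i : A) ^ 2 * addTerm ρ α β i) (addSum₂ ρ α β) :=
      (summable_of_natAbs (J := J) fun i hi => by
        rw [addTerm_eq_zero hα hβ i hi, mul_zero]).hasSum
    refine (h2.sub (hs.hasSum.mul_left (2 * devConst ρ))).congr_fun fun i => ?_
    ring
  · intro m
    rcases le_or_gt 0 m with hm | hm
    · refine (hasSum_addTerm_mul_subTerm hρ hJ hm).congr_fun fun i => ?_
      ring
    · have h := (Equiv.neg ℤ).hasSum_iff.2
        (hasSum_addTerm_mul_subTerm (α := β) (β := α) (by rw [hρ, mul_comm]) hJ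
          (neg_nonneg.2 hm.le))
      rw [addTerm_swap, neg_neg] at h
      have e : (((-m : ℤ) : A) ^ 2 - 2 * devConst ρ) = (m : A) ^ 2 - 2 * devConst ρ := by
        push_cast; ring
      rw [e] at h
      refine h.congr_fun fun i => ?_
      simp only [Function.comp, Equiv.neg_apply, addTerm_swap ρ α β, subTerm_swap ρ α β, neg_neg]
      have : -(-m - -i) = m - i := by ring
      rw [this]
      ring

theorem tsum_int_eq_sum {f : ℤ → A} {J L : ℕ} (hf : ∀ i : ℤ, J < i.natAbs → f i = 0)
    (hL : J ≤ L) :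
    ∑' i, f i = f 0 + ∑ m ∈ Finset.range L, (f (m + 1) + f (-(m + 1))) := by
  have h1 : HasSum (fun n : ℕ => f (n + 1)) (∑ m ∈ Finset.range L, f (m + 1)) :=
    hasSum_sum_of_ne_finset_zero fun n hn => hf _ (by
      rw [Finset.mem_range] at hn; omega)
  have h2 : HasSum (fun n : ℕ => f (-(n + 1))) (∑ m ∈ Finset.range L, f (-(m + 1))) :=
    hasSum_sum_of_ne_finset_zero fun n hn => hf _ (by
      rw [Finset.mem_range] at hn; omega)
  rw [(h1.of_add_one_of_neg_add_one h2).tsum_eq, Finset.sum_add_distrib]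
  ring

theorem addSum_eq {J L : ℕ} (hα : α ^ J = 0) (hβ : β ^ J = 0) (hL : J ≤ L) :
    addSum ρ α β = ρ (invAdd 0) + ∑ m ∈ Finset.range L,
      (α ^ (m + 1) + β ^ (m + 1)) * ρ (invAdd (m + 1)) := by
  rw [addSum, tsum_int_eq_sum (addTerm_eq_zero hα hβ) hL]
  congr 1
  · simp [addTerm, annMon]
  · refine Finset.sum_congr rfl fun m _ => ?_
    have e : ((m : ℤ) + 1).natAbs = m + 1 := by omega
    rw [addTerm, addTerm, annMon_succ, annMon_neg_succ, Int.natAbs_neg, e]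
    ring

theorem addSum₂_eq {J L : ℕ} (hα : α ^ J = 0) (hβ : β ^ J = 0) (hL : J ≤ L) :
    addSum₂ ρ α β = ∑ m ∈ Finset.range L,
      ((m + 1 : ℕ) : A) ^ 2 * ((α ^ (m + 1) + β ^ (m + 1)) * ρ (invAdd (m + 1))) := by
  rw [addSum₂, tsum_int_eq_sum (J := J) (fun i hi => by
    rw [addTerm_eq_zero hα hβ i hi, mul_zero]) hL]
  rw [Int.cast_zero, zero_pow two_ne_zero, zero_mul, zero_add]
  refine Finset.sum_congr rfl fun m _ => ?_
  have e : ((m : ℤ) + 1).natAbs = m + 1 := by omega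
  rw [addTerm, addTerm, annMon_succ, annMon_neg_succ, Int.natAbs_neg, e]
  push_cast
  ring

theorem subSum_eq {J L : ℕ} (hα : α ^ J = 0) (hβ : β ^ J = 0) (hL : J ≤ L) :
    subSum ρ α β = ∑ m ∈ Finset.range L,
      ((m + 1 : ℕ) : A) * ((α ^ (m + 1) + β ^ (m + 1)) * ρ (invSub (m + 1))) := by
  rw [subSum, tsum_int_eq_sum (subTerm_eq_zero hα hβ) hL]
  have e0 : subTerm ρ α β 0 = 0 := by simp [subTerm]
  rw [e0, zero_add]
  refine Finset.sum_congr rfl fun m _ => ?_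
  have e : ((m : ℤ) + 1).natAbs = m + 1 := by omega
  rw [subTerm, subTerm, annMon_succ, annMon_neg_succ, Int.natAbs_neg, e]
  ring

theorem sqConst_eq {J L : ℕ} (hρ : ρ X = α * β) (hα : α ^ J = 0) (hβ : β ^ J = 0) (hL : J ≤ L) :
    sqConst ρ α β = ρ (invAdd 0 ^ 2 + ∑ m ∈ Finset.range L,
      2 * (X ^ (m + 1) * invAdd (m + 1) ^ 2)) := by
  rw [sqConst, tsum_int_eq_sum (J := J) (fun i hi => by
    rw [addTerm_eq_zero hα hβ i hi, zero_mul]) hL, map_add, map_sum]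
  congr 1
  · simp [addTerm, annMon, sq]
  · refine Finset.sum_congr rfl fun m _ => ?_
    have e : ((m : ℤ) + 1).natAbs = m + 1 := by omega
    simp only [addTerm, annMon_succ, annMon_neg_succ, Int.natAbs_neg, e, neg_neg, map_mul,
      map_pow, map_ofNat, hρ]
    ring

theorem devConst_eq {J L : ℕ} (hJ : ρ X ^ J = 0) (hL : J ≤ L) :
    devConst ρ = ρ (∑ m ∈ Finset.range L,
      -(2 * ((m + 1 : ℕ) : PowerSeries ℂ) * (X ^ (m + 1) *
        (invAdd (m + 1) + invSub (m + 1))))) := by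
  rw [devConst, tsum_int_eq_sum (J := J) (fun i hi => by
    rw [addDev_eq_zero hJ hi, subDev_eq_zero hJ hi, mul_zero, sub_zero]) hL, map_sum]
  have e0 : ((0 : ℤ) : A) * addDev ρ 0 - subDev ρ 0 = 0 := by simp [subDev]
  rw [e0, zero_add]
  refine Finset.sum_congr rfl fun m _ => ?_
  have hne : ((m : ℤ) + 1) ≠ 0 := by omega
  have e : ((m : ℤ) + 1).natAbs = m + 1 := by omega
  have e1 : (-((m : ℤ) + 1)).toNat = 0 := by omega
  have e2 : (-(-((m : ℤ) + 1))).toNat = m + 1 := by omega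
  have h0 : (0 : ℤ) ≤ m + 1 := by omega
  have h0' : ¬ (0 : ℤ) ≤ -(m + 1) := by omega
  have h3 : lamAdd (m + 1) = 1 - X ^ (m + 1) * invAdd (m + 1) := by
    have := lamAdd_neg (-((m : ℤ) + 1))
    rw [neg_neg] at this
    rw [this, lamAdd, e2, Int.natAbs_neg, e]
  have h4 : lamSub (m + 1) = 1 + X ^ (m + 1) * invSub (m + 1) := by
    have := lamSub_neg (i := -((m : ℤ) + 1)) (by omega)
    rw [neg_neg] at this
    rw [this, lamSub, if_neg h0', e2, Int.natAbs_neg, e, sub_neg_eq_add]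
  rw [addDev_neg hne, subDev, subDev, lamSub_neg hne, addDev, h3, h4, heav, heav, if_pos h0,
    if_neg h0']
  simp only [map_mul, map_neg, map_sub, map_add, map_one, map_pow, map_natCast, map_ofNat]
  push_cast
  ring

end BilateralConvolution
end
end TwistedCancellation

namespace TwistedCancellation
noncomputable section

/-! ## Power series on an annulus -/

section Annulus

open PowerSeries

/-- The formal infinite sum `∑ f m` of power series with `f m` divisible by `X ^ (m + 1)`. -/
def infSum {R : Type*} [CommRing R] (f : ℕ → PowerSeries R) : PowerSeries R :=
  mk fun n => coeff n (∑ m ∈ Finset.range n, f m)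

theorem dvd_infSum_sub {R : Type*} [CommRing R] {f : ℕ → PowerSeries R}
    (hf : ∀ m, X ^ (m + 1) ∣ f m) (L : ℕ) : X ^ L ∣ infSum f - ∑ m ∈ Finset.range L, f m := by
  rw [X_pow_dvd_iff]
  intro n hn
  rw [map_sub, infSum, coeff_mk, sub_eq_zero, map_sum, map_sum]
  refine Finset.sum_subset (Finset.range_mono hn.le) fun m _ hm => ?_
  rw [Finset.mem_range, not_lt] at hm
  exact X_pow_dvd_iff.1 (hf m) n (by omega)

@[simp] theorem rescale_C {R : Type*} [CommRing R] (c r : R) : rescale c (C r) = C r := by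
  ext n
  rw [coeff_rescale, coeff_C]
  split_ifs with h <;> simp [h]

theorem map_infSum {R S : Type*} [CommRing R] [CommRing S] (h : R →+* S)
    (f : ℕ → PowerSeries R) : map h (infSum f) = infSum fun m => map h (f m) := by
  ext n
  simp [infSum, coeff_map]

theorem rescale_infSum {R : Type*} [CommRing R] (c : R) (f : ℕ → PowerSeries R) :
    rescale c (infSum f) = infSum fun m => rescale c (f m) := by
  ext n
  simp [infSum, coeff_rescale, Finset.mul_sum]

/-- Two power series that agree modulo every power of the variable are equal. -/
theorem eq_of_forall_X_pow_dvd {R : Type*} [CommRing R] {f g : PowerSeries R}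
    (h : ∀ L, X ^ L ∣ f - g) : f = g := by
  ext n
  have := X_pow_dvd_iff.1 (h (n + 1)) n (by omega)
  rwa [map_sub, sub_eq_zero] at this

/-- The factors with index above `L` are `1` modulo `X ^ (L + 1)`, so identities between infinite
products can be checked on finite ones. -/
theorem dvd_infProd_sub {R : Type*} [CommRing R] {f : ℕ → PowerSeries R}
    (hf : ∀ m, X ^ m ∣ f m - 1) (L : ℕ) :
    X ^ (L + 1) ∣ infProd f - ∏ m ∈ Finset.Icc 1 L, f m := by
  have key : ∀ n d, X ^ (n + 1) ∣
      ∏ m ∈ Finset.Icc 1 (n + d), f m - ∏ m ∈ Finset.Icc 1 n, f m := by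
    intro n d
    induction d with
    | zero => simp
    | succ d ih =>
      rw [← add_assoc, Finset.prod_Icc_succ_top (by omega)]
      have h1 : X ^ (n + 1) ∣ f (n + d + 1) - 1 :=
        (pow_dvd_pow X (by omega)).trans (hf (n + d + 1))
      have e : (∏ m ∈ Finset.Icc 1 (n + d), f m) * f (n + d + 1) - ∏ m ∈ Finset.Icc 1 n, f m =
          (∏ m ∈ Finset.Icc 1 (n + d), f m) * (f (n + d + 1) - 1) +
          (∏ m ∈ Finset.Icc 1 (n + d), f m - ∏ m ∈ Finset.Icc 1 n, f m) := by ring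
      rw [e]
      exact dvd_add (h1.mul_left _) ih
  rw [X_pow_dvd_iff]
  intro n hn
  obtain ⟨d, rfl⟩ : ∃ d, L = n + d := ⟨L - n, by omega⟩
  have := X_pow_dvd_iff.1 (key n d) n (by omega)
  rw [map_sub, sub_eq_zero] at this
  rw [map_sub, infProd, coeff_mk, this, sub_self]

theorem map_infProd {R S : Type*} [CommRing R] [CommRing S] (h : R →+* S)
    (f : ℕ → PowerSeries R) : map h (infProd f) = infProd fun m => map h (f m) := by
  ext n
  simp only [infProd, coeff_map, coeff_mk]
  rw [← coeff_map, map_prod]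

theorem rescale_infProd {R : Type*} [CommRing R] (c : R) (f : ℕ → PowerSeries R) :
    rescale c (infProd f) = infProd fun m => rescale c (f m) := by
  ext n
  simp only [infProd, coeff_rescale, coeff_mk]
  rw [← coeff_rescale, map_prod]

theorem constantCoeff_infProd {R : Type*} [CommRing R] (f : ℕ → PowerSeries R) :
    constantCoeff (infProd f) = 1 := by
  rw [← coeff_zero_eq_constantCoeff_apply, infProd, coeff_mk]
  simp

/-- Power series in `β` whose coefficients are power series in `α`; here `α = z` and `β = Q / z`
are coordinates of an annulus. -/
abbrev AnnSeries := PowerSeries (PowerSeries ℂ)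

/-- Power series in `β` whose coefficients are polynomials in `α`. -/
abbrev AnnPoly := PowerSeries (Polynomial ℂ)

/-- The inclusion of `ℂ[α]⟦β⟧` into `ℂ⟦α⟧⟦β⟧`. -/
def annIncl : AnnPoly →+* AnnSeries := map (Polynomial.coeToPowerSeries.ringHom)

theorem annIncl_injective : Function.Injective annIncl := by
  intro f g h
  ext1 n
  have := congrArg (coeff n) h
  simpa [annIncl, coeff_map] using this

/-- The coordinate `α` in `ℂ[α]⟦β⟧`. -/
def alP : AnnPoly := C Polynomial.X

/-- The coordinate `α` in `ℂ⟦α⟧⟦β⟧`. -/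
def alS : AnnSeries := C X

@[simp] theorem annIncl_alP : annIncl alP = alS := by
  simp [annIncl, alP, alS]

@[simp] theorem annIncl_X : annIncl X = X := by
  simp [annIncl]

/-- Power series in `Q = α β`, as elements of `ℂ[α]⟦β⟧`. -/
def rhoP : PowerSeries ℂ →+* AnnPoly :=
  (rescale (Polynomial.X : Polynomial ℂ)).comp (map Polynomial.C)

/-- Power series in `Q = α β`, as elements of `ℂ⟦α⟧⟦β⟧`. -/
def rhoS : PowerSeries ℂ →+* AnnSeries := (rescale (X : PowerSeries ℂ)).comp (map C)

@[simp] theorem annIncl_rhoP (f : PowerSeries ℂ) : annIncl (rhoP f) = rhoS f := by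
  ext n : 1
  simp [annIncl, rhoP, rhoS, coeff_map, coeff_rescale]
  exact mul_comm _ _

@[simp] theorem rhoP_X : rhoP X = alP * X := by
  simp [rhoP, alP, rescale_X]

@[simp] theorem rhoS_X : rhoS X = alS * X := by
  simp [rhoS, alS, rescale_X]

theorem X_pow_dvd_rhoP {n : ℕ} {f : PowerSeries ℂ} (h : X ^ n ∣ f) : X ^ n ∣ rhoP f := by
  obtain ⟨g, rfl⟩ := h
  rw [map_mul, map_pow, rhoP_X, mul_pow]
  exact ⟨alP ^ n * rhoP g, by ring⟩

/-- The derivation `z d/dz` on `R⟦β⟧`, where `δ` is its restriction to `R`. -/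
def annDer {R : Type*} [CommRing R] [Algebra ℂ R] (δ : Derivation ℂ R R) :
    Derivation ℂ (PowerSeries R) (PowerSeries R) :=
  Derivation.mk'
    { toFun := fun f => mk fun n => δ (coeff n f) - n * coeff n f
      map_add' := fun f g => by
        ext n
        simp only [map_add, coeff_mk]
        ring
      map_smul' := fun c f => by
        ext n
        simp only [coeff_mk, RingHom.id_apply, Algebra.smul_def, PowerSeries.algebraMap_apply,
          coeff_C_mul, Derivation.leibniz, Derivation.map_algebraMap]
        simp only [mul_zero, add_zero, Algebra.algebraMap_self, RingHom.id_apply]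
        ring } (by
    intro f g
    ext n
    simp only [LinearMap.coe_mk, AddHom.coe_mk, coeff_mk, coeff_mul, map_add, smul_eq_mul, map_sum,
      Derivation.leibniz]
    rw [Finset.mul_sum, ← Finset.sum_sub_distrib]
    have h : ∑ p ∈ Finset.HasAntidiagonal.antidiagonal n, coeff p.1 g * (δ (coeff p.2 f) - p.2 * coeff p.2 f) =
      ∑ p ∈ Finset.HasAntidiagonal.antidiagonal n, coeff p.2 g * (δ (coeff p.1 f) - p.1 * coeff p.1 f) := by
      rw [← Finset.Nat.sum_antidiagonal_swap]
      simp
    rw [h, ← Finset.sum_add_distrib]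
    refine Finset.sum_congr rfl fun p hp => ?_
    rw [← Finset.HasAntidiagonal.mem_antidiagonal.1 hp]
    push_cast
    ring)

theorem coeff_annDer {R : Type*} [CommRing R] [Algebra ℂ R] (δ : Derivation ℂ R R)
    (f : PowerSeries R) (n : ℕ) : coeff n (annDer δ f) = δ (coeff n f) - n * coeff n f := by
  simp [annDer]

theorem annDer_X {R : Type*} [CommRing R] [Algebra ℂ R] (δ : Derivation ℂ R R) :
    annDer δ X = -X := by
  ext n
  rw [coeff_annDer, coeff_X, map_neg, coeff_X]
  split_ifs with h
  · simp [h]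
  · simp

theorem annDer_C {R : Type*} [CommRing R] [Algebra ℂ R] (δ : Derivation ℂ R R) (r : R) :
    annDer δ (C r) = C (δ r) := by
  ext n
  rw [coeff_annDer, coeff_C, coeff_C]
  split_ifs with h
  · simp [h]
  · simp

theorem X_pow_dvd_annDer {R : Type*} [CommRing R] [Algebra ℂ R] (δ : Derivation ℂ R R)
    {f : PowerSeries R} {L : ℕ} (h : X ^ L ∣ f) : X ^ L ∣ annDer δ f := by
  rw [X_pow_dvd_iff] at h ⊢
  intro n hn
  rw [coeff_annDer, h n hn, map_zero, mul_zero, sub_zero]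

/-- The derivation `z d/dz` of `ℂ[α]⟦β⟧`. -/
def derP : Derivation ℂ AnnPoly AnnPoly :=
  annDer ((Polynomial.X : Polynomial ℂ) • Polynomial.derivative')

/-- The derivation `z d/dz` of `ℂ⟦α⟧⟦β⟧`. -/
def derS : Derivation ℂ AnnSeries AnnSeries := annDer ((X : PowerSeries ℂ) • d⁄dX ℂ)

theorem annIncl_derP (f : AnnPoly) : annIncl (derP f) = derS (annIncl f) := by
  ext n : 1
  have e : ((n : Polynomial ℂ) : PowerSeries ℂ) = n := map_natCast Polynomial.coeToPowerSeries.ringHom n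
  simp [annIncl, derP, derS, coeff_map, coeff_annDer, PowerSeries.derivative_coe, e]

@[simp] theorem derP_alP : derP alP = alP := by
  simp [derP, alP, annDer_C]

@[simp] theorem derS_alS : derS alS = alS := by
  simp [derS, alS, annDer_C]

@[simp] theorem derP_X : derP X = -X := annDer_X _

@[simp] theorem derS_X : derS X = -X := annDer_X _

@[simp] theorem derP_rhoP (f : PowerSeries ℂ) : derP (rhoP f) = 0 := by
  ext n : 1
  simp [derP, rhoP, coeff_annDer, coeff_rescale, coeff_map]
  rcases n with _ | n
  · simp
  · simp
    ring

@[simp] theorem derS_rhoS (f : PowerSeries ℂ) : derS (rhoS f) = 0 := by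
  rw [← annIncl_rhoP, ← annIncl_derP, derP_rhoP, map_zero]

/-- The exchange of the coordinates `α` and `β`. -/
def swapSeries {R : Type*} [CommRing R] : PowerSeries (PowerSeries R) →+* PowerSeries (PowerSeries R) where
  toFun f := mk fun i => mk fun j => coeff i (coeff j f)
  map_one' := by
    ext i j
    simp only [coeff_mk, coeff_one]
    split_ifs <;> simp_all
  map_zero' := by
    ext i j
    simp
  map_add' f g := by
    ext i j
    simp
  map_mul' f g := by
    ext i j
    simp only [coeff_mk, coeff_mul, map_sum]
    rw [Finset.sum_comm]

theorem coeff_swapSeries {R : Type*} [CommRing R] (f : PowerSeries (PowerSeries R)) (i j : ℕ) :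
    coeff j (coeff i (swapSeries f)) = coeff i (coeff j f) := by
  simp [swapSeries]

@[simp] theorem swapSeries_swapSeries {R : Type*} [CommRing R]
    (f : PowerSeries (PowerSeries R)) : swapSeries (swapSeries f) = f := by
  ext i j
  rw [coeff_swapSeries, coeff_swapSeries]

theorem swapSeries_X {R : Type*} [CommRing R] :
    swapSeries (X : PowerSeries (PowerSeries R)) = C X := by
  ext i j
  rw [coeff_swapSeries, coeff_X, coeff_C]
  split_ifs <;> simp_all [coeff_X, coeff_one]

theorem swapSeries_C_X {R : Type*} [CommRing R] :
    swapSeries (C X : PowerSeries (PowerSeries R)) = X := by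
  rw [← swapSeries_X, swapSeries_swapSeries]

theorem swapSeries_rhoS (f : PowerSeries ℂ) : swapSeries (rhoS f) = rhoS f := by
  ext i j
  rw [coeff_swapSeries]
  simp only [rhoS, RingHom.comp_apply, coeff_rescale, coeff_map, coeff_X_pow_mul', coeff_C]
  by_cases h : i = j
  · simp [h]
  · rcases lt_or_gt_of_ne h with h | h
    · rw [if_neg (by omega), if_pos h.le, if_neg (by omega)]
    · rw [if_pos h.le, if_neg (by omega), if_neg (by omega)]

/-- The swap is the substitution `z ↦ Q / z`, which reverses the sign of `z d/dz`. -/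
theorem swapSeries_derS (f : AnnSeries) : swapSeries (derS f) = -derS (swapSeries f) := by
  ext i j
  rw [coeff_swapSeries]
  simp only [derS, coeff_annDer, map_neg, map_sub, Derivation.smul_apply,
    smul_eq_mul]
  have e : ∀ (n : ℕ) (g : PowerSeries ℂ) (k : ℕ), coeff k ((n : PowerSeries ℂ) * g) = n * coeff k g := by
    intro n g k
    rw [← map_natCast (C (R := ℂ)), coeff_C_mul]
  have e2 : ∀ (g : PowerSeries ℂ) (k : ℕ), coeff k (X * d⁄dX ℂ g) = k * coeff k g := by
    intro g k
    rcases k with _ | k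
    · simp
    · rw [coeff_succ_X_mul, coeff_derivative]
      push_cast; ring
  rw [e, e, e2, e2, coeff_swapSeries]
  ring

/-- The ideal of series with no term `α ^ i β ^ j` for `i, j < J`. -/
def truncIdeal (J : ℕ) : Ideal AnnSeries where
  carrier := {f | ∀ i < J, ∀ j < J, coeff i (coeff j f) = 0}
  add_mem' := fun {f g} hf hg i hi j hj => by
    rw [map_add, map_add, hf i hi j hj, hg i hi j hj, add_zero]
  zero_mem' := fun i _ j _ => by simp
  smul_mem' := fun c f hf i hi j hj => by
    rw [smul_eq_mul, coeff_mul, map_sum]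
    refine Finset.sum_eq_zero fun p hp => ?_
    rw [coeff_mul]
    refine Finset.sum_eq_zero fun q hq => ?_
    have h1 := Finset.HasAntidiagonal.mem_antidiagonal.1 hp
    have h2 := Finset.HasAntidiagonal.mem_antidiagonal.1 hq
    rw [hf q.2 (by omega) p.2 (by omega), mul_zero]

theorem eq_of_forall_sub_mem {f g : AnnSeries} (h : ∀ J, f - g ∈ truncIdeal J) : f = g := by
  ext j i
  have := h (i + j + 1) i (by omega) j (by omega)
  rwa [map_sub, map_sub, sub_eq_zero] at this

theorem swapSeries_mem_truncIdeal {J : ℕ} {f : AnnSeries} (h : f ∈ truncIdeal J) :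
    swapSeries f ∈ truncIdeal J := fun i hi j hj => by
  rw [coeff_swapSeries]
  exact h j hj i hi

theorem X_pow_mem_truncIdeal {J L : ℕ} (h : J ≤ L) {f : AnnSeries} (hf : X ^ L ∣ f) :
    f ∈ truncIdeal J := fun i _ j hj => by
  rw [X_pow_dvd_iff.1 hf j (by omega), map_zero]

theorem alS_pow_mem_truncIdeal {J L : ℕ} (h : J ≤ L) : alS ^ L ∈ truncIdeal J := by
  have := swapSeries_mem_truncIdeal (X_pow_mem_truncIdeal h dvd_rfl)
  rwa [map_pow, swapSeries_X] at this

theorem annIncl_mem_truncIdeal {J L : ℕ} (h : J ≤ L) {f : AnnPoly} (hf : X ^ L ∣ f) :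
    annIncl f ∈ truncIdeal J := by
  refine X_pow_mem_truncIdeal h ?_
  have := map_dvd annIncl hf
  simpa using this

theorem derS_mem_truncIdeal {J : ℕ} {f : AnnSeries} (h : f ∈ truncIdeal J) :
    derS f ∈ truncIdeal J := fun i hi j hj => by
  simp only [derS, coeff_annDer, map_sub, Derivation.smul_apply, smul_eq_mul]
  rw [← map_natCast (C (R := ℂ)), coeff_C_mul, h i hi j hj, mul_zero, sub_zero]
  rcases i with _ | i
  · simp
  · rw [coeff_succ_X_mul, coeff_derivative, h _ hi j hj, zero_mul]

/-- Evaluation at `α = c` and `β = X / c`, where `c'` is the inverse of `c`. -/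
def annEval {S : Type*} [CommRing S] [Algebra ℂ S] (c c' : S) : AnnPoly →+* PowerSeries S :=
  (rescale c').comp (map (Polynomial.aeval c : Polynomial ℂ →ₐ[ℂ] S).toRingHom)

section Eval

variable {S : Type*} [CommRing S] [Algebra ℂ S] (c c' : S)

@[simp] theorem annEval_alP : annEval c c' alP = C c := by
  simp [annEval, alP]

@[simp] theorem annEval_X : annEval c c' X = C c' * X := by
  simp [annEval, rescale_X]

/-- Under the evaluation `α β` becomes `c c' X = X`, so series in `Q` are unchanged. This is why
identities between series in `Q` can be read off at any point `z = c`. -/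
theorem annEval_rhoP (h : c * c' = 1) (f : PowerSeries ℂ) :
    annEval c c' (rhoP f) = map (algebraMap ℂ S) f := by
  ext n
  simp only [annEval, rhoP, RingHom.comp_apply, coeff_rescale, coeff_map]
  simp only [AlgHom.toRingHom_eq_coe, RingHom.coe_coe, map_mul, map_pow, Polynomial.aeval_X,
    Polynomial.aeval_C]
  rw [← mul_assoc, ← mul_pow, mul_comm c', h, one_pow, one_mul]

theorem annEval_infSum (f : ℕ → AnnPoly) :
    annEval c c' (infSum f) = infSum fun m => annEval c c' (f m) := by
  simp [annEval, map_infSum, rescale_infSum]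

theorem annEval_infProd (f : ℕ → AnnPoly) :
    annEval c c' (infProd f) = infProd fun m => annEval c c' (f m) := by
  simp [annEval, map_infProd, rescale_infProd]

end Eval

/-- The elements of `ℂ[α]⟦β⟧` killed by `z d/dz` are the series in `α β`. -/
theorem eq_rhoP_of_derP_eq_zero {f : AnnPoly} (h : derP f = 0) :
    f = rhoP (annEval (1 : ℂ) 1 f) := by
  have key : ∀ j m, m ≠ j → (coeff j f).coeff m = 0 := by
    intro j m hm
    have h1 := congrArg (fun g => (coeff j g).coeff m) h
    simp only [derP, coeff_annDer, Derivation.smul_apply, map_zero, Polynomial.coeff_zero,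
      Polynomial.coeff_sub, smul_eq_mul, Polynomial.derivative'_apply] at h1
    rw [← Polynomial.C_eq_natCast, Polynomial.coeff_C_mul] at h1
    rcases m with _ | m
    · rw [Polynomial.coeff_X_mul_zero] at h1
      have : (j : ℂ) ≠ 0 := by exact_mod_cast hm.symm
      simpa [this] using h1
    · rw [Polynomial.coeff_X_mul, Polynomial.coeff_derivative] at h1
      have : ((m : ℂ) + 1) - j ≠ 0 := by
        rw [sub_ne_zero]; exact_mod_cast hm
      have h2 : (coeff j f).coeff (m + 1) * (((m : ℂ) + 1) - j) = 0 := by linear_combination h1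
      exact (mul_eq_zero.1 h2).resolve_right this
  have key2 : ∀ j, coeff j f = Polynomial.C ((coeff j f).coeff j) * Polynomial.X ^ j := by
    intro j
    ext m
    rw [Polynomial.coeff_C_mul, Polynomial.coeff_X_pow]
    split_ifs with hm
    · rw [hm, mul_one]
    · rw [key j m hm, mul_zero]
  ext j : 1
  have e : coeff j (annEval (1 : ℂ) 1 f) = (coeff j f).coeff j := by
    simp only [annEval, RingHom.comp_apply, coeff_rescale, coeff_map, one_pow, one_mul]
    rw [key2 j]
    simp
  simp only [rhoP, RingHom.comp_apply, coeff_rescale, coeff_map]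
  rw [e, mul_comm]
  exact key2 j

end Annulus
end
end TwistedCancellation

namespace TwistedCancellation
noncomputable section

/-! ### The functions `v` and `p` on the annulus and their differential equations -/

section AnnulusSeries

open PowerSeries

/-- The part of `∑ zⁱ / (1 + Qⁱ)` without pole at `z = 1`. -/
def vPoly : AnnPoly := infSum fun m =>
  (X ^ (m + 1) - (alP * (alP * X)) ^ (m + 1)) * rhoP (invAdd (m + 1))

/-- The part of `∑ i zⁱ / (1 - Qⁱ)` without pole at `z = 1`. -/
def pPoly : AnnPoly := infSum fun m =>
  ((m + 1 : ℕ) : AnnPoly) * ((X ^ (m + 1) + (alP * (alP * X)) ^ (m + 1)) * rhoP (invSub (m + 1)))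

theorem X_pow_dvd_vPoly_term (m : ℕ) : (X : AnnPoly) ^ (m + 1) ∣
    (X ^ (m + 1) - (alP * (alP * X)) ^ (m + 1)) * rhoP (invAdd (m + 1)) :=
  ⟨(1 - (alP * alP) ^ (m + 1)) * rhoP (invAdd (m + 1)), by ring⟩

theorem X_pow_dvd_pPoly_term (m : ℕ) : (X : AnnPoly) ^ (m + 1) ∣
    ((m + 1 : ℕ) : AnnPoly) *
      ((X ^ (m + 1) + (alP * (alP * X)) ^ (m + 1)) * rhoP (invSub (m + 1))) :=
  ⟨((m + 1 : ℕ) : AnnPoly) * ((1 + (alP * alP) ^ (m + 1)) * rhoP (invSub (m + 1))), by ring⟩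

/-- The series `1 / (1 - α)`. -/
def geoS : AnnSeries := C (mk 1)

theorem geoS_mul : geoS * (1 - alS) = 1 := by
  rw [geoS, alS, ← map_one (C (R := PowerSeries ℂ)), ← map_sub, ← map_mul,
    mk_one_mul_one_sub_eq_one]

/-- The series `∑ zⁱ / (1 + Qⁱ)`. -/
def vS : AnnSeries := rhoS (invAdd 0) + alS * geoS + annIncl vPoly

/-- The series `∑ i zⁱ / (1 - Qⁱ)`. -/
def pS : AnnSeries := alS * geoS ^ 2 + annIncl pPoly

/-- The constant term of the square of `∑ zⁱ / (1 + Qⁱ)`. -/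
def sqSeries : PowerSeries ℂ :=
  invAdd 0 ^ 2 + infSum fun m => 2 * (X ^ (m + 1) * invAdd (m + 1) ^ 2)

/-- The series `∑ⱼ j (1 / (1 + Qʲ) - 1 / (1 - Qʲ))`. -/
def devSeries : PowerSeries ℂ := infSum fun m =>
  -(2 * ((m + 1 : ℕ) : PowerSeries ℂ) * (X ^ (m + 1) * (invAdd (m + 1) + invSub (m + 1))))

/-- A partial sum of `vS`. -/
def vPart (L : ℕ) : AnnSeries := rhoS (invAdd 0) + ∑ m ∈ Finset.range L,
  (alS ^ (m + 1) + X ^ (m + 1)) * rhoS (invAdd (m + 1))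

/-- A partial sum of `pS`. -/
def pPart (L : ℕ) : AnnSeries := ∑ m ∈ Finset.range L,
  ((m + 1 : ℕ) : AnnSeries) * ((alS ^ (m + 1) + X ^ (m + 1)) * rhoS (invSub (m + 1)))

theorem sum_alS_pow (L : ℕ) :
    ∑ m ∈ Finset.range L, alS ^ (m + 1) = alS * geoS - alS ^ (L + 1) * geoS := by
  induction L with
  | zero => simp
  | succ L ih =>
    rw [Finset.sum_range_succ, ih]
    linear_combination (-alS ^ (L + 1)) * geoS_mul

theorem sum_mul_alS_pow (L : ℕ) :
    ∑ m ∈ Finset.range L, ((m + 1 : ℕ) : AnnSeries) * alS ^ (m + 1) =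
      alS * geoS ^ 2 - alS ^ (L + 1) * geoS ^ 2 * ((L + 1 : ℕ) - L * alS) := by
  induction L with
  | zero => simp
  | succ L ih =>
    rw [Finset.sum_range_succ, ih]
    push_cast
    linear_combination (-((L : AnnSeries) + 1) * alS ^ (L + 1) * (1 + geoS * (1 - alS))) * geoS_mul

/-- The powers of `α` are infinite in number, so `v` is not in `ℂ[α]⟦β⟧`. Writing `1 / (1 + Q ^ m) =
1 - Q ^ m / (1 + Q ^ m)` in the terms with positive powers of `z` splits off the geometric series `α
/ (1 - α)`; what remains is polynomial in `α` modulo each power of `β`. -/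
theorem vS_sub_vPart {J L : ℕ} (h : J ≤ L) : vS - vPart L ∈ truncIdeal J := by
  have h1 := annIncl_mem_truncIdeal h (dvd_infSum_sub X_pow_dvd_vPoly_term L)
  have h2 : alS ^ (L + 1) * geoS ∈ truncIdeal J :=
    Ideal.mul_mem_right _ _ (alS_pow_mem_truncIdeal (by omega))
  have e : vS - vPart L = annIncl (vPoly - ∑ m ∈ Finset.range L,
      (X ^ (m + 1) - (alP * (alP * X)) ^ (m + 1)) * rhoP (invAdd (m + 1))) +
      alS ^ (L + 1) * geoS := by
    have e2 : ∑ m ∈ Finset.range L, (alS ^ (m + 1) + X ^ (m + 1)) * rhoS (invAdd (m + 1)) =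
        ∑ m ∈ Finset.range L, alS ^ (m + 1) + ∑ m ∈ Finset.range L,
          (X ^ (m + 1) - (alS * (alS * X)) ^ (m + 1)) * rhoS (invAdd (m + 1)) := by
      rw [← Finset.sum_add_distrib]
      refine Finset.sum_congr rfl fun m _ => ?_
      have h3 := congrArg rhoS (invAdd_mul (m + 1))
      rw [map_mul, map_add, map_pow, rhoS_X, map_one] at h3
      linear_combination alS ^ (m + 1) * h3
    rw [vS, vPart, e2, sum_alS_pow]
    simp only [map_sub, map_sum, map_mul, map_pow, annIncl_X, annIncl_alP, annIncl_rhoP]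
    ring
  rw [e]
  exact add_mem h1 h2

/-- Same splitting, with `1 / (1 - Q ^ m) = 1 + Q ^ m / (1 - Q ^ m)`; the part with a pole is now `∑
m α ^ m = α / (1 - α)²`. -/
theorem pS_sub_pPart {J L : ℕ} (h : J ≤ L) : pS - pPart L ∈ truncIdeal J := by
  have h1 := annIncl_mem_truncIdeal h (dvd_infSum_sub X_pow_dvd_pPoly_term L)
  have h2 : alS ^ (L + 1) * geoS ^ 2 * ((L + 1 : ℕ) - L * alS) ∈ truncIdeal J :=
    Ideal.mul_mem_right _ _ (Ideal.mul_mem_right _ _ (alS_pow_mem_truncIdeal (by omega)))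
  have e : pS - pPart L = annIncl (pPoly - ∑ m ∈ Finset.range L,
      ((m + 1 : ℕ) : AnnPoly) *
        ((X ^ (m + 1) + (alP * (alP * X)) ^ (m + 1)) * rhoP (invSub (m + 1)))) +
      alS ^ (L + 1) * geoS ^ 2 * ((L + 1 : ℕ) - L * alS) := by
    have e2 : pPart L =
        ∑ m ∈ Finset.range L, ((m + 1 : ℕ) : AnnSeries) * alS ^ (m + 1) +
        ∑ m ∈ Finset.range L, ((m + 1 : ℕ) : AnnSeries) *
          ((X ^ (m + 1) + (alS * (alS * X)) ^ (m + 1)) * rhoS (invSub (m + 1))) := by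
      rw [← Finset.sum_add_distrib, pPart]
      refine Finset.sum_congr rfl fun m _ => ?_
      have h3 := congrArg rhoS (invSub_mul (m := m + 1) (by omega))
      rw [map_mul, map_sub, map_pow, rhoS_X, map_one] at h3
      linear_combination ((m + 1 : ℕ) : AnnSeries) * alS ^ (m + 1) * h3
    rw [pS, e2, sum_mul_alS_pow]
    simp only [map_sub, map_sum, map_mul, map_add, map_pow, annIncl_X, annIncl_alP, annIncl_rhoP,
      map_natCast]
    ring
  rw [e]
  exact add_mem h1 h2

theorem swapSeries_alS : swapSeries alS = X := swapSeries_C_X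

theorem swapSeries_annX : swapSeries (X : AnnSeries) = alS := swapSeries_X

theorem swapSeries_vPart (L : ℕ) : swapSeries (vPart L) = vPart L := by
  rw [vPart, map_add, map_sum, swapSeries_rhoS]
  refine congrArg _ (Finset.sum_congr rfl fun m _ => ?_)
  rw [map_mul, map_add, map_pow, map_pow, swapSeries_rhoS, swapSeries_alS, swapSeries_annX,
    add_comm]

theorem swapSeries_vS : swapSeries vS = vS := by
  refine eq_of_forall_sub_mem fun J => ?_
  have h1 := vS_sub_vPart (le_refl J)
  have h2 := swapSeries_mem_truncIdeal h1
  rw [map_sub, swapSeries_vPart] at h2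
  have := sub_mem h2 h1
  rwa [sub_sub_sub_cancel_right] at this

theorem rhoS_sub_mem {J : ℕ} {f g : PowerSeries ℂ} (h : X ^ J ∣ f - g) :
    rhoS f - rhoS g ∈ truncIdeal J := by
  rw [← map_sub, ← annIncl_rhoP]
  exact annIncl_mem_truncIdeal le_rfl (X_pow_dvd_rhoP h)

theorem derS_alS_pow (n : ℕ) : derS (alS ^ n) = n * alS ^ n := by
  rcases n with _ | n
  · simp
  · rw [Derivation.leibniz_pow, derS_alS, Nat.add_sub_cancel, smul_eq_mul, nsmul_eq_mul]
    ring

theorem derS_X_pow (n : ℕ) : derS ((X : AnnSeries) ^ n) = -(n * (X : AnnSeries) ^ n) := by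
  rcases n with _ | n
  · simp
  · rw [Derivation.leibniz_pow, derS_X, Nat.add_sub_cancel, smul_eq_mul, nsmul_eq_mul]
    ring

theorem derS_vPart (L : ℕ) : derS (derS (vPart L)) = ∑ m ∈ Finset.range L,
    ((m + 1 : ℕ) : AnnSeries) ^ 2 * ((alS ^ (m + 1) + X ^ (m + 1)) * rhoS (invAdd (m + 1))) := by
  rw [vPart, map_add, derS_rhoS, zero_add, map_sum, map_sum]
  refine Finset.sum_congr rfl fun m _ => ?_
  simp only [Derivation.leibniz, derS_rhoS, derS_alS_pow, derS_X_pow, zero_add,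
    smul_eq_mul, map_add, map_neg, Derivation.map_natCast, add_zero, mul_zero]
  ring

/-- The convolution identities are transported to the annulus by working modulo all ideals
`truncIdeal J`. -/
theorem vS_mul_vS_and : vS * vS = pS + rhoS sqSeries ∧
    2 * vS * pS = derS (derS vS) - 2 * rhoS devSeries * vS := by
  have key : ∀ J, vS * vS - (pS + rhoS sqSeries) ∈ truncIdeal J ∧
      2 * vS * pS - (derS (derS vS) - 2 * rhoS devSeries * vS) ∈ truncIdeal J := by
    intro J
    -- In this quotient `α`, `β` and `Q` are nilpotent; with the discrete topology all bilateral
    -- sums are finite and the convolution lemmas apply.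
    let π := Ideal.Quotient.mk (truncIdeal J)
    let ρ : PowerSeries ℂ →+* AnnSeries ⧸ truncIdeal J := π.comp rhoS
    let _ : TopologicalSpace (AnnSeries ⧸ truncIdeal J) := ⊥
    have _ : DiscreteTopology (AnnSeries ⧸ truncIdeal J) := ⟨rfl⟩
    have hρ : ρ X = π alS * π X := by
      rw [← map_mul, ← rhoS_X]; rfl
    have hα : π alS ^ J = 0 := by
      rw [← map_pow]
      exact Ideal.Quotient.eq_zero_iff_mem.2 (alS_pow_mem_truncIdeal le_rfl)
    have hβ : π X ^ J = 0 := by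
      rw [← map_pow]
      exact Ideal.Quotient.eq_zero_iff_mem.2 (X_pow_mem_truncIdeal le_rfl dvd_rfl)
    have hJ : ρ X ^ J = 0 := by rw [hρ, mul_pow, hα, zero_mul]
    have ev : π vS = addSum ρ (π alS) (π X) := by
      rw [addSum_eq hα hβ le_rfl, Ideal.Quotient.eq.2 (vS_sub_vPart (le_refl J))]
      simp [vPart, ρ, π]
    have ep : π pS = subSum ρ (π alS) (π X) := by
      rw [subSum_eq hα hβ le_rfl, Ideal.Quotient.eq.2 (pS_sub_pPart (le_refl J))]
      simp [pPart, ρ, π]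
    have ed : π (derS (derS vS)) = addSum₂ ρ (π alS) (π X) := by
      rw [addSum₂_eq hα hβ le_rfl]
      have h := derS_mem_truncIdeal (derS_mem_truncIdeal (vS_sub_vPart (le_refl J)))
      rw [map_sub, map_sub] at h
      rw [Ideal.Quotient.eq.2 h, derS_vPart]
      simp [ρ, π]
    have eC : π (rhoS sqSeries) = sqConst ρ (π alS) (π X) := by
      rw [sqConst_eq hρ hα hβ le_rfl]
      refine Ideal.Quotient.eq.2 (rhoS_sub_mem ?_)
      have := dvd_infSum_sub (f := fun m => 2 * ((X : PowerSeries ℂ) ^ (m + 1) * invAdd (m + 1) ^ 2))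
        (fun m => ⟨2 * invAdd (m + 1) ^ 2, by ring⟩) J
      rw [sqSeries]
      convert this using 1
      ring
    have eS : π (rhoS devSeries) = devConst ρ := by
      rw [devConst_eq hJ le_rfl]
      refine Ideal.Quotient.eq.2 (rhoS_sub_mem ?_)
      exact dvd_infSum_sub (fun m => ⟨-(2 * ((m + 1 : ℕ) : PowerSeries ℂ) *
        (invAdd (m + 1) + invSub (m + 1))), by ring⟩) J
    constructor
    · rw [← Ideal.Quotient.eq]
      have := addSum_mul_addSum hρ hα hβ
      rw [← ev, ← ep, ← eC] at this
      rw [map_mul, map_add]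
      exact this
    · rw [← Ideal.Quotient.eq]
      have := two_mul_addSum_mul_subSum hρ hα hβ
      rw [← ev, ← ep, ← ed, ← eS] at this
      simpa only [map_mul, map_sub, map_ofNat] using this
  exact ⟨eq_of_forall_sub_mem fun J => (key J).1, eq_of_forall_sub_mem fun J => (key J).2⟩

theorem vS_mul_vS : vS * vS = pS + rhoS sqSeries := vS_mul_vS_and.1

theorem two_mul_vS_mul_pS : 2 * vS * pS = derS (derS vS) - 2 * rhoS devSeries * vS :=
  vS_mul_vS_and.2

theorem derS_pS : derS pS = 2 * vS * derS vS := by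
  have h := congrArg derS vS_mul_vS
  rw [map_add, derS_rhoS, add_zero, Derivation.leibniz] at h
  simp only [smul_eq_mul] at h
  rw [← h]
  ring

theorem swapSeries_pS : swapSeries pS = pS := by
  have h := congrArg swapSeries vS_mul_vS
  rw [map_add, map_mul, swapSeries_vS, swapSeries_rhoS, vS_mul_vS] at h
  exact (add_right_cancel h).symm

/-- Twice the even function `u²` on the annulus, where `z u'(z) / u(z) = v`. -/
def twoW : AnnSeries := pS + rhoS devSeries + derS vS

/-- From `v² = p + S` one gets `p' = 2 v v'`, and `v'' = 2 v p + 2 D v`; hence `(p + D + v')' = 2 v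
(p + D + v')`. -/
theorem derS_twoW : derS twoW = 2 * vS * twoW := by
  rw [twoW, map_add, map_add, derS_rhoS, derS_pS]
  linear_combination -two_mul_vS_mul_pS

theorem swapSeries_twoW : swapSeries twoW = pS + rhoS devSeries - derS vS := by
  rw [twoW, map_add, map_add, swapSeries_pS, swapSeries_rhoS, swapSeries_derS, swapSeries_vS]
  ring

end AnnulusSeries
end
end TwistedCancellation

namespace TwistedCancellation
noncomputable section

/-! ### Theta products and `v` as a logarithmic derivative -/

section ThetaProducts

open PowerSeries

/-- The geometric series `y / (1 - y)`. -/
def phiP (y : AnnPoly) : AnnPoly := y * invOfUnit (1 - y) 1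

theorem phiP_mul {y : AnnPoly} (hy : X ∣ y) : phiP y * (1 - y) = y := by
  have h : invOfUnit (1 - y) 1 * (1 - y) = 1 := by
    refine invOfUnit_mul _ _ ?_
    simp [X_dvd_iff.1 hy]
  rw [phiP]
  linear_combination y * h

theorem phiP_eq_sum {y : AnnPoly} (hy : X ∣ y) (L : ℕ) :
    phiP y = ∑ m ∈ Finset.range L, y ^ (m + 1) + y ^ L * phiP y := by
  induction L with
  | zero => simp
  | succ L ih =>
    rw [Finset.sum_range_succ]
    linear_combination ih + y ^ L * phiP_mul hy

/-- Expand `1 / (1 + Q ^ m) = ∑ (-1)ⁿ Q ^ (n m)` and sum over `m` before `n`: the Lambert series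
becomes `∑ (-1)ⁿ φ(y Qⁿ)` with `φ(y) = y / (1 - y)`. Even and odd `n` are paired. -/
theorem lambert_exchange {y : AnnPoly} (hy : X ∣ y) (L : ℕ) :
    X ^ L ∣ ∑ m ∈ Finset.range L, y ^ (m + 1) * rhoP (invAdd (m + 1)) -
      ∑ n ∈ Finset.range L,
        (phiP (y * (alP * X) ^ (2 * n)) - phiP (y * (alP * X) ^ (2 * n + 1))) := by
  have h1 : ∀ k, X ^ L ∣ phiP (y * (alP * X) ^ k) -
      ∑ m ∈ Finset.range L, (y * (alP * X) ^ k) ^ (m + 1) := by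
    intro k
    have hyk : X ∣ y * (alP * X) ^ k := hy.mul_right _
    rw [sub_eq_of_eq_add' (phiP_eq_sum hyk L)]
    exact (pow_dvd_pow_of_dvd hyk L).mul_right _
  have h2 : X ^ L ∣ ∑ n ∈ Finset.range L,
      ((phiP (y * (alP * X) ^ (2 * n)) - phiP (y * (alP * X) ^ (2 * n + 1))) -
        ∑ m ∈ Finset.range L, ((y * (alP * X) ^ (2 * n)) ^ (m + 1) -
          (y * (alP * X) ^ (2 * n + 1)) ^ (m + 1))) := by
    refine Finset.dvd_sum fun n _ => ?_
    have := dvd_sub (h1 (2 * n)) (h1 (2 * n + 1))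
    rw [Finset.sum_sub_distrib]
    convert this using 1
    ring
  have h3 : X ^ L ∣ ∑ m ∈ Finset.range L, (y ^ (m + 1) * rhoP (invAdd (m + 1)) -
      ∑ n ∈ Finset.range L, ((y * (alP * X) ^ (2 * n)) ^ (m + 1) -
          (y * (alP * X) ^ (2 * n + 1)) ^ (m + 1))) := by
    refine Finset.dvd_sum fun m _ => ?_
    -- The finite alternating geometric sum, with its exact remainder of order `Q ^ (2 L (m + 1))`.
    have e : ∀ L, ∑ n ∈ Finset.range L, ((y * (alP * X) ^ (2 * n)) ^ (m + 1) -
          (y * (alP * X) ^ (2 * n + 1)) ^ (m + 1)) =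
        y ^ (m + 1) * rhoP (invAdd (m + 1)) * (1 - (alP * X) ^ (2 * L * (m + 1))) := by
      intro L
      have h4 := congrArg rhoP (invAdd_mul (m + 1))
      rw [map_mul, map_add, map_pow, rhoP_X, map_one] at h4
      induction L with
      | zero => simp
      | succ L ih =>
        rw [Finset.sum_range_succ, ih]
        have e1 : (alP * X : AnnPoly) ^ (2 * (L + 1) * (m + 1)) =
            (alP * X) ^ (2 * L * (m + 1)) * ((alP * X) ^ (m + 1)) ^ 2 := by ring
        have e2 : (y * (alP * X) ^ (2 * L)) ^ (m + 1) =
            y ^ (m + 1) * (alP * X) ^ (2 * L * (m + 1)) := by ring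
        have e3 : (y * (alP * X) ^ (2 * L + 1)) ^ (m + 1) =
            y ^ (m + 1) * (alP * X) ^ (2 * L * (m + 1)) * (alP * X) ^ (m + 1) := by ring
        rw [e1, e2, e3]
        linear_combination (-(y ^ (m + 1) * (alP * X) ^ (2 * L * (m + 1)) *
          (1 - (alP * X) ^ (m + 1)))) * h4
    rw [e L]
    have h5 : (X : AnnPoly) ^ L ∣ (alP * X) ^ (2 * L * (m + 1)) := by
      rw [mul_pow]
      exact (pow_dvd_pow X (by nlinarith)).mul_left _
    have e6 : y ^ (m + 1) * rhoP (invAdd (m + 1)) - y ^ (m + 1) * rhoP (invAdd (m + 1)) *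
        (1 - (alP * X) ^ (2 * L * (m + 1))) =
        y ^ (m + 1) * rhoP (invAdd (m + 1)) * (alP * X) ^ (2 * L * (m + 1)) := by ring
    rw [e6]
    exact h5.mul_left _
  have h7 := dvd_sub h3 h2
  rw [Finset.sum_sub_distrib, Finset.sum_sub_distrib (s := Finset.range L), Finset.sum_comm] at h7
  convert h7 using 1
  ring

/-- The first `L` terms of the partial fraction expansion of `vPoly`. -/
def vFrac (L : ℕ) : AnnPoly := ∑ n ∈ Finset.range L,
  ((phiP (alP ^ (2 * n) * X ^ (2 * n + 1)) - phiP (alP ^ (2 * n + 2) * X ^ (2 * n + 1))) -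
    (phiP (alP ^ (2 * n + 1) * X ^ (2 * n + 2)) - phiP (alP ^ (2 * n + 3) * X ^ (2 * n + 2))))

theorem vPoly_sub_vFrac (L : ℕ) : X ^ L ∣ vPoly - vFrac L := by
  have h1 := dvd_infSum_sub X_pow_dvd_vPoly_term L
  have h2 := lambert_exchange (y := X) dvd_rfl L
  have h3 := lambert_exchange (y := alP * (alP * X)) ⟨alP * alP, by ring⟩ L
  have h4 := dvd_add h1 (dvd_sub h2 h3)
  have e : vFrac L = ∑ n ∈ Finset.range L,
        (phiP (X * (alP * X) ^ (2 * n)) - phiP (X * (alP * X) ^ (2 * n + 1))) -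
      ∑ n ∈ Finset.range L,
        (phiP (alP * (alP * X) * (alP * X) ^ (2 * n)) -
          phiP (alP * (alP * X) * (alP * X) ^ (2 * n + 1))) := by
    rw [vFrac, ← Finset.sum_sub_distrib]
    refine Finset.sum_congr rfl fun n _ => ?_
    rw [show X * (alP * X) ^ (2 * n) = alP ^ (2 * n) * X ^ (2 * n + 1) by ring,
      show X * (alP * X) ^ (2 * n + 1) = alP ^ (2 * n + 1) * X ^ (2 * n + 2) by ring,
      show alP * (alP * X) * (alP * X) ^ (2 * n) = alP ^ (2 * n + 2) * X ^ (2 * n + 1) by ring,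
      show alP * (alP * X) * (alP * X) ^ (2 * n + 1) = alP ^ (2 * n + 3) * X ^ (2 * n + 2) by ring]
    ring
  have e2 : ∑ m ∈ Finset.range L, (X ^ (m + 1) - (alP * (alP * X)) ^ (m + 1)) *
      rhoP (invAdd (m + 1)) = ∑ m ∈ Finset.range L, X ^ (m + 1) * rhoP (invAdd (m + 1)) -
      ∑ m ∈ Finset.range L, (alP * (alP * X)) ^ (m + 1) * rhoP (invAdd (m + 1)) := by
    rw [← Finset.sum_sub_distrib]
    exact Finset.sum_congr rfl fun m _ => by ring
  rw [e]
  rw [e2] at h4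
  convert h4 using 1
  rw [vPoly]
  ring

/-- The factors of the theta function with zeros at `z = Q ^ (2 n)`, `n ≠ 0`. -/
def evFactor (n : ℕ) : AnnPoly :=
  (1 - alP ^ (2 * n + 1) * X ^ (2 * n)) * (1 - alP ^ (2 * n - 1) * X ^ (2 * n))

/-- The factors of the theta function with zeros at `z = Q ^ (2 n - 1)`. -/
def odFactor (n : ℕ) : AnnPoly :=
  (1 - alP ^ (2 * n - 2) * X ^ (2 * n - 1)) * (1 - alP ^ (2 * n) * X ^ (2 * n - 1))

theorem X_pow_dvd_evFactor (m : ℕ) : X ^ m ∣ evFactor m - 1 := by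
  have e : evFactor m - 1 = X ^ (2 * m) * (-alP ^ (2 * m + 1) - alP ^ (2 * m - 1) +
      alP ^ (2 * m + 1) * alP ^ (2 * m - 1) * X ^ (2 * m)) := by rw [evFactor]; ring
  rw [e]
  exact (pow_dvd_pow X (by omega)).mul_right _

theorem X_pow_dvd_odFactor (m : ℕ) : X ^ m ∣ odFactor m - 1 := by
  have e : odFactor m - 1 = X ^ (2 * m - 1) * (-alP ^ (2 * m - 2) - alP ^ (2 * m) +
      alP ^ (2 * m - 2) * alP ^ (2 * m) * X ^ (2 * m - 1)) := by rw [odFactor]; ring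
  rw [e]
  exact (pow_dvd_pow X (by omega)).mul_right _

/-- The theta function with zeros at `z = Q ^ (2 n)`, `n ≠ 0`. -/
def evTheta : AnnPoly := infProd evFactor

/-- The theta function with zeros at `z = Q ^ (2 n - 1)`. -/
def odTheta : AnnPoly := infProd odFactor

theorem derP_monomial (i j : ℕ) :
    derP (alP ^ i * X ^ j) = ((i : AnnPoly) - (j : AnnPoly)) * (alP ^ i * X ^ j) := by
  have h1 : ∀ n : ℕ, derP (alP ^ n) = (n : AnnPoly) * alP ^ n := by
    intro n
    rcases n with _ | n
    · simp
    · rw [Derivation.leibniz_pow, derP_alP, Nat.add_sub_cancel, smul_eq_mul, nsmul_eq_mul]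
      ring
  have h2 : ∀ n : ℕ, derP ((X : AnnPoly) ^ n) = -((n : AnnPoly) * (X : AnnPoly) ^ n) := by
    intro n
    rcases n with _ | n
    · simp
    · rw [Derivation.leibniz_pow, derP_X, Nat.add_sub_cancel, smul_eq_mul, nsmul_eq_mul]
      ring
  rw [Derivation.leibniz, h1, h2, smul_eq_mul, smul_eq_mul]
  ring

theorem derP_one_sub_monomial {i j : ℕ} (hj : j ≠ 0) :
    derP (1 - alP ^ i * X ^ j) =
      -(((i : AnnPoly) - (j : AnnPoly)) * phiP (alP ^ i * X ^ j)) * (1 - alP ^ i * X ^ j) := by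
  rw [map_sub, Derivation.map_one_eq_zero, derP_monomial]
  have := phiP_mul (y := alP ^ i * X ^ j) ((dvd_pow_self X hj).mul_left _)
  linear_combination ((i : AnnPoly) - (j : AnnPoly)) * this

/-- A factor `1 - αⁱ βʲ` has logarithmic derivative `-(i - j) φ(αⁱ βʲ)`, and here `i - j = ±1`. The
four factors of index `L + 1` thus contribute exactly the last summand of `vFrac (L + 1)`. The
identity is cross-multiplied to avoid quotients. -/
theorem derP_evProd_odProd (L : ℕ) :
    derP (∏ n ∈ Finset.Icc 1 L, odFactor n) * ∏ n ∈ Finset.Icc 1 L, evFactor n -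
      (∏ n ∈ Finset.Icc 1 L, odFactor n) * derP (∏ n ∈ Finset.Icc 1 L, evFactor n) =
    vFrac L * ((∏ n ∈ Finset.Icc 1 L, odFactor n) * ∏ n ∈ Finset.Icc 1 L, evFactor n) := by
  induction L with
  | zero => simp [vFrac]
  | succ L ih =>
    rw [Finset.prod_Icc_succ_top (by omega), Finset.prod_Icc_succ_top (by omega), vFrac,
      Finset.sum_range_succ, ← vFrac]
    generalize ∏ n ∈ Finset.Icc 1 L, odFactor n = m at *
    generalize ∏ n ∈ Finset.Icc 1 L, evFactor n = k at *
    have e1 : odFactor (L + 1) = (1 - alP ^ (2 * L) * X ^ (2 * L + 1)) *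
        (1 - alP ^ (2 * L + 2) * X ^ (2 * L + 1)) := rfl
    have e2 : evFactor (L + 1) = (1 - alP ^ (2 * L + 3) * X ^ (2 * L + 2)) *
        (1 - alP ^ (2 * L + 1) * X ^ (2 * L + 2)) := rfl
    have d1 := derP_one_sub_monomial (i := 2 * L) (j := 2 * L + 1) (by omega)
    have d2 := derP_one_sub_monomial (i := 2 * L + 2) (j := 2 * L + 1) (by omega)
    have d3 := derP_one_sub_monomial (i := 2 * L + 3) (j := 2 * L + 2) (by omega)
    have d4 := derP_one_sub_monomial (i := 2 * L + 1) (j := 2 * L + 2) (by omega)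
    rw [e1, e2]
    simp only [Derivation.leibniz, smul_eq_mul]
    push_cast at d1 d2 d3 d4
    generalize (1 - alP ^ (2 * L) * X ^ (2 * L + 1)) = f1 at *
    generalize (1 - alP ^ (2 * L + 2) * X ^ (2 * L + 1)) = f2 at *
    generalize (1 - alP ^ (2 * L + 3) * X ^ (2 * L + 2)) = f3 at *
    generalize (1 - alP ^ (2 * L + 1) * X ^ (2 * L + 2)) = f4 at *
    linear_combination (f1 * f2 * f3 * f4) * ih + (m * k * f2 * f3 * f4) * d1 +
      (m * k * f1 * f3 * f4) * d2 - (m * k * f1 * f2 * f4) * d3 - (m * k * f1 * f2 * f3) * d4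

theorem derP_theta : derP odTheta * evTheta - odTheta * derP evTheta =
    vPoly * (odTheta * evTheta) := by
  refine eq_of_forall_X_pow_dvd fun L => ?_
  have h1 : X ^ L ∣ odTheta - ∏ n ∈ Finset.Icc 1 L, odFactor n :=
    (pow_dvd_pow X (by omega)).trans (dvd_infProd_sub X_pow_dvd_odFactor L)
  have h2 : X ^ L ∣ evTheta - ∏ n ∈ Finset.Icc 1 L, evFactor n :=
    (pow_dvd_pow X (by omega)).trans (dvd_infProd_sub X_pow_dvd_evFactor L)
  have h3 := X_pow_dvd_annDer ((Polynomial.X : Polynomial ℂ) • Polynomial.derivative') h1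
  have h4 := X_pow_dvd_annDer ((Polynomial.X : Polynomial ℂ) • Polynomial.derivative') h2
  have h5 := vPoly_sub_vFrac L
  have key := derP_evProd_odProd L
  rw [← derP, map_sub] at h3 h4
  obtain ⟨a1, h1⟩ := h1
  obtain ⟨a2, h2⟩ := h2
  obtain ⟨a3, h3⟩ := h3
  obtain ⟨a4, h4⟩ := h4
  obtain ⟨a5, h5⟩ := h5
  generalize ∏ n ∈ Finset.Icc 1 L, odFactor n = m at *
  generalize ∏ n ∈ Finset.Icc 1 L, evFactor n = k at *
  rw [sub_eq_iff_eq_add] at h1 h2 h3 h4 h5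
  rw [h3, h4, h5, h1, h2]
  refine ⟨a3 * k + X ^ L * a3 * a2 + derP m * a2 - (m * a4 + a1 * derP k + X ^ L * a1 * a4) -
    (a5 * (X ^ L * a1 + m) * (X ^ L * a2 + k) + vFrac L * (m * a2 + a1 * k + X ^ L * a1 * a2)), ?_⟩
  linear_combination key

/-- The theta function with zeros at `z = Q ^ (2 n)`. -/
def evThetaS : AnnSeries := annIncl ((1 - alP) * evTheta)

/-- The theta function with zeros at `z = Q ^ (2 n - 1)`, on the annulus. -/
def odThetaS : AnnSeries := annIncl odTheta

/-- Under `z ↦ Q / z` the factors `1 - Q ^ (2 n - 1) / z` become `1 - z Q ^ (2 n - 2)`, which are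
the factors `1 - z Q ^ (2 n)` shifted by one place. The shift creates `1 - z` in front and loses one
factor at the end of a finite product, negligible in the limit. -/
theorem swapSeries_odThetaS : swapSeries odThetaS = evThetaS := by
  refine eq_of_forall_sub_mem fun J => ?_
  have h1 := annIncl_mem_truncIdeal (J := J) (Nat.le_succ J) (dvd_infProd_sub X_pow_dvd_odFactor J)
  have h2 := annIncl_mem_truncIdeal (J := J) (Nat.le_succ J) (dvd_infProd_sub X_pow_dvd_evFactor J)
  have h3 := swapSeries_mem_truncIdeal h1
  have h4 : alS ^ (2 * J + 1) ∈ truncIdeal J := alS_pow_mem_truncIdeal (by omega)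
  rw [map_sub] at h2
  rw [map_sub, map_sub] at h3
  have e : ∀ L, (1 - alS) * annIncl (∏ n ∈ Finset.Icc 1 L, evFactor n) =
      (1 - alS ^ (2 * L + 1) * X ^ (2 * L)) *
        swapSeries (annIncl (∏ n ∈ Finset.Icc 1 L, odFactor n)) := by
    intro L
    induction L with
    | zero => simp
    | succ L ih =>
      rw [Finset.prod_Icc_succ_top (by omega), Finset.prod_Icc_succ_top (by omega), map_mul,
        map_mul, map_mul, ← mul_assoc, ih]
      have e1 : odFactor (L + 1) = (1 - alP ^ (2 * L) * X ^ (2 * L + 1)) *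
          (1 - alP ^ (2 * L + 2) * X ^ (2 * L + 1)) := rfl
      have e2 : evFactor (L + 1) = (1 - alP ^ (2 * L + 3) * X ^ (2 * L + 2)) *
          (1 - alP ^ (2 * L + 1) * X ^ (2 * L + 2)) := rfl
      rw [e1, e2]
      simp only [map_mul, map_sub, map_one, map_pow, annIncl_alP, annIncl_X, swapSeries_alS,
        swapSeries_annX]
      ring
  have e' := e J
  rw [evThetaS, odThetaS, map_mul, map_sub, map_one, annIncl_alP]
  have e5 : swapSeries (annIncl odTheta) - (1 - alS) * annIncl evTheta =
      (swapSeries (annIncl odTheta) -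
        swapSeries (annIncl (∏ n ∈ Finset.Icc 1 J, odFactor n))) -
      (1 - alS) * (annIncl evTheta - annIncl (∏ n ∈ Finset.Icc 1 J, evFactor n)) +
      alS ^ (2 * J + 1) * (X ^ (2 * J) *
        swapSeries (annIncl (∏ n ∈ Finset.Icc 1 J, odFactor n))) := by
    linear_combination (-1 : AnnSeries) * e'
  rw [e5]
  exact add_mem (sub_mem h3 (Ideal.mul_mem_left _ _ h2)) (Ideal.mul_mem_right _ _ h4)

theorem swapSeries_evThetaS : swapSeries evThetaS = odThetaS := by
  rw [← swapSeries_odThetaS, swapSeries_swapSeries]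

/-- Including the factor `1 - α` adds `α / (1 - α)` to `vPoly`, which gives `v` without its constant
term `1 / 2`; hence `2 v - 1`. -/
theorem derS_thetaS : 2 * (derS odThetaS * evThetaS - odThetaS * derS evThetaS) =
    (2 * vS - 1) * (odThetaS * evThetaS) := by
  have h := congrArg annIncl derP_theta
  simp only [map_sub, map_mul, annIncl_derP] at h
  have h0 := congrArg rhoS (invAdd_mul 0)
  simp only [pow_zero, map_mul, map_add, map_one] at h0
  have e : derS evThetaS = -alS * annIncl evTheta + (1 - alS) * derS (annIncl evTheta) := by
    rw [evThetaS, map_mul, Derivation.leibniz, map_sub, map_sub, map_one, annIncl_alP, derS_alS,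
      Derivation.map_one_eq_zero, smul_eq_mul, smul_eq_mul]
    ring
  rw [e, evThetaS, odThetaS, vS, map_mul, map_sub, map_one, annIncl_alP]
  linear_combination 2 * (1 - alS) * h - (annIncl odTheta * annIncl evTheta * (1 - alS)) * h0 -
    (2 * alS * annIncl odTheta * annIncl evTheta) * geoS_mul

end ThetaProducts
end
end TwistedCancellation

namespace TwistedCancellation
noncomputable section

/-! ### First integral of the equation for `v` and identification of its constants -/

section ThetaConstants

open PowerSeries

/-- `∏ (1 - X ^ (2 n))`. -/
def evMinus : PowerSeries ℂ := infProd fun n => 1 - X ^ (2 * n)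

/-- `∏ (1 + X ^ (2 n))`. -/
def evPlus : PowerSeries ℂ := infProd fun n => 1 + X ^ (2 * n)

/-- `∏ (1 - X ^ (2 n - 1))`. -/
def odMinus : PowerSeries ℂ := infProd fun n => 1 - X ^ (2 * n - 1)

/-- `∏ (1 + X ^ (2 n - 1))`. -/
def odPlus : PowerSeries ℂ := infProd fun n => 1 + X ^ (2 * n - 1)

theorem X_pow_dvd_one_sub (m k : ℕ) (h : m ≤ k) : (X : PowerSeries ℂ) ^ m ∣ (1 - X ^ k) - 1 := by
  rw [sub_sub_cancel_left]
  exact (pow_dvd_pow X h).neg_right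

theorem X_pow_dvd_one_add (m k : ℕ) (h : m ≤ k) : (X : PowerSeries ℂ) ^ m ∣ (1 + X ^ k) - 1 := by
  rw [add_sub_cancel_left]
  exact pow_dvd_pow X h

theorem infProd_mul {R : Type*} [CommRing R] {f g : ℕ → PowerSeries R}
    (hf : ∀ m, X ^ m ∣ f m - 1) (hg : ∀ m, X ^ m ∣ g m - 1) :
    infProd (fun m => f m * g m) = infProd f * infProd g := by
  refine eq_of_forall_X_pow_dvd fun L => ?_
  have hfg : ∀ m, X ^ m ∣ f m * g m - 1 := fun m => by
    have e : f m * g m - 1 = (f m - 1) * g m + (g m - 1) := by ring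
    rw [e]
    exact dvd_add ((hf m).mul_right _) (hg m)
  have h0 : (X : PowerSeries R) ^ L ∣ X ^ (L + 1) := pow_dvd_pow X (by omega)
  have h1 := h0.trans (dvd_infProd_sub hf L)
  have h2 := h0.trans (dvd_infProd_sub hg L)
  have h3 := h0.trans (dvd_infProd_sub hfg L)
  rw [Finset.prod_mul_distrib] at h3
  generalize ∏ m ∈ Finset.Icc 1 L, f m = a at *
  generalize ∏ m ∈ Finset.Icc 1 L, g m = b at *
  have e : infProd (fun m => f m * g m) - infProd f * infProd g =
      (infProd (fun m => f m * g m) - a * b) - ((infProd f - a) * infProd g +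
        a * (infProd g - b)) := by ring
  rw [e]
  exact dvd_sub h3 (dvd_add (h1.mul_right _) (h2.mul_left _))

theorem infProd_pow {R : Type*} [CommRing R] {f : ℕ → PowerSeries R}
    (hf : ∀ m, X ^ m ∣ f m - 1) (k : ℕ) : infProd (fun m => f m ^ k) = infProd f ^ k := by
  have hp : ∀ k m, X ^ m ∣ f m ^ k - 1 := fun k m => by
    have := sub_dvd_pow_sub_pow (f m) 1 k
    rw [one_pow] at this
    exact (hf m).trans this
  induction k with
  | zero =>
    have : infProd (fun _ : ℕ => (1 : PowerSeries R)) = 1 := by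
      ext n
      simp [infProd]
    simpa using this
  | succ k ih =>
    rw [pow_succ, ← ih, ← infProd_mul (hp k) hf]
    rfl

theorem infProd_congr {R : Type*} [CommRing R] {f g : ℕ → PowerSeries R}
    (h : ∀ m, 1 ≤ m → f m = g m) : infProd f = infProd g := by
  ext n
  rw [infProd, infProd, coeff_mk, coeff_mk]
  congr 1
  exact Finset.prod_congr rfl fun m hm => h m (Finset.mem_Icc.1 hm).1

theorem evMinus_ne_zero : evMinus ≠ 0 := by
  intro h
  have := constantCoeff_infProd (fun n => 1 - (X : PowerSeries ℂ) ^ (2 * n))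
  rw [← evMinus, h, map_zero] at this
  exact zero_ne_one this

/-- Euler's identity `∏ (1 + X ^ n) (1 - X ^ (2 n - 1)) = 1`. -/
theorem euler_product : evPlus * odPlus * odMinus = 1 := by
  refine mul_left_cancel₀ evMinus_ne_zero ?_
  refine eq_of_forall_X_pow_dvd fun L => ?_
  have h0 : (X : PowerSeries ℂ) ^ L ∣ X ^ (L + 1) := pow_dvd_pow X (by omega)
  have h0' : (X : PowerSeries ℂ) ^ L ∣ X ^ (2 * L + 1) := pow_dvd_pow X (by omega)
  have h1 := h0.trans (dvd_infProd_sub (fun m => X_pow_dvd_one_sub m (2 * m) (by omega)) L)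
  have h1' := h0'.trans
    (dvd_infProd_sub (fun m => X_pow_dvd_one_sub m (2 * m) (by omega)) (2 * L))
  have h2 := h0.trans (dvd_infProd_sub (fun m => X_pow_dvd_one_add m (2 * m) (by omega)) L)
  have h3 := h0.trans (dvd_infProd_sub (f := fun n => 1 + (X : PowerSeries ℂ) ^ (2 * n - 1))
    (fun m => by
      rcases m with _ | m
      · simp
      · exact X_pow_dvd_one_add _ _ (by omega)) L)
  have h4 := h0.trans (dvd_infProd_sub (f := fun n => 1 - (X : PowerSeries ℂ) ^ (2 * n - 1))
    (fun m => by
      rcases m with _ | m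
      · simp
      · exact X_pow_dvd_one_sub _ _ (by omega)) L)
  -- Differences of squares: the even factors give `1 - X ^ (4 n)` and the odd ones `1 - X ^ (4 n -
  -- 2)`. Together they are all `1 - X ^ (2 m)` with `m ≤ 2 L`, so in the limit the extra factors
  -- multiply to one.
  have key : ∀ L, (∏ n ∈ Finset.Icc 1 L, (1 - (X : PowerSeries ℂ) ^ (2 * n))) *
      ((∏ n ∈ Finset.Icc 1 L, (1 + X ^ (2 * n))) * (∏ n ∈ Finset.Icc 1 L, (1 + X ^ (2 * n - 1))) *
        ∏ n ∈ Finset.Icc 1 L, (1 - X ^ (2 * n - 1))) =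
      ∏ n ∈ Finset.Icc 1 (2 * L), (1 - X ^ (2 * n)) := by
    intro L
    induction L with
    | zero => simp
    | succ L ih =>
      rw [show 2 * (L + 1) = 2 * L + 1 + 1 by ring, Finset.prod_Icc_succ_top (by omega),
        Finset.prod_Icc_succ_top (by omega), Finset.prod_Icc_succ_top (by omega),
        Finset.prod_Icc_succ_top (by omega), Finset.prod_Icc_succ_top (by omega),
        Finset.prod_Icc_succ_top (by omega), ← ih, show 2 * (L + 1) - 1 = 2 * L + 1 by omega]
      ring
  rw [← evMinus] at h1 h1'
  rw [← evPlus] at h2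
  rw [← odPlus] at h3
  rw [← odMinus] at h4
  rw [← key L] at h1'
  generalize ∏ n ∈ Finset.Icc 1 L, (1 - (X : PowerSeries ℂ) ^ (2 * n)) = a at *
  generalize ∏ n ∈ Finset.Icc 1 L, (1 + (X : PowerSeries ℂ) ^ (2 * n)) = b at *
  generalize ∏ n ∈ Finset.Icc 1 L, (1 + (X : PowerSeries ℂ) ^ (2 * n - 1)) = c at *
  generalize ∏ n ∈ Finset.Icc 1 L, (1 - (X : PowerSeries ℂ) ^ (2 * n - 1)) = d at *
  have e : evMinus * (evPlus * odPlus * odMinus) - evMinus * 1 =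
      (evMinus - a) * (evPlus * odPlus * odMinus) + a * ((evPlus - b) * (odPlus * odMinus) +
        b * ((odPlus - c) * odMinus + c * (odMinus - d))) - (evMinus - a * (b * c * d)) := by ring
  rw [e]
  exact dvd_sub (dvd_add (h1.mul_right _) ((dvd_add (h2.mul_right _)
    ((dvd_add (h3.mul_right _) (h4.mul_left _)).mul_left _)).mul_left _)) h1'

/-- The inverse of `odTheta`. -/
def odThetaInv : AnnPoly := invOfUnit odTheta 1

theorem odTheta_mul_inv : odTheta * odThetaInv = 1 := by
  refine mul_invOfUnit _ _ ?_
  rw [odTheta, constantCoeff_infProd, Units.val_one]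

/-- The square of the constant `∏ (1 - Q ^ (2 n))² / (1 - Q ^ (2 n - 1))²`, via Euler's
identity. -/
def thetaConst : PowerSeries ℂ := (evMinus * evPlus * odPlus) ^ 4

/-- The theta quotient `W' / (1 - α)²`. -/
def wPoly : AnnPoly := rhoP thetaConst * X * evTheta ^ 2 * odThetaInv ^ 2

/-- The theta quotient `W'`. -/
def wS : AnnSeries := annIncl ((1 - alP) ^ 2 * wPoly)

theorem wS_mul : wS * odThetaS ^ 2 = rhoS thetaConst * X * evThetaS ^ 2 := by
  have h := congrArg annIncl odTheta_mul_inv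
  rw [map_mul, map_one] at h
  rw [wS, wPoly, evThetaS, odThetaS]
  simp only [map_mul, map_pow, annIncl_rhoP, annIncl_X]
  linear_combination (annIncl (1 - alP) ^ 2 * rhoS thetaConst * X * annIncl evTheta ^ 2 *
    (1 + annIncl odTheta * annIncl odThetaInv)) * h

theorem odThetaS_ne_zero : odThetaS ≠ 0 := by
  intro h
  have h1 := congrArg annIncl odTheta_mul_inv
  rw [map_mul, ← odThetaS, h, zero_mul, map_one] at h1
  exact zero_ne_one h1

theorem evThetaS_ne_zero : evThetaS ≠ 0 := by
  intro h
  apply odThetaS_ne_zero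
  rw [← swapSeries_evThetaS, h, map_zero]

theorem thetaConst_ne_zero : thetaConst ≠ 0 := by
  intro h
  have h1 := pow_eq_zero_iff (n := 4) (by norm_num) |>.1 h
  have h2 := euler_product
  rcases mul_eq_zero.1 h1 with h3 | h3
  · rcases mul_eq_zero.1 h3 with h4 | h4
    · exact evMinus_ne_zero h4
    · rw [h4, zero_mul, zero_mul] at h2
      exact zero_ne_one h2
  · rw [h3, mul_zero, zero_mul] at h2
    exact zero_ne_one h2

theorem map_algebraMap_self (f : PowerSeries ℂ) : map (algebraMap ℂ ℂ) f = f := by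
  ext n
  simp

theorem annIncl_injective_rhoS {f g : PowerSeries ℂ} (h : rhoS f = rhoS g) : f = g := by
  rw [← annIncl_rhoP, ← annIncl_rhoP] at h
  have h1 := congrArg (annEval (1 : ℂ) 1) (annIncl_injective h)
  rw [annEval_rhoP _ _ (one_mul 1), annEval_rhoP _ _ (one_mul 1)] at h1
  rw [map_algebraMap_self, map_algebraMap_self] at h1
  exact h1

/-- The swap inverts the theta quotient `evThetaS² / odThetaS²` and turns the prefactor `β` into
`α`; what is left is `thetaConst² α β`. -/
theorem wS_mul_swap : wS * swapSeries wS = rhoS (thetaConst ^ 2 * X) := by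
  have h1 := wS_mul
  have h2 := congrArg swapSeries h1
  simp only [map_mul, map_pow, swapSeries_odThetaS, swapSeries_evThetaS, swapSeries_rhoS,
    swapSeries_annX] at h2
  have h3 : odThetaS ^ 2 * evThetaS ^ 2 ≠ 0 :=
    mul_ne_zero (pow_ne_zero _ odThetaS_ne_zero) (pow_ne_zero _ evThetaS_ne_zero)
  refine mul_right_cancel₀ h3 ?_
  rw [map_mul, map_pow, rhoS_X]
  linear_combination (swapSeries wS * evThetaS ^ 2) * h1 +
    (rhoS thetaConst * X * evThetaS ^ 2) * h2

theorem wS_ne_zero : wS ≠ 0 := by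
  intro h
  have h1 := wS_mul
  rw [h, zero_mul] at h1
  have h2 : rhoS thetaConst ≠ 0 := fun h => thetaConst_ne_zero
    (annIncl_injective_rhoS (by rw [h, map_zero]))
  exact mul_ne_zero (mul_ne_zero h2 X_ne_zero) (pow_ne_zero 2 evThetaS_ne_zero) h1.symm

/-- The prefactor `β` contributes `-1` to the logarithmic derivative, which cancels the `-1` in `2 v
- 1`. -/
theorem derS_wS : derS wS = -(2 * vS * wS) := by
  have h1 := wS_mul
  have h2 := congrArg derS h1
  have h3 := derS_thetaS
  simp only [Derivation.leibniz, Derivation.leibniz_pow, derS_rhoS, derS_X, smul_eq_mul,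
    nsmul_eq_mul, mul_zero, add_zero] at h2
  push_cast at h2
  norm_num at h2
  have h4 : odThetaS ^ 2 * evThetaS ≠ 0 :=
    mul_ne_zero (pow_ne_zero _ odThetaS_ne_zero) evThetaS_ne_zero
  refine mul_right_cancel₀ h4 ?_
  linear_combination evThetaS * h2 - (wS * odThetaS) * h3 + (evThetaS - 2 * derS evThetaS) * h1

theorem derS_geoS : derS geoS = alS * geoS ^ 2 := by
  have h := congrArg derS geoS_mul
  rw [Derivation.leibniz, map_sub, Derivation.map_one_eq_zero, derS_alS, smul_eq_mul,
    smul_eq_mul] at h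
  linear_combination geoS * h + (derS geoS * -1) * geoS_mul

/-- The series `(1 - α)² z v'(z)`. -/
def dvPoly : AnnPoly := alP + (1 - alP) ^ 2 * derP vPoly

/-- The series `(1 - α) v(z)`. -/
def vNum : AnnPoly := (1 - alP) * (rhoP (invAdd 0) + vPoly) + alP

/-- The series `2 (1 - α)² W`. -/
def twoWNum : AnnPoly := alP + (1 - alP) ^ 2 * (pPoly + rhoP devSeries) + dvPoly

/-- Poles at `z = 1` are cleared by powers of `1 - α`, so that the resulting elements lie in
`ℂ[α]⟦β⟧`, where `α` can be given a value. -/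
theorem annIncl_vNum : annIncl vNum = (1 - alS) * vS := by
  rw [vNum, vS]
  simp only [map_mul, map_add, map_sub, map_one, annIncl_alP, annIncl_rhoP]
  linear_combination (-alS) * geoS_mul

theorem annIncl_dvPoly : annIncl dvPoly = (1 - alS) ^ 2 * derS vS := by
  have e : derS vS = alS * geoS ^ 2 + derS (annIncl vPoly) := by
    rw [vS, map_add, map_add, derS_rhoS, Derivation.leibniz, derS_geoS, derS_alS, smul_eq_mul,
      smul_eq_mul]
    linear_combination (-alS * geoS) * geoS_mul
  rw [e, dvPoly]
  simp only [map_mul, map_add, map_sub, map_one, map_pow, annIncl_alP, annIncl_derP]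
  linear_combination (-alS * (geoS * (1 - alS) + 1)) * geoS_mul

theorem annIncl_twoWNum : annIncl twoWNum = (1 - alS) ^ 2 * twoW := by
  rw [twoWNum, map_add, annIncl_dvPoly, twoW, pS]
  simp only [map_mul, map_add, map_sub, map_one, map_pow, annIncl_alP, annIncl_rhoP]
  linear_combination (-alS * (geoS * (1 - alS) + 1)) * geoS_mul

theorem annEval_one_evTheta : annEval (1 : ℂ) 1 evTheta = evMinus ^ 2 := by
  rw [evTheta, annEval_infProd, evMinus,
    ← infProd_pow (fun m => X_pow_dvd_one_sub m (2 * m) (by omega))]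
  refine infProd_congr fun m _ => ?_
  simp [evFactor, sq]

theorem annEval_one_odTheta : annEval (1 : ℂ) 1 odTheta = odMinus ^ 2 := by
  have h : ∀ m, (X : PowerSeries ℂ) ^ m ∣ (1 - X ^ (2 * m - 1)) - 1 := fun m => by
    rcases m with _ | m
    · simp
    · exact X_pow_dvd_one_sub _ _ (by omega)
  rw [odTheta, annEval_infProd, odMinus, ← infProd_pow h]
  refine infProd_congr fun m _ => ?_
  simp [odFactor, sq]

theorem annEval_neg_one_evTheta : annEval (-1 : ℂ) (-1) evTheta = evPlus ^ 2 := by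
  rw [evTheta, annEval_infProd, evPlus,
    ← infProd_pow (fun m => X_pow_dvd_one_add m (2 * m) (by omega))]
  refine infProd_congr fun m hm => ?_
  obtain ⟨n, rfl⟩ : ∃ n, m = n + 1 := ⟨m - 1, by omega⟩
  simp only [evFactor, map_mul, map_sub, map_one, map_pow, annEval_alP, annEval_X, map_neg,
    show 2 * (n + 1) - 1 = 2 * n + 1 by omega]
  have e : ∀ n, (-1 : PowerSeries ℂ) ^ (2 * n) = 1 := fun n => by rw [pow_mul]; simp
  rw [mul_pow, pow_succ _ (2 * (n + 1)), pow_succ _ (2 * n), e, e]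
  ring

theorem annEval_neg_one_odTheta : annEval (-1 : ℂ) (-1) odTheta = odPlus ^ 2 := by
  have h : ∀ m, (X : PowerSeries ℂ) ^ m ∣ (1 + X ^ (2 * m - 1)) - 1 := fun m => by
    rcases m with _ | m
    · simp
    · exact X_pow_dvd_one_add _ _ (by omega)
  rw [odTheta, annEval_infProd, odPlus, ← infProd_pow h]
  refine infProd_congr fun m hm => ?_
  obtain ⟨n, rfl⟩ : ∃ n, m = n + 1 := ⟨m - 1, by omega⟩
  simp only [odFactor, map_mul, map_sub, map_one, map_pow, annEval_alP, annEval_X, map_neg,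
    show 2 * (n + 1) - 1 = 2 * n + 1 by omega, show 2 * (n + 1) - 2 = 2 * n by omega]
  have e : ∀ n, (-1 : PowerSeries ℂ) ^ (2 * n) = 1 := fun n => by rw [pow_mul]; simp
  rw [mul_pow, pow_succ _ (2 * n), e, e]
  ring

/-- By Euler's identity `1 / odMinus = evPlus * odPlus`; this is where the normalization
`thetaConst` is made to match `wS_mul_swap`. -/
theorem annEval_one_wPoly : annEval (1 : ℂ) 1 wPoly = thetaConst ^ 2 * X := by
  have h := congrArg (annEval (1 : ℂ) 1) odTheta_mul_inv
  rw [map_mul, map_one, annEval_one_odTheta] at h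
  have h2 := euler_product
  rw [wPoly]
  simp only [map_mul, map_pow, annEval_rhoP _ _ (one_mul (1 : ℂ)), map_algebraMap_self, annEval_X,
    annEval_one_evTheta, map_one, one_mul]
  have h3 : (evPlus * odPlus) ^ 2 = annEval 1 1 odThetaInv := by
    have h4 : (evPlus * odPlus) ^ 2 * odMinus ^ 2 = 1 := by
      rw [← mul_pow, h2, one_pow]
    linear_combination (-(evPlus * odPlus) ^ 2) * h + annEval 1 1 odThetaInv * h4
  rw [← h3, thetaConst]
  ring

/-- The two logarithmic derivatives are opposite, so the product is killed by `z d/dz` and is a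
series in `Q`. The double pole of `twoW` cancels the double zero of `wS`, which allows its value to
be read off at `z = 1`. -/
theorem twoW_mul_wS : twoW * wS = rhoS (2 * (thetaConst ^ 2 * X)) := by
  have e : twoW * wS = annIncl (twoWNum * wPoly) := by
    rw [map_mul, annIncl_twoWNum, wS, map_mul, map_pow, map_sub, map_one, annIncl_alP]
    ring
  have h1 : derP (twoWNum * wPoly) = 0 := by
    apply annIncl_injective
    rw [annIncl_derP, ← e, map_zero, Derivation.leibniz, derS_twoW, derS_wS, smul_eq_mul,
      smul_eq_mul]
    ring
  have h2 := eq_rhoP_of_derP_eq_zero h1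
  -- At `α = 1` only the polar parts survive: one from `p` and one from `v'`.
  have h3 : annEval (1 : ℂ) 1 twoWNum = 2 := by
    rw [twoWNum, dvPoly]
    simp only [map_mul, map_add, map_sub, map_pow, map_one, annEval_alP]
    norm_num
  rw [e, h2, annIncl_rhoP, map_mul, h3, annEval_one_wPoly]

theorem twoW_eq : twoW = 2 * swapSeries wS := by
  refine mul_right_cancel₀ wS_ne_zero ?_
  have h := wS_mul_swap
  rw [twoW_mul_wS, map_mul, ← h, map_ofNat]
  ring

theorem swapSeries_twoW_eq : swapSeries twoW = 2 * wS := by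
  rw [twoW_eq, map_mul, swapSeries_swapSeries, map_ofNat]

/-- The first integral: `(p + D + v')(p + D - v')` is the product of `twoW` with its swap, which
equals `4 wS * swapSeries wS`, and `p + D = v² + D - S`. -/
theorem four_mul_derS_vS_sq : derS vS ^ 2 =
    (vS ^ 2 + rhoS (devSeries - sqSeries)) ^ 2 - 4 * rhoS (thetaConst ^ 2 * X) := by
  have h1 := swapSeries_twoW
  have h2 : twoW = pS + rhoS devSeries + derS vS := rfl
  have h3 := vS_mul_vS
  have h4 : twoW * swapSeries twoW = 4 * rhoS (thetaConst ^ 2 * X) := by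
    rw [twoW_eq, ← wS_mul_swap, map_mul, swapSeries_swapSeries, map_ofNat]
    ring
  rw [h1, h2] at h4
  have h5 : vS ^ 2 + rhoS (devSeries - sqSeries) = pS + rhoS devSeries := by
    rw [map_sub]
    linear_combination h3
  rw [h5]
  linear_combination -h4

/-- The theta function `θ₁⁴ / 16` over `ℂ`. -/
theorem map_theta₁Fourth :
    map (Int.castRingHom ℂ) theta₁Fourth = X * (evMinus * evPlus ^ 2) ^ 4 := by
  have h1 : ∀ m, (X : PowerSeries ℂ) ^ m ∣ (1 - X ^ (2 * m)) - 1 := fun m =>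
    X_pow_dvd_one_sub m (2 * m) (by omega)
  have h2 : ∀ m, (X : PowerSeries ℂ) ^ m ∣ (1 + X ^ (2 * m)) ^ 2 - 1 := fun m => by
    have := sub_dvd_pow_sub_pow (1 + (X : PowerSeries ℂ) ^ (2 * m)) 1 2
    rw [one_pow] at this
    exact (X_pow_dvd_one_add m (2 * m) (by omega)).trans this
  have h3 : ∀ m, (X : PowerSeries ℂ) ^ m ∣ (1 - X ^ (2 * m)) * (1 + X ^ (2 * m)) ^ 2 - 1 :=
    fun m => by
      have e : (1 - (X : PowerSeries ℂ) ^ (2 * m)) * (1 + X ^ (2 * m)) ^ 2 - 1 =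
        ((1 - (X : PowerSeries ℂ) ^ (2 * m)) - 1) * (1 + X ^ (2 * m)) ^ 2 +
        ((1 + X ^ (2 * m)) ^ 2 - 1) := by ring
      rw [e]
      exact dvd_add ((h1 m).mul_right _) (h2 m)
  rw [theta₁Fourth, map_mul, map_X, map_infProd, evMinus, evPlus,
    ← infProd_pow (fun m => X_pow_dvd_one_add m (2 * m) (by omega)), ← infProd_mul h1 h2,
    ← infProd_pow h3]
  congr 1
  refine infProd_congr fun m _ => ?_
  simp

theorem map_theta₃Fourth :
    map (Int.castRingHom ℂ) theta₃Fourth = (evMinus * odPlus ^ 2) ^ 4 := by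
  have h1 : ∀ m, (X : PowerSeries ℂ) ^ m ∣ (1 - X ^ (2 * m)) - 1 := fun m =>
    X_pow_dvd_one_sub m (2 * m) (by omega)
  have h0 : ∀ m, (X : PowerSeries ℂ) ^ m ∣ (1 + X ^ (2 * m - 1)) - 1 := fun m => by
    rcases m with _ | m
    · simp
    · exact X_pow_dvd_one_add _ _ (by omega)
  have h2 : ∀ m, (X : PowerSeries ℂ) ^ m ∣ (1 + X ^ (2 * m - 1)) ^ 2 - 1 := fun m => by
    have := sub_dvd_pow_sub_pow (1 + (X : PowerSeries ℂ) ^ (2 * m - 1)) 1 2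
    rw [one_pow] at this
    exact (h0 m).trans this
  have h3 : ∀ m, (X : PowerSeries ℂ) ^ m ∣ (1 - X ^ (2 * m)) * (1 + X ^ (2 * m - 1)) ^ 2 - 1 :=
    fun m => by
      have e : (1 - (X : PowerSeries ℂ) ^ (2 * m)) * (1 + X ^ (2 * m - 1)) ^ 2 - 1 =
        ((1 - (X : PowerSeries ℂ) ^ (2 * m)) - 1) * (1 + X ^ (2 * m - 1)) ^ 2 +
        ((1 + X ^ (2 * m - 1)) ^ 2 - 1) := by ring
      rw [e]
      exact dvd_add ((h1 m).mul_right _) (h2 m)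
  rw [theta₃Fourth, map_infProd, evMinus, odPlus,
    ← infProd_pow h0, ← infProd_mul h1 h2, ← infProd_pow h3]
  refine infProd_congr fun m _ => ?_
  simp

theorem map_epsilon₂ : map (Int.castRingHom ℂ) epsilon₂ = thetaConst ^ 2 * X := by
  rw [epsilon₂, map_mul, map_theta₁Fourth, map_theta₃Fourth, thetaConst]
  ring

/-- Evaluation at the zero `z = -1` of `v`. The sum of `twoW` and its swap is `2 (v² + D - S)`, so
at this point it is `2 (D - S)`; the two summands there are multiples of `θ₃⁴` and `θ₁⁴`. -/
theorem map_eightDelta₂ :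
    map (Int.castRingHom ℂ) eightDelta₂ = 4 * (devSeries - sqSeries) := by
  have hc : (-1 : ℂ) * (-1) = 1 := by norm_num
  -- the value of `W'` at `z = -1`
  have h1 : annEval (-1 : ℂ) (-1) wPoly = -(X * (evMinus * evPlus ^ 2) ^ 4) := by
    have h := congrArg (annEval (-1 : ℂ) (-1)) odTheta_mul_inv
    rw [map_mul, map_one, annEval_neg_one_odTheta] at h
    rw [wPoly]
    simp only [map_mul, map_pow, annEval_rhoP _ _ hc, map_algebraMap_self, annEval_X,
      annEval_neg_one_evTheta, map_neg, map_one]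
    rw [thetaConst]
    linear_combination (-(X * (evMinus * evPlus ^ 2) ^ 4) *
      (1 + odPlus ^ 2 * annEval (-1 : ℂ) (-1) odThetaInv)) * h
  have h2 : annEval (-1 : ℂ) (-1) twoWNum = -(2 * (evMinus * odPlus ^ 2) ^ 4) := by
    have e : twoWNum * wPoly = rhoP (2 * (thetaConst ^ 2 * X)) := by
      apply annIncl_injective
      rw [annIncl_rhoP, ← twoW_mul_wS, map_mul, annIncl_twoWNum, wS, map_mul, map_pow, map_sub,
        map_one, annIncl_alP]
      ring
    have e2 := congrArg (annEval (-1 : ℂ) (-1)) e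
    rw [map_mul, h1, annEval_rhoP _ _ hc, map_algebraMap_self, thetaConst] at e2
    have e3 : X * (evMinus * evPlus ^ 2) ^ 4 ≠ 0 := by
      refine mul_ne_zero X_ne_zero (pow_ne_zero _ (mul_ne_zero evMinus_ne_zero
        (pow_ne_zero _ fun h0 => ?_)))
      have := euler_product
      rw [h0, zero_mul, zero_mul] at this
      exact zero_ne_one this
    refine mul_right_cancel₀ e3 ?_
    linear_combination -e2
  -- Since `α² = 1` at this point, the two halves of each term of `vPoly` cancel, and `2 * (1 / 2) -
  -- 1 = 0`.
  have h3 : annEval (-1 : ℂ) (-1) vNum = 0 := by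
    have e : annEval (-1 : ℂ) (-1) vPoly = 0 := by
      rw [vPoly, annEval_infSum]
      have : ∀ m, annEval (-1 : ℂ) (-1) ((X ^ (m + 1) - (alP * (alP * X)) ^ (m + 1)) *
          rhoP (invAdd (m + 1))) = 0 := by
        intro m
        simp
      simp only [this]
      ext n
      simp [infSum]
    have h0 := invAdd_mul 0
    rw [vNum]
    simp only [map_mul, map_add, map_sub, map_one, annEval_alP, annEval_rhoP _ _ hc,
      map_algebraMap_self, e, map_neg]
    linear_combination h0
  -- The swap of `twoW` is `2 wS`, and `wS` already contains `(1 - α)²`; clearing the double pole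
  -- supplies the other two factors.
  have h4 : twoWNum + 2 * ((1 - alP) ^ 4 * wPoly) =
      2 * (vNum ^ 2 + (1 - alP) ^ 2 * rhoP (devSeries - sqSeries)) := by
    apply annIncl_injective
    have h5 := swapSeries_twoW
    have h6 : twoW = pS + rhoS devSeries + derS vS := rfl
    have h7 := vS_mul_vS
    have h8 := swapSeries_twoW_eq
    rw [h5, wS] at h8
    simp only [map_mul, map_add, map_pow, map_ofNat, annIncl_twoWNum, annIncl_vNum, annIncl_rhoP,
      map_sub, map_one, annIncl_alP] at h8 ⊢
    linear_combination (-(1 - alS) ^ 2) * h8 + (1 - alS) ^ 2 * h6 - 2 * (1 - alS) ^ 2 * h7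
  have h5 := congrArg (annEval (-1 : ℂ) (-1)) h4
  simp only [map_mul, map_add, map_pow, map_ofNat, h1, h2, h3, map_sub, map_one,
    annEval_alP, annEval_rhoP _ _ hc, map_neg, map_algebraMap_self] at h5
  rw [eightDelta₂, map_neg, map_add, map_mul, map_theta₁Fourth, map_theta₃Fourth, map_ofNat]
  have h6 : (2 : PowerSeries ℂ) ≠ 0 := by
    intro h
    have h7 : constantCoeff (2 : PowerSeries ℂ) = 2 := map_ofNat _ 2
    rw [h, map_zero] at h7
    norm_num at h7
  refine mul_left_cancel₀ h6 ?_
  linear_combination h5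

theorem dvPoly_sq : dvPoly ^ 2 =
    (vNum ^ 2 + (1 - alP) ^ 2 * rhoP (devSeries - sqSeries)) ^ 2 -
      4 * (1 - alP) ^ 4 * rhoP (thetaConst ^ 2 * X) := by
  apply annIncl_injective
  have h := four_mul_derS_vS_sq
  simp only [map_mul, map_add, map_pow, map_ofNat, annIncl_dvPoly, annIncl_vNum, annIncl_rhoP,
    map_sub, map_one, annIncl_alP] at h ⊢
  linear_combination (1 - alS) ^ 4 * h

end ThetaConstants
end
end TwistedCancellation

namespace TwistedCancellation
noncomputable section

/-! ### The Euler derivation -/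

section Euler

open PowerSeries

/-- The Euler derivation `X d/dX`. -/
def eulerD (R : Type*) [CommRing R] : Derivation R (PowerSeries R) (PowerSeries R) :=
  (X : PowerSeries R) • PowerSeries.derivative R

@[simp] theorem coeff_eulerD {R : Type*} [CommRing R] (f : PowerSeries R) (m : ℕ) :
    coeff m (eulerD R f) = m * coeff m f := by
  rw [eulerD, Derivation.smul_apply, smul_eq_mul]
  rcases m with _ | m
  · simp
  · rw [coeff_succ_X_mul, PowerSeries.coeff_derivative]
    push_cast
    ring

@[simp] theorem eulerD_X {R : Type*} [CommRing R] : eulerD R X = X := by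
  simp [eulerD, PowerSeries.derivative_X]

@[simp] theorem eulerD_C {R : Type*} [CommRing R] (a : R) : eulerD R (C a) = 0 := by
  simp [eulerD, PowerSeries.derivative_C]

@[simp] theorem eulerD_ofNat {R : Type*} [CommRing R] (n : ℕ) [n.AtLeastTwo] :
    eulerD R (OfNat.ofNat n) = 0 := Derivation.map_natCast _ n

theorem eulerD_mul {R : Type*} [CommRing R] (f g : PowerSeries R) :
    eulerD R (f * g) = f * eulerD R g + g * eulerD R f := Derivation.leibniz _ f g

theorem eulerD_one {R : Type*} [CommRing R] : eulerD R 1 = 0 := Derivation.map_one_eq_zero _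

theorem map_eulerD {R S : Type*} [CommRing R] [CommRing S] (h : R →+* S) (f : PowerSeries R) :
    map h (eulerD R f) = eulerD S (map h f) := by
  ext m
  simp

theorem rescale_eulerD {R : Type*} [CommRing R] (a : R) (f : PowerSeries R) :
    rescale a (eulerD R f) = eulerD R (rescale a f) := by
  ext m
  simp only [coeff_rescale, coeff_eulerD]
  ring

end Euler

/-! ### Weighted homogeneity from the Jacobi elliptic equation -/

section WeightedSpan

open PowerSeries

variable {F K : Type*} [CommRing F] [CommRing K] [Algebra F K] (δ ε : K)

/-- The span of the monomials in `δ` and `ε` of weight `j`, where `δ` has weight `2` and `ε` has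
weight `4`. -/
def weightSpan (F : Type*) {K : Type*} [CommRing F] [CommRing K] [Algebra F K] (δ ε : K)
    (j : ℕ) : Submodule F K :=
  Submodule.span F {z | ∃ a r : ℕ, 2 * a + 4 * r = j ∧ z = δ ^ a * ε ^ r}

variable {δ ε}

theorem mul_mem_weightSpan {i j : ℕ} {x y : K} (hx : x ∈ weightSpan F δ ε i)
    (hy : y ∈ weightSpan F δ ε j) : x * y ∈ weightSpan F δ ε (i + j) := by
  have h := Submodule.mul_mem_mul hx hy
  rw [weightSpan, weightSpan, Submodule.span_mul_span] at h
  refine Submodule.span_mono ?_ h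
  rintro _ ⟨_, ⟨a, r, h1, rfl⟩, _, ⟨b, s, h2, rfl⟩, rfl⟩
  refine ⟨a + b, r + s, by omega, ?_⟩
  simp only
  ring

theorem one_mem_weightSpan : (1 : K) ∈ weightSpan F δ ε 0 :=
  Submodule.subset_span ⟨0, 0, rfl, by simp⟩

theorem δ_mem_weightSpan : δ ∈ weightSpan F δ ε 2 :=
  Submodule.subset_span ⟨1, 0, rfl, by simp⟩

theorem ε_mem_weightSpan : ε ∈ weightSpan F δ ε 4 :=
  Submodule.subset_span ⟨0, 1, rfl, by simp⟩

theorem mem_weightSpan_of_natCast_mul [Algebra ℂ F] {j m : ℕ} (hm : m ≠ 0) {x : K}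
    (h : (m : K) * x ∈ weightSpan F δ ε j) : x ∈ weightSpan F δ ε j := by
  have h1 : algebraMap ℂ F ((m : ℂ)⁻¹) * (m : F) = 1 := by
    rw [← map_natCast (algebraMap ℂ F) m, ← map_mul,
      inv_mul_cancel₀ (Nat.cast_ne_zero.2 hm), map_one]
  have h2 : x = algebraMap ℂ F ((m : ℂ)⁻¹) • ((m : K) * x) := by
    rw [← map_natCast (algebraMap F K) m, ← Algebra.smul_def, smul_smul, h1, one_smul]
  rw [h2]
  exact Submodule.smul_mem _ _ h

theorem natCast_mul_mem_weightSpan {j : ℕ} (m : ℕ) {x : K} (h : x ∈ weightSpan F δ ε j) :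
    (m : K) * x ∈ weightSpan F δ ε j := by
  rw [← nsmul_eq_mul]
  exact Submodule.smul_of_tower_mem _ m h

/-- Without constant terms, the coefficient of order `j` of a product involves only coefficients of
order below `j`. This is what lets the recursion close. -/
theorem coeff_mul_mem_weightSpan {f g : PowerSeries K} (hf : coeff 0 f = 0) (hg : coeff 0 g = 0)
    {j : ℕ} (hf' : ∀ i < j, coeff i f ∈ weightSpan F δ ε i)
    (hg' : ∀ i < j, coeff i g ∈ weightSpan F δ ε i) :
    coeff j (f * g) ∈ weightSpan F δ ε j := by
  rw [coeff_mul]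
  refine Submodule.sum_mem _ fun p hp => ?_
  have hp' := Finset.HasAntidiagonal.mem_antidiagonal.1 hp
  obtain ⟨a, b⟩ := p
  simp only at hp' ⊢
  rcases Nat.eq_zero_or_pos a with rfl | ha
  · rw [hf, zero_mul]
    exact Submodule.zero_mem _
  rcases Nat.eq_zero_or_pos b with rfl | hb
  · rw [hg, mul_zero]
    exact Submodule.zero_mem _
  rw [← hp']
  exact mul_mem_weightSpan (hf' a (by omega)) (hg' b (by omega))

/-- The coefficients of a solution of the differential equation of a Jacobi elliptic logarithmic
derivative are weighted homogeneous polynomials in the parameters. -/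
theorem coeff_mem_weightSpan [Algebra ℂ F] {V : PowerSeries K} (h0 : coeff 0 V = -1)
    (h : (eulerD K V - V) ^ 2 = (V ^ 2 + 2 * C δ * X ^ 2) ^ 2 - 4 * C ε * X ^ 4) (j : ℕ) :
    coeff j V ∈ weightSpan F δ ε j := by
  -- For `V = x v` one has `x V' - V = x² v'`, so the hypothesis is `v'² = (v² + 2 δ)² - 4 ε` with
  -- `v` having the polar part `-1 / x`.
  obtain ⟨Y, rfl⟩ : ∃ Y, V = -1 + Y := ⟨V + 1, by ring⟩
  have hY0 : coeff 0 Y = 0 := by simpa using h0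
  set u := eulerD K Y - Y with hu
  set S := Y * Y + 2 * C δ * X ^ 2 with hS
  have hu0 : coeff 0 u = 0 := by
    rw [hu, map_sub, coeff_eulerD, hY0]; simp
  have hS0 : coeff 0 S = 0 := by
    have : constantCoeff Y = 0 := by simpa using hY0
    simp [hS, this]
  -- The linear part in `Y` multiplies the coefficient of order `j` by `2 (j + 1)`, which never
  -- vanishes; the right side involves only lower coefficients of `Y` and the parameters in their
  -- own weights.
  have key : 2 * eulerD K Y + 2 * Y = 4 * (Y * Y) + S * S + 2 * S - 4 * (Y * S) - u * u -
      4 * C ε * X ^ 4 := by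
    have e : eulerD K (-1 + Y) = eulerD K Y := by simp
    rw [e] at h
    rw [hu, hS]
    linear_combination h
  have main : ∀ j, coeff j Y ∈ weightSpan F δ ε j := by
    intro j
    induction j using Nat.strong_induction_on with
    | _ j ih =>
    have hYY : ∀ i ≤ j, coeff i (Y * Y) ∈ weightSpan F δ ε i := fun i hi =>
      coeff_mul_mem_weightSpan hY0 hY0 (fun i' h' => ih i' (by omega))
        (fun i' h' => ih i' (by omega))
    have hX : ∀ (c : K) (m i : ℕ), c ∈ weightSpan F δ ε m →
        coeff i (C c * X ^ m) ∈ weightSpan F δ ε i := by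
      intro c m i hc
      rw [coeff_C_mul, coeff_X_pow]
      split_ifs with h1
      · rw [mul_one, h1]; exact hc
      · rw [mul_zero]; exact Submodule.zero_mem _
    have hSm : ∀ i ≤ j, coeff i S ∈ weightSpan F δ ε i := by
      intro i hi
      rw [hS, show (2 : PowerSeries K) * C δ * X ^ 2 = C ((2 : ℕ) * δ) * X ^ 2 by
        rw [map_mul, map_natCast]; norm_num, map_add]
      exact Submodule.add_mem _ (hYY i hi)
        (hX _ _ _ (natCast_mul_mem_weightSpan 2 δ_mem_weightSpan))
    have hum : ∀ i < j, coeff i u ∈ weightSpan F δ ε i := by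
      intro i hi
      rw [hu, map_sub, coeff_eulerD]
      exact Submodule.sub_mem _ (natCast_mul_mem_weightSpan i (ih i hi)) (ih i hi)
    have hnat : ∀ (c i : ℕ) (f : PowerSeries K), coeff i f ∈ weightSpan F δ ε i →
        coeff i ((c : PowerSeries K) * f) ∈ weightSpan F δ ε i := by
      intro c i f hf
      rw [← nsmul_eq_mul, map_nsmul]
      exact Submodule.smul_of_tower_mem _ c hf
    have h1 := congrArg (coeff j) key
    have h2 : coeff j (2 * eulerD K Y + 2 * Y) = ((2 * (j + 1) : ℕ) : K) * coeff j Y := by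
      rw [← mul_add, ← Nat.cast_ofNat (R := PowerSeries K) (n := 2), ← nsmul_eq_mul, map_nsmul,
        map_add, coeff_eulerD, nsmul_eq_mul]
      push_cast
      ring
    refine mem_weightSpan_of_natCast_mul (m := 2 * (j + 1)) (by omega) ?_
    rw [← h2, h1, map_sub, map_sub, map_sub, map_add, map_add]
    refine Submodule.sub_mem _ (Submodule.sub_mem _ (Submodule.sub_mem _ (Submodule.add_mem _
      (Submodule.add_mem _ (hnat 4 j _ (hYY j le_rfl)) ?_) (hnat 2 j _ (hSm j le_rfl)))
      (hnat 4 j _ ?_)) ?_) ?_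
    · exact coeff_mul_mem_weightSpan hS0 hS0 (fun i hi => hSm i hi.le) (fun i hi => hSm i hi.le)
    · exact coeff_mul_mem_weightSpan hY0 hS0 ih (fun i hi => hSm i hi.le)
    · exact coeff_mul_mem_weightSpan hu0 hu0 hum hum
    · rw [mul_assoc]
      exact hnat 4 j _ (hX _ _ _ ε_mem_weightSpan)
  rw [map_add]
  refine Submodule.add_mem _ ?_ (main j)
  rw [map_neg, coeff_one]
  refine Submodule.neg_mem _ ?_
  split_ifs with hj
  · rw [hj]; exact one_mem_weightSpan
  · exact Submodule.zero_mem _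

/-- A multiplicative sequence in the power sums `p` whose logarithmic derivative has weighted
homogeneous coefficients is itself weighted homogeneous. -/
theorem mem_weightSpan_of_log_deriv [Algebra ℂ F] {P ψ : ℕ → K} {p : ℕ → F} (hP0 : P 0 = 1)
    (hP : ∀ m : ℕ, (m : K) * P m = ∑ i ∈ Finset.range m, P i * (ψ (m - i) * algebraMap F K (p (m - i))))
    (hψ : ∀ j, p (j + 1) ≠ 0 → ψ (j + 1) ∈ weightSpan F δ ε (j + 1)) (m : ℕ) :
    P m ∈ weightSpan F δ ε m := by
  induction m using Nat.strong_induction_on with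
  | _ m ih =>
  rcases Nat.eq_zero_or_pos m with rfl | hm
  · rw [hP0]; exact one_mem_weightSpan
  refine mem_weightSpan_of_natCast_mul hm.ne' ?_
  rw [hP]
  refine Submodule.sum_mem _ fun i hi => ?_
  have hi' := Finset.mem_range.1 hi
  obtain ⟨j, hj⟩ : ∃ j, m - i = j + 1 := ⟨m - i - 1, by omega⟩
  rw [hj]
  -- Where the power sum vanishes nothing is required of `ψ`; this disposes of the odd part of the
  -- logarithmic derivative.
  by_cases hp : p (j + 1) = 0
  · rw [hp, map_zero, mul_zero, mul_zero]; exact Submodule.zero_mem _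
  have e : P i * (ψ (j + 1) * algebraMap F K (p (j + 1))) =
      p (j + 1) • (P i * ψ (j + 1)) := by
    rw [Algebra.smul_def]; ring
  rw [e]
  refine Submodule.smul_mem _ _ ?_
  have := mul_mem_weightSpan (ih i hi') (hψ j hp)
  rwa [show i + (j + 1) = m by omega] at this

/-- The weight equation `2 a + 4 r = 4 k + 2` forces `r ≤ k` and `a = 2 k + 1 - 2 r`. -/
theorem exists_of_mem_weightSpan {k : ℕ} {x : K} (hx : x ∈ weightSpan F δ ε (4 * k + 2)) :
    ∃ s : Fin (k + 1) → F, x = ∑ r : Fin (k + 1), s r • (δ ^ (2 * k + 1 - 2 * (r : ℕ)) *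
      ε ^ (r : ℕ)) := by
  have h : x ∈ Submodule.span F (Set.range fun r : Fin (k + 1) =>
      δ ^ (2 * k + 1 - 2 * (r : ℕ)) * ε ^ (r : ℕ)) := by
    refine Submodule.span_mono ?_ hx
    rintro _ ⟨a, r, h1, rfl⟩
    refine ⟨⟨r, by omega⟩, ?_⟩
    simp only
    congr 2
    omega
  obtain ⟨s, hs⟩ := (Submodule.mem_span_range_iff_exists_fun F).1 h
  exact ⟨s, hs.symm⟩

end WeightedSpan
end
end TwistedCancellation

namespace TwistedCancellation
noncomputable section

/-! ### Hyperbolic power series and their logarithmic derivatives -/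

section HyperbolicSeries

open PowerSeries

/-- The series of `exp (x / 2)`. -/
def expHalf : PowerSeries ℂ := rescale (1 / 2) (exp ℂ)

/-- The series of `exp (-x / 2)`. -/
def expNegHalf : PowerSeries ℂ := rescale (-(1 / 2)) (exp ℂ)

/-- The series of `sinh (x / 2) / (x / 2)`. -/
def sinhcHalf : PowerSeries ℂ := rescale (1 / 2) sinhcSeries

/-- The series of `cosh (x / 2)`. -/
def coshHalf : PowerSeries ℂ := rescale (1 / 2) coshSeries

/-- The series of `(x / 2) / sinh (x / 2)`. -/
def sinhcHalfInv : PowerSeries ℂ := rescale (1 / 2) sinhcSeries⁻¹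

/-- The series of `(x / 2) / tanh (x / 2)`. -/
def cothHalf : PowerSeries ℂ := coshHalf * sinhcHalfInv

theorem coeff_exp_complex (m : ℕ) : coeff m (exp ℂ) = (m ! : ℂ)⁻¹ := by
  rw [coeff_exp]
  simp

theorem expHalf_sq : expHalf ^ 2 = exp ℂ := by
  rw [expHalf, ← map_pow, exp_pow_eq_rescale_exp, rescale_rescale]
  norm_num

theorem expHalf_mul_expNegHalf : expHalf * expNegHalf = 1 := by
  have h := congrArg (rescale (1 / 2 : ℂ)) (exp_mul_exp_neg_eq_one (A := ℂ))
  rw [map_mul, map_one, evalNegHom, rescale_rescale] at h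
  rw [expHalf, expNegHalf, ← h]
  norm_num

theorem constantCoeff_sinhcSeries : constantCoeff sinhcSeries = 1 := by
  rw [← coeff_zero_eq_constantCoeff_apply, sinhcSeries, coeff_mk]
  simp

theorem X_mul_sinhcHalf : X * sinhcHalf = expHalf - expNegHalf := by
  ext m
  rw [map_sub, expHalf, expNegHalf, coeff_rescale, coeff_rescale, coeff_exp_complex]
  rcases m with _ | m
  · simp
  · rw [coeff_succ_X_mul, sinhcHalf, coeff_rescale, sinhcSeries, coeff_mk, neg_pow]
    split_ifs with h
    · rw [(Even.add_one h).neg_one_pow, pow_succ]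
      ring
    · rw [(Odd.add_one (Nat.not_even_iff_odd.1 h)).neg_one_pow]
      ring

theorem two_mul_coshHalf : 2 * coshHalf = expHalf + expNegHalf := by
  ext m
  rw [map_add, expHalf, expNegHalf, coeff_rescale, coeff_rescale, coeff_exp_complex, two_mul,
    map_add, coshHalf, coeff_rescale, coshSeries, coeff_mk, neg_pow]
  split_ifs with h
  · rw [h.neg_one_pow]
    ring
  · rw [(Nat.not_even_iff_odd.1 h).neg_one_pow]
    ring

theorem sinhcHalf_mul_inv : sinhcHalf * sinhcHalfInv = 1 := by
  rw [sinhcHalf, sinhcHalfInv, ← map_mul, PowerSeries.mul_inv_cancel, map_one]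
  rw [constantCoeff_sinhcSeries]
  exact one_ne_zero

theorem eulerD_expHalf : 2 * eulerD ℂ expHalf = X * expHalf := by
  ext m
  rw [two_mul, map_add, coeff_eulerD, expHalf, coeff_rescale, coeff_exp_complex]
  rcases m with _ | m
  · simp
  · rw [coeff_succ_X_mul, coeff_rescale, coeff_exp_complex, Nat.factorial_succ, pow_succ]
    have h1 : ((m + 1 : ℕ) : ℂ) ≠ 0 := Nat.cast_ne_zero.2 (by omega)
    push_cast at h1 ⊢
    rw [mul_inv]
    field_simp
    ring

theorem eulerD_expNegHalf : 2 * eulerD ℂ expNegHalf = -(X * expNegHalf) := by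
  have h := congrArg (rescale (-1 : ℂ)) eulerD_expHalf
  rw [map_mul, map_mul, rescale_eulerD, expHalf, rescale_rescale, rescale_X, map_ofNat] at h
  rw [expNegHalf]
  convert h using 1
  · norm_num
  · simp

theorem eulerD_exp : eulerD ℂ (exp ℂ) = X * exp ℂ := by
  have h := congrArg (eulerD ℂ) expHalf_sq
  rw [Derivation.leibniz_pow] at h
  rw [← h, ← expHalf_sq]
  simp only [smul_eq_mul, nsmul_eq_mul]
  push_cast
  linear_combination expHalf * eulerD_expHalf

theorem powerSeries_two_ne_zero {R : Type*} [CommRing R] [CharZero R] :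
    (2 : PowerSeries R) ≠ 0 := by
  intro h
  have h7 : constantCoeff (2 : PowerSeries R) = 2 := map_ofNat _ 2
  rw [h, map_zero] at h7
  exact two_ne_zero h7.symm

theorem eulerD_sinhcHalf : eulerD ℂ sinhcHalf = coshHalf - sinhcHalf := by
  have h := congrArg (eulerD ℂ) X_mul_sinhcHalf
  rw [Derivation.leibniz, eulerD_X, map_sub, smul_eq_mul, smul_eq_mul] at h
  refine mul_left_cancel₀ (mul_ne_zero (powerSeries_two_ne_zero (R := ℂ)) (X_ne_zero (R := ℂ))) ?_
  linear_combination 2 * h + eulerD_expHalf - eulerD_expNegHalf - X * two_mul_coshHalf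

theorem four_mul_eulerD_coshHalf : 4 * eulerD ℂ coshHalf = X ^ 2 * sinhcHalf := by
  have h := congrArg (eulerD ℂ) two_mul_coshHalf
  rw [two_mul, map_add, map_add] at h
  linear_combination 2 * h + eulerD_expHalf + eulerD_expNegHalf - X * X_mul_sinhcHalf

theorem four_mul_coshHalf_sq : 4 * coshHalf ^ 2 = 4 + X ^ 2 * sinhcHalf ^ 2 := by
  linear_combination (2 * coshHalf + expHalf + expNegHalf) * two_mul_coshHalf -
    (X * sinhcHalf + expHalf - expNegHalf) * X_mul_sinhcHalf + 4 * expHalf_mul_expNegHalf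

/-- The logarithmic derivative of `(x / 2) / sinh (x / 2)`. -/
theorem eulerD_sinhcHalfInv : eulerD ℂ sinhcHalfInv = (1 - cothHalf) * sinhcHalfInv := by
  have h := congrArg (eulerD ℂ) sinhcHalf_mul_inv
  rw [Derivation.leibniz, Derivation.map_one_eq_zero, smul_eq_mul, smul_eq_mul,
    eulerD_sinhcHalf] at h
  rw [cothHalf]
  linear_combination sinhcHalfInv * h -
    (eulerD ℂ sinhcHalfInv - sinhcHalfInv) * sinhcHalf_mul_inv

/-- The series of `x / sinh x`. -/
def xCsch : PowerSeries ℂ := sinhcSeries⁻¹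

theorem sinhcSeries_mul_xCsch : sinhcSeries * xCsch = 1 := by
  rw [xCsch, PowerSeries.mul_inv_cancel]
  rw [constantCoeff_sinhcSeries]
  exact one_ne_zero

theorem rescale_two_half (f : PowerSeries ℂ) : rescale (2 : ℂ) (rescale (1 / 2) f) = f := by
  rw [rescale_rescale]
  norm_num

theorem two_mul_X_mul_sinhcSeries :
    2 * (X * sinhcSeries) = exp ℂ - rescale (-1) (exp ℂ) := by
  have h := congrArg (rescale (2 : ℂ)) X_mul_sinhcHalf
  rw [map_mul, map_sub, sinhcHalf, rescale_two_half, expHalf, rescale_two_half, expNegHalf,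
    rescale_rescale, rescale_X] at h
  rw [show C (2 : ℂ) = 2 from map_ofNat _ 2, show (-(1 / 2) * 2 : ℂ) = -1 by norm_num] at h
  rw [← h]
  ring

theorem sinhcSeries_eq : sinhcSeries = coshHalf * sinhcHalf := by
  have h1 : rescale (-1 : ℂ) (exp ℂ) = expNegHalf ^ 2 := by
    rw [← expHalf_sq, map_pow, expHalf, expNegHalf, rescale_rescale]
    norm_num
  have h2 := two_mul_X_mul_sinhcSeries
  rw [h1, ← expHalf_sq] at h2
  refine mul_left_cancel₀ (mul_ne_zero (powerSeries_two_ne_zero (R := ℂ)) (X_ne_zero (R := ℂ))) ?_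
  linear_combination h2 - 2 * coshHalf * X_mul_sinhcHalf -
    (expHalf - expNegHalf) * two_mul_coshHalf

/-- The logarithmic derivative of `(x / 2) / tanh (x / 2)`. -/
theorem eulerD_cothHalf : eulerD ℂ cothHalf = (1 - xCsch) * cothHalf := by
  have h1 := four_mul_eulerD_coshHalf
  have h2 := four_mul_coshHalf_sq
  have h3 := sinhcHalf_mul_inv
  have h4 : coshHalf * xCsch = sinhcHalfInv := by
    have := sinhcSeries_mul_xCsch
    rw [sinhcSeries_eq] at this
    linear_combination sinhcHalfInv * this - coshHalf * xCsch * h3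
  rw [cothHalf, Derivation.leibniz, eulerD_sinhcHalfInv, smul_eq_mul, smul_eq_mul, cothHalf]
  refine mul_left_cancel₀ (mul_ne_zero (powerSeries_two_ne_zero (R := ℂ))
    (powerSeries_two_ne_zero (R := ℂ))) ?_
  linear_combination sinhcHalfInv * h1 - sinhcHalfInv ^ 2 * h2 + 4 * sinhcHalfInv * h4 -
    X ^ 2 * (sinhcHalf * sinhcHalfInv) * h3

theorem rescale_neg_one_of_even {f : PowerSeries ℂ} (h : ∀ m, Odd m → coeff m f = 0) :
    rescale (-1 : ℂ) f = f := by
  ext m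
  rw [coeff_rescale]
  rcases Nat.even_or_odd m with hm | hm
  · rw [hm.neg_one_pow, one_mul]
  · rw [h m hm, mul_zero]

theorem rescale_neg_one_sinhcSeries : rescale (-1 : ℂ) sinhcSeries = sinhcSeries :=
  rescale_neg_one_of_even fun m hm => by
    rw [sinhcSeries, coeff_mk, if_neg (Nat.not_even_iff_odd.2 hm)]

theorem rescale_neg_one_coshSeries : rescale (-1 : ℂ) coshSeries = coshSeries :=
  rescale_neg_one_of_even fun m hm => by
    rw [coshSeries, coeff_mk, if_neg (Nat.not_even_iff_odd.2 hm)]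

theorem rescale_neg_one_xCsch : rescale (-1 : ℂ) xCsch = xCsch := by
  have h := congrArg (rescale (-1 : ℂ)) sinhcSeries_mul_xCsch
  rw [map_mul, map_one, rescale_neg_one_sinhcSeries] at h
  linear_combination xCsch * h - rescale (-1 : ℂ) xCsch * sinhcSeries_mul_xCsch

theorem rescale_neg_one_cothHalf : rescale (-1 : ℂ) cothHalf = cothHalf := by
  have e : ∀ f : PowerSeries ℂ, rescale (-1 : ℂ) (rescale (1 / 2 : ℂ) f) =
      rescale (1 / 2 : ℂ) (rescale (-1 : ℂ) f) := fun f => by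
    rw [rescale_rescale, rescale_rescale]
    norm_num
  have h := rescale_neg_one_xCsch
  rw [xCsch] at h
  rw [cothHalf, map_mul, coshHalf, sinhcHalfInv, e, e, rescale_neg_one_coshSeries, h]

theorem eulerD_sinhcSeries : eulerD ℂ sinhcSeries = coshSeries - sinhcSeries := by
  have h := congrArg (rescale (2 : ℂ)) eulerD_sinhcHalf
  rwa [rescale_eulerD, map_sub, sinhcHalf, rescale_two_half, coshHalf, rescale_two_half] at h

theorem coshSeries_sq : coshSeries ^ 2 = 1 + X ^ 2 * sinhcSeries ^ 2 := by
  have h := congrArg (rescale (2 : ℂ)) four_mul_coshHalf_sq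
  simp only [map_mul, map_add, map_pow, sinhcHalf, rescale_two_half, coshHalf, rescale_X,
    map_ofNat] at h
  refine mul_left_cancel₀ (mul_ne_zero (powerSeries_two_ne_zero (R := ℂ))
    (powerSeries_two_ne_zero (R := ℂ))) ?_
  linear_combination h

end HyperbolicSeries

/-! ### The elliptic equation at the signature cusp, modulo `κ³` -/

section HyperbolicEquation

open PowerSeries

variable {K : Type*} [CommRing K] [Algebra ℂ K]

/-- Series with complex coefficients as series over a complex algebra. -/
def baseMap (K : Type*) [CommRing K] [Algebra ℂ K] : PowerSeries ℂ →+* PowerSeries K :=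
  map (algebraMap ℂ K)

@[simp] theorem baseMap_X : baseMap K X = X := map_X _

theorem eulerD_baseMap (f : PowerSeries ℂ) :
    eulerD K (baseMap K f) = baseMap K (eulerD ℂ f) := (map_eulerD _ _).symm

/-- The logarithmic derivative attached to `L̂`, deformed by the nilpotent parameter `κ`. -/
def hypV (κ : K) : PowerSeries K :=
  -baseMap K xCsch + 4 * C κ * X ^ 2 * baseMap K sinhcSeries

theorem coeff_zero_hypV (κ : K) : coeff 0 (hypV κ) = -1 := by
  have : constantCoeff xCsch = 1 := by
    rw [xCsch, constantCoeff_inv, constantCoeff_sinhcSeries, inv_one]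
  have h : constantCoeff (baseMap K xCsch) = 1 := by
    rw [baseMap, ← coeff_zero_eq_constantCoeff_apply, coeff_map, coeff_zero_eq_constantCoeff_apply,
      this, map_one]
  simp [hypV, h]

/-- At `κ = 0` the elliptic function degenerates to `-1 / sinh x`. The values of `δ` and `ε` are
those for which the second-order perturbation `4 κ x sinh x` still solves the equation. With `h = x
/ sinh x` and `c = cosh x`, the left side is the square of `c (h² + 4 κ x²)`, and `c² = 1 + sinh² x`
finishes the comparison. -/
theorem hypV_equation {κ : K} (hκ : κ ^ 3 = 0) :
    (eulerD K (hypV κ) - hypV κ) ^ 2 =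
      (hypV κ ^ 2 + 2 * C (algebraMap ℂ K (1 / 4) + 6 * κ) * X ^ 2) ^ 2 -
        4 * C (algebraMap ℂ K (1 / 16) - κ + 8 * κ ^ 2) * X ^ 4 := by
  have hκ' : (C κ) ^ 3 = 0 := by rw [← map_pow, hκ, map_zero]
  have h1 : eulerD K (baseMap K sinhcSeries) = baseMap K coshSeries - baseMap K sinhcSeries := by
    rw [eulerD_baseMap, eulerD_sinhcSeries, map_sub]
  have h2 := congrArg (baseMap K) coshSeries_sq
  have h3 := congrArg (baseMap K) sinhcSeries_mul_xCsch
  simp only [map_mul, map_add, map_pow, map_one, baseMap_X] at h2 h3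
  have h4 := congrArg (eulerD K) h3
  rw [Derivation.leibniz, Derivation.map_one_eq_zero, smul_eq_mul, smul_eq_mul, h1] at h4
  have h5 : 4 * C (algebraMap ℂ K (1 / 4)) = 1 := by
    rw [← map_ofNat (C (R := K)) 4, ← map_mul, ← map_ofNat (algebraMap ℂ K) 4, ← map_mul]
    norm_num
  have h6 : 16 * C (algebraMap ℂ K (1 / 16)) = 1 := by
    rw [← map_ofNat (C (R := K)) 16, ← map_mul, ← map_ofNat (algebraMap ℂ K) 16, ← map_mul]
    norm_num
  simp only [hypV, map_add, map_neg, map_sub, Derivation.leibniz, Derivation.leibniz_pow,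
    eulerD_C, eulerD_X, h1, smul_eq_mul, nsmul_eq_mul, map_mul, map_pow, map_ofNat]
  have e4 : eulerD K (4 : PowerSeries K) = 0 := Derivation.map_natCast _ 4
  rw [e4]
  generalize C (algebraMap ℂ K (1 / 4)) = w at *
  generalize C (algebraMap ℂ K (1 / 16)) = w' at *
  generalize baseMap K sinhcSeries = g at *
  generalize baseMap K coshSeries = c at *
  generalize hh : baseMap K xCsch = h at *
  generalize eulerD K h = dh at *
  generalize C κ = t at *
  have h7 : dh = -h ^ 2 * (c - g) := by
    linear_combination h * h4 - dh * h3
  have h8 : dh - h = -(c * h ^ 2) := by rw [h7]; linear_combination h * h3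
  have e' : (c * (h ^ 2 + 4 * t * X ^ 2)) ^ 2 =
      ((-h + 4 * t * X ^ 2 * g) ^ 2 + 2 * (w + 6 * t) * X ^ 2) ^ 2 -
        4 * (w' - t + 8 * t ^ 2) * X ^ 4 := by
    have k1 : (-h + 4 * t * X ^ 2 * g) ^ 2 = h ^ 2 - 8 * t * X ^ 2 + 16 * t ^ 2 * X ^ 4 * g ^ 2 := by
      linear_combination (-8 * t * X ^ 2) * h3
    have k2 : (c * (h ^ 2 + 4 * t * X ^ 2)) ^ 2 = (h ^ 2 + 4 * t * X ^ 2) ^ 2 +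
        X ^ 2 * (h ^ 2 + 8 * t * X ^ 2 + 16 * t ^ 2 * X ^ 4 * g ^ 2) := by
      linear_combination (h ^ 2 + 4 * t * X ^ 2) ^ 2 * h2 +
        (X ^ 2 * (h ^ 2 * (g * h + 1) + 8 * t * X ^ 2 * (g * h + 1))) * h3
    rw [k1, k2]
    linear_combination (-X ^ 2 * (h ^ 2 + 4 * t * X ^ 2) - 16 * X ^ 6 * t ^ 2 * g ^ 2 -
      4 * w' * X ^ 4 - w * X ^ 4) * h5 + w * X ^ 4 * h6 - 32 * t ^ 2 * X ^ 4 * (g * h + 1) * h3 -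
      (128 * X ^ 6 * g ^ 2 + 256 * t * X ^ 8 * g ^ 4) * hκ'
  refine Eq.trans ?_ e'
  congr 1
  push_cast
  linear_combination -h8

end HyperbolicEquation
end
end TwistedCancellation

namespace TwistedCancellation
noncomputable section

/-! ### Evaluation at `z = exp x` and the elliptic equation for `Θ₂` -/

section JacobiEvaluation

open PowerSeries

/-- The series of `exp (-x)`. -/
def expNeg : PowerSeries ℂ := rescale (-1) (exp ℂ)

theorem exp_mul_expNeg : exp ℂ * expNeg = 1 := exp_mul_exp_neg_eq_one

theorem eulerD_expNeg : eulerD ℂ expNeg = -(X * expNeg) := by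
  rw [expNeg, ← rescale_eulerD, eulerD_exp, map_mul, rescale_X]
  simp

/-- Evaluation of `ℂ[α]⟦β⟧` at `α = exp x` and `β = Q exp (-x)`; the outer variable of the target
is `x`, and the inner one is `Q`. -/
def jacEval : AnnPoly →+* PowerSeries (PowerSeries ℂ) :=
  swapSeries.comp (annEval (exp ℂ) expNeg)

/-- Constants in `Q`. -/
def constQ : PowerSeries ℂ →+* PowerSeries (PowerSeries ℂ) := map C

theorem swapSeries_C {R : Type*} [CommRing R] (f : PowerSeries R) :
    swapSeries (C f) = map C f := by
  ext i j
  rw [coeff_swapSeries, coeff_map, coeff_C, coeff_C]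
  split_ifs <;> simp

theorem swapSeries_map_C {R : Type*} [CommRing R] (f : PowerSeries R) :
    swapSeries (map C f) = C f := by
  rw [← swapSeries_C, swapSeries_swapSeries]

theorem jacEval_alP : jacEval alP = constQ (exp ℂ) := by
  rw [jacEval, RingHom.comp_apply, annEval_alP, swapSeries_C, constQ]

theorem jacEval_X : jacEval X = constQ expNeg * C X := by
  rw [jacEval, RingHom.comp_apply, annEval_X, map_mul, swapSeries_C, swapSeries_X, constQ]

theorem jacEval_rhoP (f : PowerSeries ℂ) : jacEval (rhoP f) = C f := by
  rw [jacEval, RingHom.comp_apply, annEval_rhoP _ _ exp_mul_expNeg, ← swapSeries_map_C]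
  rfl

theorem eulerD_expNeg_pow_mul_aeval (j : ℕ) (p : Polynomial ℂ) :
    eulerD ℂ (expNeg ^ j * Polynomial.aeval (exp ℂ) p) = X * (expNeg ^ j *
      Polynomial.aeval (exp ℂ) (Polynomial.X * Polynomial.derivative p - (j : Polynomial ℂ) * p)) := by
  rw [Derivation.leibniz, Derivation.leibniz_pow, Derivation.map_aeval, eulerD_exp, eulerD_expNeg]
  simp only [smul_eq_mul, nsmul_eq_mul, map_sub, map_mul, Polynomial.aeval_X, map_natCast]
  rcases j with _ | j
  · simp
    ring
  · rw [Nat.add_sub_cancel]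
    push_cast
    ring

/-- On functions of `z = exp x` the derivation `z d/dz` is `d/dx`. -/
theorem eulerD_jacEval (f : AnnPoly) : eulerD _ (jacEval f) = X * jacEval (derP f) := by
  ext m j
  have h : ∀ f m, coeff j (coeff m (jacEval f)) =
      coeff m (expNeg ^ j * Polynomial.aeval (exp ℂ) (coeff j f)) := fun f m => by
    rw [jacEval, RingHom.comp_apply, coeff_swapSeries, annEval, RingHom.comp_apply, coeff_rescale,
      coeff_map]
    rfl
  have h1 := congrArg (coeff m) (eulerD_expNeg_pow_mul_aeval j (coeff j f))
  have h2 : coeff j (derP f) = Polynomial.X * Polynomial.derivative (coeff j f) -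
      (j : Polynomial ℂ) * coeff j f := by
    rw [derP, coeff_annDer]
    rfl
  rw [coeff_eulerD] at h1 ⊢
  rw [← h2] at h1
  have e : coeff j ((m : PowerSeries ℂ) * coeff m (jacEval f)) =
      (m : ℂ) * coeff j (coeff m (jacEval f)) := by
    rw [← map_natCast (C (R := ℂ)), coeff_C_mul]
  rw [e, h, h1]
  rcases m with _ | m
  · simp
  · rw [coeff_succ_X_mul, coeff_succ_X_mul, h]

/-- The series `(exp x - 1) / x`. -/
def expQuot : PowerSeries ℂ := expHalf * sinhcHalf

theorem X_mul_expQuot : X * expQuot = exp ℂ - 1 := by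
  rw [expQuot]
  linear_combination expHalf * X_mul_sinhcHalf + expHalf_sq - expHalf_mul_expNegHalf

theorem two_mul_expQuot_mul_cothHalf : 2 * (expQuot * cothHalf) = 1 + exp ℂ := by
  rw [expQuot, cothHalf]
  linear_combination 2 * expHalf * coshHalf * sinhcHalf_mul_inv + expHalf * two_mul_coshHalf +
    expHalf_sq + expHalf_mul_expNegHalf

theorem expQuot_ne_zero : expQuot ≠ 0 := by
  have h := two_mul_expQuot_mul_cothHalf
  intro h0
  have h1 := congrArg constantCoeff h
  rw [h0, zero_mul, mul_zero, map_zero, map_add, map_one, constantCoeff_exp] at h1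
  norm_num at h1

/-- The logarithmic derivative attached to the Witten genus of `Θ₂`. -/
def jacV : PowerSeries (PowerSeries ℂ) := -constQ cothHalf + X * jacEval vPoly

theorem coeff_zero_jacV : coeff 0 jacV = -1 := by
  have : constantCoeff (constQ cothHalf) = 1 := by
    have h := congrArg constantCoeff two_mul_expQuot_mul_cothHalf
    have h1 : constantCoeff expQuot = 1 := by
      have := congrArg (coeff 1) X_mul_expQuot
      rw [show (1 : ℕ) = 0 + 1 from rfl, coeff_succ_X_mul] at this
      simpa [coeff_one, coeff_exp] using this
    rw [map_mul, map_mul, h1, map_add, map_one, constantCoeff_exp, map_ofNat] at h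
    have h2 : constantCoeff cothHalf = 1 := by linear_combination h / 2
    rw [constQ, ← coeff_zero_eq_constantCoeff_apply, coeff_map, coeff_zero_eq_constantCoeff_apply,
      h2, map_one]
  simp [jacV, this]

theorem constQ_X : constQ X = X := map_X _

theorem series_two_ne_zero : (2 : PowerSeries (PowerSeries ℂ)) ≠ 0 := by
  intro h
  have h1 : constantCoeff (2 : PowerSeries (PowerSeries ℂ)) = 2 := map_ofNat _ 2
  rw [h, map_zero] at h1
  exact powerSeries_two_ne_zero h1.symm

theorem eulerD_constQ (f : PowerSeries ℂ) : eulerD _ (constQ f) = constQ (eulerD ℂ f) :=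
  (map_eulerD _ _).symm

/-- The parameter `δ₂`. -/
def jacDelta : PowerSeries ℂ := C (1 / 2) * (devSeries - sqSeries)

/-- The parameter `ε₂`. -/
def jacEps : PowerSeries ℂ := thetaConst ^ 2 * X

theorem eight_mul_jacDelta : 8 * jacDelta = map (Int.castRingHom ℂ) eightDelta₂ := by
  have h : 2 * C (1 / 2 : ℂ) = 1 := by
    rw [← map_ofNat C 2, ← map_mul]
    norm_num
  rw [map_eightDelta₂, jacDelta]
  linear_combination 4 * (devSeries - sqSeries) * h

theorem jacEps_eq : jacEps = map (Int.castRingHom ℂ) epsilon₂ := map_epsilon₂.symm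

/-- This is `dvPoly_sq` at `z = exp x`, with `jacV = x v(exp x)`. Since `1 - exp x = -x * expQuot`,
each power of `1 - α` supplies a power of `x`, and `expQuot ^ 4` cancels from both sides. -/
theorem jacV_equation : (eulerD _ jacV - jacV) ^ 2 =
    (jacV ^ 2 + 2 * C jacDelta * X ^ 2) ^ 2 - 4 * C jacEps * X ^ 4 := by
  have hxg := congrArg constQ X_mul_expQuot
  have hgU := congrArg constQ two_mul_expQuot_mul_cothHalf
  have hθe := congrArg constQ eulerD_exp
  simp only [map_mul, map_sub, map_add, map_one, map_ofNat, constQ_X] at hxg hgU hθe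
  rw [← eulerD_constQ] at hθe
  have hθg := congrArg (eulerD _) hxg
  have hθU := congrArg (eulerD _) hgU
  simp only [Derivation.leibniz, map_sub, map_add, Derivation.map_one_eq_zero, smul_eq_mul,
    hθe, eulerD_X, zero_add, sub_zero] at hθg hθU
  have e2 : eulerD (PowerSeries ℂ) (2 : PowerSeries (PowerSeries ℂ)) = 0 := eulerD_ofNat 2
  rw [e2] at hθU
  have hθg' : eulerD _ (constQ expQuot) = constQ (exp ℂ) - constQ expQuot := by
    refine mul_left_cancel₀ (X_ne_zero (R := PowerSeries ℂ)) ?_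
    linear_combination hθg
  have hhalf : 2 * jacEval (rhoP (invAdd 0)) = 1 := by
    have h := congrArg jacEval (congrArg rhoP (invAdd_mul 0))
    simp only [pow_zero, map_mul, map_add, map_one] at h
    linear_combination h
  -- The part of `v` with a pole is `(1 + z) / (2 (1 - z))`, that is `-coth(x / 2) / 2` at `z = exp
  -- x`, which accounts for `-cothHalf` in `jacV`.
  have hn : jacEval vNum = -(constQ expQuot * jacV) := by
    rw [vNum, jacV]
    simp only [map_mul, map_add, map_sub, map_one, jacEval_alP]
    refine mul_left_cancel₀ series_two_ne_zero ?_
    linear_combination (1 - constQ (exp ℂ)) * hhalf + 2 * jacEval vPoly * hxg - hgU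
  have hd : jacEval dvPoly = constQ expQuot ^ 2 * (eulerD _ jacV - jacV) := by
    rw [dvPoly, jacV]
    simp only [map_mul, map_add, map_sub, map_one, map_pow, map_neg, jacEval_alP,
      Derivation.leibniz, eulerD_X, smul_eq_mul, eulerD_jacEval]
    refine mul_left_cancel₀ series_two_ne_zero ?_
    linear_combination constQ expQuot * hθU -
      2 * constQ expQuot * constQ cothHalf * hθg' + constQ (exp ℂ) * hxg -
      constQ (exp ℂ) * hgU -
      2 * jacEval (derP vPoly) * (X * constQ expQuot + constQ (exp ℂ) - 1) * hxg
  have h := congrArg jacEval dvPoly_sq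
  simp only [map_mul, map_add, map_sub, map_one, map_pow, map_ofNat, jacEval_alP, hn, hd, jacEval_rhoP] at h
  have h2 : 2 * C jacDelta = C (devSeries - sqSeries) := by
    have h : 2 * C (1 / 2 : ℂ) = 1 := by
      rw [← map_ofNat C 2, ← map_mul]
      norm_num
    rw [← map_ofNat C 2, ← map_mul, jacDelta, ← mul_assoc, h, one_mul]
  have hg : constQ expQuot ≠ 0 := by
    intro h0
    refine expQuot_ne_zero (map_injective C (C_injective) ?_)
    rw [map_zero]
    exact h0
  refine mul_left_cancel₀ (pow_ne_zero 4 hg) ?_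
  rw [h2, jacEps, map_sub C, map_mul C, map_pow C]
  generalize eulerD _ jacV - jacV = d at *
  generalize constQ expQuot = g at *
  generalize constQ (exp ℂ) = e at *
  have h3 : 1 - e = -(X * g) := by linear_combination hxg
  rw [h3] at h
  linear_combination h

/-- The Lambert term `Q ^ d exp x / (1 - Q ^ d exp x)`. -/
def lambert (d : ℕ) : PowerSeries (PowerSeries ℂ) := jacEval (phiP (alP ^ (d + 1) * X ^ d))

theorem constQ_exp_mul_expNeg : constQ (exp ℂ) * constQ expNeg = 1 := by
  rw [← map_mul, exp_mul_expNeg, map_one]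

theorem lambert_mul {d : ℕ} (hd : d ≠ 0) :
    lambert d * (1 - C (X ^ d) * constQ (exp ℂ)) = C (X ^ d) * constQ (exp ℂ) := by
  have h := congrArg jacEval (phiP_mul (y := alP ^ (d + 1) * X ^ d)
    ((dvd_pow_self X hd).mul_left _))
  have e : jacEval (alP ^ (d + 1) * X ^ d) = C (X ^ d) * constQ (exp ℂ) := by
    rw [map_mul, map_pow, map_pow, jacEval_alP, jacEval_X, mul_pow, pow_succ, map_pow]
    have := congrArg (· ^ d) constQ_exp_mul_expNeg
    simp only [mul_pow, one_pow] at this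
    linear_combination (constQ (exp ℂ) * C X ^ d) * this
  rw [map_mul, map_sub, map_one, e] at h
  exact h

theorem rescale_constQ (f : PowerSeries ℂ) :
    rescale (-1 : PowerSeries ℂ) (constQ f) = constQ (rescale (-1 : ℂ) f) := by
  ext m : 1
  simp [constQ, coeff_rescale, coeff_map]

/-- Under `x ↦ -x` the monomial `Q ^ (n + 1) exp x` becomes `Q ^ (n + 1) exp (-x)`, which is `α ^ n
β ^ (n + 1)`. -/
theorem rescale_lambert (n : ℕ) :
    rescale (-1 : PowerSeries ℂ) (lambert (n + 1)) = jacEval (phiP (alP ^ n * X ^ (n + 1))) := by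
  have h := congrArg jacEval (phiP_mul (y := alP ^ n * X ^ (n + 1))
    ((dvd_pow_self X (Nat.succ_ne_zero n)).mul_left _))
  have e : jacEval (alP ^ n * X ^ (n + 1)) = C (X ^ (n + 1)) * constQ expNeg := by
    rw [map_mul, map_pow, map_pow, jacEval_alP, jacEval_X, mul_pow, pow_succ, map_pow]
    have := congrArg (· ^ n) constQ_exp_mul_expNeg
    simp only [mul_pow, one_pow] at this
    linear_combination (constQ expNeg * C X ^ (n + 1)) * this
  rw [map_mul, map_sub, map_one, e] at h
  have h2 := congrArg (rescale (-1 : PowerSeries ℂ)) (lambert_mul (Nat.succ_ne_zero n))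
  have e2 : ∀ f : PowerSeries ℂ, rescale (-1 : PowerSeries ℂ) (C f) = C f := fun f => rescale_C _ _
  rw [map_mul, map_sub, map_one, map_mul, e2, rescale_constQ, ← expNeg] at h2
  have h3 : 1 - C (X ^ (n + 1)) * constQ expNeg ≠ 0 := by
    intro h0
    have h1 := congrArg (map constantCoeff) h0
    simp at h1
  refine mul_right_cancel₀ h3 ?_
  rw [h, h2]

/-- The logarithmic derivative of `Â ch(∏_{j ≤ L} S_{q^j} ⊗ Λ_{-q^{j-1/2}})`. -/
def jacPsi (L : ℕ) : PowerSeries (PowerSeries ℂ) :=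
  constQ (C (1 / 2) * (1 - cothHalf)) +
    X * ∑ n ∈ Finset.range L, (lambert (2 * n + 2) - lambert (2 * n + 1))

/-- The even part of the logarithmic derivative for `Â ch(Θ₂)` is the partial fraction expansion of
`v`; the discrepancy modulo `Q ^ L` is due to using only `L` factors. -/
theorem jacPsi_add_rescale (L : ℕ) :
    C X ^ L ∣ jacPsi L + rescale (-1 : PowerSeries ℂ) (jacPsi L) - (jacV + 1) := by
  have h1 : jacEval (vFrac L) = ∑ n ∈ Finset.range L, (lambert (2 * n + 2) - lambert (2 * n + 1)) -
      rescale (-1 : PowerSeries ℂ)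
        (∑ n ∈ Finset.range L, (lambert (2 * n + 2) - lambert (2 * n + 1))) := by
    rw [vFrac, map_sum, map_sum, ← Finset.sum_sub_distrib]
    refine Finset.sum_congr rfl fun n _ => ?_
    rw [map_sub (rescale _), rescale_lambert, show 2 * n + 2 = (2 * n + 1) + 1 from rfl,
      rescale_lambert, map_sub, map_sub, map_sub, lambert, lambert]
    ring
  have h2 : jacEval X ^ L ∣ jacEval (vPoly - vFrac L) := by
    rw [← map_pow]
    exact map_dvd jacEval (vPoly_sub_vFrac L)
  rw [jacEval_X, mul_pow, map_sub] at h2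
  have h3 : constQ (C (1 / 2) * (1 - cothHalf)) +
      rescale (-1 : PowerSeries ℂ) (constQ (C (1 / 2) * (1 - cothHalf))) =
        1 - constQ cothHalf := by
    have h : 2 * C (1 / 2 : ℂ) = 1 := by
      rw [← map_ofNat C 2, ← map_mul]
      norm_num
    rw [rescale_constQ, map_mul (rescale (-1 : ℂ)), map_sub (rescale (-1 : ℂ)), map_one,
      rescale_neg_one_cothHalf, rescale_C, ← map_add, ← two_mul, ← mul_assoc, h, one_mul, map_sub,
      map_one]
  have h4 : jacPsi L + rescale (-1 : PowerSeries ℂ) (jacPsi L) - (jacV + 1) =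
      -(X * (jacEval vPoly - jacEval (vFrac L))) := by
    rw [jacPsi, map_add (rescale _), map_mul (rescale _) X, rescale_X, jacV, h1, map_neg, map_one]
    linear_combination h3
  rw [h4]
  exact ((dvd_of_mul_left_dvd h2).mul_left _).neg_right

end JacobiEvaluation
end
end TwistedCancellation

namespace TwistedCancellation
noncomputable section

/-! ### Power series of a scaled matrix; traces and determinants -/

section MatrixEvaluation

open PowerSeries

variable {R : Type*} [CommRing R] {ι : Type*} [Fintype ι] [DecidableEq ι]

/-- The Leibniz rule for finite products. -/
theorem derivation_prod {A : Type*} [CommRing A] {S : Type*} [CommRing S]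
    [Algebra S A] (D : Derivation S A A) {κ : Type*} [DecidableEq κ] (s : Finset κ) (f : κ → A) :
    D (∏ i ∈ s, f i) = ∑ i ∈ s, D (f i) * ∏ j ∈ s.erase i, f j := by
  induction s using Finset.induction_on with
  | empty => simp
  | insert a s ha ih =>
    rw [Finset.prod_insert ha, Derivation.leibniz, ih, Finset.sum_insert ha,
      Finset.erase_insert ha, smul_eq_mul, smul_eq_mul, Finset.mul_sum, add_comm, mul_comm]
    congr 1
    refine Finset.sum_congr rfl fun i hi => ?_
    have hia : i ≠ a := fun h => ha (h ▸ hi)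
    rw [Finset.erase_insert_of_ne hia.symm, Finset.prod_insert (by simp [ha])]
    ring

/-- Jacobi's formula for the derivative of a determinant. -/
theorem derivation_det {A S : Type*} [CommRing A] [CommRing S] [Algebra S A]
    (D : Derivation S A A) (M : Matrix ι ι A) :
    D M.det = (M.adjugate * M.map D).trace := by
  have h1 : D M.det = ∑ i, (M.updateCol i fun k => D (M k i)).det := by
    simp only [Matrix.det_apply, map_sum]
    rw [Finset.sum_comm]
    refine Finset.sum_congr rfl fun σ _ => ?_
    have e : D (Equiv.Perm.sign σ • ∏ i, M (σ i) i) =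
        Equiv.Perm.sign σ • D (∏ i, M (σ i) i) := by
      rw [Units.smul_def, Units.smul_def, map_zsmul]
    rw [e, derivation_prod, Finset.smul_sum]
    refine Finset.sum_congr rfl fun i _ => ?_
    congr 1
    rw [← Finset.mul_prod_erase Finset.univ _ (Finset.mem_univ i), Matrix.updateCol_self]
    congr 1
    refine Finset.prod_congr rfl fun j hj => ?_
    rw [Matrix.updateCol_ne (Finset.ne_of_mem_erase hj)]
  rw [h1, Matrix.trace]
  refine Finset.sum_congr rfl fun i _ => ?_
  rw [← Matrix.cramer_apply, Matrix.cramer_eq_adjugate_mulVec, Matrix.diag_apply, Matrix.mul_apply]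
  rfl

/-- The matrix `f(tA)` of power series in `t`. -/
def matEval (A : Matrix ι ι R) (f : PowerSeries R) : Matrix ι ι (PowerSeries R) :=
  Matrix.of fun i j => mk fun m => coeff m f * (A ^ m) i j

theorem coeff_matEval (A : Matrix ι ι R) (f : PowerSeries R) (m : ℕ) (i j : ι) :
    coeff m (matEval A f i j) = coeff m f * (A ^ m) i j := by
  rw [matEval, Matrix.of_apply, coeff_mk]

theorem matEval_mul (A : Matrix ι ι R) (f g : PowerSeries R) :
    matEval A (f * g) = matEval A f * matEval A g := by
  ext i j m
  rw [coeff_matEval, Matrix.mul_apply, map_sum, coeff_mul, Finset.sum_mul]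
  simp only [coeff_mul, coeff_matEval]
  rw [Finset.sum_comm]
  refine Finset.sum_congr rfl fun p hp => ?_
  rw [← Finset.HasAntidiagonal.mem_antidiagonal.1 hp, pow_add, Matrix.mul_apply, Finset.mul_sum]
  refine Finset.sum_congr rfl fun k _ => ?_
  ring

theorem matEval_add (A : Matrix ι ι R) (f g : PowerSeries R) :
    matEval A (f + g) = matEval A f + matEval A g := by
  ext i j m
  simp only [coeff_matEval, Matrix.add_apply, map_add, add_mul]

theorem matEval_C (A : Matrix ι ι R) (c : R) :
    matEval A (C c) = (C c : PowerSeries R) • (1 : Matrix ι ι (PowerSeries R)) := by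
  ext i j m
  rw [coeff_matEval, coeff_C, Matrix.smul_apply, smul_eq_mul, coeff_C_mul, Matrix.one_apply]
  split_ifs with h1 h2 h2
  · simp [h1, h2]
  · simp [h1, h2]
  · simp [h1, h2, coeff_one]
  · simp

theorem matEval_one (A : Matrix ι ι R) : matEval A 1 = 1 := by
  have := matEval_C A 1
  simpa using this

theorem map_eulerD_matEval (A : Matrix ι ι R) (f : PowerSeries R) :
    (matEval A f).map (eulerD R) = matEval A (eulerD R f) := by
  ext i j m
  rw [Matrix.map_apply, coeff_eulerD, coeff_matEval, coeff_matEval, coeff_eulerD, mul_assoc]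

/-- The power sum `∑ ψ_m tr(A ^ m) t ^ m`. -/
def powTrace (A : Matrix ι ι R) (f : PowerSeries R) : PowerSeries R := (matEval A f).trace

theorem coeff_powTrace (A : Matrix ι ι R) (f : PowerSeries R) (m : ℕ) :
    coeff m (powTrace A f) = coeff m f * (A ^ m).trace := by
  simp only [powTrace, Matrix.trace, map_sum, Matrix.diag_apply, coeff_matEval, Finset.mul_sum]

theorem powTrace_add (A : Matrix ι ι R) (f g : PowerSeries R) :
    powTrace A (f + g) = powTrace A f + powTrace A g := by
  rw [powTrace, matEval_add, Matrix.trace_add, powTrace, powTrace]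

theorem powTrace_C_mul (A : Matrix ι ι R) (c : R) (f : PowerSeries R) :
    powTrace A (C c * f) = C c * powTrace A f := by
  ext m
  rw [coeff_powTrace, coeff_C_mul, coeff_C_mul, coeff_powTrace, mul_assoc]

theorem powTrace_neg (A : Matrix ι ι R) (f : PowerSeries R) :
    powTrace A (-f) = -powTrace A f := by
  ext m
  rw [coeff_powTrace, map_neg, map_neg, coeff_powTrace, neg_mul]

theorem powTrace_zero (A : Matrix ι ι R) : powTrace A 0 = 0 := by
  ext m
  simp [coeff_powTrace]

theorem eulerD_powTrace (A : Matrix ι ι R) (f : PowerSeries R) :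
    eulerD R (powTrace A f) = powTrace A (eulerD R f) := by
  ext m
  simp only [coeff_powTrace, coeff_eulerD, mul_assoc]

/-- The logarithmic derivative of `det f(tA)` is the power sum with coefficients those of the
logarithmic derivative of `f`. -/
theorem eulerD_det_matEval (A : Matrix ι ι R) {f ψ : PowerSeries R} (h : eulerD R f = ψ * f) :
    eulerD R (matEval A f).det = (matEval A f).det * powTrace A ψ := by
  rw [derivation_det, map_eulerD_matEval, h, mul_comm ψ f, matEval_mul, ← mul_assoc,
    Matrix.adjugate_mul, Matrix.smul_mul, one_mul, Matrix.trace_smul, smul_eq_mul, powTrace]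

theorem map_matEval {S : Type*} [CommRing S] (h : R →+* S) (A : Matrix ι ι R)
    (f : PowerSeries R) : (matEval A f).map (map h) = matEval (A.map h) (map h f) := by
  ext i j m
  rw [Matrix.map_apply, coeff_map, coeff_matEval, coeff_matEval, coeff_map, map_mul,
    ← Matrix.map_pow, Matrix.map_apply]

theorem map_powTrace {S : Type*} [CommRing S] (h : R →+* S) (A : Matrix ι ι R)
    (f : PowerSeries R) : map h (powTrace A f) = powTrace (A.map h) (map h f) := by
  ext m
  rw [coeff_map, coeff_powTrace, coeff_powTrace, map_mul, coeff_map, ← Matrix.map_pow,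
    Matrix.trace, Matrix.trace, map_sum]
  rfl

/-- Uniqueness for the matrix differential equation of the exponential. -/
theorem eq_matEval_exp [Algebra ℂ R] (B : Matrix ι ι R) {Y : Matrix ι ι (PowerSeries R)}
    (h0 : Y.map (coeff 0) = 1)
    (h : Y.map (eulerD R) = (X : PowerSeries R) • (B.map C * Y)) :
    Y = matEval B (map (algebraMap ℂ R) (exp ℂ)) := by
  have key : ∀ m, Y.map (coeff m) = algebraMap ℂ R (m ! : ℂ)⁻¹ • B ^ m := by
    intro m
    induction m with
    | zero => simpa using h0
    | succ m ih =>
      have h1 := congrArg (fun Z : Matrix ι ι (PowerSeries R) => Z.map (coeff (m + 1))) h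
      have h2 : (B.map C * Y).map (coeff m) = B * Y.map (coeff m) := by
        ext i j
        simp [Matrix.mul_apply, coeff_C_mul]
      have h3 : ((X : PowerSeries R) • (B.map C * Y)).map (coeff (m + 1)) =
          (B.map C * Y).map (coeff m) := by
        ext i j
        simp only [Matrix.map_apply, Matrix.smul_apply, smul_eq_mul, coeff_succ_X_mul]
      have h4 : (Y.map (eulerD R)).map (coeff (m + 1)) =
          ((m + 1 : ℕ) : R) • Y.map (coeff (m + 1)) := by
        ext i j
        simp only [Matrix.map_apply, coeff_eulerD, Matrix.smul_apply, smul_eq_mul]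
      rw [h4, h3, h2, ih] at h1
      have h5 : algebraMap ℂ R ((m + 1 : ℕ) : ℂ)⁻¹ * ((m + 1 : ℕ) : R) = 1 := by
        rw [← map_natCast (algebraMap ℂ R), ← map_mul,
          inv_mul_cancel₀ (Nat.cast_ne_zero.2 (by omega)), map_one]
      have h6 := congrArg (algebraMap ℂ R ((m + 1 : ℕ) : ℂ)⁻¹ • ·) h1
      simp only [smul_smul, h5, one_smul] at h6
      rw [h6, Matrix.mul_smul, smul_smul, ← map_mul, ← pow_succ', Nat.factorial_succ, Nat.cast_mul,
        mul_inv]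
  ext i j m
  rw [coeff_matEval, coeff_map, coeff_exp_complex]
  have := congrFun (congrFun (key m) i) j
  simpa using this

theorem map_eulerD_matEval_exp [Algebra ℂ R] (A : Matrix ι ι R) :
    (matEval A (map (algebraMap ℂ R) (exp ℂ))).map (eulerD R) =
      (X : PowerSeries R) • (A.map C * matEval A (map (algebraMap ℂ R) (exp ℂ))) := by
  ext i j m
  rw [Matrix.map_apply, coeff_eulerD, coeff_matEval, Matrix.smul_apply, smul_eq_mul]
  rcases m with _ | m
  · simp
  · rw [coeff_succ_X_mul, Matrix.mul_apply, map_sum, pow_succ', Matrix.mul_apply, Finset.mul_sum,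
      Finset.mul_sum]
    refine Finset.sum_congr rfl fun k _ => ?_
    rw [Matrix.map_apply, coeff_C_mul, coeff_matEval, coeff_map, coeff_map, coeff_exp_complex,
      coeff_exp_complex, Nat.factorial_succ]
    have h5 : ((m + 1 : ℕ) : R) * algebraMap ℂ R ((m + 1 : ℕ) : ℂ)⁻¹ = 1 := by
      rw [← map_natCast (algebraMap ℂ R), ← map_mul,
        mul_inv_cancel₀ (Nat.cast_ne_zero.2 (by omega)), map_one]
    rw [Nat.cast_mul, mul_inv, map_mul]
    linear_combination (algebraMap ℂ R (m ! : ℂ)⁻¹ * (A i k * (A ^ m) k j)) * h5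

theorem coeff_zero_matEval_exp [Algebra ℂ R] (A : Matrix ι ι R) :
    (matEval A (map (algebraMap ℂ R) (exp ℂ))).map (coeff 0) = 1 := by
  ext i j
  rw [Matrix.map_apply, coeff_matEval]
  simp

end MatrixEvaluation
end
end TwistedCancellation

namespace TwistedCancellation
noncomputable section

/-! ### Exponentials of curvatures on tensor products -/

section TensorPowers

open PowerSeries

variable {R : Type*} [CommRing R] {ι : Type*} [Fintype ι] [DecidableEq ι]

/-- The matrix `∑ₛ 1 ⊗ ⋯ ⊗ A ⊗ ⋯ ⊗ 1`. -/
def tensorSum (A : Matrix ι ι R) (b : ℕ) : Matrix (Fin b → ι) (Fin b → ι) R :=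
  Matrix.of fun I J => ∑ s, if ∀ t, t ≠ s → I t = J t then A (I s) (J s) else 0

/-- The matrix `E ⊗ ⋯ ⊗ E`. -/
def tensorProd (E : Matrix ι ι R) (b : ℕ) : Matrix (Fin b → ι) (Fin b → ι) R :=
  Matrix.of fun I J => ∏ s, E (I s) (J s)

/-- The series of the exponential function over a complex algebra. -/
def expBase (R : Type*) [CommRing R] [Algebra ℂ R] : PowerSeries R :=
  map (algebraMap ℂ R) (exp ℂ)

theorem coeff_zero_matEval_exp_apply [Algebra ℂ R] (A : Matrix ι ι R) (i j : ι) :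
    coeff 0 (matEval A (expBase R) i j) = (1 : Matrix ι ι R) i j :=
  congrFun (congrFun (coeff_zero_matEval_exp A) i) j

theorem eulerD_matEval_exp_apply [Algebra ℂ R] (A : Matrix ι ι R) (i j : ι) :
    eulerD R (matEval A (expBase R) i j) =
      X * ∑ k, C (A i k) * matEval A (expBase R) k j := by
  have h := congrFun (congrFun (map_eulerD_matEval_exp A) i) j
  rw [Matrix.map_apply, Matrix.smul_apply, smul_eq_mul, Matrix.mul_apply] at h
  exact h

/-- The exponential of `∑ 1 ⊗ ⋯ ⊗ A ⊗ ⋯ ⊗ 1` is the tensor power of the exponential, because both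
solve the same linear differential equation with value `1` at `t = 0`. -/
theorem matEval_tensorSum [Algebra ℂ R] (A : Matrix ι ι R) (b : ℕ) :
    matEval (tensorSum A b) (expBase R) = tensorProd (matEval A (expBase R)) b := by
  symm
  refine eq_matEval_exp _ ?_ ?_
  · ext I J
    rw [Matrix.map_apply, tensorProd, Matrix.of_apply, coeff_zero_eq_constantCoeff_apply, map_prod]
    simp only [← coeff_zero_eq_constantCoeff_apply, coeff_zero_matEval_exp_apply, Matrix.one_apply]
    split_ifs with h
    · simp [h]
    · obtain ⟨s, hs⟩ := Function.ne_iff.1 h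
      exact Finset.prod_eq_zero (Finset.mem_univ s) (if_neg hs)
  · ext I J : 1
    rw [Matrix.map_apply, tensorProd, Matrix.of_apply, derivation_prod, Matrix.smul_apply,
      smul_eq_mul, Matrix.mul_apply]
    simp only [eulerD_matEval_exp_apply, Matrix.map_apply, Matrix.of_apply, tensorSum, map_sum,
      Finset.sum_mul, Finset.mul_sum]
    rw [Finset.sum_comm (s := (Finset.univ : Finset (Fin b → ι)))]
    refine Finset.sum_congr rfl fun s _ => ?_
    -- For fixed `s` only the multi-indices that agree with `I` outside the slot `s` contribute.
    refine Finset.sum_of_injOn (fun k => Function.update I s k) ?_ ?_ ?_ ?_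
    · intro k _ k' _ h
      have := congrFun h s
      simpa using this
    · intro k _
      simp
    · intro K _ hK
      rw [if_neg, map_zero, zero_mul, mul_zero]
      intro h
      refine hK ⟨K s, by simp, ?_⟩
      ext t
      show Function.update I s (K s) t = K t
      by_cases ht : t = s
      · rw [ht, Function.update_self]
      · rw [Function.update_of_ne ht, h t ht]
    · intro k _
      rw [if_pos (fun t ht => (Function.update_of_ne ht _ _).symm), Function.update_self,
        ← Finset.mul_prod_erase Finset.univ _ (Finset.mem_univ s), Function.update_self]
      have : ∏ t ∈ Finset.univ.erase s, matEval A (expBase R) (Function.update I s k t) (J t) =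
          ∏ t ∈ Finset.univ.erase s, matEval A (expBase R) (I t) (J t) :=
        Finset.prod_congr rfl fun t ht => by
          rw [Function.update_of_ne (Finset.ne_of_mem_erase ht)]
      rw [this]
      ring

theorem matEval_kroneckerSum [Algebra ℂ R] (A : Matrix ι ι R) :
    matEval (A ⊗ₖ 1 + 1 ⊗ₖ A) (expBase R) =
      matEval A (expBase R) ⊗ₖ matEval A (expBase R) := by
  symm
  refine eq_matEval_exp _ ?_ ?_
  · ext ⟨i, i'⟩ ⟨j, j'⟩
    rw [Matrix.map_apply, Matrix.kroneckerMap_apply, coeff_zero_eq_constantCoeff_apply, map_mul]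
    simp only [← coeff_zero_eq_constantCoeff_apply, coeff_zero_matEval_exp_apply, ← Matrix.one_kronecker_one]
    rfl
  · have h1 : (A ⊗ₖ (1 : Matrix ι ι R) + (1 : Matrix ι ι R) ⊗ₖ A).map (C : R →+* PowerSeries R) =
        A.map C ⊗ₖ 1 + 1 ⊗ₖ A.map C := by
      ext ⟨i, i'⟩ ⟨j, j'⟩ : 1
      simp only [Matrix.map_apply, Matrix.add_apply, Matrix.kroneckerMap_apply, map_add, map_mul,
        Matrix.one_apply]
      split_ifs <;> simp
    rw [h1, add_mul, ← Matrix.mul_kronecker_mul, ← Matrix.mul_kronecker_mul, one_mul]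
    ext ⟨i, i'⟩ ⟨j, j'⟩ : 1
    simp only [Matrix.map_apply, Matrix.kroneckerMap_apply, Derivation.leibniz, Matrix.smul_apply,
      Matrix.add_apply, smul_eq_mul, eulerD_matEval_exp_apply, Matrix.mul_apply]
    ring

theorem trace_matEval_kroneckerSum [Algebra ℂ R] (A : Matrix ι ι R) :
    powTrace (A ⊗ₖ 1 + 1 ⊗ₖ A) (expBase R) = powTrace A (expBase R) ^ 2 := by
  rw [powTrace, matEval_kroneckerSum, Matrix.trace_kronecker, powTrace, sq]

end TensorPowers

/-! ### Traces of permutations on tensor powers -/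

section PermutationTraces

variable {R : Type*} [CommRing R] {ι : Type*} [Fintype ι]

/-- The trivial character of the symmetric group for `c = 1`, and the sign otherwise. -/
def permChar (c : ℤˣ) {b : ℕ} (σ : Equiv.Perm (Fin b)) : ℤˣ :=
  if c = 1 then 1 else Equiv.Perm.sign σ

theorem permChar_decomposeFin (c : ℤˣ) {b : ℕ} (p : Fin (b + 1)) (e : Equiv.Perm (Fin b)) :
    permChar c (Equiv.Perm.decomposeFin.symm (p, e)) = (if p = 0 then 1 else c) * permChar c e := by
  rw [permChar, permChar]
  rcases Int.units_eq_one_or c with rfl | rfl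
  · simp
  · have h : (-1 : ℤˣ) ≠ 1 := by decide
    rw [if_neg h, if_neg h, Equiv.Perm.decomposeFin.symm_sign]

theorem permChar_conj (c : ℤˣ) {b : ℕ} (π σ : Equiv.Perm (Fin b)) :
    permChar c ((π.symm.trans σ).trans π) = permChar c σ := by
  rw [permChar, permChar]
  split_ifs
  · rfl
  · exact Equiv.Perm.sign_symm_trans_trans σ π

/-- The trace of `E 0 ⊗ ⋯ ⊗ E (b - 1)` composed with `∑_σ χ(σ) σ`. -/
def permTrace (c : ℤˣ) {b : ℕ} (E : Fin b → Matrix ι ι R) : R :=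
  ∑ σ : Equiv.Perm (Fin b), ((permChar c σ : ℤ) : R) * ∑ J : Fin b → ι, ∏ s, E s (J s) (J (σ s))

theorem permTrace_comp (c : ℤˣ) {b : ℕ} (E : Fin b → Matrix ι ι R) (π : Equiv.Perm (Fin b)) :
    permTrace c (E ∘ π) = permTrace c E := by
  rw [permTrace, permTrace]
  refine Fintype.sum_equiv (Equiv.permCongr π) _ _ fun σ => ?_
  rw [Equiv.permCongr_def, permChar_conj]
  congr 1
  refine Fintype.sum_equiv (Equiv.arrowCongr π (Equiv.refl ι)) _ _ fun J => ?_
  refine Fintype.prod_equiv π _ _ fun s => ?_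
  simp

/-- Sort the permutations by what happens to `0`. Either it is fixed and splits off `E₀.trace`, or
it is inserted into a cycle right after some `x`, which replaces `E x` by `E x * E₀` and multiplies
the character by `c`. -/
theorem permTrace_cons (c : ℤˣ) {b : ℕ} (E₀ : Matrix ι ι R) (E : Fin b → Matrix ι ι R) :
    permTrace c (Fin.cons E₀ E : Fin (b + 1) → Matrix ι ι R) = E₀.trace * permTrace c E +
      ((c : ℤ) : R) * ∑ x, permTrace c (Function.update E x (E x * E₀)) := by
  have hcons : ∀ f : (Fin (b + 1) → ι) → R, ∑ J, f J = ∑ j, ∑ J : Fin b → ι, f (Fin.cons j J) :=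
    fun f => by
      rw [← (Fin.consEquiv fun _ : Fin (b + 1) => ι).sum_comp, Fintype.sum_prod_type]
      rfl
  rw [permTrace, ← Equiv.sum_comp Equiv.Perm.decomposeFin.symm, Fintype.sum_prod_type,
    Fin.sum_univ_succ]
  congr 1
  · rw [permTrace, Finset.mul_sum]
    refine Finset.sum_congr rfl fun e _ => ?_
    rw [permChar_decomposeFin, if_pos rfl, one_mul, hcons]
    simp only [Fin.prod_univ_succ, Fin.cons_zero, Fin.cons_succ,
      Equiv.Perm.decomposeFin_symm_apply_zero, Equiv.Perm.decomposeFin_symm_apply_succ,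
      Equiv.swap_self, Equiv.refl_apply]
    rw [Matrix.trace]
    simp only [Matrix.diag_apply, ← Finset.mul_sum, ← Finset.sum_mul]
    ring
  · rw [Finset.mul_sum]
    rw [Finset.sum_comm]
    have e1 : ∀ x, ((c : ℤ) : R) * permTrace c (Function.update E x (E x * E₀)) =
        ∑ σ : Equiv.Perm (Fin b), ((c : ℤ) : R) * (((permChar c σ : ℤ) : R) * ∑ J : Fin b → ι,
          ∏ s, Function.update E x (E x * E₀) s (J s) (J (σ s))) := fun x => by
      rw [permTrace, Finset.mul_sum]
    simp only [e1]
    rw [Finset.sum_comm (s := (Finset.univ : Finset (Fin b)))]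
    refine Finset.sum_congr rfl fun e _ => ?_
    -- Reindex the image of `0` as `(e x).succ`, so that the cycle runs `x → 0 → e x`.
    rw [← Equiv.sum_comp e]
    refine Finset.sum_congr rfl fun x _ => ?_
    rw [permChar_decomposeFin, if_neg (Fin.succ_ne_zero _), hcons, Units.val_mul, Int.cast_mul,
      mul_assoc, Finset.sum_comm]
    congr 2
    refine Finset.sum_congr rfl fun J _ => ?_
    rw [← Finset.mul_prod_erase Finset.univ _ (Finset.mem_univ x), Function.update_self,
      Matrix.mul_apply, Finset.sum_mul]
    refine Finset.sum_congr rfl fun j _ => ?_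
    rw [Fin.prod_univ_succ]
    simp only [Fin.cons_zero, Fin.cons_succ,
      Equiv.Perm.decomposeFin_symm_apply_zero, Equiv.Perm.decomposeFin_symm_apply_succ]
    rw [← Finset.mul_prod_erase Finset.univ _ (Finset.mem_univ x), Equiv.swap_apply_right,
      Fin.cons_zero]
    have : ∏ y ∈ Finset.univ.erase x, E y (J y)
          ((Fin.cons j J : Fin (b + 1) → ι) (Equiv.swap 0 (e x).succ (e y).succ)) =
        ∏ y ∈ Finset.univ.erase x, Function.update E x (E x * E₀) y (J y) (J (e y)) :=
      Finset.prod_congr rfl fun y hy => by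
        have hy' := Finset.ne_of_mem_erase hy
        rw [Function.update_of_ne hy', Equiv.swap_apply_of_ne_of_ne (Fin.succ_ne_zero _)
          (fun h => hy' (e.injective (Fin.succ_injective _ h))), Fin.cons_succ]
    rw [this]
    ring

/-- Newton's recursion for the traces of `∑_σ χ(σ) σ` on tensor powers. -/
theorem permTrace_pow_cons [DecidableEq ι] (c : ℤˣ) (E : Matrix ι ι R) (b m : ℕ) :
    permTrace c (Fin.cons (E ^ m) (fun _ => E) : Fin (b + 1) → Matrix ι ι R) =
      ∑ i ∈ Finset.range (b + 1), ((c : ℤ) : R) ^ i * (b.descFactorial i : R) *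
        ((E ^ (m + i)).trace * permTrace c (fun _ : Fin (b - i) => E)) := by
  induction b generalizing m with
  | zero => simp [permTrace_cons]
  | succ b ih =>
    -- Conjugation by the transposition of `0` and `x` moves the modified slot to the front, so all
    -- `b + 1` summands are equal; this produces the falling factorial.
    have h : ∀ x : Fin (b + 1), permTrace c (Function.update (fun _ : Fin (b + 1) => E) x (E * E ^ m)) =
        permTrace c (Fin.cons (E ^ (m + 1)) (fun _ => E) : Fin (b + 1) → Matrix ι ι R) := by
      intro x
      rw [← permTrace_comp c _ (Equiv.swap 0 x)]
      congr 1
      ext1 y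
      rw [Function.comp_apply, ← pow_succ']
      refine Fin.cases ?_ (fun y => ?_) y
      · rw [Equiv.swap_apply_left, Function.update_self, Fin.cons_zero]
      · rw [Fin.cons_succ, Function.update_of_ne]
        intro h
        have h2 := congrArg (Equiv.swap 0 x) h
        rw [Equiv.swap_apply_self, Equiv.swap_apply_right] at h2
        exact Fin.succ_ne_zero _ h2
    rw [permTrace_cons, Finset.sum_range_succ']
    simp only [h, ih, Finset.sum_const, Finset.card_univ, Fintype.card_fin]
    rw [add_comm]
    congr 1
    · rw [nsmul_eq_mul, Finset.mul_sum, Finset.mul_sum]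
      refine Finset.sum_congr rfl fun i _ => ?_
      rw [Nat.succ_descFactorial_succ, Nat.add_sub_add_right, show m + 1 + i = m + (i + 1) by ring]
      push_cast
      ring
    · simp

end PermutationTraces
end
end TwistedCancellation

namespace TwistedCancellation
noncomputable section

/-! ### Generating series of symmetric and exterior powers -/

section NewtonSeries

open PowerSeries

variable {R : Type*} [CommRing R] {ι : Type*} [Fintype ι]

theorem natCast_mul_cancel [Algebra ℂ R] {m : ℕ} (hm : m ≠ 0) {x y : R} (h : (m : R) * x = m * y) : x = y := by
  have h1 : algebraMap ℂ R ((m : ℂ)⁻¹) * (m : R) = 1 := by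
    rw [← map_natCast (algebraMap ℂ R) m, ← map_mul,
      inv_mul_cancel₀ (Nat.cast_ne_zero.2 hm), map_one]
  have h2 := congrArg (algebraMap ℂ R ((m : ℂ)⁻¹) * ·) h
  simp only [← mul_assoc, h1, one_mul] at h2
  exact h2

theorem eq_of_eulerD_eq [Algebra ℂ R] {f g : PowerSeries R} (h : eulerD R f = eulerD R g)
    (h0 : coeff 0 f = coeff 0 g) : f = g := by
  ext m
  rcases Nat.eq_zero_or_pos m with rfl | hm
  · exact h0
  · have := congrArg (coeff m) h
    rw [coeff_eulerD, coeff_eulerD] at this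
    exact natCast_mul_cancel hm.ne' this

/-- Uniqueness for first order homogeneous linear differential equations. -/
theorem eq_of_log_deriv_eq [Algebra ℂ R] {f g T : PowerSeries R} (hf : eulerD R f = f * T)
    (hg : eulerD R g = g * T) (hT : coeff 0 T = 0) (h0 : coeff 0 f = coeff 0 g) : f = g := by
  ext m
  induction m using Nat.strong_induction_on with
  | _ m ih =>
  rcases Nat.eq_zero_or_pos m with rfl | hm
  · exact h0
  refine natCast_mul_cancel hm.ne' ?_
  rw [← coeff_eulerD, ← coeff_eulerD, hf, hg, coeff_mul, coeff_mul]
  refine Finset.sum_congr rfl fun p hp => ?_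
  have hp' := Finset.HasAntidiagonal.mem_antidiagonal.1 hp
  rcases Nat.eq_zero_or_pos p.2 with h2 | h2
  · rw [h2, hT, mul_zero, mul_zero]
  · rw [ih p.1 (by omega)]

/-- The normalized trace of `∑_σ χ(σ) σ` on the tensor power. -/
def powerTrace [Algebra ℂ R] (c : ℤˣ) (E : Matrix ι ι R) (b : ℕ) : R :=
  algebraMap ℂ R (b ! : ℂ)⁻¹ * permTrace c (fun _ : Fin b => E)

theorem powerTrace_zero [Algebra ℂ R] (c : ℤˣ) (E : Matrix ι ι R) : powerTrace c E 0 = 1 := by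
  rcases Int.units_eq_one_or c with rfl | rfl <;>
  simp [powerTrace, permTrace, permChar]

theorem powerTrace_succ [Algebra ℂ R] [DecidableEq ι] (c : ℤˣ) (E : Matrix ι ι R) (b : ℕ) :
    ((b + 1 : ℕ) : R) * powerTrace c E (b + 1) = ∑ i ∈ Finset.range (b + 1),
      ((c : ℤ) : R) ^ i * ((E ^ (i + 1)).trace * powerTrace c E (b - i)) := by
  have h := permTrace_pow_cons c E b 1
  have e : (Fin.cons (E ^ 1) (fun _ => E) : Fin (b + 1) → Matrix ι ι R) = fun _ => E := by
    ext1 y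
    refine Fin.cases ?_ (fun y => ?_) y
    · rw [Fin.cons_zero, pow_one]
    · rw [Fin.cons_succ]
  rw [e] at h
  rw [powerTrace, h, ← mul_assoc, Finset.mul_sum]
  refine Finset.sum_congr rfl fun i hi => ?_
  have hi' : i ≤ b := Nat.lt_succ_iff.1 (Finset.mem_range.1 hi)
  have h1 : ((b + 1 : ℕ) : R) * algebraMap ℂ R ((b + 1) ! : ℂ)⁻¹ * (b.descFactorial i : R) =
      algebraMap ℂ R ((b - i) ! : ℂ)⁻¹ := by
    rw [← map_natCast (algebraMap ℂ R), ← map_natCast (algebraMap ℂ R), ← map_mul, ← map_mul]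
    congr 1
    have h2 : ((b - i)! : ℂ) * (b.descFactorial i : ℂ) = (b ! : ℂ) := by
      exact_mod_cast Nat.factorial_mul_descFactorial hi'
    have h3 : ((b - i)! : ℂ) ≠ 0 := Nat.cast_ne_zero.2 (Nat.factorial_ne_zero _)
    have h4 : (b ! : ℂ) ≠ 0 := Nat.cast_ne_zero.2 (Nat.factorial_ne_zero _)
    have h5 : ((b + 1 : ℕ) : ℂ) ≠ 0 := Nat.cast_ne_zero.2 (by omega)
    rw [Nat.factorial_succ, Nat.cast_mul, mul_inv, ← mul_assoc, mul_inv_cancel₀ h5, one_mul,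
      ← h2, mul_inv]
    rw [← h2] at h4
    have h6 := right_ne_zero_of_mul h4
    field_simp
  rw [powerTrace, add_comm 1 i]
  linear_combination (((c : ℤ) : R) ^ i * ((E ^ (i + 1)).trace *
    permTrace c fun _ : Fin (b - i) => E)) * h1

/-- The series `∑ c ^ b τ_b u ^ b` of normalized traces. -/
def powerSeriesTrace [Algebra ℂ R] (c : ℤˣ) (E : Matrix ι ι R) : PowerSeries R :=
  mk fun b => ((c : ℤ) : R) ^ b * powerTrace c E b

theorem units_mul_self (c : ℤˣ) : ((c : ℤ) : R) * ((c : ℤ) : R) = 1 := by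
  rw [← Int.cast_mul, ← Units.val_mul, Int.units_mul_self]
  simp

/-- Newton's identities in generating form. The sign `c ^ b` in the series is arranged so that the
logarithmic derivative is `c` times the series of power sums `tr(E ^ m)`, for symmetric and exterior
powers alike. -/
theorem eulerD_powerSeriesTrace [Algebra ℂ R] [DecidableEq ι] (c : ℤˣ) (E : Matrix ι ι R) :
    eulerD R (powerSeriesTrace c E) =
      powerSeriesTrace c E * (C ((c : ℤ) : R) * powTrace E (X * mk 1)) := by
  ext m
  rw [coeff_eulerD]
  rcases m with _ | m
  · have : coeff 0 (powTrace E (X * mk 1)) = 0 := by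
      rw [coeff_powTrace]
      simp
    rw [coeff_zero_eq_constantCoeff_apply] at this
    simp [this]
  have hc := units_mul_self (R := R) c
  rw [mul_comm (powerSeriesTrace c E), mul_assoc, coeff_C_mul, coeff_mul,
    Finset.Nat.sum_antidiagonal_succ]
  have h0 : coeff 0 (powTrace E (X * mk 1)) = 0 := by
    rw [coeff_powTrace]
    simp
  rw [h0, zero_mul, zero_add, Finset.Nat.sum_antidiagonal_eq_sum_range_succ_mk, powerSeriesTrace,
    coeff_mk, mul_left_comm, powerTrace_succ, Finset.mul_sum, Finset.mul_sum]
  refine Finset.sum_congr rfl fun i hi => ?_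
  have hi' : i ≤ m := Nat.lt_succ_iff.1 (Finset.mem_range.1 hi)
  rw [coeff_powTrace, coeff_succ_X_mul, coeff_mk, coeff_mk, Pi.one_apply, one_mul]
  have h1 : ((c : ℤ) : R) ^ (m + 1) * ((c : ℤ) : R) ^ i = ((c : ℤ) : R) * ((c : ℤ) : R) ^ (m - i) := by
    obtain ⟨j, rfl⟩ := Nat.exists_eq_add_of_le hi'
    rw [Nat.add_sub_cancel_left, show i + j + 1 = i + (j + 1) by ring, pow_add, mul_comm,
      ← mul_assoc, ← mul_pow, hc, one_pow, one_mul, pow_succ, mul_comm]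
  linear_combination ((E ^ (i + 1)).trace * powerTrace c E (m - i)) * h1

theorem eulerD_det_one_sub [DecidableEq ι] (E : Matrix ι ι R) :
    eulerD R (matEval E (1 - X)).det =
      (matEval E (1 - X)).det * -powTrace E (X * mk 1) := by
  rw [← powTrace_neg]
  refine eulerD_det_matEval E ?_
  rw [map_sub, Derivation.map_one_eq_zero, eulerD_X]
  linear_combination X * mk_one_mul_one_sub_eq_one R

theorem coeff_zero_det_matEval [DecidableEq ι] (E : Matrix ι ι R) {f : PowerSeries R} (h : coeff 0 f = 1) :
    coeff 0 (matEval E f).det = 1 := by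
  rw [coeff_zero_eq_constantCoeff_apply, RingHom.map_det, RingHom.mapMatrix_apply]
  have : (matEval E f).map constantCoeff = 1 := by
    ext i j
    rw [Matrix.map_apply, ← coeff_zero_eq_constantCoeff_apply, coeff_matEval, h, one_mul, pow_zero]
  rw [this, Matrix.det_one]

theorem coeff_zero_powTrace_X_mul [DecidableEq ι] (E : Matrix ι ι R) (f : PowerSeries R) :
    coeff 0 (powTrace E (X * f)) = 0 := by
  rw [coeff_powTrace]
  simp

/-- `∑ ch(S^b) u^b = det(1 - u E)⁻¹`. -/
theorem powerSeriesTrace_one_mul_det [Algebra ℂ R] [DecidableEq ι] (E : Matrix ι ι R) :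
    powerSeriesTrace 1 E * (matEval E (1 - X)).det = 1 := by
  refine eq_of_eulerD_eq ?_ ?_
  · rw [Derivation.leibniz, Derivation.map_one_eq_zero, eulerD_det_one_sub,
      eulerD_powerSeriesTrace, smul_eq_mul, smul_eq_mul]
    simp
    ring
  · have h := coeff_zero_det_matEval E (f := 1 - X) (by simp)
    have h' : coeff 0 (powerSeriesTrace 1 E) = 1 := by
      rw [powerSeriesTrace, coeff_mk, powerTrace_zero]
      simp
    rw [coeff_zero_eq_constantCoeff_apply] at h h'
    rw [coeff_zero_eq_constantCoeff_apply, map_mul, h, h']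
    simp

/-- `∑ ch(Λ^b) (-u)^b = det(1 - u E)`. -/
theorem powerSeriesTrace_neg_one [Algebra ℂ R] [DecidableEq ι] (E : Matrix ι ι R) :
    powerSeriesTrace (-1) E = (matEval E (1 - X)).det := by
  refine eq_of_log_deriv_eq (T := -powTrace E (X * mk 1)) ?_ (eulerD_det_one_sub E) ?_ ?_
  · rw [eulerD_powerSeriesTrace]
    simp
  · rw [map_neg, coeff_zero_powTrace_X_mul, neg_zero]
  · rw [coeff_zero_det_matEval E (by simp), powerSeriesTrace, coeff_mk, powerTrace_zero]
    simp

end NewtonSeries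

/-! ### The substitution `u = q ^ d` -/

section Expansion

open PowerSeries

/-- The substitution `X ↦ X ^ d`, as a ring homomorphism. -/
def expandHom (R : Type*) [CommRing R] {d : ℕ} (hd : d ≠ 0) : PowerSeries R →+* PowerSeries R :=
  (expand d hd).toRingHom

theorem expandHom_X {R : Type*} [CommRing R] {d : ℕ} (hd : d ≠ 0) : expandHom R hd X = X ^ d :=
  expand_X d hd

theorem expandHom_C {R : Type*} [CommRing R] {d : ℕ} (hd : d ≠ 0) (r : R) :
    expandHom R hd (C r) = C r :=
  expand_C d hd r

theorem expandHom_mk {R : Type*} [CommRing R] {d : ℕ} (hd : d ≠ 0) (f : ℕ → R) :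
    expandHom R hd (mk f) = mk fun m => if d ∣ m then f (m / d) else 0 := by
  ext m
  rw [coeff_mk]
  refine (coeff_expand d hd (mk f)).trans ?_
  simp

variable {F : Type*} [CommRing F] [Algebra ℂ F] {ι : Type*} [Fintype ι] [DecidableEq ι]

/-- Constants in the inner variable. -/
def innerC (F : Type*) [CommRing F] : PowerSeries F →+* PowerSeries (PowerSeries F) := map C

/-- The determinant of `1 - q exp(tA)` at `q = X ^ d`. -/
def detExp (A : Matrix ι ι F) (d : ℕ) : PowerSeries (PowerSeries F) :=
  (matEval (A.map C) (1 - C (X ^ d) * expBase (PowerSeries F))).det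

theorem innerC_expBase : innerC F (expBase F) = expBase (PowerSeries F) := by
  ext m : 1
  rw [innerC, expBase, expBase, coeff_map, coeff_map, coeff_map, PowerSeries.algebraMap_apply]

/-- In Newton's series the outer variable is `u` and the inner one is the curvature scale `t`. After
`u ↦ X ^ d` the swap makes `t` the outer variable, as needed for logarithmic derivatives in `t`. -/
theorem swapSeries_expand_det {d : ℕ} (hd : d ≠ 0) (A : Matrix ι ι F) :
    swapSeries (expandHom _ hd (matEval (matEval A (expBase F)) (1 - X)).det) = detExp A d := by
  have h := RingHom.map_det (swapSeries.comp (expandHom (PowerSeries F) hd) :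
    PowerSeries (PowerSeries F) →+* PowerSeries (PowerSeries F)) (matEval (matEval A (expBase F)) (1 - X))
  rw [detExp]
  refine h.trans ?_
  congr 1
  rw [sub_eq_add_neg, sub_eq_add_neg, matEval_add, matEval_add, matEval_one, matEval_one]
  ext i j : 1
  rw [RingHom.mapMatrix_apply, Matrix.map_apply, Matrix.add_apply, Matrix.add_apply, map_add]
  congr 1
  · rw [Matrix.one_apply]
    split_ifs <;> simp
  · have h1 : matEval (matEval A (expBase F)) (-X) i j = -(X * C (matEval A (expBase F) i j)) := by
      ext1 m
      rw [coeff_matEval, map_neg, map_neg, coeff_X]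
      rcases m with _ | m
      · simp
      · rw [coeff_succ_X_mul, coeff_C]
        by_cases hm : m = 0
        · subst hm; simp
        · simp [hm]
    have h2 : matEval (A.map C) (-(C (X ^ d) * expBase (PowerSeries F))) i j =
        -(C (X ^ d) * innerC F (matEval A (expBase F) i j)) := by
      have h3 := congrFun (congrFun (map_matEval (C : F →+* PowerSeries F) A (expBase F)) i) j
      rw [Matrix.map_apply] at h3
      rw [innerC, h3, ← innerC, innerC_expBase]
      ext1 m
      rw [coeff_matEval, map_neg, map_neg, coeff_C_mul, coeff_C_mul, coeff_matEval]
      ring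
    rw [h1, h2, map_neg, RingHom.comp_apply]
    rw [map_mul, expandHom_X, expandHom_C, map_mul, map_pow, swapSeries_X, swapSeries_C, map_pow, innerC]

end Expansion
end
end TwistedCancellation

namespace TwistedCancellation
noncomputable section

/-! ### Logarithmic derivative of the twisted form for truncations of `Θ₂` -/

section ThetaBundle

open PowerSeries

variable {F : Type*} [CommRing F] [Algebra ℂ F] {ι : Type*} [Fintype ι] [DecidableEq ι]

/-- The Chern character of a virtual bundle, graded by the power of `t` for the curvature `tA`. -/
def vbEval (A : Matrix ι ι F) : VirtualBundle →+* PowerSeries F :=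
  (MvPolynomial.aeval (Sum.elim (powerTrace 1 (matEval A (expBase F)))
    (powerTrace (-1) (matEval A (expBase F))))).toRingHom

theorem vbEval_symPow (A : Matrix ι ι F) (b : ℕ) :
    vbEval A (symPow b) = powerTrace 1 (matEval A (expBase F)) b := by
  rw [symPow, vbEval]
  split_ifs with h
  · rw [map_one, h, powerTrace_zero]
  · simp

theorem vbEval_extPow (A : Matrix ι ι F) (b : ℕ) :
    vbEval A (extPow b) = powerTrace (-1) (matEval A (expBase F)) b := by
  rw [extPow, vbEval]
  split_ifs with h
  · rw [map_one, h, powerTrace_zero]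
  · simp

/-- Evaluation of series of virtual bundles; the outer variable of the target is `t`. -/
def thetaEval (A : Matrix ι ι F) : PowerSeries VirtualBundle →+* PowerSeries (PowerSeries F) :=
  swapSeries.comp (map (vbEval A))

theorem thetaEval_X (A : Matrix ι ι F) : thetaEval A X = C X := by
  rw [thetaEval, RingHom.comp_apply, map_X, swapSeries_X]

/-- Complex double series as double series over a complex algebra. -/
def dblMap (F : Type*) [CommRing F] [Algebra ℂ F] :
    PowerSeries (PowerSeries ℂ) →+* PowerSeries (PowerSeries F) := map (baseMap F)

theorem dblMap_X : dblMap F X = X := map_X _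

theorem dblMap_C (f : PowerSeries ℂ) : dblMap F (C f) = C (baseMap F f) := map_C _ _

theorem dblMap_constQ (f : PowerSeries ℂ) : dblMap F (constQ f) = innerC F (baseMap F f) := by
  ext m : 1
  simp only [dblMap, constQ, innerC, baseMap, coeff_map, map_C]

theorem dblMap_constQ_exp : dblMap F (constQ (exp ℂ)) = expBase (PowerSeries F) := by
  rw [dblMap_constQ, ← innerC_expBase]
  rfl

/-- The power sum over the inner variable as a parameter. -/
abbrev paramTrace (A : Matrix ι ι F) (f : PowerSeries (PowerSeries ℂ)) :
    PowerSeries (PowerSeries F) := powTrace (A.map C) (dblMap F f)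

theorem paramTrace_add (A : Matrix ι ι F) (f g : PowerSeries (PowerSeries ℂ)) :
    paramTrace A (f + g) = paramTrace A f + paramTrace A g := by
  rw [paramTrace, map_add, powTrace_add]

theorem paramTrace_neg (A : Matrix ι ι F) (f : PowerSeries (PowerSeries ℂ)) :
    paramTrace A (-f) = -paramTrace A f := by
  rw [paramTrace, map_neg, powTrace_neg]

/-- The scalar series `1 - Q ^ d exp x` has logarithmic derivative `-x` times the Lambert term;
Jacobi's formula transfers this to the determinant. -/
theorem eulerD_detExp (A : Matrix ι ι F) {d : ℕ} (hd : d ≠ 0) :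
    eulerD _ (detExp A d) = detExp A d * -paramTrace A (X * lambert d) := by
  rw [← paramTrace_neg]
  refine eulerD_det_matEval _ ?_
  have h := congrArg (dblMap F) (lambert_mul hd)
  have h2 := congrArg (dblMap F) (congrArg constQ eulerD_exp)
  simp only [map_mul, map_sub, map_one, dblMap_C, dblMap_constQ_exp, map_pow, baseMap_X,
    constQ_X, dblMap_X] at h h2
  have h3 : eulerD _ (expBase (PowerSeries F)) = X * expBase (PowerSeries F) := by
    rw [expBase, ← map_eulerD, eulerD_exp, map_mul, map_X]
  rw [map_neg, map_mul, dblMap_X, map_sub, eulerD_one, eulerD_mul,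
    eulerD_C, h3, map_pow]
  linear_combination X * h

theorem detExp_eq (A : Matrix ι ι F) {d : ℕ} (hd : d ≠ 0) :
    swapSeries (map (vbEval A) (mk fun m => if d ∣ m then (-1) ^ (m / d) * extPow (m / d) else 0)) =
      detExp A d := by
  rw [← swapSeries_expand_det hd, ← powerSeriesTrace_neg_one, powerSeriesTrace, expandHom_mk]
  congr 1
  ext m : 1
  rw [coeff_map, coeff_mk, coeff_mk]
  split_ifs with h
  · rw [map_mul, vbEval_extPow]
    simp
  · exact map_zero _

theorem symSeries_mul_detExp (A : Matrix ι ι F) {d : ℕ} (hd : d ≠ 0) :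
    swapSeries (map (vbEval A) (mk fun m => if d ∣ m then symPow (m / d) else 0)) *
      detExp A d = 1 := by
  have h := congrArg swapSeries (congrArg (expandHom _ hd)
    (powerSeriesTrace_one_mul_det (matEval A (expBase F))))
  rw [map_mul, map_mul, swapSeries_expand_det, powerSeriesTrace, expandHom_mk, map_one,
    map_one] at h
  rw [← h]
  congr 2
  ext m : 1
  rw [coeff_map, coeff_mk, coeff_mk]
  split_ifs with h
  · rw [vbEval_symPow]
    simp
  · exact map_zero _

theorem thetaEval_one_sub (A : Matrix ι ι F) (N d : ℕ) :
    thetaEval A ((1 - X ^ d) ^ N) = C ((1 - X ^ d) ^ N) := by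
  simp only [map_pow, map_sub, map_one, thetaEval_X]

theorem eulerD_thetaEval_totalSym (A : Matrix ι ι F) (N : ℕ) {d : ℕ} (hd : d ≠ 0) :
    eulerD _ (thetaEval A (totalSym N d)) =
      thetaEval A (totalSym N d) * paramTrace A (X * lambert d) := by
  have h := symSeries_mul_detExp A hd
  rw [totalSym, map_mul, thetaEval_one_sub, eulerD_mul, eulerD_C, mul_zero, zero_add,
    thetaEval, RingHom.comp_apply]
  generalize swapSeries (map (vbEval A) (mk fun m => if d ∣ m then symPow (m / d) else 0)) = s at *
  have h1 := congrArg (eulerD _) h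
  rw [eulerD_mul, eulerD_detExp A hd, eulerD_one] at h1
  have h2 : eulerD _ s = s * paramTrace A (X * lambert d) := by
    linear_combination s * h1 - (eulerD _ s - s * paramTrace A (X * lambert d)) * h
  rw [h2]
  ring

theorem eulerD_thetaEval_totalExt (A : Matrix ι ι F) (N : ℕ) {d : ℕ} (hd : d ≠ 0) :
    eulerD _ (thetaEval A (totalExt N d)) =
      thetaEval A (totalExt N d) * -paramTrace A (X * lambert d) := by
  have hinv : (1 - X ^ d : PowerSeries VirtualBundle) ^ N *
      invOfUnit ((1 - X ^ d) ^ N) 1 = 1 := by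
    refine mul_invOfUnit _ _ ?_
    simp [hd]
  have h1 := congrArg (thetaEval A) hinv
  rw [map_mul, thetaEval_one_sub, map_one] at h1
  have h2 := congrArg (eulerD _) h1
  rw [eulerD_mul, eulerD_C, mul_zero, add_zero, eulerD_one] at h2
  have h3 : eulerD _ (thetaEval A (invOfUnit ((1 - X ^ d) ^ N) 1)) = 0 := by
    linear_combination thetaEval A (invOfUnit ((1 - X ^ d) ^ N) 1) * h2 -
      eulerD _ (thetaEval A (invOfUnit ((1 - X ^ d) ^ N) 1)) * h1
  rw [totalExt, map_mul, eulerD_mul, h3, mul_zero, zero_add]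
  have h4 : thetaEval A (mk fun m => if d ∣ m then (-1) ^ (m / d) * extPow (m / d) else 0) =
      detExp A d := detExp_eq A hd
  rw [h4, eulerD_detExp A hd]
  ring

theorem X_pow_dvd_mk_sub_one {R : Type*} [CommRing R] {f : ℕ → R} (h0 : f 0 = 1) (d : ℕ) :
    X ^ d ∣ (mk fun m => if d ∣ m then f (m / d) else 0) - 1 := by
  rw [X_pow_dvd_iff]
  intro m hm
  rw [map_sub, coeff_mk, coeff_one]
  by_cases h : m = 0
  · subst h
    simp [h0]
  · rw [if_neg h, if_neg (Nat.not_dvd_of_pos_of_lt (by omega) hm), sub_zero]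

theorem X_pow_dvd_one_sub_pow_sub_one {R : Type*} [CommRing R] (d N : ℕ) :
    (X : PowerSeries R) ^ d ∣ (1 - X ^ d) ^ N - 1 := by
  have h := sub_dvd_pow_sub_pow (1 - (X : PowerSeries R) ^ d) 1 N
  rw [one_pow, sub_sub_cancel_left, neg_dvd] at h
  exact h

theorem dvd_mul_sub_one {R : Type*} [CommRing R] {x a b : R} (ha : x ∣ a - 1) (hb : x ∣ b - 1) :
    x ∣ a * b - 1 := by
  have e : a * b - 1 = (a - 1) * b + (b - 1) := by ring
  rw [e]
  exact dvd_add (ha.mul_right _) hb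

theorem X_pow_dvd_totalSym (N d : ℕ) : X ^ d ∣ totalSym N d - 1 := by
  rw [totalSym]
  exact dvd_mul_sub_one (X_pow_dvd_mk_sub_one (by simp [symPow]) d)
    (X_pow_dvd_one_sub_pow_sub_one d N)

theorem X_pow_dvd_totalExt (N : ℕ) {d : ℕ} (hd : d ≠ 0) : X ^ d ∣ totalExt N d - 1 := by
  rw [totalExt]
  refine dvd_mul_sub_one (X_pow_dvd_mk_sub_one (f := fun b => (-1) ^ b * extPow b)
    (by simp [extPow]) d) ?_
  have hinv : (1 - X ^ d : PowerSeries VirtualBundle) ^ N *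
      invOfUnit ((1 - X ^ d) ^ N) 1 = 1 := by
    refine mul_invOfUnit _ _ ?_
    simp [hd]
  have h := (X_pow_dvd_one_sub_pow_sub_one (R := VirtualBundle) d N).mul_right
    (-invOfUnit ((1 - X ^ d) ^ N) 1)
  have e : ((1 - X ^ d : PowerSeries VirtualBundle) ^ N - 1) * -invOfUnit ((1 - X ^ d) ^ N) 1 =
      invOfUnit ((1 - X ^ d) ^ N) 1 - 1 := by
    linear_combination -hinv
  rwa [e] at h

theorem X_pow_dvd_theta_sub (N L : ℕ) : X ^ (L + 1) ∣ Theta₂ N -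
    ∏ j ∈ Finset.Icc 1 L, totalSym N (2 * j) * totalExt N (2 * j - 1) := by
  refine dvd_infProd_sub (fun m => ?_) L
  rcases Nat.eq_zero_or_pos m with rfl | hm
  · simp
  · exact dvd_mul_sub_one ((pow_dvd_pow X (by omega)).trans (X_pow_dvd_totalSym N (2 * m)))
      ((pow_dvd_pow X (by omega)).trans (X_pow_dvd_totalExt N (d := 2 * m - 1) (by omega)))

/-- The rank corrections `(1 - Q ^ d) ^ (±N)` do not depend on `t`, so only symmetric powers (even
`d`, sign `+`) and exterior powers (odd `d`, sign `-`) contribute. -/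
theorem eulerD_thetaEval_prod (A : Matrix ι ι F) (N L : ℕ) :
    eulerD _ (thetaEval A (∏ j ∈ Finset.Icc 1 L, totalSym N (2 * j) * totalExt N (2 * j - 1))) =
      thetaEval A (∏ j ∈ Finset.Icc 1 L, totalSym N (2 * j) * totalExt N (2 * j - 1)) *
        paramTrace A (X * ∑ n ∈ Finset.range L, (lambert (2 * n + 2) - lambert (2 * n + 1))) := by
  induction L with
  | zero =>
    simp [paramTrace, powTrace_zero]
  | succ L ih =>
    have e : ∀ a b c : PowerSeries (PowerSeries ℂ), X * (a + (b - c)) =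
        X * a + (X * b + -(X * c)) := fun a b c => by ring
    rw [Finset.prod_Icc_succ_top (by omega), map_mul, eulerD_mul, ih, map_mul,
      eulerD_mul, eulerD_thetaEval_totalSym A N (by omega),
      eulerD_thetaEval_totalExt A N (by omega), Finset.sum_range_succ, e, paramTrace_add,
      paramTrace_add, paramTrace_neg, show 2 * (L + 1) - 1 = 2 * L + 1 by omega,
      show 2 * (L + 1) = 2 * L + 2 by ring]
    ring

theorem eulerD_innerC {F : Type*} [CommRing F] (f : PowerSeries F) : eulerD _ (innerC F f) = innerC F (eulerD F f) :=
  (map_eulerD _ _).symm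

theorem paramTrace_constQ (A : Matrix ι ι F) (f : PowerSeries ℂ) :
    paramTrace A (constQ f) = innerC F (powTrace A (baseMap F f)) := by
  rw [paramTrace, dblMap_constQ, innerC, map_powTrace]

/-- The logarithmic derivative of a square root of a determinant. -/
theorem eulerD_of_sq_eq_det (A : Matrix ι ι F) {a : PowerSeries F} (ha : coeff 0 a = 1)
    {f ψ : PowerSeries ℂ} (hf : eulerD ℂ f = ψ * f) (h : a ^ 2 = (matEval A (baseMap F f)).det) :
    eulerD F a = a * powTrace A (baseMap F (C (1 / 2) * ψ)) := by
  have h1 := eulerD_det_matEval A (f := baseMap F f) (ψ := baseMap F ψ)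
    (by rw [eulerD_baseMap, hf, map_mul])
  rw [← h, Derivation.leibniz_pow, smul_eq_mul, nsmul_eq_mul] at h1
  have hu : IsUnit a := isUnit_iff_constantCoeff.2 (by
    rw [coeff_zero_eq_constantCoeff_apply] at ha
    rw [ha]
    exact isUnit_one)
  have h2 : C (algebraMap ℂ F (1 / 2)) * 2 = 1 := by
    rw [← map_ofNat (C (R := F)) 2, ← map_mul, ← map_ofNat (algebraMap ℂ F) 2, ← map_mul]
    norm_num
  have h3 : baseMap F (C (1 / 2) * ψ) = C (algebraMap ℂ F (1 / 2)) * baseMap F ψ := by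
    rw [map_mul, baseMap, map_C]
  rw [h3, powTrace_C_mul]
  refine hu.mul_left_cancel ?_
  norm_num at h1
  linear_combination C (algebraMap ℂ F (1 / 2)) * h1 - (a * eulerD F a) * h2

/-- The logarithmic derivative of the truncated twisted `Â`-form. -/
theorem eulerD_twisted_prod (A : Matrix ι ι F) (N L : ℕ) {a : PowerSeries F}
    (ha : coeff 0 a = 1) (h : a ^ 2 = (matEval A (baseMap F sinhcHalfInv)).det) :
    eulerD _ (innerC F a *
      thetaEval A (∏ j ∈ Finset.Icc 1 L, totalSym N (2 * j) * totalExt N (2 * j - 1))) =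
    innerC F a *
      thetaEval A (∏ j ∈ Finset.Icc 1 L, totalSym N (2 * j) * totalExt N (2 * j - 1)) *
        paramTrace A (jacPsi L) := by
  rw [eulerD_mul, eulerD_thetaEval_prod, eulerD_innerC,
    eulerD_of_sq_eq_det A ha eulerD_sinhcHalfInv h, jacPsi, paramTrace_add, paramTrace_constQ,
    map_mul]
  ring

end ThetaBundle
end
end TwistedCancellation

namespace TwistedCancellation
noncomputable section

/-! ### One universal polynomial for two solutions -/

section CommonCoefficients

open PowerSeries

/-- A differential operator equation determines the coefficient of `t ^ (4 k + 2)` as a weighted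
homogeneous polynomial in the parameters. -/
theorem coeff_mem_weightSpan_of_log_deriv {F K : Type*} [CommRing F] [Algebra ℂ F] [CommRing K]
    [Algebra F K] {ι : Type*} [Fintype ι] [DecidableEq ι] {A : Matrix ι ι F}
    (hodd : ∀ m, Odd m → (A ^ m).trace = 0) {δ ε : K} {V ψ P : PowerSeries K}
    (hV0 : coeff 0 V = -1)
    (hV : (eulerD K V - V) ^ 2 = (V ^ 2 + 2 * C δ * X ^ 2) ^ 2 - 4 * C ε * X ^ 4)
    (hψ : ψ + rescale (-1) ψ = V + 1) (hP0 : coeff 0 P = 1)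
    (hP : eulerD K P = P * powTrace (A.map (algebraMap F K)) ψ) (m : ℕ) :
    coeff m P ∈ weightSpan F δ ε m := by
  -- The symmetrization controls the even coefficients of `ψ` only; the odd ones meet vanishing
  -- traces.
  have hψ' : ∀ j, Even j → ((2 : ℕ) : K) * coeff j ψ = coeff j V + coeff j 1 := fun j hj => by
    have h := congrArg (coeff j) hψ
    rw [map_add, map_add, coeff_rescale, hj.neg_one_pow] at h
    push_cast
    linear_combination h
  have hψ0 : coeff 0 ψ = 0 := by
    have h := hψ' 0 (by simp)
    rw [hV0, coeff_zero_one, neg_add_cancel] at h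
    have h1 : algebraMap F K (algebraMap ℂ F (1 / 2)) * ((2 : ℕ) : K) = 1 := by
      rw [← map_natCast (algebraMap F K), ← map_natCast (algebraMap ℂ F), ← map_mul, ← map_mul]
      norm_num
    linear_combination (algebraMap F K (algebraMap ℂ F (1 / 2))) * h - coeff 0 ψ * h1
  refine mem_weightSpan_of_log_deriv (P := fun j => coeff j P) (ψ := fun j => coeff j ψ) (p := fun j => (A ^ j).trace)
    hP0 (fun m => ?_) (fun j hj => ?_) m
  · have h := congrArg (coeff m) hP
    have htr : ∀ j, ((A.map (algebraMap F K)) ^ j).trace = algebraMap F K (A ^ j).trace := fun j => by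
      rw [← Matrix.map_pow, Matrix.trace, Matrix.trace, map_sum]
      rfl
    rw [coeff_eulerD, coeff_mul, Finset.Nat.sum_antidiagonal_eq_sum_range_succ_mk,
      Finset.sum_range_succ] at h
    simp only [coeff_powTrace, Nat.sub_self, hψ0, zero_mul, mul_zero, add_zero, htr] at h
    exact h
  · have hev : Even (j + 1) := by
      by_contra ho
      exact hj (hodd _ (Nat.not_even_iff_odd.1 ho))
    refine mem_weightSpan_of_natCast_mul (m := 2) (by norm_num) ?_
    rw [hψ' _ hev, coeff_one, if_neg (Nat.succ_ne_zero j), add_zero]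
    exact coeff_mem_weightSpan hV0 hV _

/-- The power series with pairs of coefficients. -/
def pairSeries {K₁ K₂ : Type*} [CommRing K₁] [CommRing K₂] (f : PowerSeries K₁)
    (g : PowerSeries K₂) : PowerSeries (K₁ × K₂) := mk fun m => (coeff m f, coeff m g)

section Pair

variable {K₁ K₂ : Type*} [CommRing K₁] [CommRing K₂]

@[simp] theorem map_fst_pairSeries (f : PowerSeries K₁) (g : PowerSeries K₂) :
    map (RingHom.fst K₁ K₂) (pairSeries f g) = f := by
  ext m
  simp [pairSeries]

@[simp] theorem map_snd_pairSeries (f : PowerSeries K₁) (g : PowerSeries K₂) :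
    map (RingHom.snd K₁ K₂) (pairSeries f g) = g := by
  ext m
  simp [pairSeries]

theorem prod_series_ext {f g : PowerSeries (K₁ × K₂)}
    (h1 : map (RingHom.fst K₁ K₂) f = map (RingHom.fst K₁ K₂) g)
    (h2 : map (RingHom.snd K₁ K₂) f = map (RingHom.snd K₁ K₂) g) : f = g := by
  ext1 m
  have e1 := congrArg (coeff m) h1
  have e2 := congrArg (coeff m) h2
  rw [coeff_map, coeff_map] at e1 e2
  exact Prod.ext e1 e2

end Pair

theorem map_rescale_neg_one {R S : Type*} [CommRing R] [CommRing S] (h : R →+* S)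
    (f : PowerSeries R) : map h (rescale (-1) f) = rescale (-1) (map h f) := by
  ext m
  simp

/-- Two solutions of the same type share their weighted homogeneous polynomial. -/
theorem exists_common_coeff {F K₁ K₂ : Type*} [CommRing F] [Algebra ℂ F] [CommRing K₁]
    [Algebra F K₁] [CommRing K₂] [Algebra F K₂] {ι : Type*} [Fintype ι] [DecidableEq ι]
    {A : Matrix ι ι F} (hodd : ∀ m, Odd m → (A ^ m).trace = 0)
    {δ₁ ε₁ : K₁} {V₁ ψ₁ P₁ : PowerSeries K₁} (hV0₁ : coeff 0 V₁ = -1)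
    (hV₁ : (eulerD K₁ V₁ - V₁) ^ 2 = (V₁ ^ 2 + 2 * C δ₁ * X ^ 2) ^ 2 - 4 * C ε₁ * X ^ 4)
    (hψ₁ : ψ₁ + rescale (-1) ψ₁ = V₁ + 1) (hP0₁ : coeff 0 P₁ = 1)
    (hP₁ : eulerD K₁ P₁ = P₁ * powTrace (A.map (algebraMap F K₁)) ψ₁)
    {δ₂ ε₂ : K₂} {V₂ ψ₂ P₂ : PowerSeries K₂} (hV0₂ : coeff 0 V₂ = -1)
    (hV₂ : (eulerD K₂ V₂ - V₂) ^ 2 = (V₂ ^ 2 + 2 * C δ₂ * X ^ 2) ^ 2 - 4 * C ε₂ * X ^ 4)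
    (hψ₂ : ψ₂ + rescale (-1) ψ₂ = V₂ + 1) (hP0₂ : coeff 0 P₂ = 1)
    (hP₂ : eulerD K₂ P₂ = P₂ * powTrace (A.map (algebraMap F K₂)) ψ₂) (k : ℕ) :
    ∃ s : Fin (k + 1) → F,
      coeff (4 * k + 2) P₁ = ∑ r : Fin (k + 1), algebraMap F K₁ (s r) *
        (δ₁ ^ (2 * k + 1 - 2 * (r : ℕ)) * ε₁ ^ (r : ℕ)) ∧
      coeff (4 * k + 2) P₂ = ∑ r : Fin (k + 1), algebraMap F K₂ (s r) *
        (δ₂ ^ (2 * k + 1 - 2 * (r : ℕ)) * ε₂ ^ (r : ℕ)) := by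
  have hm1 : (A.map (algebraMap F (K₁ × K₂))).map (RingHom.fst K₁ K₂) =
      A.map (algebraMap F K₁) := rfl
  have hm2 : (A.map (algebraMap F (K₁ × K₂))).map (RingHom.snd K₁ K₂) =
      A.map (algebraMap F K₂) := rfl
  -- In the product ring the two problems are one. Scalars from `F` act diagonally, so a single
  -- family `s` serves both components.
  have h := coeff_mem_weightSpan_of_log_deriv (K := K₁ × K₂) (δ := (δ₁, δ₂)) (ε := (ε₁, ε₂))
    (V := pairSeries V₁ V₂) (ψ := pairSeries ψ₁ ψ₂) (P := pairSeries P₁ P₂) hodd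
    (by rw [pairSeries, coeff_mk, hV0₁, hV0₂]; rfl)
    (by
      refine prod_series_ext ?_ ?_
      · simp only [map_pow, map_sub, map_eulerD, map_fst_pairSeries, map_add, map_mul, map_C,
          map_X, map_ofNat]
        exact hV₁
      · simp only [map_pow, map_sub, map_eulerD, map_snd_pairSeries, map_add, map_mul, map_C,
          map_X, map_ofNat]
        exact hV₂)
    (by
      refine prod_series_ext ?_ ?_
      · simpa only [map_add, map_rescale_neg_one, map_fst_pairSeries, map_one] using hψ₁
      · simpa only [map_add, map_rescale_neg_one, map_snd_pairSeries, map_one] using hψ₂)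
    (by rw [pairSeries, coeff_mk, hP0₁, hP0₂]; rfl)
    (by
      refine prod_series_ext ?_ ?_
      · simpa only [map_mul, map_eulerD, map_fst_pairSeries, map_powTrace, hm1] using hP₁
      · simpa only [map_mul, map_eulerD, map_snd_pairSeries, map_powTrace, hm2] using hP₂)
    (4 * k + 2)
  obtain ⟨s, hs⟩ := exists_of_mem_weightSpan h
  refine ⟨s, ?_, ?_⟩
  · have := congrArg (RingHom.fst K₁ K₂) hs
    rw [map_sum] at this
    simpa [pairSeries, Algebra.smul_def] using this
  · have := congrArg (RingHom.snd K₁ K₂) hs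
    rw [map_sum] at this
    simpa [pairSeries, Algebra.smul_def] using this

end CommonCoefficients

/-! ### Truncated power series rings -/

section Truncation

open PowerSeries

variable (F : Type*) [CommRing F] (L : ℕ)

/-- The truncated power series ring `F[X] / X ^ L`. -/
abbrev TruncRing : Type _ := PowerSeries F ⧸ Ideal.span {(X : PowerSeries F) ^ L}

/-- The projection to the truncated power series ring. -/
def truncMk : PowerSeries F →+* TruncRing F L := Ideal.Quotient.mk _

variable {F L}

theorem truncMk_eq_iff {f g : PowerSeries F} :
    truncMk F L f = truncMk F L g ↔ ∀ m < L, coeff m f = coeff m g := by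
  rw [truncMk, Ideal.Quotient.eq, Ideal.mem_span_singleton, X_pow_dvd_iff]
  simp only [map_sub, sub_eq_zero]

theorem truncMk_X_pow : truncMk F L X ^ L = 0 := by
  rw [← map_pow, truncMk, Ideal.Quotient.eq_zero_iff_mem]
  exact Ideal.mem_span_singleton_self _

theorem algebraMap_truncRing (a : F) : algebraMap F (TruncRing F L) a = truncMk F L (C a) := rfl

theorem algebraMap_complex_truncRing [Algebra ℂ F] (a : ℂ) :
    algebraMap ℂ (TruncRing F L) a = truncMk F L (C (algebraMap ℂ F a)) :=
  congrArg (truncMk F L) (PowerSeries.algebraMap_apply (R := ℂ) (A := F))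

end Truncation

/-! ### The common polynomial for the twisted `Â` and `L̂` forms -/

section Evaluation

open PowerSeries

variable {F : Type*} [CommRing F] [Algebra ℂ F] {ι : Type*} [Fintype ι] [DecidableEq ι]

theorem coeff_zero_det_matEval_eq {R : Type*} [CommRing R] (E : Matrix ι ι R)
    (f : PowerSeries R) : coeff 0 (matEval E f).det = coeff 0 f ^ Fintype.card ι := by
  rw [coeff_zero_eq_constantCoeff_apply, RingHom.map_det, RingHom.mapMatrix_apply]
  have : (matEval E f).map constantCoeff = coeff 0 f • (1 : Matrix ι ι R) := by
    ext i j
    rw [Matrix.map_apply, ← coeff_zero_eq_constantCoeff_apply, coeff_matEval, pow_zero,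
      Matrix.smul_apply, smul_eq_mul]
  rw [this, Matrix.det_smul, Matrix.det_one, mul_one]

theorem coeff_zero_detExp (A : Matrix ι ι F) (d : ℕ) :
    coeff 0 (detExp A d) = (1 - X ^ d) ^ Fintype.card ι := by
  rw [detExp, coeff_zero_det_matEval_eq, map_sub, coeff_C_mul, expBase, coeff_map, coeff_zero_one,
    coeff_zero_eq_constantCoeff_apply, constantCoeff_exp, map_one, mul_one]

/-- Subtracting the trivial bundle of full rank is what normalizes the degree-zero part to `1`. -/
theorem coeff_zero_thetaEval_totalSym (A : Matrix ι ι F) {d : ℕ} (hd : d ≠ 0) :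
    coeff 0 (thetaEval A (totalSym (Fintype.card ι) d)) = 1 := by
  have h := congrArg constantCoeff (symSeries_mul_detExp A hd)
  rw [map_mul, map_one, ← coeff_zero_eq_constantCoeff_apply (detExp A d), coeff_zero_detExp] at h
  rw [totalSym, map_mul, thetaEval_one_sub, coeff_zero_eq_constantCoeff_apply, map_mul,
    constantCoeff_C, thetaEval, RingHom.comp_apply]
  exact h

theorem coeff_zero_thetaEval_totalExt (A : Matrix ι ι F) {d : ℕ} (hd : d ≠ 0) :
    coeff 0 (thetaEval A (totalExt (Fintype.card ι) d)) = 1 := by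
  have hinv : (1 - X ^ d : PowerSeries VirtualBundle) ^ Fintype.card ι *
      invOfUnit ((1 - X ^ d) ^ Fintype.card ι) 1 = 1 := by
    refine mul_invOfUnit _ _ ?_
    simp [hd]
  have h1 := congrArg constantCoeff (congrArg (thetaEval A) hinv)
  rw [map_mul, thetaEval_one_sub, map_one, map_mul, constantCoeff_C, map_one] at h1
  have h4 : thetaEval A (mk fun m => if d ∣ m then (-1) ^ (m / d) * extPow (m / d) else 0) =
      detExp A d := detExp_eq A hd
  rw [totalExt, map_mul, h4, coeff_zero_eq_constantCoeff_apply, map_mul,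
    ← coeff_zero_eq_constantCoeff_apply (detExp A d), coeff_zero_detExp]
  exact h1

theorem coeff_zero_thetaEval_prod (A : Matrix ι ι F) (L : ℕ) :
    coeff 0 (thetaEval A (∏ j ∈ Finset.Icc 1 L,
      totalSym (Fintype.card ι) (2 * j) * totalExt (Fintype.card ι) (2 * j - 1))) = 1 := by
  rw [map_prod, coeff_zero_eq_constantCoeff_apply, map_prod]
  refine Finset.prod_eq_one fun j hj => ?_
  have hj' := (Finset.mem_Icc.1 hj).1
  rw [map_mul, map_mul, ← coeff_zero_eq_constantCoeff_apply, ← coeff_zero_eq_constantCoeff_apply,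
    coeff_zero_thetaEval_totalSym A (by omega), coeff_zero_thetaEval_totalExt A (by omega),
    one_mul]

/-- The parameter `δ` at the other cusp. -/
def cuspDelta : PowerSeries ℂ := C (1 / 4) + 6 * X

/-- The parameter `ε` at the other cusp. -/
def cuspEps : PowerSeries ℂ := C (1 / 16) - X + 8 * X ^ 2

/-- The coefficients of the twisted `Â`-form and of the twisted `L̂`-forms are given by the same
weighted homogeneous polynomial. -/
theorem exists_common_polynomial {A : Matrix ι ι F} (hodd : ∀ m, Odd m → (A ^ m).trace = 0)
    {a l : PowerSeries F} (ha0 : coeff 0 a = 1) (hl0 : coeff 0 l = 1)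
    (ha : a ^ 2 = (matEval A (baseMap F sinhcHalfInv)).det)
    (hl : l ^ 2 = (matEval A (baseMap F cothHalf)).det) {τ : PowerSeries F}
    (hτ : τ = powTrace A (expBase F) - (Fintype.card ι : PowerSeries F)) (k : ℕ) :
    ∃ s : Fin (k + 1) → F,
      (∀ m < 3, coeff m (C (coeff (4 * k + 2) l) + C (2 * coeff (4 * k + 2) (l * τ)) * X +
          C (2 * coeff (4 * k + 2) (l * τ ^ 2)) * X ^ 2) =
        ∑ r : Fin (k + 1), s r * algebraMap ℂ F (coeff m
          (cuspDelta ^ (2 * k + 1 - 2 * (r : ℕ)) * cuspEps ^ (r : ℕ)))) ∧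
      (∀ m < k + 1, coeff (4 * k + 2) (a * vbEval A (B (Fintype.card ι) m)) =
        ∑ r : Fin (k + 1), s r * algebraMap ℂ F (coeff m
          (jacDelta ^ (2 * k + 1 - 2 * (r : ℕ)) * jacEps ^ (r : ℕ)))) := by
  set κ : TruncRing F 3 := truncMk F 3 X with hκ
  have hκ3 : κ ^ 3 = 0 := truncMk_X_pow
  set N := Fintype.card ι with hN
  -- first cusp
  set P₁ : PowerSeries (TruncRing F 3) := map (algebraMap F _) l *
    (1 + 2 * C κ * map (algebraMap F _) τ + 2 * C κ ^ 2 * map (algebraMap F _) τ ^ 2) with hP₁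
  -- The twist in `P₁` is `exp(2 κ τ)`, exact since `κ³ = 0`. Its logarithmic derivative is `2 κ`
  -- times that of the power sum `τ`, namely the power sum of `2 κ x exp x`; symmetrized in `x` this
  -- is `4 κ x sinh x`.
  set ψ₁ : PowerSeries (TruncRing F 3) := baseMap _ (C (1 / 2) * (1 - xCsch)) +
    C (2 * κ) * (X * expBase _) with hψ₁
  have hbase : ∀ f, map (algebraMap F (TruncRing F 3)) (baseMap F f) = baseMap (TruncRing F 3) f :=
    fun f => by
      ext1 m
      rw [baseMap, baseMap, coeff_map, coeff_map, coeff_map, algebraMap_complex_truncRing,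
        algebraMap_truncRing]
  have e1 : ψ₁ + rescale (-1) ψ₁ = hypV κ + 1 := by
    have h1 : ∀ f, rescale (-1) (baseMap (TruncRing F 3) f) = baseMap _ (rescale (-1) f) :=
      fun f => (map_rescale_neg_one _ f).symm
    have h2 := congrArg (baseMap (TruncRing F 3)) two_mul_X_mul_sinhcSeries
    have h3 : C (1 / 2 : ℂ) * (1 - xCsch) + C (1 / 2) * (1 - xCsch) = 1 - xCsch := by
      rw [← add_mul, ← map_add]
      norm_num
    have h4 := congrArg (baseMap (TruncRing F 3)) h3
    have hE : expBase (TruncRing F 3) = baseMap _ (exp ℂ) := rfl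
    rw [hψ₁, hypV, map_add, map_mul (rescale _), map_mul (rescale _), rescale_X, h1, rescale_C, hE,
      h1, map_mul (rescale _), map_sub (rescale _), map_one, rescale_C, rescale_neg_one_xCsch,
      map_neg, map_one]
    simp only [map_mul, map_sub, map_add, map_one, map_ofNat, baseMap_X] at h2 h4 ⊢
    linear_combination h4 - 2 * C κ * X * h2
  have hτ0 : coeff 0 τ = 0 := by
    have h : coeff 0 ((N : ℕ) : PowerSeries F) = N := by
      rw [coeff_zero_eq_constantCoeff_apply, map_natCast]
    rw [hτ, map_sub, coeff_powTrace, expBase, coeff_map, coeff_zero_eq_constantCoeff_apply,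
      constantCoeff_exp, map_one, one_mul, pow_zero, Matrix.trace_one, h, sub_self]
  have e2 : coeff 0 P₁ = 1 := by
    rw [coeff_zero_eq_constantCoeff_apply] at hl0 hτ0
    have h1 : constantCoeff (map (algebraMap F (TruncRing F 3)) l) = 1 := by
      rw [← coeff_zero_eq_constantCoeff_apply, coeff_map, coeff_zero_eq_constantCoeff_apply, hl0,
        map_one]
    have h2 : constantCoeff (map (algebraMap F (TruncRing F 3)) τ) = 0 := by
      rw [← coeff_zero_eq_constantCoeff_apply, coeff_map, coeff_zero_eq_constantCoeff_apply, hτ0,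
        map_zero]
    rw [hP₁, coeff_zero_eq_constantCoeff_apply, map_mul, map_add, map_add, map_mul, map_mul _ _
      (map (algebraMap F (TruncRing F 3)) τ ^ 2), map_pow, h1, h2, map_one]
    ring
  have e3 : eulerD _ P₁ = P₁ * powTrace (A.map (algebraMap F (TruncRing F 3))) ψ₁ := by
    have h1 := congrArg (map (algebraMap F (TruncRing F 3)))
      (eulerD_of_sq_eq_det A hl0 eulerD_cothHalf hl)
    rw [map_mul, map_eulerD, map_powTrace, hbase] at h1
    have h2 : eulerD F τ = powTrace A (X * expBase F) := by
      rw [hτ, map_sub, eulerD_powTrace, Derivation.map_natCast, sub_zero, expBase, ← map_eulerD,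
        eulerD_exp, map_mul, map_X]
    have h3 := congrArg (map (algebraMap F (TruncRing F 3))) h2
    rw [map_eulerD, map_powTrace, map_mul, map_X, show expBase F = baseMap F (exp ℂ) from rfl,
      hbase, show baseMap (TruncRing F 3) (exp ℂ) = expBase _ from rfl] at h3
    have h4 : (C κ) ^ 3 = 0 := by rw [← map_pow, hκ3, map_zero]
    rw [hψ₁, powTrace_add, powTrace_C_mul, hP₁]
    simp only [eulerD_mul, map_add, eulerD_one, h1, h3, eulerD_C, pow_two, map_mul,
      map_ofNat]
    have h5 : eulerD (TruncRing F 3) 2 = 0 := eulerD_ofNat 2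
    linear_combination (map (algebraMap F (TruncRing F 3)) l * C κ *
      map (algebraMap F (TruncRing F 3)) τ + map (algebraMap F (TruncRing F 3)) l * C κ ^ 2 *
      map (algebraMap F (TruncRing F 3)) τ ^ 2) * h5 + (-4 * map (algebraMap F (TruncRing F 3)) l *
      map (algebraMap F (TruncRing F 3)) τ ^ 2 *
      powTrace (A.map (algebraMap F (TruncRing F 3))) (X * expBase (TruncRing F 3))) * h4
  -- second cusp
  set ρ : PowerSeries ℂ →+* TruncRing F (k + 1) := (truncMk F (k + 1)).comp (baseMap F) with hρ
  set P₂ : PowerSeries (TruncRing F (k + 1)) :=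
    map (truncMk F (k + 1)) (innerC F a * thetaEval A (Theta₂ N)) with hP₂
  have hX0 : ρ X ^ (k + 1) = 0 := by
    rw [hρ, RingHom.comp_apply, baseMap_X, truncMk_X_pow]
  -- Only the powers `Q ^ m` with `m ≤ k` are compared, so `k + 1` factors of the infinite product
  -- are enough.
  have hP₂' : P₂ = map (truncMk F (k + 1)) (innerC F a * thetaEval A
      (∏ j ∈ Finset.Icc 1 (k + 1), totalSym N (2 * j) * totalExt N (2 * j - 1))) := by
    obtain ⟨w, hw⟩ := X_pow_dvd_theta_sub N (k + 1)
    rw [hP₂, sub_eq_iff_eq_add.1 hw]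
    simp only [map_mul, map_add, map_pow, thetaEval_X, map_C]
    have : (C (truncMk F (k + 1) X)) ^ (k + 1 + 1) = 0 := by
      rw [pow_succ, ← map_pow, truncMk_X_pow, map_zero, zero_mul]
    rw [this, zero_mul, zero_add]
  have f1 : map ρ (jacPsi (k + 1)) + rescale (-1) (map ρ (jacPsi (k + 1))) = map ρ jacV + 1 := by
    obtain ⟨w, hw⟩ := jacPsi_add_rescale (k + 1)
    have h := congrArg (map ρ) hw
    rw [map_mul, map_pow, map_C, ← map_pow, hX0, map_zero, zero_mul, map_sub, map_add, map_add,
      map_rescale_neg_one, map_one] at h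
    exact sub_eq_zero.1 h
  have f2 : coeff 0 P₂ = 1 := by
    have h1 := coeff_zero_thetaEval_prod A (k + 1)
    have h2 : coeff 0 (innerC F a) = 1 := by
      rw [innerC, coeff_map, ha0, map_one]
    rw [coeff_zero_eq_constantCoeff_apply] at h1 h2
    rw [hP₂', coeff_map, coeff_zero_eq_constantCoeff_apply, map_mul, h1, h2, one_mul, map_one]
  have f3 : eulerD _ P₂ = P₂ * powTrace (A.map (algebraMap F (TruncRing F (k + 1))))
      (map ρ (jacPsi (k + 1))) := by
    have h1 : map (truncMk F (k + 1)) (dblMap F (jacPsi (k + 1))) = map ρ (jacPsi (k + 1)) := by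
      ext1 m
      simp only [dblMap, coeff_map, hρ, RingHom.comp_apply]
    rw [hP₂', ← map_eulerD, eulerD_twisted_prod A N (k + 1) ha0 ha, map_mul, map_powTrace, h1]
    rfl
  have f4 : (eulerD _ (map ρ jacV) - map ρ jacV) ^ 2 =
      (map ρ jacV ^ 2 + 2 * C (ρ jacDelta) * X ^ 2) ^ 2 - 4 * C (ρ jacEps) * X ^ 4 := by
    have h := congrArg (map ρ) jacV_equation
    simpa only [map_pow, map_sub, map_eulerD, map_add, map_mul, map_C, map_X, map_ofNat] using h
  have f5 : coeff 0 (map ρ jacV) = -1 := by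
    rw [coeff_map, coeff_zero_jacV, map_neg, map_one]
  obtain ⟨s, hs1, hs2⟩ := exists_common_coeff hodd (coeff_zero_hypV κ) (hypV_equation hκ3) e1 e2 e3
    f5 f4 f1 f2 f3 k
  refine ⟨s, ?_, ?_⟩
  · have h1 : coeff (4 * k + 2) P₁ = truncMk F 3 (C (coeff (4 * k + 2) l) +
        C (2 * coeff (4 * k + 2) (l * τ)) * X + C (2 * coeff (4 * k + 2) (l * τ ^ 2)) * X ^ 2) := by
      have h2 : P₁ = map (algebraMap F _) l + C (2 * κ) * map (algebraMap F _) (l * τ) +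
          C (2 * κ ^ 2) * map (algebraMap F _) (l * τ ^ 2) := by
        rw [hP₁]
        simp only [map_mul, map_pow, map_ofNat]
        ring
      rw [h2, map_add, map_add, coeff_C_mul, coeff_C_mul, coeff_map, coeff_map, coeff_map]
      simp only [map_add, algebraMap_truncRing, map_mul, map_pow,
        map_ofNat, hκ]
      ring
    have h2 : ∑ r : Fin (k + 1), algebraMap F (TruncRing F 3) (s r) *
        ((algebraMap ℂ (TruncRing F 3) (1 / 4) + 6 * κ) ^ (2 * k + 1 - 2 * (r : ℕ)) *
          (algebraMap ℂ (TruncRing F 3) (1 / 16) - κ + 8 * κ ^ 2) ^ (r : ℕ)) =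
        truncMk F 3 (∑ r : Fin (k + 1), C (s r) *
          baseMap F (cuspDelta ^ (2 * k + 1 - 2 * (r : ℕ)) * cuspEps ^ (r : ℕ))) := by
      have h3 : ∀ c : ℂ, baseMap F (C c) = C (algebraMap ℂ F c) := fun c => map_C _ _
      rw [map_sum]
      refine Finset.sum_congr rfl fun r _ => ?_
      simp only [map_mul, map_pow, cuspDelta, cuspEps, map_add, map_sub, map_ofNat, baseMap_X, h3,
        algebraMap_truncRing, algebraMap_complex_truncRing, hκ]
    rw [h1, h2, truncMk_eq_iff] at hs1
    intro m hm
    rw [hs1 m hm, map_sum]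
    refine Finset.sum_congr rfl fun r _ => ?_
    rw [coeff_C_mul, baseMap, coeff_map]
  · have h2 : ∑ r : Fin (k + 1), algebraMap F (TruncRing F (k + 1)) (s r) *
        ((ρ jacDelta) ^ (2 * k + 1 - 2 * (r : ℕ)) * (ρ jacEps) ^ (r : ℕ)) =
        truncMk F (k + 1) (∑ r : Fin (k + 1), C (s r) *
          baseMap F (jacDelta ^ (2 * k + 1 - 2 * (r : ℕ)) * jacEps ^ (r : ℕ))) := by
      rw [map_sum]
      refine Finset.sum_congr rfl fun r _ => ?_
      simp only [map_mul, map_pow, algebraMap_truncRing, hρ, RingHom.comp_apply]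
    rw [h2, hP₂, coeff_map, truncMk_eq_iff] at hs2
    intro m hm
    have h3 := hs2 m hm
    rw [map_sum] at h3
    -- Swapping back makes `Q` the outer variable, whose coefficients are the bundles `B_m`.
    have h4 : innerC F a * thetaEval A (Theta₂ N) =
        swapSeries (C a * map (vbEval A) (Theta₂ N)) := by
      rw [map_mul, swapSeries_C]
      rfl
    rw [h4, coeff_swapSeries, coeff_C_mul, coeff_map] at h3
    rw [B, h3]
    refine Finset.sum_congr rfl fun r _ => ?_
    rw [coeff_C_mul, baseMap, coeff_map]

end Evaluation
end
end TwistedCancellation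

namespace TwistedCancellation
noncomputable section

/-! ### The canonical integer matrix -/

section CanonicalMatrix

open PowerSeries

/-- The coefficients of the monomials `(8 δ₂) ^ (2 k + 1 - 2 r) ε₂ ^ r`. -/
def monomialMatrix (k : ℕ) : Matrix (Fin (k + 1)) (Fin (k + 1)) ℤ := Matrix.of fun m r =>
  coeff (m : ℕ) (eightDelta₂ ^ (2 * k + 1 - 2 * (r : ℕ)) * epsilon₂ ^ (r : ℕ))

theorem coeff_zero_theta₁Fourth : coeff 0 theta₁Fourth = 0 := by
  simp [theta₁Fourth]

theorem coeff_one_theta₁Fourth : coeff 1 theta₁Fourth = 1 := by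
  rw [theta₁Fourth, show 1 = 0 + 1 from rfl, coeff_succ_X_mul, infProd, coeff_mk]
  simp

theorem coeff_zero_theta₃Fourth : coeff 0 theta₃Fourth = 1 := by
  rw [theta₃Fourth, infProd, coeff_mk]
  simp

theorem coeff_one_theta₃Fourth : coeff 1 theta₃Fourth = 8 := by
  rw [theta₃Fourth, infProd, coeff_mk, Finset.Icc_self, Finset.prod_singleton, coeff_one_pow,
    coeff_one_mul, coeff_one_pow]
  simp [coeff_X_pow, coeff_one, coeff_X]

theorem constantCoeff_eightDelta₂ : constantCoeff eightDelta₂ = -1 := by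
  have h1 := coeff_zero_theta₁Fourth
  have h3 := coeff_zero_theta₃Fourth
  rw [coeff_zero_eq_constantCoeff_apply] at h1 h3
  rw [eightDelta₂, map_neg, map_add, map_mul, h1, h3]
  simp

theorem coeff_one_eightDelta₂ : coeff 1 eightDelta₂ = -24 := by
  have h16 : (16 : PowerSeries ℤ) = C 16 := (map_ofNat C 16).symm
  rw [eightDelta₂, map_neg, map_add, h16, coeff_C_mul, coeff_one_theta₁Fourth,
    coeff_one_theta₃Fourth]
  norm_num

theorem exists_epsilon₂ : ∃ u : PowerSeries ℤ, constantCoeff u = 1 ∧ epsilon₂ = X * u := by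
  refine ⟨infProd (fun j => ((1 - X ^ (2 * j)) * (1 + X ^ (2 * j)) ^ 2) ^ 4) * theta₃Fourth,
    ?_, ?_⟩
  · have h3 := coeff_zero_theta₃Fourth
    rw [coeff_zero_eq_constantCoeff_apply] at h3
    rw [map_mul, constantCoeff_infProd, h3, one_mul]
  · rw [epsilon₂, theta₁Fourth, mul_assoc]

theorem monomialMatrix_of_lt {k : ℕ} {m r : Fin (k + 1)} (h : m < r) :
    monomialMatrix k m r = 0 := by
  obtain ⟨u, _, hu⟩ := exists_epsilon₂
  rw [monomialMatrix, Matrix.of_apply, hu, mul_pow, mul_left_comm]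
  exact X_pow_dvd_iff.1 (dvd_mul_right _ _) _ h

/-- The leading coefficients are `-1` for `8 δ₂`, taken to an odd power, and `1` for `ε₂`. With
triangularity this makes the matrix invertible over `ℤ`, which gives existence and uniqueness of the
`c r j`. -/
theorem monomialMatrix_self {k : ℕ} (r : Fin (k + 1)) : monomialMatrix k r r = -1 := by
  obtain ⟨u, hu1, hu⟩ := exists_epsilon₂
  rw [monomialMatrix, Matrix.of_apply, hu, mul_pow, mul_left_comm]
  have h := coeff_X_pow_mul (eightDelta₂ ^ (2 * k + 1 - 2 * (r : ℕ)) * u ^ (r : ℕ)) (r : ℕ) 0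
  rw [zero_add] at h
  rw [h, coeff_zero_eq_constantCoeff_apply, map_mul, map_pow, map_pow, hu1, one_pow, mul_one,
    constantCoeff_eightDelta₂]
  refine Odd.neg_one_pow ?_
  have := r.is_lt
  exact ⟨k - r, by omega⟩

theorem isUnit_det_monomialMatrix (k : ℕ) : IsUnit (monomialMatrix k).det := by
  rw [Matrix.det_of_isLowerTriangular _ (fun i j h => monomialMatrix_of_lt h)]
  simp [monomialMatrix_self]

theorem isCanonical_iff {k : ℕ} {c : Matrix (Fin (k + 1)) (Fin (k + 1)) ℤ} :
    IsCanonical k c ↔ monomialMatrix k * c = 1 := by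
  rw [← Matrix.ext_iff]
  refine forall_congr' fun m => forall_congr' fun j => ?_
  rw [Matrix.mul_apply, Matrix.one_apply]
  simp only [monomialMatrix, Matrix.of_apply, mul_comm]

/-- The canonical matrix. -/
def canonicalMatrix (k : ℕ) : Matrix (Fin (k + 1)) (Fin (k + 1)) ℤ := (monomialMatrix k)⁻¹

theorem monomialMatrix_mul_canonicalMatrix (k : ℕ) :
    monomialMatrix k * canonicalMatrix k = 1 :=
  Matrix.mul_nonsing_inv _ (isUnit_det_monomialMatrix k)

theorem canonicalMatrix_mul_monomialMatrix (k : ℕ) :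
    canonicalMatrix k * monomialMatrix k = 1 :=
  Matrix.nonsing_inv_mul _ (isUnit_det_monomialMatrix k)

theorem isCanonical_canonicalMatrix (k : ℕ) : IsCanonical k (canonicalMatrix k) :=
  isCanonical_iff.2 (monomialMatrix_mul_canonicalMatrix k)

theorem eq_canonicalMatrix {k : ℕ} {c : Matrix (Fin (k + 1)) (Fin (k + 1)) ℤ}
    (h : IsCanonical k c) : c = canonicalMatrix k :=
  (Matrix.inv_eq_right_inv (isCanonical_iff.1 h)).symm

theorem canonicalMatrix_of_lt {k : ℕ} {r j : Fin (k + 1)} (h : r < j) :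
    canonicalMatrix k r j = 0 := by
  let _ : Invertible (monomialMatrix k) :=
    Matrix.invertibleOfIsUnitDet _ (isUnit_det_monomialMatrix k)
  have h1 : (monomialMatrix k).BlockTriangular OrderDual.toDual :=
    fun i j h => monomialMatrix_of_lt (OrderDual.toDual_lt_toDual.1 h)
  exact Matrix.blockTriangular_inv_of_blockTriangular h1 (OrderDual.toDual_lt_toDual.2 h)

theorem canonicalMatrix_self {k : ℕ} (r : Fin (k + 1)) : canonicalMatrix k r r = -1 := by
  have h := congrFun (congrFun (monomialMatrix_mul_canonicalMatrix k) r) r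
  rw [Matrix.mul_apply, Matrix.one_apply_eq, Finset.sum_eq_single r, monomialMatrix_self] at h
  · omega
  · intro b _ hb
    rcases lt_or_gt_of_ne hb with h1 | h1
    · rw [canonicalMatrix_of_lt h1, mul_zero]
    · rw [monomialMatrix_of_lt h1, zero_mul]
  · simp

/-- The value is `7 * 24`: the coefficient of order one in `(8 δ₂) ^ 7` is `7 * (-24)`, and
inverting a lower triangular matrix with diagonal `-1` changes the sign of this entry just below the
diagonal. -/
theorem canonicalMatrix_three_one_zero : canonicalMatrix 3 1 0 = 168 := by
  have h := congrFun (congrFun (monomialMatrix_mul_canonicalMatrix 3) 1) 0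
  have h2 : monomialMatrix 3 1 0 = -168 := by
    rw [monomialMatrix, Matrix.of_apply]
    simp only [Fin.val_one, Fin.val_zero, mul_zero, Nat.sub_zero, pow_zero, mul_one]
    rw [coeff_one_pow, coeff_one_eightDelta₂, constantCoeff_eightDelta₂]
    norm_num
  rw [Matrix.mul_apply, Fin.sum_univ_four, h2, canonicalMatrix_self, monomialMatrix_self,
    monomialMatrix_of_lt (m := 1) (r := 2) (by decide),
    monomialMatrix_of_lt (m := 1) (r := 3) (by decide), Matrix.one_apply_ne (by decide)] at h
  omega

theorem B_zero (N : ℕ) : B N 0 = 1 := by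
  rw [B, coeff_zero_eq_constantCoeff_apply, Theta₂, constantCoeff_infProd]

/-- Order one in `q^{1/2}` comes only from the exterior factor at `u = -X`: its linear term is
`-extPow 1`, and the rank correction `(1 - X) ^ (-N)` contributes `N`. -/
theorem B_one (N : ℕ) : B N 1 = (N : VirtualBundle) - extPow 1 := by
  have h1 : (X : PowerSeries VirtualBundle) ^ 2 ∣ totalSym N 2 - 1 := X_pow_dvd_totalSym N 2
  have h2 : coeff 1 (totalSym N 2) = 0 := by
    have := X_pow_dvd_iff.1 h1 1 (by norm_num)
    rw [map_sub, coeff_one, if_neg one_ne_zero, sub_zero] at this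
    exact this
  have h3 : constantCoeff (totalSym N 2) = 1 := by
    have := X_pow_dvd_iff.1 h1 0 (by norm_num)
    rw [map_sub, coeff_zero_one, sub_eq_zero,
      coeff_zero_eq_constantCoeff_apply] at this
    exact this
  have hinv : (1 - X ^ 1 : PowerSeries VirtualBundle) ^ N * invOfUnit ((1 - X ^ 1) ^ N) 1 = 1 := by
    refine mul_invOfUnit _ _ ?_
    simp
  have h5 : constantCoeff (invOfUnit ((1 - X ^ 1 : PowerSeries VirtualBundle) ^ N) 1) = 1 := by
    simp
  have h4 : coeff 1 (invOfUnit ((1 - X ^ 1 : PowerSeries VirtualBundle) ^ N) 1) = N := by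
    have h := congrArg (coeff 1) hinv
    rw [coeff_one_mul, h5, coeff_one_pow] at h
    simp only [pow_one, map_sub, map_one, constantCoeff_X, sub_zero, map_pow, one_pow,
      coeff_one_X, coeff_one, one_ne_zero, if_false, zero_sub] at h
    simp only [pow_one]
    linear_combination h
  have h6 : coeff 1 (totalExt N 1) = (N : VirtualBundle) - extPow 1 := by
    rw [totalExt, coeff_one_mul, h4, h5, coeff_mk, ← coeff_zero_eq_constantCoeff_apply, coeff_mk]
    simp [extPow]
    ring
  rw [B, Theta₂, infProd, coeff_mk, Finset.Icc_self, Finset.prod_singleton, coeff_one_mul]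
  norm_num
  rw [h2, h3, h6]
  ring

end CanonicalMatrix

/-! ### Expansion of the monomials at the signature cusp -/

section CuspCoefficients

open PowerSeries

/-- Since `4 cuspDelta = 1 + 24 X` and `16 cuspEps = 1 - 16 X + 128 X²`, the factor `4 ^ (α + 2 r)`
clears all denominators. The coefficient of `X²` in the `r`-th power of the second series is exactly
`128 r²`. -/
theorem coeff_cuspDelta_pow_mul_cuspEps_pow (α r : ℕ) :
    coeff 0 (cuspDelta ^ α * cuspEps ^ r) * 4 ^ (α + 2 * r) = 1 ∧
    coeff 1 (cuspDelta ^ α * cuspEps ^ r) * 4 ^ (α + 2 * r) = 24 * α - 16 * r ∧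
    coeff 2 (cuspDelta ^ α * cuspEps ^ r) * 4 ^ (α + 2 * r) =
      288 * α * ((α : ℂ) - 1) + 128 * r ^ 2 - 384 * α * r := by
  have key : ∀ α r : ℕ, ∃ w, C (4 ^ (α + 2 * r) : ℂ) * (cuspDelta ^ α * cuspEps ^ r) =
      1 + C (24 * (α : ℂ) - 16 * r) * X +
        C (288 * (α : ℂ) * ((α : ℂ) - 1) + 128 * r ^ 2 - 384 * α * r) * X ^ 2 +
          X ^ 3 * w := by
    have h4 : C (4 : ℂ) * cuspDelta = 1 + 24 * X := by
      rw [cuspDelta, mul_add, ← map_mul, show C (4 : ℂ) = 4 from map_ofNat C 4]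
      norm_num
      ring
    have h16 : C (16 : ℂ) * cuspEps = 1 - 16 * X + 128 * X ^ 2 := by
      rw [cuspEps, mul_add, mul_sub, ← map_mul, show C (16 : ℂ) = 16 from map_ofNat C 16]
      norm_num
      ring
    intro α r
    induction α with
    | zero =>
      induction r with
      | zero => exact ⟨0, by simp⟩
      | succ r ih =>
        obtain ⟨w, hw⟩ := ih
        refine ⟨w * (1 - 16 * X + 128 * X ^ 2) + 128 * (-16 * (r : PowerSeries ℂ)) -
          16 * (128 * (r : PowerSeries ℂ) ^ 2) + 128 * (128 * (r : PowerSeries ℂ) ^ 2) * X, ?_⟩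
        rw [show 0 + 2 * (r + 1) = 0 + 2 * r + 2 by ring, pow_add (4 : ℂ),
          show (4 : ℂ) ^ 2 = 16 by norm_num, map_mul C, pow_succ cuspEps]
        simp only [map_zero, map_add, map_sub, map_mul, map_pow, map_natCast, map_ofNat, map_one,
          Nat.cast_add, Nat.cast_one, Nat.cast_zero] at hw h16 ⊢
        linear_combination (16 * cuspEps) * hw + (1 + (24 * 0 - 16 * (r : PowerSeries ℂ)) * X +
          (288 * 0 * (0 - 1) + 128 * (r : PowerSeries ℂ) ^ 2 - 384 * 0 * r) * X ^ 2 + X ^ 3 * w) * h16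
    | succ α ih =>
      obtain ⟨w, hw⟩ := ih
      refine ⟨w * (1 + 24 * X) + 24 * (288 * (α : PowerSeries ℂ) * ((α : PowerSeries ℂ) - 1) +
        128 * (r : PowerSeries ℂ) ^ 2 - 384 * (α : PowerSeries ℂ) * (r : PowerSeries ℂ)), ?_⟩
      rw [show α + 1 + 2 * r = α + 2 * r + 1 by ring, pow_succ (4 : ℂ), map_mul C,
        pow_succ cuspDelta]
      simp only [map_add, map_sub, map_mul, map_pow, map_natCast, map_ofNat, map_one,
        Nat.cast_add, Nat.cast_one] at hw h4 ⊢
      linear_combination (4 * cuspDelta) * hw + (1 + (24 * (α : PowerSeries ℂ) - 16 * (r : PowerSeries ℂ)) * X +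
        (288 * (α : PowerSeries ℂ) * ((α : PowerSeries ℂ) - 1) + 128 * (r : PowerSeries ℂ) ^ 2 -
          384 * (α : PowerSeries ℂ) * (r : PowerSeries ℂ)) * X ^ 2 + X ^ 3 * w) * h4
  obtain ⟨w, hw⟩ := key α r
  have h : ∀ m, coeff m (cuspDelta ^ α * cuspEps ^ r) * 4 ^ (α + 2 * r) =
      coeff m (1 + C (24 * (α : ℂ) - 16 * r) * X +
        C (288 * (α : ℂ) * ((α : ℂ) - 1) + 128 * r ^ 2 - 384 * α * r) * X ^ 2 +
          X ^ 3 * w) := fun m => by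
    rw [← hw, coeff_C_mul, mul_comm]
  refine ⟨(h 0).trans ?_, (h 1).trans ?_, (h 2).trans ?_⟩ <;>
  · rw [map_add _ _ (X ^ 3 * w), coeff_X_pow_mul', if_neg (by norm_num), add_zero, map_add,
      map_add, coeff_C_mul, coeff_C_mul, coeff_X_pow, coeff_X, coeff_one]
    norm_num

end CuspCoefficients
end
end TwistedCancellation

namespace TwistedCancellation
noncomputable section

/-! ### Homogeneous series paired with their values at `t = 1` -/

section GradedPairs

open PowerSeries

variable {F : Type*} [CommRing F] [Algebra ℂ F] (W : ℕ → Submodule ℂ F) [SetLike.GradedMonoid W]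

/-- The pairs `(s, a)` of a power series `s` whose coefficients are homogeneous of the degrees given
by their indices, and the sum `a` of these coefficients. -/
def gradedPairs : Subring (PowerSeries F × F) where
  carrier := {p | (∀ m, coeff m p.1 ∈ W m) ∧ ∃ P : Polynomial F, p.1 = P ∧ p.2 = P.eval 1}
  zero_mem' := ⟨fun m => by simp, 0, by simp⟩
  one_mem' := by
    refine ⟨fun m => ?_, 1, by simp⟩
    rw [Prod.fst_one, coeff_one]
    split_ifs with h
    · rw [h]
      exact SetLike.GradedOne.one_mem
    · exact zero_mem _
  add_mem' := by
    rintro _ _ ⟨h1, P1, hP1, hE1⟩ ⟨h2, P2, hP2, hE2⟩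
    refine ⟨fun m => ?_, P1 + P2, ?_, ?_⟩
    · rw [Prod.fst_add, map_add]
      exact add_mem (h1 m) (h2 m)
    · rw [Prod.fst_add, hP1, hP2, Polynomial.coe_add]
    · rw [Prod.snd_add, hE1, hE2, Polynomial.eval_add]
  neg_mem' := by
    rintro _ ⟨h1, P1, hP1, hE1⟩
    refine ⟨fun m => ?_, -P1, ?_, ?_⟩
    · rw [Prod.fst_neg, map_neg]
      exact neg_mem (h1 m)
    · rw [Prod.fst_neg, hP1, Polynomial.coe_neg]
    · rw [Prod.snd_neg, hE1, Polynomial.eval_neg]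
  mul_mem' := by
    rintro _ _ ⟨h1, P1, hP1, hE1⟩ ⟨h2, P2, hP2, hE2⟩
    refine ⟨fun m => ?_, P1 * P2, ?_, ?_⟩
    · rw [Prod.fst_mul, coeff_mul]
      refine sum_mem fun p hp => ?_
      rw [← Finset.HasAntidiagonal.mem_antidiagonal.1 hp]
      exact SetLike.GradedMul.mul_mem (h1 _) (h2 _)
    · rw [Prod.fst_mul, hP1, hP2, Polynomial.coe_mul]
    · rw [Prod.snd_mul, hE1, hE2, Polynomial.eval_mul]

variable {W}

theorem coeff_mem_of_gradedPairs {s : PowerSeries F} {a : F} (h : (s, a) ∈ gradedPairs W) (m : ℕ) :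
    coeff m s ∈ W m := h.1 m

theorem gradedPairs_of_mem_zero {a : F} (h : a ∈ W 0) : (C a, a) ∈ gradedPairs W := by
  refine ⟨fun m => ?_, Polynomial.C a, by simp, by simp⟩
  rw [coeff_C]
  split_ifs with hm
  · rwa [hm]
  · exact zero_mem _

theorem algebraMap_mem_zero (c : ℂ) : algebraMap ℂ F c ∈ W 0 := by
  rw [Algebra.algebraMap_eq_smul_one]
  exact Submodule.smul_mem _ _ SetLike.GradedOne.one_mem

theorem gradedPairs_algebraMap (c : ℂ) :
    (C (algebraMap ℂ F c), algebraMap ℂ F c) ∈ gradedPairs W :=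
  gradedPairs_of_mem_zero (algebraMap_mem_zero c)

theorem gradedPairs_mul {s s' : PowerSeries F} {a a' : F} (h : (s, a) ∈ gradedPairs W)
    (h' : (s', a') ∈ gradedPairs W) : (s * s', a * a') ∈ gradedPairs W := by
  have := (gradedPairs W).mul_mem h h'
  rwa [Prod.mk_mul_mk] at this

theorem gradedPairs_add {s s' : PowerSeries F} {a a' : F} (h : (s, a) ∈ gradedPairs W)
    (h' : (s', a') ∈ gradedPairs W) : (s + s', a + a') ∈ gradedPairs W := by
  have := (gradedPairs W).add_mem h h'
  rwa [Prod.mk_add_mk] at this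

theorem gradedPairs_sub {s s' : PowerSeries F} {a a' : F} (h : (s, a) ∈ gradedPairs W)
    (h' : (s', a') ∈ gradedPairs W) : (s - s', a - a') ∈ gradedPairs W := by
  have := (gradedPairs W).sub_mem h h'
  rwa [Prod.mk_sub_mk] at this

theorem gradedPairs_pow {s : PowerSeries F} {a : F} (h : (s, a) ∈ gradedPairs W) (m : ℕ) :
    (s ^ m, a ^ m) ∈ gradedPairs W := by
  have := (gradedPairs W).pow_mem h m
  rwa [Prod.pow_mk] at this

theorem gradedPairs_one : ((1 : PowerSeries F), (1 : F)) ∈ gradedPairs W := (gradedPairs W).one_mem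

theorem gradedPairs_intCast (a : ℤ) : ((a : PowerSeries F), (a : F)) ∈ gradedPairs W :=
  intCast_mem (gradedPairs W) a

theorem gradedPairs_smul {s : PowerSeries F} {a : F} (c : ℂ) (h : (s, a) ∈ gradedPairs W) :
    (C (algebraMap ℂ F c) * s, c • a) ∈ gradedPairs W := by
  rw [Algebra.smul_def]
  exact gradedPairs_mul (gradedPairs_algebraMap c) h

theorem gradedPairs_sum {κ : Type*} (t : Finset κ) {s : κ → PowerSeries F} {a : κ → F}
    (h : ∀ i ∈ t, (s i, a i) ∈ gradedPairs W) :
    (∑ i ∈ t, s i, ∑ i ∈ t, a i) ∈ gradedPairs W := by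
  have := sum_mem h
  rwa [show ∑ i ∈ t, (s i, a i) = (∑ i ∈ t, s i, ∑ i ∈ t, a i) from
    Prod.ext (by simp [Prod.fst_sum]) (by simp [Prod.snd_sum])] at this

theorem gradedPairs_prod {κ : Type*} (t : Finset κ) {s : κ → PowerSeries F} {a : κ → F}
    (h : ∀ i ∈ t, (s i, a i) ∈ gradedPairs W) :
    (∏ i ∈ t, s i, ∏ i ∈ t, a i) ∈ gradedPairs W := by
  have := prod_mem h
  rwa [show ∏ i ∈ t, (s i, a i) = (∏ i ∈ t, s i, ∏ i ∈ t, a i) from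
    Prod.ext (by simp [Prod.fst_prod]) (by simp [Prod.snd_prod])] at this

theorem gradedPairs_det {ι : Type*} [Fintype ι] [DecidableEq ι] {A : Matrix ι ι (PowerSeries F)}
    {B : Matrix ι ι F} (h : ∀ i j, (A i j, B i j) ∈ gradedPairs W) :
    (A.det, B.det) ∈ gradedPairs W := by
  rw [Matrix.det_apply', Matrix.det_apply']
  refine gradedPairs_sum _ fun σ _ => ?_
  exact gradedPairs_mul (gradedPairs_intCast _) (gradedPairs_prod _ fun i _ => h _ _)

theorem gradedPairs_trace {ι : Type*} [Fintype ι] {A : Matrix ι ι (PowerSeries F)}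
    {B : Matrix ι ι F} (h : ∀ i j, (A i j, B i j) ∈ gradedPairs W) :
    (A.trace, B.trace) ∈ gradedPairs W :=
  gradedPairs_sum _ fun i _ => h i i

theorem gradedPairs_matrix_mul {ι : Type*} [Fintype ι] {A A' : Matrix ι ι (PowerSeries F)}
    {B B' : Matrix ι ι F} (h : ∀ i j, (A i j, B i j) ∈ gradedPairs W)
    (h' : ∀ i j, (A' i j, B' i j) ∈ gradedPairs W) (i j : ι) :
    ((A * A') i j, (B * B') i j) ∈ gradedPairs W := by
  rw [Matrix.mul_apply, Matrix.mul_apply]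
  exact gradedPairs_sum _ fun k _ => gradedPairs_mul (h _ _) (h' _ _)

theorem matrix_pow_mem {ι : Type*} [Fintype ι] [DecidableEq ι] {A : Matrix ι ι F}
    (hA : ∀ i j, A i j ∈ W 1) (m : ℕ) (i j : ι) : (A ^ m) i j ∈ W m := by
  induction m generalizing i j with
  | zero =>
    rw [pow_zero, Matrix.one_apply]
    split_ifs
    · exact SetLike.GradedOne.one_mem
    · exact zero_mem _
  | succ m ih =>
    rw [pow_succ, Matrix.mul_apply]
    exact sum_mem fun k _ => SetLike.GradedMul.mul_mem (ih i k) (hA k j)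

/-- Homogeneous pieces above `N` are zero, so the series is a polynomial and the sum cut off at `N`
is its full value at `1`. This justifies the truncated sums in the definitions of the forms. -/
theorem gradedPairs_of_coeff {N : ℕ} (hW : ∀ m, N < m → W m = ⊥) {s : PowerSeries F}
    (hs : ∀ m, coeff m s ∈ W m) :
    (s, ∑ m ∈ Finset.range (N + 1), coeff m s) ∈ gradedPairs W := by
  refine ⟨hs, trunc (N + 1) s, ?_, ?_⟩
  · ext m
    rw [Polynomial.coeff_coe, coeff_trunc]
    split_ifs with h
    · rfl
    · have := hs m
      rwa [hW m (by omega), Submodule.mem_bot] at this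
  · show (∑ m ∈ Finset.range (N + 1), coeff m s) = _
    rw [Polynomial.eval_eq_sum_range' (natDegree_trunc_lt s N)]
    refine Finset.sum_congr rfl fun m hm => ?_
    rw [coeff_trunc, if_pos (Finset.mem_range.1 hm), one_pow, mul_one]

theorem gradedPairs_matEval {N : ℕ} (hW : ∀ m, N < m → W m = ⊥) {ι : Type*} [Fintype ι]
    [DecidableEq ι] {A : Matrix ι ι F} (hA : ∀ i j, A i j ∈ W 1) (f : PowerSeries ℂ) (i j : ι) :
    (matEval A (baseMap F f) i j, (∑ m ∈ Finset.range (N + 1), coeff m f • A ^ m) i j) ∈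
      gradedPairs W := by
  have h : ∀ m, coeff m (matEval A (baseMap F f) i j) = coeff m f • (A ^ m) i j := fun m => by
    rw [coeff_matEval, baseMap, coeff_map, Algebra.smul_def]
  have := gradedPairs_of_coeff hW (s := matEval A (baseMap F f) i j) fun m => by
    rw [h]
    exact Submodule.smul_mem _ _ (matrix_pow_mem hA m i j)
  rw [Matrix.sum_apply]
  simpa only [h, Matrix.smul_apply] using this

theorem gradedPairs_aeval {σ : Type*} {f : σ → PowerSeries F} {g : σ → F}
    (h : ∀ i, (f i, g i) ∈ gradedPairs W) (E : MvPolynomial σ ℤ) :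
    (MvPolynomial.aeval f E, MvPolynomial.aeval g E) ∈ gradedPairs W := by
  induction E using MvPolynomial.induction_on with
  | C a =>
    rw [MvPolynomial.aeval_C, MvPolynomial.aeval_C]
    simpa using gradedPairs_intCast a
  | add p q hp hq =>
    rw [map_add, map_add]
    exact gradedPairs_add hp hq
  | mul_X p i hp =>
    rw [map_mul, map_mul, MvPolynomial.aeval_X, MvPolynomial.aeval_X]
    exact gradedPairs_mul hp (h i)

end GradedPairs

/-! ### Square roots by the binomial series -/

section SquareRoot

open PowerSeries

/-- The truncated binomial series of exponent `1 / 2` at `y`. -/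
def sqrtSum {R : Type*} [CommRing R] (h : ℂ →+* R) (N : ℕ) (y : R) : R :=
  ∑ m ∈ Finset.range N, h ((Ring.choose (1 / 2 : ℚ) m : ℚ) : ℂ) * y ^ m

theorem sqrtSum_sq {R : Type*} [CommRing R] (h : ℂ →+* R) {N : ℕ} {y : R} (hy : y ^ N = 0) :
    sqrtSum h N y ^ 2 = 1 + y := by
  rcases Nat.eq_zero_or_pos N with rfl | hN
  · have : Subsingleton R := subsingleton_of_zero_eq_one (by rw [← hy, pow_zero])
    exact Subsingleton.elim _ _
  set b : PowerSeries ℂ := PowerSeries.binomialSeries ℂ (1 / 2 : ℚ)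
  have hb : b ^ 2 = 1 + X := by
    rw [sq, ← binomialSeries_add, show (1 / 2 + 1 / 2 : ℚ) = ((1 : ℕ) : ℚ) by norm_num,
      binomialSeries_nat, pow_one]
  have h1 : sqrtSum h N y = (trunc N b).eval₂ h y := by
    obtain ⟨N, rfl⟩ := Nat.exists_eq_succ_of_ne_zero hN.ne'
    rw [Polynomial.eval₂_eq_sum_range' h (natDegree_trunc_lt b N), sqrtSum]
    refine Finset.sum_congr rfl fun m hm => ?_
    rw [coeff_trunc, if_pos (Finset.mem_range.1 hm), binomialSeries_coeff]
    congr 2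
    rw [Rat.smul_one_eq_cast]
  -- The truncated binomial series squares to `1 + X` up to order `N`, and the error dies at an
  -- element whose `N`-th power is zero.
  have h2 : Polynomial.X ^ N ∣ trunc N b ^ 2 - (1 + Polynomial.X) := by
    rw [Polynomial.X_pow_dvd_iff]
    intro d hd
    have h3 : coeff d ((trunc N b : PowerSeries ℂ) ^ 2) = coeff d (b ^ 2) := by
      rw [sq, sq, ← coeff_mul_eq_coeff_trunc_mul_trunc _ _ hd]
    rw [Polynomial.coeff_sub, sub_eq_zero, ← Polynomial.coeff_coe, Polynomial.coe_pow, h3, hb,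
      ← Polynomial.coeff_coe]
    simp
  obtain ⟨w, hw⟩ := h2
  have h4 := congrArg (Polynomial.eval₂RingHom h y) hw
  rw [map_mul, map_pow, map_sub, map_pow, map_add, map_one, Polynomial.coe_eval₂RingHom,
    Polynomial.eval₂_X, hy, zero_mul] at h4
  rw [h1]
  exact sub_eq_zero.1 h4

variable {F : Type*} [CommRing F] [Algebra ℂ F] {W : ℕ → Submodule ℂ F} [SetLike.GradedMonoid W]

theorem gradedPairs_pow_eq_zero {N : ℕ} (hW : ∀ m, N < m → W m = ⊥) {y : PowerSeries F} {a : F}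
    (h : (y, a) ∈ gradedPairs W) (h0 : coeff 0 y = 0) : y ^ (N + 1) = 0 := by
  have h1 : (X : PowerSeries F) ∣ y := X_dvd_iff.2 (by simpa using h0)
  ext m
  rw [map_zero]
  rcases Nat.lt_or_ge m (N + 1) with hm | hm
  · exact X_pow_dvd_iff.1 (pow_dvd_pow_of_dvd h1 (N + 1)) m hm
  · have := coeff_mem_of_gradedPairs (gradedPairs_pow h (N + 1)) m
    rw [hW m (by omega)] at this
    exact this

/-- Square roots of homogeneous series, together with their values. -/
theorem exists_sqrt_gradedPairs {N : ℕ} (hW : ∀ m, N < m → W m = ⊥) {y : PowerSeries F} {a : F}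
    (h : (y, a) ∈ gradedPairs W) (h0 : coeff 0 y = 1) :
    ∃ s, (s, ∑ m ∈ Finset.range (N + 1), ((Ring.choose (1 / 2 : ℚ) m : ℚ) : ℂ) • (a - 1) ^ m) ∈
      gradedPairs W ∧ s ^ 2 = y ∧ coeff 0 s = 1 := by
  have h1 : (y - 1, a - 1) ∈ gradedPairs W := gradedPairs_sub h gradedPairs_one
  have h2 : coeff 0 (y - 1) = 0 := by rw [map_sub, h0, coeff_zero_one, sub_self]
  have h3 := gradedPairs_pow_eq_zero hW h1 h2
  refine ⟨∑ m ∈ Finset.range (N + 1),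
    C (algebraMap ℂ F ((Ring.choose (1 / 2 : ℚ) m : ℚ) : ℂ)) * (y - 1) ^ m,
    gradedPairs_sum _ fun m _ => gradedPairs_smul _ (gradedPairs_pow h1 m), ?_, ?_⟩
  · have := sqrtSum_sq ((C : F →+* PowerSeries F).comp (algebraMap ℂ F)) h3
    rw [add_sub_cancel] at this
    exact this
  · rw [map_sum, Finset.sum_eq_single 0]
    · simp
    · intro m _ hm
      rw [coeff_C_mul, coeff_zero_eq_constantCoeff_apply, map_pow,
        ← coeff_zero_eq_constantCoeff_apply, h2, zero_pow hm, mul_zero]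
    · simp

end SquareRoot

end
end TwistedCancellation

namespace TwistedCancellation
noncomputable section

/-! ### The grading of even forms at a point -/

section FormGrading

open PowerSeries

variable {n : ℕ} {M : Type*} [TopologicalSpace M] [ChartedSpace (EuclideanSpace ℝ (Fin n)) M]
  (x : M)

/-- The forms of degree `2m`, in the centre. -/
def evenForm (m : ℕ) : Submodule ℂ (CForm n x) :=
  (⋀[ℂ]^(2 * m) (Cotangent n x)).comap (Subalgebra.center ℂ (Form n x)).val.toLinearMap

variable {x}

theorem mem_evenForm {m : ℕ} {a : CForm n x} :
    a ∈ evenForm x m ↔ (a : Form n x) ∈ ⋀[ℂ]^(2 * m) (Cotangent n x) := Iff.rfl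

instance : SetLike.GradedMonoid (evenForm (n := n) x) where
  one_mem := by
    rw [mem_evenForm]
    exact (SetLike.GradedOne.one_mem : (1 : Form n x) ∈ ⋀[ℂ]^0 (Cotangent n x))
  mul_mem := fun i j a b ha hb => by
    rw [mem_evenForm] at ha hb ⊢
    rw [mul_add]
    exact SetLike.GradedMul.mul_mem (A := fun i : ℕ => ⋀[ℂ]^i (Cotangent n x)) ha hb

/-- A complex-valued covector is determined by its values on the standard basis. -/
def cotangentCoords (x : M) : Cotangent n x →ₗ[ℂ] (Fin n → ℂ) where
  toFun f i := f (basisVec i)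
  map_add' _ _ := rfl
  map_smul' _ _ := rfl

theorem cotangentCoords_injective : Function.Injective (cotangentCoords (n := n) x) := by
  intro f g h
  have h1 : ∀ i, f (basisVec i) = g (basisVec i) := fun i => congrFun h i
  have h2 : (f : EuclideanSpace ℝ (Fin n) →L[ℝ] ℂ).toLinearMap =
      (g : EuclideanSpace ℝ (Fin n) →L[ℝ] ℂ).toLinearMap :=
    (EuclideanSpace.basisFun (Fin n) ℝ).toBasis.ext fun i => by
      rw [OrthonormalBasis.coe_toBasis, EuclideanSpace.basisFun_apply]
      exact h1 i
  exact ContinuousLinearMap.coe_injective h2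

instance : Module.Finite ℂ (Cotangent n x) :=
  Module.Finite.of_injective _ cotangentCoords_injective

theorem finrank_cotangent_le : Module.finrank ℂ (Cotangent n x) ≤ n := by
  simpa using LinearMap.finrank_le_finrank_of_injective (cotangentCoords_injective (n := n) (x := x))

/-- Degree `2 m > n` would already suffice; the cruder bound is the one at which the sums in
`evalSeries` and `formSqrt` stop. -/
theorem evenForm_eq_bot (m : ℕ) (hm : n < m) : evenForm (n := n) x m = ⊥ := by
  have h : Module.finrank ℂ (⋀[ℂ]^(2 * m) (Cotangent n x)) = 0 := by
    rw [exteriorPower.finrank_eq]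
    exact Nat.choose_eq_zero_of_lt (by have := finrank_cotangent_le (n := n) (x := x); omega)
  rw [Submodule.finrank_eq_zero] at h
  rw [eq_bot_iff]
  intro a ha
  rw [mem_evenForm, h, Submodule.mem_bot] at ha
  exact Subtype.ext ha

theorem coe_eq_sum_of_gradedPairs {s : PowerSeries (CForm n x)} {a : CForm n x}
    (h : (s, a) ∈ gradedPairs (evenForm x)) :
    ∃ N, ∀ K, N ≤ K → (a : Form n x) = ∑ m ∈ Finset.range K, ((coeff m s : CForm n x) : Form n x) := by
  obtain ⟨_, P, hP, hE⟩ := h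
  refine ⟨P.natDegree + 1, fun K hK => ?_⟩
  rw [show a = P.eval 1 from hE, show s = (P : PowerSeries (CForm n x)) from hP,
    Polynomial.eval_eq_sum_range' (by omega : P.natDegree < K), AddSubmonoidClass.coe_finsetSum]
  simp

theorem component_of_gradedPairs {s : PowerSeries (CForm n x)} {a : CForm n x}
    (h : (s, a) ∈ gradedPairs (evenForm x)) (m : ℕ) :
    component x (2 * m) a = ((coeff m s : CForm n x) : Form n x) := by
  obtain ⟨N, hN⟩ := coe_eq_sum_of_gradedPairs h
  rw [component, hN (N + m + 1) (by omega), map_sum, Finset.sum_eq_single m]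
  · rw [GradedAlgebra.proj_apply]
    exact DirectSum.decompose_of_mem_same _ (h.1 m)
  · intro i _ hi
    rw [GradedAlgebra.proj_apply]
    exact DirectSum.decompose_of_mem_ne _ (h.1 i) (by omega)
  · intro hm
    exact absurd (Finset.mem_range.2 (by omega)) hm

theorem algebraMapInv_eq_zero {V : Type*} [AddCommGroup V] [Module ℂ V] {d : ℕ} (hd : d ≠ 0)
    {a : ExteriorAlgebra ℂ V} (ha : a ∈ ⋀[ℂ]^d V) : ExteriorAlgebra.algebraMapInv a = 0 := by
  obtain ⟨d, rfl⟩ := Nat.exists_eq_succ_of_ne_zero hd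
  have h : ⋀[ℂ]^(d + 1) V ≤ LinearMap.ker (ExteriorAlgebra.algebraMapInv (R := ℂ) (M := V)).toLinearMap := by
    refine (pow_succ (LinearMap.range (ExteriorAlgebra.ι ℂ : V →ₗ[ℂ] _)) d).le.trans ?_
    refine Submodule.mul_le.2 ?_
    rintro u _ _ ⟨v, rfl⟩
    rw [LinearMap.mem_ker, AlgHom.toLinearMap_apply, map_mul, ExteriorAlgebra.algebraMapInv,
      ExteriorAlgebra.lift_ι_apply]
    simp
  exact h ha

theorem algebraMapInv_of_gradedPairs {s : PowerSeries (CForm n x)} {a : CForm n x} {c : ℂ}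
    (h : (s, a) ∈ gradedPairs (evenForm x)) (h0 : coeff 0 s = algebraMap ℂ (CForm n x) c) :
    ExteriorAlgebra.algebraMapInv (a : Form n x) = c := by
  obtain ⟨N, hN⟩ := coe_eq_sum_of_gradedPairs h
  rw [hN (N + 1) (by omega), map_sum, Finset.sum_eq_single 0]
  · rw [h0]
    exact ExteriorAlgebra.algebraMap_leftInverse _ c
  · intro i _ hi
    exact algebraMapInv_eq_zero (by omega) (h.1 i)
  · simp

/-- The normalization `α / c` in `formSqrt` reduces to constant term one; the factor `√c` is kept
outside so that the series `s` satisfies `s ^ 2 = y` exactly. -/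
theorem exists_formSqrt_gradedPairs {y : PowerSeries (CForm n x)} {a : CForm n x} {c : ℝ}
    (hc : 0 < c) (h : (C (algebraMap ℂ (CForm n x) c) * y, a) ∈ gradedPairs (evenForm x))
    (h0 : coeff 0 y = 1) :
    ∃ s, (C (algebraMap ℂ (CForm n x) (Real.sqrt c : ℝ)) * s, formSqrt a) ∈
      gradedPairs (evenForm x) ∧ s ^ 2 = y ∧ coeff 0 s = 1 := by
  have hc' : (c : ℂ) ≠ 0 := by exact_mod_cast hc.ne'
  have h1 : ExteriorAlgebra.algebraMapInv (a : Form n x) = (c : ℂ) :=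
    algebraMapInv_of_gradedPairs h (by rw [coeff_C_mul, h0, mul_one])
  have h2 := gradedPairs_smul (c : ℂ)⁻¹ h
  rw [← mul_assoc, ← map_mul, ← map_mul, inv_mul_cancel₀ hc', map_one, map_one, one_mul] at h2
  obtain ⟨s, hs, hs2, hs0⟩ := exists_sqrt_gradedPairs evenForm_eq_bot h2 h0
  refine ⟨s, ?_, hs2, hs0⟩
  have h3 := gradedPairs_smul ((Real.sqrt c : ℝ) : ℂ) hs
  rw [formSqrt, h1, Complex.ofReal_re]
  exact h3

theorem dCoord₂_mem (k l : Fin n) : dCoord₂ x k l ∈ evenForm x 1 := by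
  rw [mem_evenForm, mul_one]
  refine (sq (LinearMap.range (ExteriorAlgebra.ι ℂ : Cotangent n x →ₗ[ℂ] _))).ge ?_
  exact Submodule.mul_mem_mul ⟨_, rfl⟩ ⟨_, rfl⟩

theorem gradedPairs_evalSeries {ι : Type*} [Fintype ι] [DecidableEq ι]
    {A : Matrix ι ι (CForm n x)} (hA : ∀ i j, A i j ∈ evenForm x 1) (f : PowerSeries ℂ) (i j : ι) :
    (matEval A (baseMap _ f) i j, evalSeries f A i j) ∈ gradedPairs (evenForm x) :=
  gradedPairs_matEval evenForm_eq_bot hA f i j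

theorem gradedPairs_ch {ι : Type*} [Fintype ι] [DecidableEq ι]
    {R : Matrix ι ι (CForm n x)} (hR : ∀ i j, R i j ∈ evenForm x 1) :
    (powTrace ((Complex.I / (2 * Real.pi)) • R) (expBase _), ch R) ∈ gradedPairs (evenForm x) :=
  gradedPairs_trace (gradedPairs_evalSeries (fun i j => Submodule.smul_mem _ _ (hR i j)) (exp ℂ))

/-- The projection of the tensor power to the part of character `χ`, with values in a ring. -/
def charProj (R : Type*) [CommRing R] [Algebra ℂ R] (c : ℤˣ) (ι : Type*) [DecidableEq ι] (b : ℕ) :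
    Matrix (Fin b → ι) (Fin b → ι) R :=
  Matrix.of fun I J => algebraMap ℂ R (b ! : ℂ)⁻¹ *
    ∑ σ : Equiv.Perm (Fin b), if I = J ∘ σ then (((permChar c σ : ℤˣ) : ℤ) : R) else 0

theorem charProj_mem (c : ℤˣ) (b : ℕ) (I J : Fin b → Fin n) :
    charProj (CForm n x) c (Fin n) b I J ∈ evenForm x 0 := by
  rw [charProj, Matrix.of_apply, ← Algebra.smul_def]
  refine Submodule.smul_mem _ _ (sum_mem fun σ _ => ?_)
  split_ifs
  · rw [← map_intCast (algebraMap ℂ (CForm n x))]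
    exact algebraMap_mem_zero _
  · exact zero_mem _

theorem curvature_mem [IsManifold (𝓡 n) ∞ M] (g : RiemMetric n M) (i j : Fin n) :
    curvature g x i j ∈ evenForm x 1 := by
  rw [curvature, Matrix.of_apply]
  exact sum_mem fun _ _ => sum_mem fun _ _ => Submodule.smul_mem _ _ (dCoord₂_mem _ _)

end FormGrading

/-! ### The characteristic forms as values of graded series -/

section CharacteristicForms

open PowerSeries

variable {n : ℕ} {M : Type*} [TopologicalSpace M] [ChartedSpace (EuclideanSpace ℝ (Fin n)) M]
  [IsManifold (𝓡 n) ∞ M] (g : RiemMetric n M) (x : M)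

/-- The matrix `(√-1 / 2π) R^{TM}`. -/
def chernMatrix : Matrix (Fin n) (Fin n) (CForm n x) :=
  (Complex.I / (2 * Real.pi)) • curvature g x

variable {g x}

theorem chernMatrix_mem (i j : Fin n) : chernMatrix g x i j ∈ evenForm x 1 :=
  Submodule.smul_mem _ _ (curvature_mem g i j)

/-- The genera use `√-1 / 4π` and the Chern character `√-1 / 2π`. Everything is expressed in the
second, so the series of the genera are rescaled by `1 / 2`. -/
theorem evalSeries_half (f : PowerSeries ℂ) :
    evalSeries f ((Complex.I / (4 * Real.pi)) • curvature g x) =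
      evalSeries (rescale (1 / 2 : ℂ) f) (chernMatrix g x) := by
  rw [evalSeries, evalSeries]
  refine Finset.sum_congr rfl fun m _ => ?_
  rw [coeff_rescale, chernMatrix, smul_pow, smul_pow, smul_smul, smul_smul, mul_comm _ (coeff m f),
    mul_assoc, ← mul_pow]
  congr 3
  ring

theorem matEval_C_mul {F : Type*} [CommRing F] {ι : Type*} [Fintype ι] [DecidableEq ι]
    (A : Matrix ι ι F) (c : F) (f : PowerSeries F) :
    matEval A (C c * f) = (C c : PowerSeries F) • matEval A f := by
  rw [matEval_mul, matEval_C, Matrix.smul_mul, one_mul]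

theorem constantCoeff_sinhcHalfInv : constantCoeff sinhcHalfInv = 1 := by
  rw [sinhcHalfInv, ← coeff_zero_eq_constantCoeff_apply, coeff_rescale, pow_zero,
    one_mul, coeff_zero_eq_constantCoeff_apply, constantCoeff_inv, constantCoeff_sinhcSeries, inv_one]

theorem constantCoeff_cothHalf : constantCoeff cothHalf = 1 := by
  rw [cothHalf, map_mul, constantCoeff_sinhcHalfInv, coshHalf,
    ← coeff_zero_eq_constantCoeff_apply, coeff_rescale, coshSeries, coeff_mk]
  simp

theorem exists_aHat_gradedPairs : ∃ a, (a, aHat g x) ∈ gradedPairs (evenForm x) ∧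
    coeff 0 a = 1 ∧ a ^ 2 = (matEval (chernMatrix g x) (baseMap _ sinhcHalfInv)).det := by
  have h := gradedPairs_det (gradedPairs_evalSeries (chernMatrix_mem (g := g) (x := x)) sinhcHalfInv)
  have h0 : coeff 0 (matEval (chernMatrix g x) (baseMap _ sinhcHalfInv)).det = 1 :=
    coeff_zero_det_matEval _ (by
      rw [baseMap, coeff_map, coeff_zero_eq_constantCoeff_apply, constantCoeff_sinhcHalfInv, map_one])
  obtain ⟨s, hs, hs2, hs0⟩ := exists_formSqrt_gradedPairs (c := 1) one_pos (by simpa using h) h0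
  refine ⟨s, ?_, hs0, hs2⟩
  rw [Real.sqrt_one, Complex.ofReal_one, map_one, map_one, one_mul] at hs
  rw [aHat, evalSeries_half]
  exact hs

/-- The series `2 z / tanh z` starts with `2`, so the determinant starts with `2 ^ n` and its square
root with `2 ^ r`. -/
theorem exists_lHat_gradedPairs {r : ℕ} (hr : n = 2 * r) :
    ∃ l, (C (algebraMap ℂ _ (2 ^ r)) * l, lHat g x) ∈ gradedPairs (evenForm x) ∧
    coeff 0 l = 1 ∧ l ^ 2 = (matEval (chernMatrix g x) (baseMap _ cothHalf)).det := by
  have h := gradedPairs_det (gradedPairs_evalSeries (chernMatrix_mem (g := g) (x := x))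
    (rescale (1 / 2 : ℂ) ((2 : ℂ) • (coshSeries * sinhcSeries⁻¹))))
  have h1 : rescale (1 / 2 : ℂ) ((2 : ℂ) • (coshSeries * sinhcSeries⁻¹)) = C 2 * cothHalf := by
    rw [smul_eq_C_mul, map_mul, map_mul, rescale_C]
    rfl
  have h0 : coeff 0 (matEval (chernMatrix g x) (baseMap _ cothHalf)).det = 1 :=
    coeff_zero_det_matEval _ (by
      rw [baseMap, coeff_map, coeff_zero_eq_constantCoeff_apply, constantCoeff_cothHalf, map_one])
  rw [h1] at h
  have h2 : (matEval (chernMatrix g x) (baseMap _ (C 2 * cothHalf))).det =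
      C (algebraMap ℂ _ ((2 ^ n : ℝ) : ℂ)) * (matEval (chernMatrix g x) (baseMap _ cothHalf)).det := by
    rw [map_mul, show baseMap (CForm n x) (C 2) = C (algebraMap ℂ _ 2) from map_C _ _,
      matEval_C_mul, Matrix.det_smul, Fintype.card_fin]
    rw [Complex.ofReal_pow, Complex.ofReal_ofNat, map_pow, map_pow]
  rw [h2] at h
  obtain ⟨s, hs, hs2, hs0⟩ := exists_formSqrt_gradedPairs (c := 2 ^ n) (by positivity) h h0
  refine ⟨s, ?_, hs0, hs2⟩
  rw [lHat, evalSeries_half, h1]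
  have h3 : Real.sqrt (2 ^ n) = 2 ^ r := by
    rw [hr, mul_comm, pow_mul, Real.sqrt_sq (by positivity)]
  rw [h3, Complex.ofReal_pow, Complex.ofReal_ofNat] at hs
  exact hs

theorem gradedPairs_chT :
    (powTrace (chernMatrix g x) (expBase _), chT g x) ∈ gradedPairs (evenForm x) :=
  gradedPairs_ch (curvature_mem g)

theorem gradedPairs_chTT :
    (powTrace (chernMatrix g x) (expBase _) ^ 2, chTT g x) ∈ gradedPairs (evenForm x) := by
  rw [← trace_matEval_kroneckerSum, chernMatrix]
  have h := gradedPairs_ch (R := curvature g x ⊗ₖ 1 + 1 ⊗ₖ curvature g x) (x := x) ?_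
  · rw [smul_add, ← Matrix.smul_kronecker, ← Matrix.kronecker_smul] at h
    exact h
  · rintro ⟨i, i'⟩ ⟨j, j'⟩
    rw [Matrix.add_apply, Matrix.kroneckerMap_apply, Matrix.kroneckerMap_apply, Matrix.one_apply,
      Matrix.one_apply]
    refine add_mem ?_ ?_ <;> split_ifs <;> simp [curvature_mem]

/-- Links the Chern character of a symmetric or exterior power, defined through a projection of the
tensor power, with the permutation traces of Newton's recursion. -/
theorem trace_charProj_mul_tensorProd {R : Type*} [CommRing R] [Algebra ℂ R] (c : ℤˣ) {ι : Type*}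
    [Fintype ι] [DecidableEq ι] (E : Matrix ι ι R) (b : ℕ) :
    (charProj R c ι b * tensorProd E b).trace = powerTrace c E b := by
  have h : ∀ I J : Fin b → ι, charProj R c ι b I J * tensorProd E b J I =
      algebraMap ℂ R (b ! : ℂ)⁻¹ * ∑ σ : Equiv.Perm (Fin b), if I = J ∘ σ then
        ((permChar c σ : ℤ) : R) * ∏ s, E (J s) (J (σ s)) else 0 := fun I J => by
    rw [charProj, tensorProd, Matrix.of_apply, Matrix.of_apply, mul_assoc, Finset.sum_mul]
    congr 1
    refine Finset.sum_congr rfl fun σ _ => ?_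
    split_ifs with h
    · rw [h]
      rfl
    · rw [zero_mul]
  rw [powerTrace, permTrace, Matrix.trace]
  simp only [Matrix.diag_apply, Matrix.mul_apply, h, ← Finset.mul_sum]
  congr 1
  rw [Finset.sum_comm]
  simp only [Finset.mul_sum]
  conv_rhs => rw [Finset.sum_comm]
  refine Finset.sum_congr rfl fun J _ => ?_
  rw [Finset.sum_comm]
  refine Finset.sum_congr rfl fun σ _ => ?_
  rw [Finset.sum_ite_eq' Finset.univ (J ∘ σ), if_pos (Finset.mem_univ _)]

theorem map_C_charProj {F : Type*} [CommRing F] [Algebra ℂ F] (c : ℤˣ) (b : ℕ) :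
    (charProj F c (Fin n) b).map C = charProj (PowerSeries F) c (Fin n) b := by
  ext I J : 1
  rw [charProj, charProj, Matrix.map_apply, Matrix.of_apply, Matrix.of_apply, map_mul, map_sum]
  refine congrArg₂ (· * ·) PowerSeries.algebraMap_apply.symm (Finset.sum_congr rfl fun σ _ => ?_)
  split_ifs
  · rw [map_intCast]
  · rw [map_zero]

theorem gradedPairs_charProj (c : ℤˣ) (b : ℕ) :
    (powerTrace c (matEval (chernMatrix g x) (expBase _)) b,
      chOfProj (charProj (CForm n x) c (Fin n) b) (tensorPowerCurvature (curvature g x) b)) ∈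
      gradedPairs (evenForm x) := by
  have h : (Complex.I / (2 * Real.pi)) • tensorPowerCurvature (curvature g x) b =
      tensorSum (chernMatrix g x) b := by
    ext1 I J
    rw [Matrix.smul_apply, tensorPowerCurvature, tensorSum, Matrix.of_apply, Matrix.of_apply,
      Finset.smul_sum]
    refine Finset.sum_congr rfl fun s _ => ?_
    split_ifs
    · rfl
    · rw [smul_zero]
  rw [← trace_charProj_mul_tensorProd, ← matEval_tensorSum, ← map_C_charProj, chOfProj, h]
  refine gradedPairs_trace (gradedPairs_matrix_mul
    (fun I J => gradedPairs_of_mem_zero (charProj_mem c b I J))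
    (gradedPairs_evalSeries (fun I J => ?_) (exp ℂ)))
  rw [tensorSum, Matrix.of_apply]
  refine sum_mem fun s _ => ?_
  split_ifs
  · exact chernMatrix_mem _ _
  · exact zero_mem _

theorem chSym_eq (b : ℕ) : chSym g x b =
    chOfProj (charProj (CForm n x) 1 (Fin n) b) (tensorPowerCurvature (curvature g x) b) := by
  rw [chSym]
  congr 1
  ext1 I J
  rw [symProj, charProj, Matrix.of_apply, Matrix.of_apply, ← Algebra.smul_def]
  congr 1
  refine Finset.sum_congr rfl fun σ _ => ?_
  rw [permChar, if_pos rfl]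
  exact if_congr Iff.rfl (Int.cast_one (R := CForm n x)).symm rfl

theorem chExt_eq (b : ℕ) : chExt g x b =
    chOfProj (charProj (CForm n x) (-1) (Fin n) b) (tensorPowerCurvature (curvature g x) b) := by
  rw [chExt]
  congr 1

theorem gradedPairs_chVirtual (E : VirtualBundle) :
    (vbEval (chernMatrix g x) E, chVirtual g x E) ∈ gradedPairs (evenForm x) := by
  refine gradedPairs_aeval ?_ E
  rintro (b | b)
  · rw [Sum.elim_inl, Sum.elim_inl, chSym_eq]
    exact gradedPairs_charProj 1 b
  · rw [Sum.elim_inr, Sum.elim_inr, chExt_eq]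
    exact gradedPairs_charProj (-1) b

end CharacteristicForms

end
end TwistedCancellation

namespace TwistedCancellation
noncomputable section

/-! ### Vanishing of odd power sums of skew endomorphisms -/

section OddTraces

variable {R : Type*} [CommRing R] [Algebra ℂ R] {ι : Type*} [Fintype ι] [DecidableEq ι]

/-- The odd power sums of an endomorphism that is skew for a nondegenerate bilinear form vanish. -/
theorem trace_pow_eq_zero_of_skew {A G H : Matrix ι ι R} (hGH : H * G = 1) (hG : Gᵀ = G)
    (h : (G * A)ᵀ = -(G * A)) {m : ℕ} (hm : Odd m) : (A ^ m).trace = 0 := by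
  have h1 : G * A = -Aᵀ * G := by
    rw [Matrix.transpose_mul, hG] at h
    rw [neg_mul, h, neg_neg]
  have h2 : ∀ m : ℕ, G * A ^ m = (-Aᵀ) ^ m * G := fun m => by
    induction m with
    | zero => simp
    | succ m ih => rw [pow_succ, ← mul_assoc, ih, mul_assoc, h1, ← mul_assoc, ← pow_succ]
  have h3 : (A ^ m).trace = -(A ^ m).trace := by
    calc (A ^ m).trace = (H * (G * A ^ m)).trace := by rw [← mul_assoc, hGH, one_mul]
      _ = ((-Aᵀ) ^ m).trace := by
        rw [h2, ← mul_assoc, Matrix.trace_mul_comm, ← mul_assoc, mul_eq_one_comm.1 hGH, one_mul]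
      _ = -(A ^ m).trace := by
        rw [hm.neg_pow, Matrix.trace_neg, ← Matrix.transpose_pow, Matrix.trace_transpose]
  refine natCast_mul_cancel two_ne_zero (y := 0) ?_
  rw [mul_zero]
  push_cast
  linear_combination h3

end OddTraces

/-! ### Smoothness and nondegeneracy of the Gram matrix -/

section Metric

theorem det_of_posDef_ne_zero {n : ℕ} {V : Type*} [AddCommGroup V] [Module ℝ V] [TopologicalSpace V]
    [IsTopologicalAddGroup V] [ContinuousSMul ℝ V] (β : V →L[ℝ] V →L[ℝ] ℝ)
    (hβ : ∀ v, v ≠ 0 → 0 < β v v) (D : EuclideanSpace ℝ (Fin n) →L[ℝ] V)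
    (hD : Function.Injective D) :
    (Matrix.of fun i j => β (D (basisVec i)) (D (basisVec j))).det ≠ 0 := by
  intro h
  obtain ⟨v, hv, hv0⟩ := Matrix.exists_mulVec_eq_zero_iff.2 h
  set w : EuclideanSpace ℝ (Fin n) := ∑ i, v i • basisVec i
  have hw : w ≠ 0 := by
    intro hw
    refine hv (funext fun j => ?_)
    have := congrArg (fun u : EuclideanSpace ℝ (Fin n) => u j) hw
    simpa [w, basisVec, Pi.single_apply] using this
  have h1 : β (D w) (D w) = v ⬝ᵥ ((Matrix.of fun i j => β (D (basisVec i)) (D (basisVec j))) *ᵥ v) := by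
    simp only [w, map_sum, map_smul, dotProduct, Matrix.mulVec, Matrix.of_apply,
      _root_.sum_apply, _root_.smul_apply, smul_eq_mul, Finset.mul_sum]
    rw [Finset.sum_comm]
    refine Finset.sum_congr rfl fun i _ => Finset.sum_congr rfl fun j _ => ?_
    ring
  have h2 := hβ (D w) ((map_ne_zero_iff D hD).2 hw)
  rw [h1, hv0, dotProduct_zero] at h2
  exact lt_irrefl _ h2

variable {n : ℕ} {M : Type*} [TopologicalSpace M] [ChartedSpace (EuclideanSpace ℝ (Fin n)) M]
  [IsManifold (𝓡 n) ∞ M] (g : RiemMetric n M) (x : M)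

/-- A coordinate field is the tangent map of the inverse chart applied to a constant section, hence
smooth on the chart target. -/
theorem contMDiffOn_coordVector (i : Fin n) :
    ContMDiffOn 𝓘(ℝ, EuclideanSpace ℝ (Fin n)) (𝓡 n).tangent ∞
      (fun y => (⟨(extChartAt (𝓡 n) x).symm y, coordVector x y i⟩ : TangentBundle (𝓡 n) M))
      (extChartAt (𝓡 n) x).target := by
  have ho : IsOpen (extChartAt (𝓡 n) x).target := isOpen_extChartAt_target x
  have h1 := (contMDiffOn_extChartAt_symm (I := 𝓡 n) (n := ∞) x).contMDiffOn_tangentMapWithin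
    (m := ∞) (by simp) ho.uniqueMDiffOn
  have h2 : ContMDiff 𝓘(ℝ, EuclideanSpace ℝ (Fin n)) 𝓘(ℝ, EuclideanSpace ℝ (Fin n)).tangent ∞
      (fun y => (⟨y, basisVec i⟩ :
        TangentBundle 𝓘(ℝ, EuclideanSpace ℝ (Fin n)) (EuclideanSpace ℝ (Fin n)))) := by
    exact contMDiff_vectorSpace_iff_contDiff.2 contDiff_const
  refine (h1.comp h2.contMDiffOn (fun y hy => hy)).congr fun y hy => ?_
  rw [Function.comp_apply, tangentMapWithin, mfderivWithin_of_isOpen ho hy]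
  rfl

theorem contDiffOn_gram (i j : Fin n) :
    ContDiffOn ℝ ∞ (fun y => gram g x y i j) (extChartAt (𝓡 n) x).target := by
  rw [← contMDiffOn_iff_contDiffOn]
  have hb := contMDiffOn_extChartAt_symm (I := 𝓡 n) (n := ∞) x
  have h := ContMDiffOn.clm_bundle_apply₂ (F₁ := EuclideanSpace ℝ (Fin n))
    (F₂ := EuclideanSpace ℝ (Fin n)) (E₃ := Bundle.Trivial M ℝ)
    (g.contMDiff.comp_contMDiffOn hb) (contMDiffOn_coordVector x i)
    (contMDiffOn_coordVector x j)
  intro y hy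
  have := h y hy
  simp only [Bundle.contMDiffWithinAt_totalSpace] at this
  exact this.2

theorem gram_symm (y : EuclideanSpace ℝ (Fin n)) (i j : Fin n) :
    gram g x y i j = gram g x y j i := g.symm _ _ _

theorem injective_mfderiv_chart_symm {y : EuclideanSpace ℝ (Fin n)}
    (hy : y ∈ (extChartAt (𝓡 n) x).target) :
    Function.Injective (mfderiv 𝓘(ℝ, EuclideanSpace ℝ (Fin n)) (𝓡 n) (extChartAt (𝓡 n) x).symm y) := by
  have : IsManifold (𝓡 n) 1 M := IsManifold.of_le (n := ∞) (by simp)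
  have h := isInvertible_mfderivWithin_extChartAt_symm (I := 𝓡 n) hy
  rw [ModelWithCorners.range_eq_univ, mfderivWithin_univ] at h
  exact h.injective

theorem det_gram_ne_zero {y : EuclideanSpace ℝ (Fin n)} (hy : y ∈ (extChartAt (𝓡 n) x).target) :
    (gram g x y).det ≠ 0 :=
  det_of_posDef_ne_zero (g.inner _) (g.pos _) _ (injective_mfderiv_chart_symm x hy)

end Metric

/-! ### Skew symmetry of the curvature of a metric -/

section SkewCurvature

variable {n : ℕ} {G : EuclideanSpace ℝ (Fin n) → Matrix (Fin n) (Fin n) ℝ}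

/-- The Christoffel symbols of a metric on an open subset of `ℝⁿ`. -/
def christoffelOf (G : EuclideanSpace ℝ (Fin n) → Matrix (Fin n) (Fin n) ℝ) (i j k : Fin n)
    (y : EuclideanSpace ℝ (Fin n)) : ℝ :=
  (1 / 2) * ∑ l, (G y)⁻¹ i l *
    (partialDeriv j (fun z => G z l k) y + partialDeriv k (fun z => G z l j) y
      - partialDeriv l (fun z => G z j k) y)

/-- The curvature of a metric on an open subset of `ℝⁿ`, as a matrix for each pair of directions. -/
def riemannOf (G : EuclideanSpace ℝ (Fin n) → Matrix (Fin n) (Fin n) ℝ)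
    (p : EuclideanSpace ℝ (Fin n)) (k l : Fin n) : Matrix (Fin n) (Fin n) ℝ :=
  Matrix.of fun i j => partialDeriv k (christoffelOf G i l j) p -
    partialDeriv l (christoffelOf G i k j) p +
    ∑ m, (christoffelOf G i k m p * christoffelOf G m l j p -
      christoffelOf G i l m p * christoffelOf G m k j p)

theorem partialDeriv_comm {f : EuclideanSpace ℝ (Fin n) → ℝ} {p : EuclideanSpace ℝ (Fin n)}
    (hf : ContDiffAt ℝ ∞ f p) (k l : Fin n) :
    partialDeriv k (partialDeriv l f) p = partialDeriv l (partialDeriv k f) p := by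
  have h1 : DifferentiableAt ℝ (fderiv ℝ f) p :=
    (hf.fderiv_right (m := 1) (by norm_cast)).differentiableAt one_ne_zero
  have h2 : ∀ k l : Fin n, partialDeriv k (partialDeriv l f) p =
      fderiv ℝ (fderiv ℝ f) p (basisVec k) (basisVec l) := fun k l => by
    show fderiv ℝ (fun y => fderiv ℝ f y (basisVec l)) p (basisVec k) = _
    rw [fderiv_clm_apply h1 (differentiableAt_const _)]
    simp
  rw [h2, h2]
  exact (hf.isSymmSndFDerivAt (by
    rw [minSmoothness_of_isRCLikeNormedField]
    exact WithTop.coe_le_coe.2 le_top)).eq _ _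

theorem contDiffAt_partialDeriv {f : EuclideanSpace ℝ (Fin n) → ℝ} {p : EuclideanSpace ℝ (Fin n)}
    (hf : ContDiffAt ℝ ∞ f p) (k : Fin n) : ContDiffAt ℝ ∞ (partialDeriv k f) p :=
  (hf.fderiv_right (m := ∞) (by simp)).clm_apply contDiffAt_const

theorem contDiffAt_det {p : EuclideanSpace ℝ (Fin n)}
    (hG : ∀ i j, ContDiffAt ℝ ∞ (fun y => G y i j) p) :
    ContDiffAt ℝ ∞ (fun y => (G y).det) p := by
  simp only [Matrix.det_apply']
  exact ContDiffAt.sum fun σ _ => contDiffAt_const.mul (contDiffAt_prod fun i _ => hG _ _)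

theorem contDiffAt_inv {p : EuclideanSpace ℝ (Fin n)}
    (hG : ∀ i j, ContDiffAt ℝ ∞ (fun y => G y i j) p) (hp : (G p).det ≠ 0) (i j : Fin n) :
    ContDiffAt ℝ ∞ (fun y => (G y)⁻¹ i j) p := by
  simp only [Matrix.inv_def, Matrix.smul_apply, Matrix.adjugate_apply, smul_eq_mul,
    Ring.inverse_eq_inv']
  refine ((contDiffAt_det hG).inv hp).mul (contDiffAt_det fun a b => ?_)
  simp only [Matrix.updateRow_apply]
  split_ifs
  · exact contDiffAt_const
  · exact hG _ _

theorem contDiffAt_christoffelOf {p : EuclideanSpace ℝ (Fin n)}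
    (hG : ∀ i j, ContDiffAt ℝ ∞ (fun y => G y i j) p) (hp : (G p).det ≠ 0) (i j k : Fin n) :
    ContDiffAt ℝ ∞ (christoffelOf G i j k) p :=
  contDiffAt_const.mul (ContDiffAt.sum fun l _ => (contDiffAt_inv hG hp i l).mul
    (((contDiffAt_partialDeriv (hG _ _) _).add (contDiffAt_partialDeriv (hG _ _) _)).sub
      (contDiffAt_partialDeriv (hG _ _) _)))

/-- Lowering the index with the metric cancels the inverse matrix and leaves Christoffel symbols of
the first kind. -/
theorem sum_mul_christoffelOf {y : EuclideanSpace ℝ (Fin n)} (hy : (G y).det ≠ 0) (a j k : Fin n) :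
    ∑ i, G y a i * christoffelOf G i k j y =
      (1 / 2) * (partialDeriv k (fun z => G z a j) y + partialDeriv j (fun z => G z a k) y -
        partialDeriv a (fun z => G z k j) y) := by
  have h : G y * (G y)⁻¹ = 1 := Matrix.mul_nonsing_inv _ (isUnit_iff_ne_zero.2 hy)
  simp only [christoffelOf, Finset.mul_sum]
  rw [Finset.sum_comm]
  have h1 : ∀ l, ∑ i, G y a i * (1 / 2 * ((G y)⁻¹ i l *
      (partialDeriv k (fun z => G z l j) y + partialDeriv j (fun z => G z l k) y -
        partialDeriv l (fun z => G z k j) y))) = (1 : Matrix (Fin n) (Fin n) ℝ) a l * (1 / 2 *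
      (partialDeriv k (fun z => G z l j) y + partialDeriv j (fun z => G z l k) y -
        partialDeriv l (fun z => G z k j) y)) := fun l => by
    rw [← h, Matrix.mul_apply, Finset.sum_mul]
    exact Finset.sum_congr rfl fun i _ => by ring
  simp only [h1, Matrix.one_apply, ite_mul, one_mul, zero_mul]
  rw [Finset.sum_ite_eq, if_pos (Finset.mem_univ _)]

/-- Compatibility of the Christoffel symbols with the metric. -/
theorem partialDeriv_eq_sum_christoffelOf (hs : ∀ y i j, G y i j = G y j i)
    {y : EuclideanSpace ℝ (Fin n)} (hy : (G y).det ≠ 0) (a j k : Fin n) :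
    partialDeriv k (fun z => G z a j) y =
      ∑ i, G y a i * christoffelOf G i k j y + ∑ i, G y j i * christoffelOf G i k a y := by
  rw [sum_mul_christoffelOf hy, sum_mul_christoffelOf hy]
  simp only [hs _ j a, hs _ k j, hs _ k a]
  ring

theorem partialDeriv_sum_mul {p : EuclideanSpace ℝ (Fin n)}
    {f h : Fin n → EuclideanSpace ℝ (Fin n) → ℝ} (hf : ∀ i, DifferentiableAt ℝ (f i) p)
    (hh : ∀ i, DifferentiableAt ℝ (h i) p) (k : Fin n) :
    partialDeriv k (fun y => ∑ i, f i y * h i y) p =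
      ∑ i, partialDeriv k (f i) p * h i p + ∑ i, f i p * partialDeriv k (h i) p := by
  rw [partialDeriv, fderiv_fun_sum fun i _ => (hf i).fun_mul (hh i), _root_.sum_apply,
    ← Finset.sum_add_distrib]
  refine Finset.sum_congr rfl fun i _ => ?_
  rw [fderiv_fun_mul (hf i) (hh i)]
  simp only [partialDeriv, _root_.add_apply, _root_.smul_apply, smul_eq_mul]
  ring

/-- Here `P` and `P'` stand for the derivatives of the lowered symbols `G Γ'` and `G Γ`, so `P + Pᵀ`
and `P' + P'ᵀ` are the mixed second derivatives of the metric. The lowered curvature is `P - P'`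
minus `Γᵀ G Γ' - Γ'ᵀ G Γ`: the latter is visibly skew, and the former is skew because second
derivatives commute. -/
theorem skew_of_second_derivatives {R : Type*} [CommRing R] {ι : Type*} [Fintype ι]
    {G Γ Γ' D D' P P' : Matrix ι ι R} (hG : Gᵀ = G)
    (hP : P = (G * Γ + (G * Γ)ᵀ) * Γ' + G * D) (hP' : P' = (G * Γ' + (G * Γ')ᵀ) * Γ + G * D')
    (h : P + Pᵀ = P' + P'ᵀ) :
    (G * (D - D' + (Γ * Γ' - Γ' * Γ)))ᵀ = -(G * (D - D' + (Γ * Γ' - Γ' * Γ))) := by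
  have h1 : G * (D - D' + (Γ * Γ' - Γ' * Γ)) = P - P' - (Γᵀ * (G * Γ') - Γ'ᵀ * (G * Γ)) := by
    rw [hP, hP', Matrix.transpose_mul, Matrix.transpose_mul, hG]
    noncomm_ring
  have h2 : Pᵀ - P'ᵀ = P' - P := by
    rw [sub_eq_sub_iff_add_eq_add, add_comm, h, add_comm]
  rw [h1, Matrix.transpose_sub, Matrix.transpose_sub, Matrix.transpose_sub, h2]
  simp only [Matrix.transpose_mul, Matrix.transpose_transpose, hG, mul_assoc]
  abel

theorem riemannOf_skew {U : Set (EuclideanSpace ℝ (Fin n))} (hU : IsOpen U)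
    (hG : ∀ i j, ContDiffOn ℝ ∞ (fun y => G y i j) U) (hs : ∀ y i j, G y i j = G y j i)
    (hd : ∀ y ∈ U, (G y).det ≠ 0) {p : EuclideanSpace ℝ (Fin n)} (hp : p ∈ U) (k l : Fin n) :
    (G p * riemannOf G p k l)ᵀ = -(G p * riemannOf G p k l) := by
  have hGp : ∀ i j, ContDiffAt ℝ ∞ (fun y => G y i j) p := fun i j =>
    (hG i j).contDiffAt (hU.mem_nhds hp)
  have hGd : ∀ i j, DifferentiableAt ℝ (fun y => G y i j) p := fun i j =>
    (hGp i j).differentiableAt (by simp)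
  have hΓd : ∀ i j k, DifferentiableAt ℝ (christoffelOf G i j k) p := fun i j k =>
    (contDiffAt_christoffelOf hGp (hd p hp) i j k).differentiableAt (by simp)
  set Γ : Fin n → Matrix (Fin n) (Fin n) ℝ := fun k => Matrix.of fun i j => christoffelOf G i k j p
  set D : Fin n → Fin n → Matrix (Fin n) (Fin n) ℝ := fun k l =>
    Matrix.of fun i j => partialDeriv k (christoffelOf G i l j) p
  set P : Fin n → Fin n → Matrix (Fin n) (Fin n) ℝ := fun k l =>
    Matrix.of fun a j => partialDeriv k (fun y => ∑ i, G y a i * christoffelOf G i l j y) p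
  have hP : ∀ k l, P k l = (G p * Γ k + (G p * Γ k)ᵀ) * Γ l + G p * D k l := fun k l => by
    ext a j
    simp only [P, Matrix.of_apply]
    rw [partialDeriv_sum_mul (fun i => hGd a i) (fun i => hΓd i l j), Matrix.add_apply,
      Matrix.mul_apply, Matrix.mul_apply]
    refine congrArg₂ (· + ·) (Finset.sum_congr rfl fun i _ => ?_) rfl
    rw [partialDeriv_eq_sum_christoffelOf hs (hd p hp), Matrix.add_apply, Matrix.transpose_apply,
      Matrix.mul_apply, Matrix.mul_apply]
    rfl
  -- Metric compatibility holds on the whole open set `U`, so it may be differentiated at `p`.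
  have hPP : ∀ k l, P k l + (P k l)ᵀ =
      Matrix.of fun a j => partialDeriv k (partialDeriv l (fun z => G z a j)) p := fun k l => by
    ext a j
    have h1 : partialDeriv l (fun z => G z a j) =ᶠ[nhds p] (fun y =>
        ∑ i, G y a i * christoffelOf G i l j y) + (fun y =>
        ∑ i, G y j i * christoffelOf G i l a y) := by
      filter_upwards [hU.mem_nhds hp] with y hy
      exact partialDeriv_eq_sum_christoffelOf hs (hd y hy) a j l
    have h2 : ∀ a j, DifferentiableAt ℝ (fun y => ∑ i, G y a i * christoffelOf G i l j y) p :=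
      fun a j => DifferentiableAt.fun_sum fun i _ => (hGd a i).fun_mul (hΓd i l j)
    rw [Matrix.add_apply, Matrix.transpose_apply, Matrix.of_apply, partialDeriv, h1.fderiv_eq,
      fderiv_add (h2 a j) (h2 j a)]
    rfl
  have hR : riemannOf G p k l = D k l - D l k + (Γ k * Γ l - Γ l * Γ k) := by
    ext i j
    simp only [riemannOf, Matrix.of_apply, Matrix.add_apply, Matrix.sub_apply, Matrix.mul_apply,
      D, Γ, Finset.sum_sub_distrib]
  rw [hR]
  refine skew_of_second_derivatives ?_ (hP k l) (hP l k) ?_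
  · ext i j
    exact hs p j i
  · rw [hPP, hPP]
    ext a j
    exact partialDeriv_comm (hGp a j) k l

end SkewCurvature

/-! ### Vanishing of the odd curvature traces -/

section CurvatureTraces

variable {n : ℕ} {M : Type*} [TopologicalSpace M] [ChartedSpace (EuclideanSpace ℝ (Fin n)) M]
  [IsManifold (𝓡 n) ∞ M] (g : RiemMetric n M) (x : M)

/-- For each pair of directions the curvature matrix is skew for the Gram matrix; this passes to
combinations with two-form coefficients, over the commutative ring of central forms. -/
theorem trace_chernMatrix_pow_eq_zero {m : ℕ} (hm : Odd m) : (chernMatrix g x ^ m).trace = 0 := by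
  set p := extChartAt (𝓡 n) x x
  have hp : p ∈ (extChartAt (𝓡 n) x).target := mem_extChartAt_target x
  have hskew := riemannOf_skew (isOpen_extChartAt_target (I := 𝓡 n) x) (contDiffOn_gram g x)
    (gram_symm g x) (fun y hy => det_gram_ne_zero g x hy) hp
  set h : ℝ →+* CForm n x := (algebraMap ℂ (CForm n x)).comp Complex.ofRealHom
  have hs : ∀ (r : ℝ) (a : CForm n x), (r : ℂ) • a = h r * a := fun r a => Algebra.smul_def _ _
  set Gm := (gram g x p).map h
  have hR : ∀ i j, chernMatrix g x i j = (Complex.I / (2 * Real.pi)) • ∑ k, ∑ l,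
      h (1 / 2 * riemannOf (gram g x) p k l i j) * dCoord₂ x k l := fun i j => by
    rw [chernMatrix, Matrix.smul_apply, curvature, Matrix.of_apply]
    simp only [hs]
    rfl
  have hGR : ∀ a j, (Gm * chernMatrix g x) a j = (Complex.I / (2 * Real.pi)) • ∑ k, ∑ l,
      h (1 / 2 * (gram g x p * riemannOf (gram g x) p k l) a j) * dCoord₂ x k l := fun a j => by
    rw [Matrix.mul_apply]
    simp only [hR, mul_smul_comm, ← Finset.smul_sum]
    congr 1
    simp only [Finset.mul_sum, Matrix.mul_apply, map_sum, Finset.sum_mul]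
    rw [Finset.sum_comm]
    refine Finset.sum_congr rfl fun k _ => ?_
    rw [Finset.sum_comm]
    refine Finset.sum_congr rfl fun l _ => Finset.sum_congr rfl fun i _ => ?_
    rw [show Gm a i = h (gram g x p a i) from rfl, map_mul, map_mul, map_mul]
    ring
  refine trace_pow_eq_zero_of_skew (G := Gm) (H := (gram g x p)⁻¹.map h) ?_ ?_ ?_ hm
  · rw [← Matrix.map_mul, Matrix.nonsing_inv_mul _ (isUnit_iff_ne_zero.2 (det_gram_ne_zero g x hp)),
      Matrix.map_one _ (map_zero h) (map_one h)]
  · ext1 i j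
    exact congrArg h (gram_symm g x p j i)
  · ext1 a j
    rw [Matrix.transpose_apply, Matrix.neg_apply, hGR, hGR]
    refine Eq.trans (congrArg _ ?_) (smul_neg _ _)
    rw [← Finset.sum_neg_distrib]
    refine Finset.sum_congr rfl fun k _ => ?_
    rw [← Finset.sum_neg_distrib]
    refine Finset.sum_congr rfl fun l _ => ?_
    have := congrFun (congrFun (hskew k l) a) j
    rw [Matrix.transpose_apply, Matrix.neg_apply] at this
    rw [this, mul_neg, map_neg]
    exact neg_mul _ _

end CurvatureTraces

end
end TwistedCancellation

namespace TwistedCancellation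
noncomputable section

/-! ### The cancellation formula and its low-dimensional cases -/

section Cancellation

open PowerSeries

theorem pow_mul_coeff_jac (α r m : ℕ) : (8 : ℂ) ^ α * coeff m (jacDelta ^ α * jacEps ^ r) =
    ((coeff m (eightDelta₂ ^ α * epsilon₂ ^ r) : ℤ) : ℂ) := by
  have h : C ((8 : ℂ) ^ α) * (jacDelta ^ α * jacEps ^ r) =
      map (Int.castRingHom ℂ) (eightDelta₂ ^ α * epsilon₂ ^ r) := by
    rw [map_mul, map_pow (map _), map_pow (map _), ← eight_mul_jacDelta, ← jacEps_eq, mul_pow,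
      map_pow, show C (8 : ℂ) = 8 from map_ofNat C 8, mul_assoc]
  rw [← coeff_C_mul, h, coeff_map]
  rfl

theorem powerTrace_one {R : Type*} [CommRing R] [Algebra ℂ R] {ι : Type*} [Fintype ι]
    [DecidableEq ι] (c : ℤˣ) (E : Matrix ι ι R) : powerTrace c E 1 = E.trace := by
  have h := powerTrace_succ c E 0
  simpa [powerTrace_zero] using h

/-- A form is determined by its graded series, so two constructions agree as soon as their series
do. -/
theorem gradedPairs_unique {F : Type*} [CommRing F] [Algebra ℂ F] {W : ℕ → Submodule ℂ F}
    [SetLike.GradedMonoid W] {s : PowerSeries F} {a a' : F} (h : (s, a) ∈ gradedPairs W)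
    (h' : (s, a') ∈ gradedPairs W) : a = a' := by
  obtain ⟨_, P, hP, hE⟩ := h
  obtain ⟨_, P', hP', hE'⟩ := h'
  have : P = P' := Polynomial.coe_injective F (hP.symm.trans hP')
  rw [show a = P.eval 1 from hE, show a' = P'.eval 1 from hE', this]

theorem bBundle_zero (k : ℕ) : bBundle k (canonicalMatrix k) 0 = -1 := by
  rw [bBundle, Finset.sum_eq_single 0]
  · rw [canonicalMatrix_self, Fin.val_zero, B_zero]
    simp
  · intro j _ hj
    rw [canonicalMatrix_of_lt (Fin.pos_iff_ne_zero.2 hj), zero_smul]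
  · simp

theorem bBundle_three_one : bBundle 3 (canonicalMatrix 3) 1 = 140 + extPow 1 := by
  rw [bBundle, Fin.sum_univ_four, canonicalMatrix_three_one_zero, canonicalMatrix_self,
    canonicalMatrix_of_lt (r := 1) (j := 2) (by decide),
    canonicalMatrix_of_lt (r := 1) (j := 3) (by decide), Fin.val_zero, Fin.val_one, B_zero, B_one]
  simp only [zsmul_eq_mul]
  push_cast
  ring

/-- The coefficient of the form `h_r`, up to powers of two, in the twisted signature form. -/
def signatureCoeff (k r : ℕ) (u v : ℂ) : ℂ :=
  (144 * (2 * (k - r) + 1) * (2 * (k - r)) + 64 * r ^ 2 - 192 * (2 * (k - r) + 1) * r) +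
    (2 * (8 * k + 4) + u) * (12 * (2 * (k - r) + 1) - 8 * r) +
    ((8 * k + 4) ^ 2 + u * (8 * k + 4) + v)

theorem component_add {n : ℕ} {M : Type*} [TopologicalSpace M]
    [ChartedSpace (EuclideanSpace ℝ (Fin n)) M] (x : M) (d : ℕ) (a b : CForm n x) :
    component x d (a + b) = component x d a + component x d b := by
  rw [component, Subalgebra.coe_add, map_add, component, component]

theorem component_smul {n : ℕ} {M : Type*} [TopologicalSpace M]
    [ChartedSpace (EuclideanSpace ℝ (Fin n)) M] (x : M) (d : ℕ) (c : ℂ) (a : CForm n x) :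
    component x d (c • a) = c • component x d a := by
  rw [component, Subalgebra.coe_smul, map_smul, component]

/-- Expand `T² + u T + v` about `T = N`, since the common polynomial yields the twists by powers of
`τ = T - N`. -/
theorem coeff_twist {F : Type*} [CommRing F] [Algebra ℂ F] (m N : ℕ) (c u v : ℂ)
    (l T : PowerSeries F) :
    coeff m (C (algebraMap ℂ F c) * l * T ^ 2 +
      C (algebraMap ℂ F u) * (C (algebraMap ℂ F c) * l * T) +
      C (algebraMap ℂ F v) * (C (algebraMap ℂ F c) * l)) =
    algebraMap ℂ F c * (coeff m (l * (T - (N : PowerSeries F)) ^ 2) +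
      algebraMap ℂ F (2 * N + u) * coeff m (l * (T - (N : PowerSeries F))) +
      algebraMap ℂ F (N ^ 2 + u * N + v) * coeff m l) := by
  rw [← coeff_C_mul, ← coeff_C_mul, ← map_add (coeff m), ← map_add (coeff m), ← coeff_C_mul]
  congr 1
  simp only [map_add, map_mul, map_pow, map_ofNat, map_natCast]
  ring

theorem combination_eq_smul {F : Type*} [CommRing F] [Algebra ℂ F] (a b c : F) :
    a - 55 * b + 768 * c = a + (-55 : ℂ) • b + (768 : ℂ) • c := by
  rw [Algebra.smul_def, Algebra.smul_def, map_neg, map_ofNat, map_ofNat]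
  ring

theorem mul_neg_one_eq_smul {F : Type*} [CommRing F] [Algebra ℂ F] (a : F) :
    a * -1 = (-1 : ℂ) • a := by
  rw [Algebra.smul_def, map_neg, map_one]
  ring

theorem mul_ofNat_add {F : Type*} [CommRing F] (a b : F) : a * (140 + b) = a * b + 140 * a := by
  ring

theorem sub_eq_add_smul {F : Type*} [CommRing F] [Algebra ℂ F] (a b : F) :
    a - 52 * b = a + 140 * b + (-192 : ℂ) • b := by
  rw [Algebra.smul_def, map_neg, map_ofNat]
  ring

theorem sub_mul_eq_smul {F : Type*} [CommRing F] [Algebra ℂ F] (a b c : F) :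
    a - 112 * c = a + (0 : ℂ) • b + (-112 : ℂ) • c := by
  rw [Algebra.smul_def, Algebra.smul_def, map_neg, map_ofNat, map_zero]
  ring

theorem component_top {k : ℕ} {M : Type*} [TopologicalSpace M]
    [ChartedSpace (EuclideanSpace ℝ (Fin (8 * k + 4))) M] (x : M) {s : PowerSeries (CForm (8 * k + 4) x)} {a : CForm (8 * k + 4) x}
    (h : (s, a) ∈ gradedPairs (evenForm x)) :
    component x (8 * k + 4) a = (coeff (4 * k + 2) s : CForm (8 * k + 4) x) := by
  have := component_of_gradedPairs h (4 * k + 2)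
  rwa [show 2 * (4 * k + 2) = 8 * k + 4 by ring] at this

/-- The canonical matrix inverts the matrix of monomial coefficients, so the combination `b_r`
isolates `s r`. The power of `8` is the difference between monomials in `δ₂` and in `8 δ₂`. -/
theorem coeff_vbEval_bBundle {F : Type*} [CommRing F] [Algebra ℂ F] {ι : Type*} [Fintype ι]
    [DecidableEq ι] (A : Matrix ι ι F) (a : PowerSeries F) (k : ℕ) (s : Fin (k + 1) → F)
    (h : ∀ m < k + 1, coeff (4 * k + 2) (a * vbEval A (B (8 * k + 4) m)) = ∑ r : Fin (k + 1),
      s r * algebraMap ℂ F (coeff m (jacDelta ^ (2 * k + 1 - 2 * (r : ℕ)) * jacEps ^ (r : ℕ))))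
    (r : Fin (k + 1)) :
    coeff (4 * k + 2) (a * vbEval A (bBundle k (canonicalMatrix k) r)) =
      ((8 : ℂ) ^ (2 * k + 1 - 2 * (r : ℕ)))⁻¹ • s r := by
  set w : Fin (k + 1) → F := fun r => ((8 : ℂ) ^ (2 * k + 1 - 2 * (r : ℕ)))⁻¹ • s r
  have h1 : ∀ j : Fin (k + 1), coeff (4 * k + 2) (a * vbEval A (B (8 * k + 4) j)) =
      ∑ r, (monomialMatrix k j r : F) * w r := fun j => by
    rw [h j j.is_lt]
    refine Finset.sum_congr rfl fun r _ => ?_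
    have h8 : ((8 : ℂ) ^ (2 * k + 1 - 2 * (r : ℕ))) ≠ 0 := pow_ne_zero _ (by norm_num)
    rw [monomialMatrix, Matrix.of_apply, ← map_intCast (algebraMap ℂ F), ← pow_mul_coeff_jac,
      ← Algebra.smul_def, smul_smul, mul_comm, ← Algebra.smul_def, mul_right_comm,
      mul_inv_cancel₀ h8, one_mul]
  have h2 : ∀ j j', ∑ i, (canonicalMatrix k j i : F) * (monomialMatrix k i j' : F) =
      if j = j' then 1 else 0 := fun j j' => by
    have := congrArg (Int.cast : ℤ → F)
      (congrFun (congrFun (canonicalMatrix_mul_monomialMatrix k) j) j')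
    rw [Matrix.mul_apply, Matrix.one_apply] at this
    push_cast at this
    exact this
  have h3 : coeff (4 * k + 2) (a * vbEval A (bBundle k (canonicalMatrix k) r)) =
      ∑ j, (canonicalMatrix k r j : F) * coeff (4 * k + 2) (a * vbEval A (B (8 * k + 4) j)) := by
    rw [bBundle, map_sum, Finset.mul_sum, map_sum]
    refine Finset.sum_congr rfl fun j _ => ?_
    rw [map_zsmul, mul_smul_comm, map_zsmul, zsmul_eq_mul]
  rw [h3]
  simp only [h1, Finset.mul_sum, ← mul_assoc]
  rw [Finset.sum_comm]
  simp only [← Finset.sum_mul, h2, ite_mul, one_mul, zero_mul]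
  rw [Finset.sum_ite_eq, if_pos (Finset.mem_univ _)]

/-- Here `p0`, `p1`, `p2` are the components twisted by `1`, `τ`, `τ²`. The constant `2 ^ (4 k + 2)`
of `L̂` cancels the denominators `4 ^ (2 k + 1)` of the monomials at this cusp. -/
theorem sum_cusp_coeff {F : Type*} [CommRing F] [Algebra ℂ F] (k : ℕ) (s : Fin (k + 1) → F)
    {p0 p1 p2 : F}
    (h : ∀ m < 3, coeff m (C p0 + C (2 * p1) * X + C (2 * p2) * X ^ 2) = ∑ r : Fin (k + 1),
      s r * algebraMap ℂ F (coeff m (cuspDelta ^ (2 * k + 1 - 2 * (r : ℕ)) * cuspEps ^ (r : ℕ))))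
    (u v : ℂ) :
    algebraMap ℂ F (2 ^ (4 * k + 2)) * (p2 + algebraMap ℂ F (2 * (8 * k + 4) + u) * p1 +
      algebraMap ℂ F ((8 * k + 4) ^ 2 + u * (8 * k + 4) + v) * p0) =
      ∑ r : Fin (k + 1), signatureCoeff k r u v • s r := by
  set e : ℕ → Fin (k + 1) → ℂ := fun m r =>
    coeff m (cuspDelta ^ (2 * k + 1 - 2 * (r : ℕ)) * cuspEps ^ (r : ℕ))
  have h0 : p0 = ∑ r, s r * algebraMap ℂ F (e 0 r) := by
    rw [← h 0 (by norm_num)]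
    simp
  have h1 : 2 * p1 = ∑ r, s r * algebraMap ℂ F (e 1 r) := by
    rw [← h 1 (by norm_num)]
    simp only [map_add, coeff_C_mul, coeff_C, coeff_X_pow, coeff_one_X]
    norm_num
  have h2 : 2 * p2 = ∑ r, s r * algebraMap ℂ F (e 2 r) := by
    rw [← h 2 (by norm_num)]
    simp only [map_add, coeff_C_mul, coeff_C, coeff_X_pow, coeff_X]
    norm_num
  refine natCast_mul_cancel two_ne_zero ?_
  have h3 : ((2 : ℕ) : F) * (algebraMap ℂ F (2 ^ (4 * k + 2)) *
      (p2 + algebraMap ℂ F (2 * (8 * k + 4) + u) * p1 +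
      algebraMap ℂ F ((8 * k + 4) ^ 2 + u * (8 * k + 4) + v) * p0)) =
      algebraMap ℂ F (2 ^ (4 * k + 2)) * (2 * p2 + algebraMap ℂ F (2 * (8 * k + 4) + u) * (2 * p1) +
      algebraMap ℂ F (2 * ((8 * k + 4) ^ 2 + u * (8 * k + 4) + v)) * p0) := by
    rw [map_mul _ (2 : ℂ) ((8 * k + 4) ^ 2 + u * (8 * k + 4) + v), map_ofNat]
    push_cast
    ring
  rw [h3, h0, h1, h2]
  simp only [Finset.mul_sum, ← Finset.sum_add_distrib]
  refine Finset.sum_congr rfl fun r _ => ?_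
  have hr := r.is_lt
  obtain ⟨c0, c1, c2⟩ := coeff_cuspDelta_pow_mul_cuspEps_pow (2 * k + 1 - 2 * (r : ℕ)) r
  rw [show 2 * k + 1 - 2 * (r : ℕ) + 2 * r = 2 * k + 1 by omega,
    show (4 : ℂ) ^ (2 * k + 1) = 2 ^ (4 * k + 2) by
      rw [show (4 : ℂ) = 2 ^ 2 by norm_num, ← pow_mul]
      congr 1
      ring] at c0 c1 c2
  have hc : ((2 * k + 1 - 2 * (r : ℕ) : ℕ) : ℂ) = 2 * (k - r) + 1 := by
    rw [Nat.cast_sub (by omega)]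
    push_cast
    ring
  rw [hc] at c1 c2
  have key : (2 : ℂ) ^ (4 * k + 2) * (e 2 r + (2 * (8 * k + 4) + u) * e 1 r +
      2 * ((8 * k + 4) ^ 2 + u * (8 * k + 4) + v) * e 0 r) = 2 * signatureCoeff k r u v := by
    rw [signatureCoeff]
    linear_combination c2 + (2 * (8 * k + 4) + u) * c1 +
      2 * ((8 * k + 4) ^ 2 + u * (8 * k + 4) + v) * c0
  have key' := congrArg (algebraMap ℂ F) key
  simp only [map_mul, map_add] at key'
  rw [Algebra.smul_def]
  simp only [map_mul, map_add, map_ofNat, Nat.cast_ofNat] at key' ⊢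
  linear_combination s r * key'

variable {k : ℕ} {M : Type*} [TopologicalSpace M]
  [ChartedSpace (EuclideanSpace ℝ (Fin (8 * k + 4))) M] [IsManifold (𝓡 (8 * k + 4)) ∞ M]
  (g : RiemMetric (8 * k + 4) M) (x : M)

theorem exists_cancellation_forms : ∃ s : Fin (k + 1) → CForm (8 * k + 4) x,
    (∀ r : Fin (k + 1), hForm g x (canonicalMatrix k) r =
      (((8 : ℂ) ^ (2 * k + 1 - 2 * (r : ℕ)))⁻¹ • s r : CForm (8 * k + 4) x)) ∧
    ∀ u v : ℂ, component x (8 * k + 4)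
      (lHat g x * chTT g x + u • (lHat g x * chT g x) + v • lHat g x) =
      (∑ r : Fin (k + 1), signatureCoeff k r u v • s r : CForm (8 * k + 4) x) := by
  obtain ⟨a, ha, ha0, ha2⟩ := exists_aHat_gradedPairs (g := g) (x := x)
  obtain ⟨l, hl, hl0, hl2⟩ := exists_lHat_gradedPairs (g := g) (x := x) (r := 4 * k + 2) (by ring)
  obtain ⟨s, hs, hs'⟩ := exists_common_polynomial
    (fun m hm => trace_chernMatrix_pow_eq_zero g x hm) ha0 hl0 ha2 hl2 rfl k
  simp only [Fintype.card_fin] at hs hs'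
  refine ⟨s, fun r => ?_, fun u v => ?_⟩
  · rw [hForm, component_top x (gradedPairs_mul ha (gradedPairs_chVirtual _)),
      coeff_vbEval_bBundle _ a k s hs' r]
  · have h := gradedPairs_add (gradedPairs_add (gradedPairs_mul hl (gradedPairs_chTT (g := g)))
      (gradedPairs_smul u (gradedPairs_mul hl (gradedPairs_chT (g := g))))) (gradedPairs_smul v hl)
    rw [component_top x h, ← sum_cusp_coeff k s hs u v]
    have h4 := coeff_twist (4 * k + 2) (8 * k + 4) (2 ^ (4 * k + 2)) u v l
      (powTrace (chernMatrix g x) (expBase (CForm (8 * k + 4) x)))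
    push_cast at h4 ⊢
    exact congrArg Subtype.val h4

/-- Vanishing at `r = k` amounts to `112 + 16 u + v = 0`, for every `k`; vanishing also at `r = k -
1` forces `u = -55`, hence `v = 768`. The first relation with `u = 0` gives the `-112` of dimension
four. -/
theorem signatureCoeff_cancel (k r : ℕ) :
    signatureCoeff k r (-55) 768 = 2 ^ 10 * ((k - r) * (k - r - 1)) := by
  rw [signatureCoeff]
  ring

/-- The cancellation formula. -/
theorem component_signature_eq_sum :
    component x (8 * k + 4) (lHat g x * chTT g x - 55 * (lHat g x * chT g x) + 768 * lHat g x) =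
      (2 : ℂ) ^ 25 • ∑ r ∈ Finset.univ.filter (fun r : Fin (k + 1) => (r : ℕ) + 2 ≤ k),
        (((k : ℂ) - r) * ((k : ℂ) - r - 1) * 2 ^ (6 * (k - (r : ℕ) - 2))) •
          hForm g x (canonicalMatrix k) r := by
  obtain ⟨s, h1, h2⟩ := exists_cancellation_forms g x
  have h3 : lHat g x * chTT g x - 55 * (lHat g x * chT g x) + 768 * lHat g x =
      lHat g x * chTT g x + (-55 : ℂ) • (lHat g x * chT g x) + (768 : ℂ) • lHat g x :=
    combination_eq_smul _ _ _
  rw [h3, h2, Finset.smul_sum, Finset.sum_filter, AddSubmonoidClass.coe_finsetSum]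
  refine Finset.sum_congr rfl fun r _ => ?_
  rw [signatureCoeff_cancel, h1]
  have hr := r.is_lt
  split_ifs with h
  · obtain ⟨j, hj⟩ := Nat.exists_eq_add_of_le h
    rw [Subalgebra.coe_smul, Subalgebra.coe_smul, smul_smul, smul_smul,
      show k - (r : ℕ) - 2 = j by omega, show 2 * k + 1 - 2 * (r : ℕ) = 2 * j + 5 by omega]
    congr 1
    -- With `j = k - r - 2`, this factor together with the `2 ^ 10` of `signatureCoeff_cancel`
    -- accounts for `2 ^ 25 * 2 ^ (6 j)`.
    have h8 : (8 : ℂ) ^ (2 * j + 5) = 2 ^ (6 * j) * 2 ^ 15 := by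
      rw [show (8 : ℂ) = 2 ^ 3 by norm_num, ← pow_mul, ← pow_add]
      congr 1
      ring
    have h9 : (2 : ℂ) ^ (6 * j) ≠ 0 := pow_ne_zero _ two_ne_zero
    rw [h8]
    field_simp
  · have h4 : ((k : ℂ) - r) * (k - r - 1) = 0 := by
      rcases (by omega : k = r ∨ k = r + 1) with h | h
      · have : (k : ℂ) = (r : ℕ) := by exact_mod_cast h
        rw [this, sub_self, zero_mul]
      · have : (k : ℂ) = (r : ℕ) + 1 := by exact_mod_cast h
        rw [this]
        ring
    rw [h4, mul_zero, zero_smul, Subalgebra.coe_zero]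

theorem component_signature_dim_four (hk : k = 0) :
    component x (8 * k + 4) (lHat g x * chTT g x - 112 * lHat g x) = 0 := by
  obtain ⟨s, _, h2⟩ := exists_cancellation_forms g x
  have h3 : ∀ r : Fin (k + 1), signatureCoeff k r 0 (-112) = 0 := fun r => by
    have hr : (r : ℕ) = 0 := by omega
    rw [hr, signatureCoeff, show (k : ℂ) = 0 by exact_mod_cast hk]
    norm_num
  have h4 : lHat g x * chTT g x - 112 * lHat g x =
      lHat g x * chTT g x + (0 : ℂ) • (lHat g x * chT g x) + (-112 : ℂ) • lHat g x :=
    sub_mul_eq_smul _ _ _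
  rw [h4, h2, Finset.sum_eq_zero, Subalgebra.coe_zero]
  intro r _
  rw [h3, zero_smul]

theorem hForm_zero : hForm g x (canonicalMatrix k) 0 = -component x (8 * k + 4) (aHat g x) := by
  have h : aHat g x * -1 = (-1 : ℂ) • aHat g x := mul_neg_one_eq_smul _
  rw [hForm, bBundle_zero, chVirtual, map_neg, map_one, h, component_smul, neg_one_smul]

theorem chVirtual_extPow_one : chVirtual g x (extPow 1) = chT g x := by
  refine gradedPairs_unique (gradedPairs_chVirtual _) ?_
  rw [vbEval_extPow, powerTrace_one]
  exact gradedPairs_chT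

theorem hForm_three_one {M : Type*} [TopologicalSpace M]
    [ChartedSpace (EuclideanSpace ℝ (Fin (8 * 3 + 4))) M] [IsManifold (𝓡 (8 * 3 + 4)) ∞ M]
    (g : RiemMetric (8 * 3 + 4) M) (x : M) : hForm g x (canonicalMatrix 3) 1 =
      component x (8 * 3 + 4) (aHat g x * chT g x + 140 * aHat g x) := by
  have h : chVirtual g x (140 + extPow 1) = 140 + chT g x := by
    rw [← chVirtual_extPow_one, chVirtual, chVirtual, map_add, map_ofNat]
  rw [hForm, bBundle_three_one, h]
  exact congrArg (component x _) (mul_ofNat_add _ _)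

end Cancellation

end
end TwistedCancellation

theorem theorem2p2 (k : ℕ) :
    ∃ c : Matrix (Fin (k + 1)) (Fin (k + 1)) ℤ,
      IsCanonical k c ∧ (∀ c', IsCanonical k c' → c' = c) ∧ (∀ r j, r < j → c r j = 0) ∧
      ∀ (M : Type*) [TopologicalSpace M] [ChartedSpace (EuclideanSpace ℝ (Fin (8 * k + 4))) M]
        [IsManifold (𝓡 (8 * k + 4)) ∞ M] (g : RiemMetric (8 * k + 4) M) (x : M),
        component x (8 * k + 4)
            (lHat g x * chTT g x - 55 * (lHat g x * chT g x) + 768 * lHat g x)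
          = (2 : ℂ) ^ 25 • ∑ r ∈ Finset.univ.filter (fun r : Fin (k + 1) => (r : ℕ) + 2 ≤ k),
              (((k : ℂ) - r) * ((k : ℂ) - r - 1) * 2 ^ (6 * (k - (r : ℕ) - 2))) •
                hForm g x c r ∧
        (k ≤ 1 → component x (8 * k + 4)
            (lHat g x * chTT g x - 55 * (lHat g x * chT g x) + 768 * lHat g x) = 0) ∧
        (k = 0 → component x (8 * k + 4) (lHat g x * chTT g x - 112 * lHat g x) = 0) ∧
        (k = 2 → component x (8 * k + 4)
            (lHat g x * chTT g x - 55 * (lHat g x * chT g x) + 768 * lHat g x)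
          = -(2 : ℂ) ^ 26 • component x (8 * k + 4) (aHat g x)) ∧
        (k = 3 → component x (8 * k + 4)
            (lHat g x * chTT g x - 55 * (lHat g x * chT g x) + 768 * lHat g x)
          = (2 : ℂ) ^ 26 • component x (8 * k + 4) (aHat g x * chT g x - 52 * aHat g x)) := by
  refine ⟨canonicalMatrix k, isCanonical_canonicalMatrix k, fun c' h => eq_canonicalMatrix h,
    fun r j h => canonicalMatrix_of_lt h, fun M _ _ _ g x => ?_⟩
  have main := component_signature_eq_sum g x
  refine ⟨main, fun hk => ?_, component_signature_dim_four g x, ?_, ?_⟩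
  · rw [main, Finset.sum_eq_zero, smul_zero]
    intro r hr
    have := (Finset.mem_filter.1 hr).2
    omega
  · rintro rfl
    -- Only `r = 0` survives, with coefficient `2 * 1`, and `h_0` is minus the `Â`-form.
    rw [main, Finset.sum_filter, Fin.sum_univ_three, hForm_zero]
    norm_num [smul_smul]
  · rintro rfl
    -- The surviving terms are `3 * 2 * 2 ^ 6 = 384` times `h_0` and `2` times `h_1`. After
    -- extracting a factor `2` the multiple of `Â` is `140 - 192 = -52`.
    rw [main, Finset.sum_filter, Fin.sum_univ_four, hForm_zero, hForm_three_one]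
    have h : aHat g x * chT g x - 52 * aHat g x =
        (aHat g x * chT g x + 140 * aHat g x) + (-192 : ℂ) • aHat g x := sub_eq_add_smul _ _
    have h' : component x (8 * 3 + 4) (aHat g x * chT g x - 52 * aHat g x) =
        component x (8 * 3 + 4) (aHat g x * chT g x + 140 * aHat g x) +
          (-192 : ℂ) • component x (8 * 3 + 4) (aHat g x) := by
      rw [h, component_add x _ (aHat g x * chT g x + 140 * aHat g x), component_smul]
    rw [h']
    clear main h h'
    generalize component x (8 * 3 + 4) (aHat g x * chT g x + 140 * aHat g x) = y
    generalize component x (8 * 3 + 4) (aHat g x) = z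
    norm_num [smul_smul]
    module
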